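/- Let $L\subseteq\{3,4,5,\dots\}$. A number $n\in\mathbb N=\{0,1,2,\dots\}$ is called $L$-admissible if it is a (possibly empty) sum of not necessarily distinct elements of $L$. Let $g_L$ be the greatest common divisor of the elements of $L$, and let $p_L\in\mathbb N$ be the least number such that $\eta g_L$ is $L$-admissible for all $\eta>p_L$. (If $g_L\notin L$ and $L\neq\emptyset$, this is the Frobenius number of $\{\lambda : g_L\lambda\in L\}$; otherwise it is $0$.) Let $G=(V,E)$ be the complete undirected graph on a finite set $V$ of $n$ vertices, with edge weights $w:E\to\mathbb N$ that satisfy the triangle inequality. An $L$-cycle cover is a set $C\subseteq E$ such that every vertex is incident to exactly two edges of $C$ and the length of every cycle of $(V,C)$ is in $L$. Its weight is $w(C)=\sum_{e\in C}w(e)$. The algorithm ApxUndir works as follows (ties and other open choices are resolved arbitrarily). 1. If $n$ is not $L$-admissible, return $\bot$. 2. Run the Goemans–Williamson algorithm with $f(S)=0$ if $g_L$ divides $|S|$ and $f(S)=1$ otherwise, for $S\subseteq V$. That is: start with $F=\emptyset$, $\mathcal C=\{\{v\}:v\in V\}$, and $d(v)=0$ for all $v$. While some $S\in\mathcal C$ has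 $f(S)=1$, find distinct $P,Q\in\mathcal C$ with $f(P)+f(Q)>0$ and an edge $\{i,j\}$ with $i\in P$, $j\in Q$ that minimize $\varepsilon=\frac{w(\{i,j\})-d(i)-d(j)}{f(P)+f(Q)}$; add $\{i,j\}$ to $F$, increase $d(v)$ by $\varepsilon f(R)$ for all $v\in R\in\mathcal C$, and replace $P$ and $Q$ in $\mathcal C$ by $P\cup Q$. Finally, simultaneously discard from $F$ all edges $e$ for which no connected component $N$ of $(V,F\setminus\{e\})$ has $f(N)=1$. 3. While some connected component of $(V,F)$ is illegal, i.e. has a number of vertices that is not $L$-admissible: for every illegal component with vertex set $S$ choose a lightest edge that connects $S$ to $V\setminus S$; add all chosen edges to $F$; then, as long as there are cycles, remove one of the edges just added that lies on a cycle. 4. For every connected component of $(V,F)$: duplicate each edge, walk along an Eulerian cycle, take shortcuts at vertices already visited to obtain a Hamiltonian cycle of the component, cut this cycle into paths whose numbers of vertices are in $L$, and close every path to a cycle by connecting its endpoints. Return the set $C^{\mathrm{apx}}$ of the edges of all these cycles. **Theorem.** For every $L\subseteq\{3,4,5,\dots\}$, ApxUndir is a factor $4\cdot(p_L+4)$ approximation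 algorithm for $L$-cycle covers of minimum weight in complete undirected graphs with weights that satisfy the triangle inequality, and its running time is $O(n^2\log n)$. Precisely: (a) On every such input $(V,w)$, whatever the open choices: if ApxUndir returns a set $C^{\mathrm{apx}}$, then $C^{\mathrm{apx}}$ is an $L$-cycle cover and $w(C^{\mathrm{apx}})\le 4\,(p_L+4)\cdot w(C)$ for every $L$-cycle cover $C$; if it returns $\bot$, then there is no $L$-cycle cover. (b) For every $L$ there are a program for a random access machine and a function $T:\mathbb N\to\mathbb N$ with $T(n)=O(n^2\log n)$ such that, for all $n$ and all weights $w$ on the complete graph with $n$ vertices that satisfy the triangle inequality, the program halts on input $(n,w)$ after at most $T(n)$ steps, and its output is the output of a run of ApxUndir. The machine has finitely many arrays of natural numbers and finitely many arrays of rational numbers (the weights and numbers derived from them). Reading or writing a cell, addition, subtraction, halving and comparison take one step each; there is no multiplication, and rational numbers influence natural numbers only through comparisons. -/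

import Mathlib

/-! ### Cycle covers of complete graphs -/

namespace CycleCover

variable {V : Type*}

/-- The simple graph `(V, F)` with edge set `F`. -/
def edgeGraph (F : Finset (Sym2 V)) : SimpleGraph V :=
  SimpleGraph.fromEdgeSet (F : Set (Sym2 V))

/-- The triangle inequality for edge weights of the complete graph on `V`. Values of `w` on the
diagonal of `Sym2 V` (which are not edges) are never used. -/
def TriangleInequality (w : Sym2 V → ℕ) : Prop :=
  ∀ u v x : V, u ≠ v → u ≠ x → x ≠ v → w s(u, v) ≤ w s(u, x) + w s(x, v)

/-- The weight of a set of edges. -/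
def weight (w : Sym2 V → ℕ) (C : Finset (Sym2 V)) : ℕ := ∑ e ∈ C, w e

/-- `C` is a cycle cover of the complete graph on `V`: a set of edges such that every vertex is
incident to exactly two of them. -/
def IsCycleCover [DecidableEq V] (C : Finset (Sym2 V)) : Prop :=
  (∀ e ∈ C, ¬ e.IsDiag) ∧ ∀ v : V, (C.filter fun e => v ∈ e).card = 2

/-- An `L`-cycle cover: the length of every cycle is in `L`. -/
def IsLCycleCover [DecidableEq V] (L : Set ℕ) (C : Finset (Sym2 V)) : Prop :=
  IsCycleCover C ∧ ∀ (v : V) (p : (edgeGraph C).Walk v v), p.IsCycle → p.length ∈ L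

/-- `n` is `L`-admissible: it is a sum of (not necessarily distinct) elements of `L`. -/
def Admissible (L : Set ℕ) (n : ℕ) : Prop := n ∈ AddSubmonoid.closure L

/-- The number `g_L`, the greatest common divisor of all elements of `L`. -/
noncomputable def gcdOf (L : Set ℕ) : ℕ := Nat.setGcd L

/-- The number `p_L`: the least `p` such that `η * g_L` is `L`-admissible for all `η > p`. -/
noncomputable def frob (L : Set ℕ) : ℕ :=
  sInf {p : ℕ | ∀ η > p, Admissible L (η * gcdOf L)}

/-- The minimum in the definition of `frob` is attained. -/
theorem frob_spec (L : Set ℕ) : ∀ η > frob L, Admissible L (η * gcdOf L) := by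
  have hne : {p : ℕ | ∀ η > p, Admissible L (η * gcdOf L)}.Nonempty := by
    by_cases h0 : gcdOf L = 0
    · exact ⟨0, fun η _ => by simp [Admissible, h0]⟩
    · obtain ⟨N, hN⟩ := Nat.exists_mem_closure_of_ge L
      refine ⟨N, fun η hη => hN _ ?_ (Dvd.intro_left η rfl)⟩
      exact le_trans hη.le (Nat.le_mul_of_pos_right η (Nat.pos_of_ne_zero h0))
  exact Nat.sInf_mem hne

/-- `out` is a correct answer with approximation factor `r` for the minimum-weight `L`-cycle cover
problem on `(V, w)`; `none` stands for the answer `⊥` (there is no `L`-cycle cover). -/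
def IsApproxAnswer [DecidableEq V] (L : Set ℕ) (w : Sym2 V → ℕ) (r : ℕ) :
    Option (Finset (Sym2 V)) → Prop
  | none => ¬ ∃ C, IsLCycleCover (V := V) L C
  | some C => IsLCycleCover L C ∧ ∀ C', IsLCycleCover L C' → weight w C ≤ r * weight w C'

/-! ### Connected components of forests -/

open Classical in
/-- The vertex set of the connected component of `v` in `(V, F)`. -/
noncomputable def component [Fintype V] (F : Finset (Sym2 V)) (v : V) : Finset V :=
  Finset.univ.filter fun u => (edgeGraph F).Reachable v u

/-- The vertex sets of all connected components of `(V, F)`. -/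
noncomputable def components [Fintype V] [DecidableEq V] (F : Finset (Sym2 V)) :
    Finset (Finset V) :=
  Finset.univ.image (component F)

/-! ### The Goemans-Williamson algorithm for constrained forest problems

The algorithm is nondeterministic only in how it breaks ties. -/

/-- A state of the main loop: the edges chosen so far, the current partition of the vertices into
components, and the accumulated dual values of the vertices. -/
structure GWState (V : Type*) where
  forest : Finset (Sym2 V)
  comps : Finset (Finset V)
  d : V → ℚ

/-- Initially no edge is chosen, all components are singletons, all dual values are zero. -/
def GWState.init [Fintype V] [DecidableEq V] : GWState V where
  forest := ∅
  comps := Finset.univ.image fun v => {v}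
  d := fun _ => 0

/-- The edge `{i, j}` joins the distinct components `P ∋ i` and `Q ∋ j`, at least one of which is
active, and it becomes tight after raising the duals of the active components by `ε`. -/
def GWCandidate (w : Sym2 V → ℕ) (f : Finset V → ℕ) (σ : GWState V)
    (P Q : Finset V) (i j : V) (ε : ℚ) : Prop :=
  P ∈ σ.comps ∧ Q ∈ σ.comps ∧ P ≠ Q ∧ i ∈ P ∧ j ∈ Q ∧ f P + f Q ≠ 0 ∧
    ε = ((w s(i, j) : ℚ) - σ.d i - σ.d j) / ((f P : ℚ) + (f Q : ℚ))

/-- One iteration of the main loop, which is entered while some component `C` has `f C = 1`. -/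
inductive GWStep [DecidableEq V] (w : Sym2 V → ℕ) (f : Finset V → ℕ) :
    GWState V → GWState V → Prop
  | grow (σ : GWState V) (P Q : Finset V) (i j : V) (ε : ℚ) (d' : V → ℚ)
      (active : ∃ C ∈ σ.comps, f C = 1)
      (cand : GWCandidate w f σ P Q i j ε)
      (least : ∀ P' Q' i' j' ε', GWCandidate w f σ P' Q' i' j' ε' → ε ≤ ε')
      (raise : ∀ R ∈ σ.comps, ∀ v ∈ R, d' v = σ.d v + ε * (f R : ℚ)) :
      GWStep w f σ
        { forest := insert s(i, j) σ.forest
          comps := insert (P ∪ Q) ((σ.comps.erase P).erase Q)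
          d := d' }

open Classical in
/-- The final deletion step: keep the edges `e` such that some connected component `N` of
`(V, F \ {e})` has `f N = 1`. -/
noncomputable def gwPrune [Fintype V] (f : Finset V → ℕ) (F : Finset (Sym2 V)) :
    Finset (Sym2 V) :=
  F.filter fun e => ∃ v : V, f (component (F.erase e) v) = 1

/-- `F` is a possible output of the Goemans-Williamson algorithm on the complete graph on `V` with
edge weights `w` and the proper function `f`. -/
def GoeWill [Fintype V] [DecidableEq V] (w : Sym2 V → ℕ) (f : Finset V → ℕ)
    (F : Finset (Sym2 V)) : Prop :=
  ∃ σ : GWState V, Relation.ReflTransGen (GWStep w f) GWState.init σ ∧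
    (∀ C ∈ σ.comps, f C ≠ 1) ∧ F = gwPrune f σ.forest

/-- The function `f_L`: it is `0` on the sets whose size is divisible by `g_L`, and `1` on all
others. -/
noncomputable def properFun (L : Set ℕ) (S : Finset V) : ℕ :=
  if gcdOf L ∣ S.card then 0 else 1

/-! ### The phases that repair illegal components -/

/-- The edge `e` connects `S` to its complement. -/
def Crosses (S : Finset V) (e : Sym2 V) : Prop := ∃ u ∈ S, ∃ v ∉ S, e = s(u, v)

/-- `e` is a lightest edge connecting `S` to its complement. -/
def IsLightestCrossing (w : Sym2 V → ℕ) (S : Finset V) (e : Sym2 V) : Prop :=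
  Crosses S e ∧ ∀ e', Crosses S e' → w e ≤ w e'

/-- Remove from `H` an edge that belongs to `A` and lies on a cycle of `(V, H)`. -/
def BreakStep [DecidableEq V] (A : Finset (Sym2 V)) (H H' : Finset (Sym2 V)) : Prop :=
  ∃ e ∈ A, (∃ (v : V) (c : (edgeGraph H).Walk v v), c.IsCycle ∧ e ∈ c.edges) ∧ H' = H.erase e

open Classical in
/-- The illegal components of `(V, F)`: those whose size is not `L`-admissible. -/
noncomputable def illegal [Fintype V] (L : Set ℕ) (F : Finset (Sym2 V)) : Finset (Finset V) :=
  (components F).filter fun S => ¬ Admissible L S.card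

/-- One phase, which is entered while there is an illegal component: add a lightest outgoing edge
for every illegal component, then remove added edges that lie on cycles until there are no cycles
left. -/
def Phase [Fintype V] [DecidableEq V] (L : Set ℕ) (w : Sym2 V → ℕ) (F F' : Finset (Sym2 V)) :
    Prop :=
  (illegal L F).Nonempty ∧
    ∃ e : Finset V → Sym2 V, (∀ S ∈ illegal L F, IsLightestCrossing w S (e S)) ∧
      Relation.ReflTransGen (BreakStep ((illegal L F).image e)) (F ∪ (illegal L F).image e) F' ∧
      (edgeGraph F').IsAcyclic

/-! ### From the forest to the cycle cover -/

/-- `p` is an Eulerian cycle of the multigraph obtained from the component `S` of `(V, F)` by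
duplicating each edge: it traverses every edge of this component exactly twice. -/
def IsDoubledEulerTour [DecidableEq V] (F : Finset (Sym2 V)) (S : Finset V) {v : V}
    (p : (edgeGraph F).Walk v v) : Prop :=
  v ∈ S ∧ ∀ e ∈ F, (∃ u ∈ e, u ∈ S) → p.edges.count e = 2

/-- The entries of a list in the order of their first occurrences (`List.dedup` keeps the last
ones). This is the effect of taking shortcuts around vertices already visited. -/
def firstVisits [DecidableEq V] (l : List V) : List V := l.reverse.dedup.reverse

/-- The edges of the closed tour through the entries of `b` in this order. -/
def tourEdges (b : List V) : List (Sym2 V) := List.zipWith (fun x y => s(x, y)) b (b.rotate 1)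

/-- The Hamiltonian cycle of the component `S` of `(V, F)` that arises from a doubled Euler tour
by shortcuts is cut into the paths `bs`, whose numbers of vertices are in `L`. -/
def IsPathSplit [DecidableEq V] (L : Set ℕ) (F : Finset (Sym2 V)) (S : Finset V)
    (bs : List (List V)) : Prop :=
  (∃ (v : V) (p : (edgeGraph F).Walk v v), IsDoubledEulerTour F S p ∧
    List.IsRotated bs.flatten (firstVisits p.support)) ∧
  ∀ b ∈ bs, b.length ∈ L

/-- `C` is the union of the cycles obtained by closing the paths of all components of `(V, F)`. -/
def IsClosedUp [Fintype V] [DecidableEq V] (L : Set ℕ) (F C : Finset (Sym2 V)) : Prop :=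
  ∃ bs : Finset V → List (List V), (∀ S ∈ components F, IsPathSplit L F S (bs S)) ∧
    C = (components F).biUnion fun S => ((bs S).flatMap tourEdges).toFinset

/-- `out` is a possible output of the algorithm `ApxUndir` on the complete graph on `V` with edge
weights `w`; the choices which the algorithm leaves open are arbitrary. -/
def ApxUndir [Fintype V] [DecidableEq V] (L : Set ℕ) (w : Sym2 V → ℕ)
    (out : Option (Finset (Sym2 V))) : Prop :=
  (¬ Admissible L (Fintype.card V) ∧ out = none) ∨
  (Admissible L (Fintype.card V) ∧ ∃ F₀ F C : Finset (Sym2 V),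
    GoeWill w (properFun L) F₀ ∧ Relation.ReflTransGen (Phase L w) F₀ F ∧ illegal L F = ∅ ∧
    IsClosedUp L F C ∧ out = some C)

end CycleCover

/-! ### Random access machines

A program uses finitely many arrays of natural numbers (indices, counters, pointers) and finitely
many arrays of rational numbers (weights and quantities derived from them). The elementary
operations are reading and writing a cell, addition, subtraction, halving and comparison, each of
unit cost. There is no multiplication, and numbers of the second kind influence the natural
numbers only through comparisons. -/

namespace RAM

/-- Contents of the arrays: `idx a k` and `scal a k` are the `k`-th cells of the `a`-th array. -/
structure Store where
  idx : ℕ → ℕ → ℕ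
  scal : ℕ → ℕ → ℚ

/-- Expressions for natural numbers; subtraction is truncated, halving rounds down. -/
inductive IExpr
  | const (k : ℕ)
  | load (a : ℕ) (i : IExpr)
  | add (x y : IExpr)
  | sub (x y : IExpr)
  | half (x : IExpr)

/-- Expressions for rational numbers. -/
inductive SExpr
  | const (k : ℕ)
  | load (a : ℕ) (i : IExpr)
  | add (x y : SExpr)
  | sub (x y : SExpr)
  | half (x : SExpr)

/-- Tests. -/
inductive Test
  | ile (x y : IExpr)
  | sle (x y : SExpr)
  | not (b : Test)
  | and (b c : Test)

/-- Structured programs. -/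
inductive Program
  | skip
  | istore (a : ℕ) (i x : IExpr)
  | sstore (a : ℕ) (i : IExpr) (x : SExpr)
  | seq (c₁ c₂ : Program)
  | branch (b : Test) (c₁ c₂ : Program)
  | loop (b : Test) (c : Program)

def IExpr.eval (σ : Store) : IExpr → ℕ
  | const k => k
  | load a i => σ.idx a (i.eval σ)
  | add x y => x.eval σ + y.eval σ
  | sub x y => x.eval σ - y.eval σ
  | half x => x.eval σ / 2

def SExpr.eval (σ : Store) : SExpr → ℚ
  | const k => (k : ℚ)
  | load a i => σ.scal a (i.eval σ)
  | add x y => x.eval σ + y.eval σ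
  | sub x y => x.eval σ - y.eval σ
  | half x => x.eval σ / 2

def Test.holds (σ : Store) : Test → Prop
  | ile x y => x.eval σ ≤ y.eval σ
  | sle x y => x.eval σ ≤ y.eval σ
  | not b => ¬ b.holds σ
  | and b c => b.holds σ ∧ c.holds σ

/-- The number of elementary operations for evaluating an expression. -/
def IExpr.cost : IExpr → ℕ
  | const _ => 1
  | load _ i => i.cost + 1
  | add x y => x.cost + y.cost + 1
  | sub x y => x.cost + y.cost + 1
  | half x => x.cost + 1

def SExpr.cost : SExpr → ℕ
  | const _ => 1
  | load _ i => i.cost + 1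
  | add x y => x.cost + y.cost + 1
  | sub x y => x.cost + y.cost + 1
  | half x => x.cost + 1

def Test.cost : Test → ℕ
  | ile x y => x.cost + y.cost + 1
  | sle x y => x.cost + y.cost + 1
  | not b => b.cost + 1
  | and b c => b.cost + c.cost + 1

/-- Write `x` into the `i`-th cell of the `a`-th index array. -/
def Store.setIdx (σ : Store) (a i x : ℕ) : Store :=
  { σ with idx := Function.update σ.idx a (Function.update (σ.idx a) i x) }

/-- Write `x` into the `i`-th cell of the `a`-th scalar array. -/
def Store.setScal (σ : Store) (a i : ℕ) (x : ℚ) : Store :=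
  { σ with scal := Function.update σ.scal a (Function.update (σ.scal a) i x) }

/-- `Exec c σ t τ`: the program `c`, started with contents `σ`, halts after exactly `t` elementary
steps with contents `τ`. -/
inductive Exec : Program → Store → ℕ → Store → Prop
  | skip (σ : Store) : Exec .skip σ 1 σ
  | istore (σ : Store) (a : ℕ) (i x : IExpr) :
      Exec (.istore a i x) σ (i.cost + x.cost + 1) (σ.setIdx a (i.eval σ) (x.eval σ))
  | sstore (σ : Store) (a : ℕ) (i : IExpr) (x : SExpr) :
      Exec (.sstore a i x) σ (i.cost + x.cost + 1) (σ.setScal a (i.eval σ) (x.eval σ))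
  | seq {σ₁ σ₂ σ₃ : Store} {c₁ c₂ : Program} {t₁ t₂ : ℕ} :
      Exec c₁ σ₁ t₁ σ₂ → Exec c₂ σ₂ t₂ σ₃ → Exec (.seq c₁ c₂) σ₁ (t₁ + t₂) σ₃
  | branch_true {σ τ : Store} {b : Test} {c₁ c₂ : Program} {t : ℕ} :
      b.holds σ → Exec c₁ σ t τ → Exec (.branch b c₁ c₂) σ (b.cost + t + 1) τ
  | branch_false {σ τ : Store} {b : Test} {c₁ c₂ : Program} {t : ℕ} :
      ¬ b.holds σ → Exec c₂ σ t τ → Exec (.branch b c₁ c₂) σ (b.cost + t + 1) τ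
  | loop_done {σ : Store} {b : Test} {c : Program} :
      ¬ b.holds σ → Exec (.loop b c) σ (b.cost + 1) σ
  | loop_next {σ₁ σ₂ σ₃ : Store} {b : Test} {c : Program} {t₁ t₂ : ℕ} :
      b.holds σ₁ → Exec c σ₁ t₁ σ₂ → Exec (.loop b c) σ₂ t₂ σ₃ →
      Exec (.loop b c) σ₁ (b.cost + t₁ + t₂ + 1) σ₃

/-- The initial contents for the complete graph on `Fin n` with edge weights `w`: the cell `0` of
the index array `0` contains `n`, the scalar array `0` contains the `n × n` weight matrix row by
row (with zeros on the diagonal), and all other cells contain `0`. -/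
def input (n : ℕ) (w : Sym2 (Fin n) → ℕ) : Store where
  idx := fun a k => if a = 0 ∧ k = 0 then n else 0
  scal := fun a k =>
    if h : a = 0 ∧ k < n * n then
      let i : Fin n := ⟨k / n, Nat.div_lt_of_lt_mul h.2⟩
      let j : Fin n := ⟨k % n, Nat.mod_lt _ (Nat.pos_of_mul_pos_left (Nat.zero_lt_of_lt h.2))⟩
      if i = j then 0 else (w s(i, j) : ℚ)
    else 0

/-- The output convention: cell `0` of the index array `1` contains `0` for `⊥` and `1` otherwise;
in the latter case its cell `1` contains the length `m` of a list of edges that enumerates the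
edge set, and the endpoints of the `k`-th edge are the `k`-th cells of the index arrays `2`
and `3`, for `k < m`. -/
def Encodes {n : ℕ} (σ : Store) : Option (Finset (Sym2 (Fin n))) → Prop
  | none => σ.idx 1 0 = 0
  | some C => σ.idx 1 0 = 1 ∧ ∀ e : Sym2 ℕ,
      (∃ k < σ.idx 1 1, e = s(σ.idx 2 k, σ.idx 3 k)) ↔ ∃ e' ∈ C, e = e'.map Fin.val

end RAM

/-!
The approximation guarantee compares the three stages of the algorithm with an arbitrary `L`-cycle
cover `C`.

* Write `g` for `gcdOf L`. A set whose size is not divisible by `g` is not admissible, so at least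
  two edges of `C` leave it (`two_le_card_cut`; their number is even by `even_card_cut`). In the
  pruned forest, the active components of any earlier stage have average degree at most two
  (`sum_card_cut_gwPrune_le`): an inactive component cannot be a leaf, since a lone edge leaving it
  would split off a number of vertices divisible by `g` and would have been pruned. The dual values
  turn these two counts into `weight F₀ ≤ weight C` (`exists_load`, `GoeWill.weight_le`).
* Every phase adds at most `weight C`, as `C` leaves every illegal component at least twice and an
  edge leaves at most two components (`sum_lightest_le`). All component sizes are multiples of `g`,
  and after `k` phases an illegal component has at least `(k + 1) * g` vertices, so that there are
  at most `frob L` phases (`PhaseInv`, `exists_phaseInv`).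
* Doubling, taking shortcuts and closing up the paths costs a factor of two twice
  (`IsClosedUp.weight_le`).

So the output weighs at most `4 * (frob L + 1)` times as much as `C`. That its cycles have lengths
in `L` is `isLCycleCover_of_blocks`.

For the running time, programs are written with counting loops only (`Code`). They have a
denotational semantics (`Code.den`), which reduces correctness to loop invariants
(`Code.forTo_rule`), and the running time can be read off from the nesting depth of the loops
(`Code.time_le`). The `n` iterations of the Goemans-Williamson algorithm have to take time
`O(n log n)` each. To this end the program stores, for every pair of components, an edge between
them with least slack, together with the time at which it becomes tight if the number of active
components among the two does not change. This time stays constant until one of the two components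
is united with another. A tournament tree over all pairs yields the pair that comes first, and
uniting two components affects only `O(n)` pairs, each of which costs one path of the tree
(`refresh_spec`, `GWInv.step`). The other stages explore the forest a bounded number of times,
in time `O(n²)` each. An exploration attaches one vertex after the other as a leaf and inserts it behind its
parent in a list, which is then the order in which a doubled Euler tour visits the vertices
(`IsTourList.insert_leaf`, `explore_spec`). The numbers of vertices below the vertices, modulo `g`,
tell which edges to prune (`prune_spec`). Which numbers are divisible by `g` or admissible, and
which path length to use for the remaining part of a component, is looked up in tables. These are
periodic from some point on, so finitely many constants suffice (`exists_tables`).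
-/

/-! ### Forests and their components -/

namespace CycleCover

variable {V : Type*}

theorem edgeGraph_adj {F : Finset (Sym2 V)} {u v : V} :
    (edgeGraph F).Adj u v ↔ s(u, v) ∈ F ∧ u ≠ v := by
  simp [edgeGraph]

theorem mem_edgeSet_edgeGraph {F : Finset (Sym2 V)} {e : Sym2 V} :
    e ∈ (edgeGraph F).edgeSet ↔ e ∈ F ∧ ¬ e.IsDiag := by
  induction e with | h u v => simp [edgeGraph_adj]

theorem edgeGraph_mono {F F' : Finset (Sym2 V)} (h : F ⊆ F') : edgeGraph F ≤ edgeGraph F' := by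
  intro u v
  simp only [edgeGraph_adj]
  exact fun ⟨a, b⟩ => ⟨h a, b⟩

theorem edgeGraph_insert [DecidableEq V] {F : Finset (Sym2 V)} {i j : V} :
    edgeGraph (insert s(i, j) F) = edgeGraph F ⊔ SimpleGraph.edge i j := by
  ext u v
  simp only [edgeGraph_adj, SimpleGraph.sup_adj, SimpleGraph.edge_adj, Finset.mem_insert, Sym2.eq_iff]
  grind

theorem edgeGraph_erase [DecidableEq V] {F : Finset (Sym2 V)} {e : Sym2 V} :
    edgeGraph (F.erase e) = (edgeGraph F).deleteEdges {e} := by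
  ext u v
  simp only [edgeGraph_adj, SimpleGraph.deleteEdges_adj, Finset.mem_erase, Set.mem_singleton_iff]
  grind

/-- In a forest no edge can be bypassed. -/
theorem not_reachable_erase [DecidableEq V] {F : Finset (Sym2 V)} (hF : (edgeGraph F).IsAcyclic)
    {x y : V} (h : s(x, y) ∈ F) (hne : x ≠ y) : ¬ (edgeGraph (F.erase s(x, y))).Reachable x y := by
  rw [edgeGraph_erase]
  exact SimpleGraph.isAcyclic_iff_forall_adj_isBridge.1 hF (edgeGraph_adj.2 ⟨h, hne⟩)

theorem reachable_erase_of_notMem_edges [DecidableEq V] {F : Finset (Sym2 V)} {e : Sym2 V} {u v : V}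
    (p : (edgeGraph F).Walk u v) (h : e ∉ p.edges) : (edgeGraph (F.erase e)).Reachable u v := by
  rw [edgeGraph_erase]
  exact ⟨p.toDeleteEdge e h⟩

/-- A vertex connected to `x` is, after deletion of the edge `{x, y}`, still connected to one of
its endpoints. -/
theorem reachable_erase_or [DecidableEq V] {F : Finset (Sym2 V)} {x y u : V}
    (hu : (edgeGraph F).Reachable x u) :
    (edgeGraph (F.erase s(x, y))).Reachable x u ∨ (edgeGraph (F.erase s(x, y))).Reachable y u := by
  obtain ⟨p⟩ := hu.symm
  clear hu
  induction p with
  | nil => exact Or.inl .rfl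
  | @cons a b c hab q ih =>
    by_cases hxy : s(a, b) = s(c, y)
    · rcases Sym2.eq_iff.1 hxy with ⟨rfl, rfl⟩ | ⟨rfl, rfl⟩
      · exact Or.inl .rfl
      · exact Or.inr .rfl
    · have hab' : (edgeGraph (F.erase s(c, y))).Adj b a := by
        rw [edgeGraph_adj, Finset.mem_erase]
        rw [edgeGraph_adj] at hab
        exact ⟨⟨by rwa [Sym2.eq_swap], by rw [Sym2.eq_swap]; exact hab.1⟩, hab.2.symm⟩
      exact ih.imp (fun h => h.trans hab'.reachable) fun h => h.trans hab'.reachable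

theorem acyclic_insert [DecidableEq V] {F : Finset (Sym2 V)} (hF : (edgeGraph F).IsAcyclic) {i j : V}
    (h : ¬ (edgeGraph F).Reachable i j) : (edgeGraph (insert s(i, j) F)).IsAcyclic := by
  rw [edgeGraph_insert]
  exact hF.sup_edge_of_not_reachable h

section Fin
variable [Fintype V]

theorem mem_component {F : Finset (Sym2 V)} {u v : V} :
    u ∈ component F v ↔ (edgeGraph F).Reachable v u := by
  simp [component]

theorem self_mem_component (F : Finset (Sym2 V)) (v : V) : v ∈ component F v :=
  mem_component.2 .rfl

theorem component_eq_iff {F : Finset (Sym2 V)} {u v : V} :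
    component F u = component F v ↔ (edgeGraph F).Reachable u v := by
  constructor
  · intro h
    exact mem_component.1 (h ▸ self_mem_component F v)
  · intro h
    ext x
    simp only [mem_component]
    exact ⟨fun k => h.symm.trans k, fun k => h.trans k⟩

theorem component_eq_of_mem {F : Finset (Sym2 V)} {u v : V} (h : u ∈ component F v) :
    component F u = component F v :=
  component_eq_iff.2 (mem_component.1 h).symm

theorem component_empty (v : V) : component (∅ : Finset (Sym2 V)) v = {v} := by
  ext u
  rw [mem_component, Finset.mem_singleton]
  have : edgeGraph (∅ : Finset (Sym2 V)) = ⊥ := by simp [edgeGraph]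
  rw [this, SimpleGraph.reachable_bot, eq_comm]

variable [DecidableEq V]

theorem mem_components {F : Finset (Sym2 V)} {S : Finset V} :
    S ∈ components F ↔ ∃ v, component F v = S := by
  simp [components]

theorem component_mem_components (F : Finset (Sym2 V)) (v : V) :
    component F v ∈ components F := mem_components.2 ⟨v, rfl⟩

theorem eq_component_of_mem {F : Finset (Sym2 V)} {S : Finset V} (hS : S ∈ components F) {v : V}
    (hv : v ∈ S) : S = component F v := by
  obtain ⟨x, rfl⟩ := mem_components.1 hS
  exact (component_eq_of_mem hv).symm

/-- Adding an edge between two components unites them and changes no other component. -/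
theorem component_insert {F : Finset (Sym2 V)} {i j : V} (v : V) :
    component (insert s(i, j) F) v =
      if v ∈ component F i ∪ component F j then component F i ∪ component F j
      else component F v := by
  by_cases hij : i = j
  · subst hij
    have : edgeGraph (insert s(i, i) F) = edgeGraph F := by
      rw [edgeGraph_insert, SimpleGraph.edge_self_eq_bot, sup_bot_eq]
    ext u
    simp only [mem_component, this, Finset.union_self]
    split_ifs with h
    · simp only [Finset.union_self, mem_component] at h ⊢
      exact ⟨fun k => h.trans k, fun k => h.symm.trans k⟩
    · rw [mem_component]
  have hle : edgeGraph F ≤ edgeGraph (insert s(i, j) F) := edgeGraph_mono (Finset.subset_insert _ _)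
  have hadj : (edgeGraph (insert s(i, j) F)).Adj i j :=
    edgeGraph_adj.2 ⟨Finset.mem_insert_self _ _, hij⟩
  -- one edge never leaves the claimed set
  have key : ∀ a b, (edgeGraph (insert s(i, j) F)).Reachable a b →
      (a ∈ component F i ∪ component F j ∧ b ∈ component F i ∪ component F j) ∨
        (edgeGraph F).Reachable a b := by
    rintro a b ⟨p⟩
    induction p with
    | nil => exact Or.inr .rfl
    | @cons a b c hab q ih =>
      rw [edgeGraph_adj, Finset.mem_insert] at hab
      rcases hab with ⟨hab | hab, hne⟩
      · left
        have h1 : a ∈ component F i ∪ component F j ∧ b ∈ component F i ∪ component F j := by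
          rcases Sym2.eq_iff.1 hab with ⟨rfl, rfl⟩ | ⟨rfl, rfl⟩ <;>
            simp [self_mem_component]
        refine ⟨h1.1, ?_⟩
        rcases ih with ih | ih
        · exact ih.2
        · have h2 := h1.2
          simp only [Finset.mem_union, mem_component] at h2 ⊢
          exact h2.imp (fun h => h.trans ih) fun h => h.trans ih
      · have h1 : (edgeGraph F).Reachable a b := (edgeGraph_adj.2 ⟨hab, hne⟩).reachable
        rcases ih with ih | ih
        · left
          refine ⟨?_, ih.2⟩
          have h2 := ih.1
          simp only [Finset.mem_union, mem_component] at h2 ⊢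
          exact h2.imp (fun h => h.trans h1.symm) fun h => h.trans h1.symm
        · exact Or.inr (h1.trans ih)
  have key2 : ∀ a ∈ component F i ∪ component F j,
      (edgeGraph (insert s(i, j) F)).Reachable i a := by
    intro a ha
    simp only [Finset.mem_union, mem_component] at ha
    exact ha.elim (fun h => h.mono hle) fun h => hadj.reachable.trans (h.mono hle)
  ext u
  rw [mem_component]
  split_ifs with h
  · constructor
    · intro hr
      rcases key v u hr with h' | h'
      · exact h'.2
      · simp only [Finset.mem_union, mem_component] at h ⊢
        exact h.imp (fun h => h.trans h') fun h => h.trans h'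
    · intro hu
      exact (key2 v h).symm.trans (key2 u hu)
  · rw [mem_component]
    exact ⟨fun hr => (key v u hr).elim (fun h' => absurd h'.1 h) id, fun hr => hr.mono hle⟩

/-- A new edge unites the components of its endpoints. -/
theorem components_insert {F : Finset (Sym2 V)} {i j : V} :
    components (insert s(i, j) F) =
      insert (component F i ∪ component F j)
        (((components F).erase (component F i)).erase (component F j)) := by
  ext S
  rw [mem_components]
  simp only [component_insert, Finset.mem_insert, Finset.mem_erase, mem_components]
  constructor
  · rintro ⟨v, hv⟩
    split_ifs at hv with h
    · exact Or.inl hv.symm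
    · right
      subst hv
      simp only [Finset.mem_union, not_or] at h
      refine ⟨fun h' => h.2 ?_, fun h' => h.1 ?_, v, rfl⟩
      · rw [← h']; exact self_mem_component F v
      · rw [← h']; exact self_mem_component F v
  · rintro (rfl | ⟨h1, h2, v, rfl⟩)
    · exact ⟨i, by simp [self_mem_component]⟩
    · refine ⟨v, if_neg ?_⟩
      simp only [Finset.mem_union, not_or]
      exact ⟨fun h => h2 (component_eq_of_mem h), fun h => h1 (component_eq_of_mem h)⟩

theorem card_components_insert {F : Finset (Sym2 V)} {i j : V}
    (h : ¬ (edgeGraph F).Reachable i j) :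
    (components (insert s(i, j) F)).card + 1 = (components F).card := by
  have hne : component F j ≠ component F i := fun h' => h (component_eq_iff.1 h').symm
  rw [components_insert, Finset.card_insert_of_notMem, Finset.card_erase_of_mem,
    Finset.card_erase_of_mem (component_mem_components F i)]
  · have h2 : 1 < (components F).card := Finset.one_lt_card.2
      ⟨_, component_mem_components F i, _, component_mem_components F j, hne.symm⟩
    omega
  · exact Finset.mem_erase.2 ⟨hne, component_mem_components F j⟩
  · intro hmem
    simp only [Finset.mem_erase] at hmem
    refine hmem.1 ?_
    exact eq_component_of_mem hmem.2.2 (Finset.mem_union_right _ (self_mem_component F j))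

theorem components_empty :
    components (∅ : Finset (Sym2 V)) = Finset.univ.image fun v => {v} := by
  unfold components
  congr 1
  ext v : 1
  exact component_empty v

/-- A forest has as many edges and components together as it has vertices. -/
theorem card_add_card_components (F : Finset (Sym2 V)) (hF : (edgeGraph F).IsAcyclic)
    (hd : ∀ e ∈ F, ¬ e.IsDiag) : F.card + (components F).card = Fintype.card V := by
  induction F using Finset.induction_on with
  | empty =>
    rw [components_empty, Finset.card_image_of_injective _ (Finset.singleton_injective)]
    simp
  | insert e F he ih =>
    induction e with | h i j =>
    have hij : i ≠ j := by simpa using hd _ (Finset.mem_insert_self _ _)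
    have h := not_reachable_erase hF (Finset.mem_insert_self _ _) hij
    rw [Finset.erase_insert he] at h
    have := ih (hF.anti (edgeGraph_mono (Finset.subset_insert _ _)))
      fun e he => hd e (Finset.mem_insert_of_mem he)
    rw [Finset.card_insert_of_notMem he]
    have := card_components_insert h
    omega

/-! ### Cutting a forest -/

/-- The number of vertices on the side of `y` when the edge `{x, y}` is removed from `F`. -/
noncomputable def sideCard (F : Finset (Sym2 V)) (x y : V) : ℕ :=
  (component (F.erase s(x, y)) y).card

theorem sideCard_add_sideCard {F : Finset (Sym2 V)} (hF : (edgeGraph F).IsAcyclic) {x y : V}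
    (h : s(x, y) ∈ F) (hne : x ≠ y) :
    sideCard F x y + sideCard F y x = (component F x).card := by
  unfold sideCard
  rw [show s(y, x) = s(x, y) from Sym2.eq_swap, ← Finset.card_union_of_disjoint]
  · congr 1
    ext u
    simp only [Finset.mem_union, mem_component]
    have hle := edgeGraph_mono (Finset.erase_subset s(x, y) F)
    have hxy : (edgeGraph F).Reachable x y := (edgeGraph_adj.2 ⟨h, hne⟩).reachable
    exact ⟨fun k => k.elim (fun k => hxy.trans (k.mono hle)) fun k => k.mono hle,
      fun k => (reachable_erase_or (y := y) k).symm⟩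
  · rw [Finset.disjoint_left]
    intro u hu hu'
    rw [mem_component] at hu hu'
    exact not_reachable_erase hF h hne (hu'.trans hu.symm)

/-- The component of `x` consists of `x` and the sides of the neighbours of `x`. -/
theorem card_component_eq_one_add {F : Finset (Sym2 V)} (hF : (edgeGraph F).IsAcyclic) (x : V) :
    (component F x).card =
      1 + ∑ y ∈ Finset.univ.filter (fun y => s(x, y) ∈ F ∧ x ≠ y), sideCard F x y := by
  have hnot : ∀ y, s(x, y) ∈ F ∧ x ≠ y → x ∉ component (F.erase s(x, y)) y := fun y hy hx =>
    not_reachable_erase hF hy.1 hy.2 (mem_component.1 hx).symm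
  have hset : component F x = insert x ((Finset.univ.filter (fun y => s(x, y) ∈ F ∧ x ≠ y)).biUnion
      fun y => component (F.erase s(x, y)) y) := by
    ext u
    simp only [mem_component, Finset.mem_insert, Finset.mem_biUnion, Finset.mem_filter,
      Finset.mem_univ, true_and]
    constructor
    · intro hu
      by_cases hxu : u = x
      · exact Or.inl hxu
      right
      obtain ⟨p, hp⟩ := hu.exists_isPath
      cases p with
      | nil => exact absurd rfl hxu
      | @cons _ y _ hxy q =>
        refine ⟨y, edgeGraph_adj.1 hxy, reachable_erase_of_notMem_edges q ?_⟩
        intro hmem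
        exact ((SimpleGraph.Walk.cons_isPath_iff _ _).1 hp).2 (q.fst_mem_support_of_mem_edges hmem)
    · rintro (rfl | ⟨y, hy, hu⟩)
      · exact .rfl
      · exact (edgeGraph_adj.2 hy).reachable.trans
          (hu.mono (edgeGraph_mono (Finset.erase_subset _ _)))
  rw [hset, Finset.card_insert_of_notMem, Finset.card_biUnion, add_comm]
  · rfl
  · intro y hy z hz hyz
    rw [Finset.mem_coe, Finset.mem_filter] at hy hz
    refine Finset.disjoint_left.2 fun u hu hu' => ?_
    -- a walk from `y` to `u` that avoids `x` also survives the removal of `{x, z}`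
    have hu1 := mem_component.1 hu
    obtain ⟨p⟩ := hu1
    have hxp : x ∉ p.support := fun hx => hnot y hy.2 (mem_component.2 ⟨p.takeUntil x hx⟩)
    have h3 : (edgeGraph (F.erase s(x, z))).Reachable y u := by
      let p' := p.mapLe (edgeGraph_mono (Finset.erase_subset s(x, y) F))
      refine reachable_erase_of_notMem_edges p' fun hmem => hxp ?_
      have := p'.fst_mem_support_of_mem_edges hmem
      rwa [SimpleGraph.Walk.support_mapLe_eq_support] at this
    have h4 : (edgeGraph (F.erase s(x, z))).Adj x y := by
      rw [edgeGraph_adj, Finset.mem_erase]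
      refine ⟨⟨fun h => hyz ?_, hy.2.1⟩, hy.2.2⟩
      rcases Sym2.eq_iff.1 h with h | h
      · exact h.2
      · exact h.2.trans h.1
    exact not_reachable_erase hF hz.2.1 hz.2.2
      (h4.reachable.trans (h3.trans (mem_component.1 hu').symm))
  · simp only [Finset.mem_biUnion, Finset.mem_filter, Finset.mem_univ, true_and, not_exists, not_and]
    exact fun y hy => hnot y hy

/-- Modulo `g`, the size of `S` and the numbers of vertices split off by the edges leaving `S` add up
to zero, if `g` divides the sizes of all components. This is a flow argument: every vertex satisfies
`card_component_eq_one_add`, and an edge inside `S` splits off complementary parts of its component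
in its two directions. -/
theorem sum_card_component_cut {F : Finset (Sym2 V)} (hF : (edgeGraph F).IsAcyclic) {g : ℕ}
    (hg : ∀ v, g ∣ (component F v).card) (S : Finset V) :
    (S.card : ZMod g) + ∑ x ∈ S, ∑ y ∈ Finset.univ.filter (fun y => y ∉ S ∧ s(x, y) ∈ F),
      (sideCard F x y : ZMod g) = 0 := by
  have h0 : ∀ v, ((component F v).card : ZMod g) = 0 := fun v =>
    (ZMod.natCast_eq_zero_iff _ _).2 (hg v)
  -- contributions of the edges inside `S` cancel in pairs
  have hin : ∑ x ∈ S, ∑ y ∈ Finset.univ.filter (fun y => y ∈ S ∧ s(x, y) ∈ F ∧ x ≠ y),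
      (sideCard F x y : ZMod g) = 0 := by
    rw [Finset.sum_sigma']
    refine Finset.sum_involution (fun a _ => ⟨a.2, a.1⟩) ?_ ?_ ?_ ?_
    · rintro ⟨x, y⟩ h
      simp only [Finset.mem_sigma, Finset.mem_filter, Finset.mem_univ, true_and] at h
      have := sideCard_add_sideCard hF h.2.2.1 h.2.2.2
      rw [← Nat.cast_add, this, h0]
    · rintro ⟨x, y⟩ h _ heq
      simp only [Finset.mem_sigma, Finset.mem_filter, Finset.mem_univ, true_and] at h
      exact h.2.2.2 (congrArg Sigma.fst heq).symm
    · rintro ⟨x, y⟩ h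
      simp only [Finset.mem_sigma, Finset.mem_filter, Finset.mem_univ, true_and] at h ⊢
      exact ⟨h.2.1, h.1, by rw [Sym2.eq_swap]; exact h.2.2.1, h.2.2.2.symm⟩
    · rintro ⟨x, y⟩ h
      rfl
  have hx : ∀ x ∈ S, (1 : ZMod g)
      + ∑ y ∈ Finset.univ.filter (fun y => y ∉ S ∧ s(x, y) ∈ F), (sideCard F x y : ZMod g)
      + ∑ y ∈ Finset.univ.filter (fun y => y ∈ S ∧ s(x, y) ∈ F ∧ x ≠ y),
        (sideCard F x y : ZMod g) = 0 := by
    intro x hxS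
    have h1 := card_component_eq_one_add hF x
    have h2 := h0 x
    rw [h1] at h2
    push_cast at h2
    rw [← h2, add_assoc, ← Finset.sum_union]
    · congr 1
      refine Finset.sum_congr ?_ fun _ _ => rfl
      ext y
      simp only [Finset.mem_union, Finset.mem_filter, Finset.mem_univ, true_and]
      constructor
      · rintro (⟨a, b⟩ | ⟨a, b, c⟩)
        · exact ⟨b, fun h => a (h ▸ hxS)⟩
        · exact ⟨b, c⟩
      · rintro ⟨a, b⟩
        by_cases hy : y ∈ S
        · exact Or.inr ⟨hy, a, b⟩
        · exact Or.inl ⟨hy, a⟩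
    · rw [Finset.disjoint_left]
      intro y h h'
      rw [Finset.mem_filter] at h h'
      exact h.2.1 h'.2.1
  have := Finset.sum_eq_zero hx
  rw [Finset.sum_add_distrib, Finset.sum_add_distrib, hin, add_zero] at this
  simpa using this

/-- If all edges leaving `S` split off a number of vertices divisible by `g`, then so does `S`. -/
theorem dvd_card_of_cut {F : Finset (Sym2 V)} (hF : (edgeGraph F).IsAcyclic) {g : ℕ}
    (hg : ∀ v, g ∣ (component F v).card) {S : Finset V}
    (h : ∀ x ∈ S, ∀ y ∉ S, s(x, y) ∈ F → g ∣ sideCard F x y) : g ∣ S.card := by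
  have := sum_card_component_cut hF hg S
  rw [Finset.sum_eq_zero, add_zero] at this
  · exact (ZMod.natCast_eq_zero_iff _ _).1 this
  · intro x hx
    refine Finset.sum_eq_zero fun y hy => ?_
    rw [Finset.mem_filter] at hy
    exact (ZMod.natCast_eq_zero_iff _ _).2 (h x hx y hy.2.1 hy.2.2)

/-- If `g` divides `|S|` and all edges leaving `S` but possibly one split off a number of vertices
divisible by `g`, then so does the remaining one. -/
theorem dvd_sideCard_of_cut {F : Finset (Sym2 V)} (hF : (edgeGraph F).IsAcyclic) {g : ℕ}
    (hg : ∀ v, g ∣ (component F v).card) {S : Finset V} (hS : g ∣ S.card) {x₀ y₀ : V}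
    (hx₀ : x₀ ∈ S) (hy₀ : y₀ ∉ S) (h₀ : s(x₀, y₀) ∈ F)
    (h : ∀ x ∈ S, ∀ y ∉ S, s(x, y) ∈ F → s(x, y) ≠ s(x₀, y₀) → g ∣ sideCard F x y) :
    g ∣ sideCard F x₀ y₀ := by
  have := sum_card_component_cut hF hg S
  rw [(ZMod.natCast_eq_zero_iff _ _).2 hS, zero_add, Finset.sum_eq_single x₀,
    Finset.sum_eq_single y₀] at this
  · exact (ZMod.natCast_eq_zero_iff _ _).1 this
  · intro y hy hne
    rw [Finset.mem_filter] at hy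
    refine (ZMod.natCast_eq_zero_iff _ _).2 (h x₀ hx₀ y hy.2.1 hy.2.2 fun h' => ?_)
    rcases Sym2.eq_iff.1 h' with h' | h'
    · exact hne h'.2
    · exact hy₀ (h'.1 ▸ hx₀)
  · intro h'
    exact absurd (Finset.mem_filter.2 ⟨Finset.mem_univ _, hy₀, h₀⟩) h'
  · intro x hx hne
    refine Finset.sum_eq_zero fun y hy => ?_
    rw [Finset.mem_filter] at hy
    refine (ZMod.natCast_eq_zero_iff _ _).2 (h x hx y hy.2.1 hy.2.2 fun h' => ?_)
    rcases Sym2.eq_iff.1 h' with h' | h'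
    · exact hne h'.1
    · exact hy₀ (h'.1 ▸ hx)
  · exact fun h' => absurd hx₀ h'

/-! ### Pruning -/

theorem properFun_eq_zero_iff {L : Set ℕ} {S : Finset V} :
    properFun L S = 0 ↔ gcdOf L ∣ S.card := by
  unfold properFun; split_ifs <;> simp_all

theorem properFun_eq_one_iff {L : Set ℕ} {S : Finset V} :
    properFun L S = 1 ↔ ¬ gcdOf L ∣ S.card := by
  unfold properFun; split_ifs <;> simp_all

theorem gwPrune_subset (f : Finset V → ℕ) (F : Finset (Sym2 V)) : gwPrune f F ⊆ F := by
  unfold gwPrune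
  exact Finset.filter_subset _ _

theorem mem_gwPrune {f : Finset V → ℕ} {F : Finset (Sym2 V)} {e : Sym2 V} :
    e ∈ gwPrune f F ↔ e ∈ F ∧ ∃ v, f (component (F.erase e) v) = 1 := by
  unfold gwPrune
  rw [Finset.mem_filter]
  congr!

/-- An edge survives pruning exactly if `g_L` does not divide the sizes of its two sides. -/
theorem mem_gwPrune_iff {L : Set ℕ} {F : Finset (Sym2 V)} (hF : (edgeGraph F).IsAcyclic)
    (hg : ∀ v, gcdOf L ∣ (component F v).card) {x y : V} (h : s(x, y) ∈ F) (hne : x ≠ y) :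
    s(x, y) ∈ gwPrune (properFun L) F ↔ ¬ gcdOf L ∣ sideCard F x y := by
  rw [mem_gwPrune]
  simp only [properFun_eq_one_iff, h, true_and]
  constructor
  · rintro ⟨v, hv⟩ hd
    apply hv
    have hle := edgeGraph_mono (Finset.erase_subset s(x, y) F)
    have hd' : gcdOf L ∣ sideCard F y x := by
      have := hg x
      rw [← sideCard_add_sideCard hF h hne] at this
      exact (Nat.dvd_add_right hd).1 this
    by_cases hv' : (edgeGraph F).Reachable x v
    · rcases reachable_erase_or (y := y) hv' with h1 | h1
      · rw [← component_eq_iff.2 h1, Sym2.eq_swap]; exact hd'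
      · rw [← component_eq_iff.2 h1]; exact hd
    · have : component (F.erase s(x, y)) v = component F v := by
        ext u
        rw [mem_component, mem_component]
        refine ⟨fun k => k.mono hle, fun k => ?_⟩
        obtain ⟨p⟩ := k
        refine reachable_erase_of_notMem_edges p fun hmem => hv' ?_
        exact (SimpleGraph.Reachable.symm ⟨p.takeUntil x (p.fst_mem_support_of_mem_edges hmem)⟩)
      rw [this]
      exact hg v
  · intro hd
    exact ⟨y, hd⟩

/-- Pruning preserves that `g_L` divides the sizes of all components, as every discarded edge splits
off a multiple of `g_L`. -/
theorem dvd_card_component_gwPrune {L : Set ℕ} {F : Finset (Sym2 V)}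
    (hF : (edgeGraph F).IsAcyclic) (hg : ∀ v, gcdOf L ∣ (component F v).card) (v : V) :
    gcdOf L ∣ (component (gwPrune (properFun L) F) v).card := by
  refine dvd_card_of_cut hF hg fun x hx y hy hxy => ?_
  by_contra hd
  have hne : x ≠ y := fun h => hy (h ▸ hx)
  have hmem := (mem_gwPrune_iff hF hg hxy hne).2 hd
  refine hy (mem_component.2 ((mem_component.1 hx).trans ?_))
  exact (edgeGraph_adj.2 ⟨hmem, hne⟩).reachable

/-! ### Crossing edges -/

theorem crosses_iff {S : Finset V} {u v : V} :
    Crosses S s(u, v) ↔ (u ∈ S ∧ v ∉ S) ∨ (v ∈ S ∧ u ∉ S) := by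
  constructor
  · rintro ⟨a, ha, b, hb, h⟩
    rcases Sym2.eq_iff.1 h with ⟨rfl, rfl⟩ | ⟨rfl, rfl⟩
    · exact Or.inl ⟨ha, hb⟩
    · exact Or.inr ⟨ha, hb⟩
  · rintro (⟨h, h'⟩ | ⟨h, h'⟩)
    · exact ⟨u, h, v, h', rfl⟩
    · exact ⟨v, h, u, h', Sym2.eq_swap⟩

open Classical in
/-- The set of edges of `X` that connect `S` to its complement. -/
noncomputable def cut (X : Finset (Sym2 V)) (S : Finset V) : Finset (Sym2 V) :=
  X.filter fun e => Crosses S e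

theorem mem_cut {X : Finset (Sym2 V)} {S : Finset V} {e : Sym2 V} :
    e ∈ cut X S ↔ e ∈ X ∧ Crosses S e := by
  simp [cut]

/-- An edge between two components crosses exactly these two. -/
theorem crosses_component_iff {E : Finset (Sym2 V)} {u v : V} {R : Finset V}
    (hR : R ∈ components E) :
    Crosses R s(u, v) ↔ component E u ≠ component E v ∧ (R = component E u ∨ R = component E v) := by
  rw [crosses_iff]
  obtain ⟨r, rfl⟩ := mem_components.1 hR
  simp only [mem_component, ne_eq, component_eq_iff]
  constructor
  · rintro (⟨h, h'⟩ | ⟨h, h'⟩)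
    · exact ⟨fun k => h' (h.trans k), Or.inl h⟩
    · exact ⟨fun k => h' (h.trans k.symm), Or.inr h⟩
  · rintro ⟨h, h' | h'⟩
    · exact Or.inl ⟨h', fun k => h (h'.symm.trans k)⟩
    · exact Or.inr ⟨h', fun k => h (k.symm.trans h')⟩

open Classical in
theorem sum_crosses_components (E : Finset (Sym2 V)) (u v : V) {M : Type*} [AddCommMonoid M]
    (c : Finset V → M) :
    ∑ R ∈ components E, (if Crosses R s(u, v) then c R else 0) =
      if component E u = component E v then 0 else c (component E u) + c (component E v) := by
  split_ifs with h
  · refine Finset.sum_eq_zero fun R hR => if_neg fun h' => ?_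
    exact ((crosses_component_iff hR).1 h').1 h
  · rw [← Finset.sum_filter, ← Finset.sum_pair h]
    refine Finset.sum_congr ?_ fun _ _ => rfl
    ext R
    simp only [Finset.mem_filter, Finset.mem_insert, Finset.mem_singleton]
    constructor
    · rintro ⟨hR, h'⟩
      exact ((crosses_component_iff hR).1 h').2
    · intro h'
      have hR : R ∈ components E := by
        rcases h' with rfl | rfl <;> exact component_mem_components _ _
      exact ⟨hR, (crosses_component_iff hR).2 ⟨h, h'⟩⟩

open Classical in
theorem sum_mul_card_cut (X : Finset (Sym2 V)) (P : Finset (Finset V)) (c : Finset V → ℕ) :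
    ∑ R ∈ P, c R * (cut X R).card = ∑ e ∈ X, ∑ R ∈ P, if Crosses R e then c R else 0 := by
  rw [Finset.sum_comm]
  refine Finset.sum_congr rfl fun R _ => ?_
  rw [← Finset.sum_filter, Finset.sum_const, smul_eq_mul, mul_comm]
  rfl

/-- The combinatorial core of the Goemans-Williamson bound: in the pruned forest, the active
components of any earlier stage have average degree at most two. -/
theorem sum_card_cut_gwPrune_le {L : Set ℕ} {E F : Finset (Sym2 V)} (hEF : E ⊆ F)
    (hF : (edgeGraph F).IsAcyclic) (hd : ∀ e ∈ F, ¬ e.IsDiag)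
    (hg : ∀ v, gcdOf L ∣ (component F v).card) :
    ∑ R ∈ components E, properFun L R * (cut (gwPrune (properFun L) F) R).card ≤
      2 * ∑ R ∈ components E, properFun L R := by
  set F' := gwPrune (properFun L) F with hF'
  have hF'F : F' ⊆ F := gwPrune_subset _ _
  have hsep : ∀ u v, s(u, v) ∈ F → s(u, v) ∉ E → component E u ≠ component E v := by
    intro u v huv hE h
    have hne : u ≠ v := by simpa using hd _ huv
    refine not_reachable_erase hF huv hne ((component_eq_iff.1 h).mono (edgeGraph_mono ?_))
    exact Finset.subset_erase.2 ⟨hEF, hE⟩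
  have hsame : ∀ u v, s(u, v) ∈ E → component E u = component E v := by
    intro u v huv
    exact component_eq_iff.2 (edgeGraph_adj.2 ⟨huv, by simpa using hd _ (hEF huv)⟩).reachable
  set H := F' \ E with hH
  -- every edge of `H` crosses two components
  have htot : ∑ R ∈ components E, (cut F' R).card = 2 * H.card := by
    have h1 := sum_mul_card_cut F' (components E) fun _ => 1
    simp only [one_mul] at h1
    rw [h1, hH, Finset.card_eq_sum_ones, Finset.mul_sum, Finset.sdiff_eq_filter, Finset.sum_filter]
    refine Finset.sum_congr rfl fun e he => ?_
    induction e with | h u v =>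
    rw [sum_crosses_components]
    by_cases hE : s(u, v) ∈ E
    · rw [if_pos (hsame u v hE), if_neg (not_not.2 hE)]
    · rw [if_neg (hsep u v (hF'F he) hE), if_pos hE, mul_one]
  -- components without crossing edges survive in `E ∪ H`
  have hHcard : H.card ≤ ((components E).filter fun R => (cut F' R).card ≠ 0).card := by
    have hEH : E ∪ H ⊆ F := Finset.union_subset hEF (Finset.sdiff_subset.trans hF'F)
    have c1 := card_add_card_components (E ∪ H) (hF.anti (edgeGraph_mono hEH))
      fun e he => hd e (hEH he)
    have c2 := card_add_card_components E (hF.anti (edgeGraph_mono hEF)) fun e he => hd e (hEF he)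
    have hdis : Disjoint E H := Finset.disjoint_sdiff
    rw [Finset.card_union_of_disjoint hdis] at c1
    have c3 := Finset.card_filter_add_card_filter_not (s := components E)
      (fun R => (cut F' R).card ≠ 0)
    have c4 : ((components E).filter fun R => ¬ (cut F' R).card ≠ 0).card ≤
        (components (E ∪ H)).card := by
      refine Finset.card_le_card fun R hR => ?_
      rw [Finset.mem_filter, not_not, Finset.card_eq_zero] at hR
      obtain ⟨hR, hcut⟩ := hR
      obtain ⟨r, rfl⟩ := mem_components.1 hR
      rw [mem_components]
      refine ⟨r, ?_⟩
      ext u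
      rw [mem_component, mem_component]
      refine ⟨fun k => ?_, fun k => k.mono (edgeGraph_mono Finset.subset_union_left)⟩
      obtain ⟨p⟩ := k.symm
      clear k
      induction p with
      | nil => exact .rfl
      | @cons a b c hab q ih =>
        have ih' := ih hR hcut
        refine ih'.trans ?_
        obtain ⟨hab, hne⟩ := edgeGraph_adj.1 hab
        by_cases hE : s(a, b) ∈ E
        · exact (edgeGraph_adj.2 ⟨by rwa [Sym2.eq_swap], hne.symm⟩).reachable
        · have hmem : s(a, b) ∈ F' := (Finset.mem_sdiff.1 ((Finset.mem_union.1 hab).resolve_left hE)).1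
          exfalso
          have : s(a, b) ∈ cut F' (component E c) := by
            rw [mem_cut]
            refine ⟨hmem, (crosses_component_iff hR).2 ⟨hsep a b (hF'F hmem) hE, Or.inr ?_⟩⟩
            exact component_eq_iff.2 ih'
          rw [hcut] at this
          simp at this
    omega
  -- an inactive component is not a leaf
  have hdeg : ∀ R ∈ components E, properFun L R = 0 → (cut F' R).card ≠ 0 → 2 ≤ (cut F' R).card := by
    intro R hR h0 hc
    by_contra hlt
    have h1 : (cut F' R).card = 1 := by omega
    obtain ⟨e, he⟩ := Finset.card_eq_one.1 h1
    have hemem : e ∈ cut F' R := by rw [he]; simp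
    obtain ⟨heF', x, hx, y, hy, rfl⟩ := mem_cut.1 hemem
    have hne : x ≠ y := fun h => hy (h ▸ hx)
    refine (mem_gwPrune_iff hF hg (hF'F heF') hne).1 heF' ?_
    refine dvd_sideCard_of_cut hF hg (properFun_eq_zero_iff.1 h0) hx hy (hF'F heF') ?_
    intro a ha b hb hab hne'
    by_contra hnd
    have hmem := (mem_gwPrune_iff hF hg hab (fun h => hb (h ▸ ha))).2 hnd
    have : s(a, b) ∈ cut F' R := mem_cut.2 ⟨hmem, a, ha, b, hb, rfl⟩
    rw [he, Finset.mem_singleton] at this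
    exact hne' this
  have hle : ∑ R ∈ components E, properFun L R * (cut F' R).card + 2 * H.card ≤
      2 * H.card + 2 * ∑ R ∈ components E, properFun L R := by
    calc _ ≤ ∑ R ∈ components E, properFun L R * (cut F' R).card
          + 2 * ((components E).filter fun R => (cut F' R).card ≠ 0).card := by omega
      _ = ∑ R ∈ components E, (properFun L R * (cut F' R).card
          + if (cut F' R).card ≠ 0 then 2 else 0) := by
        rw [Finset.sum_add_distrib, ← Finset.sum_filter, Finset.sum_const, smul_eq_mul, mul_comm 2]
      _ ≤ ∑ R ∈ components E, ((cut F' R).card + 2 * properFun L R) := by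
        refine Finset.sum_le_sum fun R hR => ?_
        by_cases h0 : properFun L R = 0
        · have := hdeg R hR h0
          rw [h0]
          split_ifs with hc <;> simp_all
        · have h1 : properFun L R = 1 := by
            rw [properFun_eq_one_iff, ← properFun_eq_zero_iff]; exact h0
          rw [h1]
          split_ifs <;> omega
      _ = _ := by rw [Finset.sum_add_distrib, htot, Finset.mul_sum]
  omega

end Fin
end CycleCover

namespace CycleCover

variable {V : Type*}

/-! ### Cycle covers and cuts -/

section Cover
variable [Fintype V] [DecidableEq V]

/-- A set that is a union of components has the sum of their sizes as its size. -/
theorem card_eq_sum_components {F : Finset (Sym2 V)} {S : Finset V}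
    (hS : ∀ v ∈ S, component F v ⊆ S) :
    S.card = ∑ R ∈ (components F).filter (· ⊆ S), R.card := by
  have h : S = ((components F).filter (· ⊆ S)).biUnion id := by
    ext v
    simp only [Finset.mem_biUnion, Finset.mem_filter, id]
    exact ⟨fun hv => ⟨_, ⟨component_mem_components F v, hS v hv⟩, self_mem_component F v⟩,
      fun ⟨R, hR, hv⟩ => hR.2 hv⟩
  conv_lhs => rw [h]
  rw [Finset.card_biUnion]
  · rfl
  · intro R hR R' hR' hne
    refine Finset.disjoint_left.2 fun v hv hv' => hne ?_
    rw [eq_component_of_mem (Finset.mem_filter.1 hR).1 hv,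
      eq_component_of_mem (Finset.mem_filter.1 hR').1 hv']

theorem ncard_neighborSet_of_isCycleCover {C : Finset (Sym2 V)} (hC : IsCycleCover C) (v : V) :
    ((edgeGraph C).neighborSet v).ncard = 2 := by
  rw [← hC.2 v, ← Set.ncard_coe_finset, ← Set.ncard_image_of_injective (f := fun u => s(v, u))]
  · congr 1
    ext e
    simp only [Set.mem_image, SimpleGraph.mem_neighborSet, edgeGraph_adj, Finset.coe_filter,
      Set.mem_ofPred_eq]
    constructor
    · rintro ⟨u, ⟨h, _⟩, rfl⟩
      exact ⟨h, Sym2.mem_mk_left _ _⟩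
    · rintro ⟨h, hv⟩
      obtain ⟨u, rfl⟩ := hv
      exact ⟨u, ⟨h, by simpa using hC.1 _ h⟩, rfl⟩
  · intro a b hab
    exact Sym2.congr_right.1 hab

theorem isCycles_edgeGraph {C : Finset (Sym2 V)} (hC : IsCycleCover C) :
    (edgeGraph C).IsCycles := fun v _ => ncard_neighborSet_of_isCycleCover hC v

/-- A cycle of a cycle cover visits its whole component. -/
theorem length_eq_card_component {C : Finset (Sym2 V)} (hC : IsCycleCover C) {v : V}
    (p : (edgeGraph C).Walk v v) (hp : p.IsCycle) : p.length = (component C v).card := by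
  have hsupp : ∀ u, u ∈ p.support ↔ (edgeGraph C).Reachable v u := by
    classical
    intro u
    constructor
    · intro hu
      exact ⟨p.takeUntil u hu⟩
    · intro hu
      obtain ⟨q⟩ := hu.symm
      clear hu
      have key : ∀ {a b : V} (q : (edgeGraph C).Walk a b), b ∈ p.support → a ∈ p.support := by
        intro a b q
        induction q with
        | nil => exact id
        | cons hadj q ih =>
          intro hb
          have hmem := ih hb
          have := (hp.adj_toSubgraph_iff_of_isCycles (isCycles_edgeGraph hC)
            (p.mem_verts_toSubgraph.2 hmem) _).2 hadj.symm
          exact p.mem_verts_toSubgraph.1 (p.toSubgraph.edge_vert this.symm)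
      exact key q p.start_mem_support
  have h1 : component C v = p.support.tail.toFinset := by
    ext u
    rw [mem_component, ← hsupp, List.mem_toFinset]
    cases p with
    | nil => exact absurd rfl hp.ne_nil
    | cons h q =>
      simp only [SimpleGraph.Walk.support_cons, List.mem_cons, List.tail_cons]
      exact ⟨fun h' => h'.elim (fun h' => h' ▸ q.end_mem_support) id, Or.inr⟩
  rw [h1, List.toFinset_card_of_nodup hp.support_nodup]
  simp

theorem card_component_mem {L : Set ℕ} {C : Finset (Sym2 V)} (hC : IsLCycleCover L C) (v : V) :
    (component C v).card ∈ L := by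
  have hcyc := isCycles_edgeGraph hC.1
  have hne : ((edgeGraph C).neighborSet v).Nonempty := by
    apply Set.nonempty_of_ncard_ne_zero
    rw [ncard_neighborSet_of_isCycleCover hC.1]
    norm_num
  obtain ⟨p, hp, -⟩ := hcyc.exists_cycle_toSubgraph_verts_eq_connectedComponentSupp
    (c := (edgeGraph C).connectedComponentMk v) (v := v) rfl hne
  rw [← length_eq_card_component hC.1 p hp]
  exact hC.2 v p hp

/-- A vertex set without crossing edges of an `L`-cycle cover has `L`-admissible size. -/
theorem admissible_of_cut_eq_empty {L : Set ℕ} {C : Finset (Sym2 V)} (hC : IsLCycleCover L C)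
    {S : Finset V} (h : cut C S = ∅) : Admissible L S.card := by
  rw [card_eq_sum_components (F := C) (S := S)]
  · refine AddSubmonoid.sum_mem _ fun R hR => ?_
    obtain ⟨v, rfl⟩ := mem_components.1 (Finset.mem_filter.1 hR).1
    exact AddSubmonoid.subset_closure (card_component_mem hC v)
  · intro v hv u hu
    obtain ⟨p⟩ := (mem_component.1 hu).symm
    clear hu
    induction p with
    | nil => exact hv
    | cons hadj q ih =>
      have h1 := ih hv
      by_contra h2
      have : s(_, _) ∈ cut C S := mem_cut.2 ⟨(edgeGraph_adj.1 hadj.symm).1, _, h1, _, h2, rfl⟩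
      simp [h] at this

/-- The number of edges of a cycle cover that leave a given vertex set is even. -/
theorem even_card_cut {C : Finset (Sym2 V)} (hC : IsCycleCover C) (S : Finset V) :
    Even (cut C S).card := by
  classical
  have h1 : ∑ v ∈ S, (C.filter fun e => v ∈ e).card = 2 * S.card := by
    rw [Finset.sum_congr rfl fun v _ => hC.2 v]; simp [mul_comm]
  have h2 : ∑ v ∈ S, (C.filter fun e => v ∈ e).card = ∑ e ∈ C, (S.filter fun v => v ∈ e).card := by
    simp only [Finset.card_filter]
    exact Finset.sum_comm
  have h3 : (cut C S).card = ∑ e ∈ C, if Crosses S e then 1 else 0 := by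
    rw [← Finset.card_filter]
    unfold cut
    congr!
  have h4 : ∀ e ∈ C, ∃ k, (S.filter fun v => v ∈ e).card = (if Crosses S e then 1 else 0) + 2 * k := by
    intro e he
    have hd := hC.1 e he
    induction e with | h a b =>
    have hab : a ≠ b := by simpa using hd
    have : (S.filter fun v => v ∈ s(a, b)) = ({a, b} : Finset V).filter (· ∈ S) := by
      ext v; simp [and_comm]
    rw [this, Finset.filter_insert, Finset.filter_singleton]
    simp only [crosses_iff]
    by_cases ha : a ∈ S <;> by_cases hb : b ∈ S <;> simp [ha, hb, Finset.card_pair hab]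
  choose! k hk using h4
  rw [Finset.sum_congr rfl hk, Finset.sum_add_distrib, ← h3, ← Finset.mul_sum] at h2
  rw [h1] at h2
  rw [Nat.even_iff]
  omega

/-- An `L`-cycle cover leaves a set of inadmissible size at least twice. -/
theorem two_le_card_cut {L : Set ℕ} {C : Finset (Sym2 V)} (hC : IsLCycleCover L C)
    {S : Finset V} (h : ¬ Admissible L S.card) : 2 ≤ (cut C S).card := by
  have h1 := even_card_cut hC.1 S
  have h2 : (cut C S).card ≠ 0 := fun h0 =>
    h (admissible_of_cut_eq_empty hC (Finset.card_eq_zero.1 h0))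
  rw [Nat.even_iff] at h1
  omega

theorem gcdOf_dvd_of_admissible {L : Set ℕ} {n : ℕ} (h : Admissible L n) : gcdOf L ∣ n := by
  refine AddSubmonoid.closure_induction (motive := fun n _ => gcdOf L ∣ n) ?_ ?_ ?_ h
  · intro x hx
    exact Nat.setGcd_dvd_of_mem hx
  · exact dvd_zero _
  · intro x y _ _ hx hy
    exact dvd_add hx hy

end Cover

/-! ### The Goemans-Williamson bound -/

section GW
variable [Fintype V] [DecidableEq V] {w : Sym2 V → ℕ} {f : Finset V → ℕ}

/-- What all states of the main loop have in common: the components are those of the forest. -/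
structure GWState.IsForestState (σ : GWState V) : Prop where
  comps_eq : σ.comps = components σ.forest
  acyclic : (edgeGraph σ.forest).IsAcyclic
  not_diag : ∀ e ∈ σ.forest, ¬ e.IsDiag

theorem isForestState_init : (GWState.init : GWState V).IsForestState where
  comps_eq := components_empty.symm
  acyclic := by
    have : edgeGraph (∅ : Finset (Sym2 V)) = ⊥ := by simp [edgeGraph]
    simp [GWState.init, this]
  not_diag := by simp [GWState.init]

theorem GWStep.isForestState {σ τ : GWState V} (h : GWStep w f σ τ) (hσ : σ.IsForestState) :
    τ.IsForestState := by
  cases h with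
  | grow P Q i j ε d' active cand least raise =>
    obtain ⟨hP, hQ, hPQ, hi, hj, -, -⟩ := cand
    rw [hσ.comps_eq] at hP hQ
    have hP' := eq_component_of_mem hP hi
    have hQ' := eq_component_of_mem hQ hj
    have hnr : ¬ (edgeGraph σ.forest).Reachable i j := fun h =>
      hPQ (by rw [hP', hQ', component_eq_iff.2 h])
    refine ⟨?_, acyclic_insert hσ.acyclic hnr, ?_⟩
    · dsimp only
      rw [components_insert, ← hP', ← hQ', hσ.comps_eq]
    · intro e he
      rcases Finset.mem_insert.1 he with rfl | he
      · rw [Sym2.mk_isDiag_iff]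
        rintro rfl
        exact hnr .rfl
      · exact hσ.not_diag e he

theorem isForestState_of_reachable {σ : GWState V}
    (h : Relation.ReflTransGen (GWStep w f) GWState.init σ) : σ.IsForestState := by
  induction h with
  | refl => exact isForestState_init
  | tail _ h ih => exact h.isForestState ih

theorem forest_subset_of_reachable {σ τ : GWState V}
    (h : Relation.ReflTransGen (GWStep w f) σ τ) : σ.forest ⊆ τ.forest := by
  induction h with
  | refl => exact subset_rfl
  | tail _ h ih =>
    cases h
    exact ih.trans (Finset.subset_insert _ _)

/-- The dual solution, seen from the edges: `load e` is the total dual value of the sets crossed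
by `e`. It never exceeds the weight, with equality for the chosen edges. Since the loads of an edge
set are accumulated from its crossings with active components, an edge set which crosses active
components at most as often as another one at all times has at most the same load. -/
theorem exists_load {σ : GWState V} (h : Relation.ReflTransGen (GWStep w f) GWState.init σ) :
    ∃ load : Sym2 V → ℚ, (∀ e, ¬ e.IsDiag → load e ≤ w e) ∧ (∀ e ∈ σ.forest, load e = w e) ∧
      (∀ u v, component σ.forest u ≠ component σ.forest v → load s(u, v) = σ.d u + σ.d v) ∧
      ∀ X Y : Finset (Sym2 V),
        (∀ τ, Relation.ReflTransGen (GWStep w f) GWState.init τ →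
          Relation.ReflTransGen (GWStep w f) τ σ →
          ∑ R ∈ τ.comps, f R * (cut X R).card ≤ ∑ R ∈ τ.comps, f R * (cut Y R).card) →
        ∑ e ∈ X, load e ≤ ∑ e ∈ Y, load e := by
  classical
  induction h with
  | refl => exact ⟨fun _ => 0, by simp, by simp [GWState.init], by simp [GWState.init], by simp⟩
  | @tail σ τ hσ hstep ih =>
    obtain ⟨load, hle, heq, hd, hsum⟩ := ih
    have hfs := isForestState_of_reachable hσ
    have hstep' := hstep
    cases hstep with
    | grow P Q i j ε d' active cand least raise =>
      have hcand := cand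
      obtain ⟨hP, hQ, hPQ, hi, hj, hne, hε⟩ := cand
      rw [hfs.comps_eq] at hP hQ
      have hP' := eq_component_of_mem hP hi
      have hQ' := eq_component_of_mem hQ hj
      have hij : component σ.forest i ≠ component σ.forest j := by rwa [← hP', ← hQ']
      have hpos : (0 : ℚ) < (f P : ℚ) + (f Q : ℚ) := by exact_mod_cast Nat.pos_of_ne_zero hne
      have hndiag : ∀ u v, component σ.forest u ≠ component σ.forest v → ¬ s(u, v).IsDiag := by
        intro u v huv
        rw [Sym2.mk_isDiag_iff]
        rintro rfl
        exact huv rfl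
      have hε0 : 0 ≤ ε := by
        rw [hε]
        refine div_nonneg ?_ hpos.le
        have := hle _ (hndiag i j hij)
        rw [hd i j hij] at this
        linarith
      set inc : Sym2 V → ℕ := fun e => ∑ R ∈ components σ.forest, if Crosses R e then f R else 0
        with hinc
      have hinc1 : ∀ u v, component σ.forest u = component σ.forest v → inc s(u, v) = 0 := by
        intro u v h
        simp only [hinc]
        rw [sum_crosses_components, if_pos h]
      have hinc2 : ∀ u v, component σ.forest u ≠ component σ.forest v →
          inc s(u, v) = f (component σ.forest u) + f (component σ.forest v) := by
        intro u v h
        simp only [hinc]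
        rw [sum_crosses_components, if_neg h]
      have hd' : ∀ v, d' v = σ.d v + ε * (f (component σ.forest v) : ℚ) := fun v =>
        raise _ (by rw [hfs.comps_eq]; exact component_mem_components _ v) v (self_mem_component _ v)
      refine ⟨fun e => load e + ε * inc e, ?_, ?_, ?_, ?_⟩
      · intro e he
        induction e with | h u v =>
        dsimp only
        by_cases huv : component σ.forest u = component σ.forest v
        · rw [hinc1 u v huv]
          simpa using hle _ he
        · rw [hinc2 u v huv]
          by_cases h0 : f (component σ.forest u) + f (component σ.forest v) = 0
          · rw [h0]
            simpa using hle _ he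
          · have := least (component σ.forest u) (component σ.forest v) u v _
              ⟨by rw [hfs.comps_eq]; exact component_mem_components _ u,
                by rw [hfs.comps_eq]; exact component_mem_components _ v, huv,
                self_mem_component _ u, self_mem_component _ v, h0, rfl⟩
            rw [le_div_iff₀ (by exact_mod_cast Nat.pos_of_ne_zero h0)] at this
            rw [hd u v huv]
            push_cast
            linarith
      · intro e he
        dsimp only
        rcases Finset.mem_insert.1 he with rfl | he
        · rw [hinc2 i j hij, hd i j hij, hε, ← hP', ← hQ']
          push_cast
          rw [div_mul_cancel₀ _ hpos.ne']
          ring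
        · induction e with | h u v =>
          have huv : u ≠ v := by simpa using hfs.not_diag _ he
          rw [hinc1 u v (component_eq_iff.2 (edgeGraph_adj.2 ⟨he, huv⟩).reachable)]
          simpa using heq _ he
      · intro u v huv
        have huv' : component σ.forest u ≠ component σ.forest v := by
          intro h
          apply huv
          rw [component_eq_iff] at h ⊢
          exact h.mono (edgeGraph_mono (Finset.subset_insert _ _))
        dsimp only
        rw [hinc2 u v huv', hd u v huv', hd', hd']
        push_cast
        ring
      · intro X Y hXY
        have h1 := hsum X Y fun ρ h1 h2 => hXY ρ h1 (h2.tail hstep')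
        have h2 := hXY σ hσ (Relation.ReflTransGen.single hstep')
        rw [hfs.comps_eq, sum_mul_card_cut, sum_mul_card_cut] at h2
        have h3 : (∑ e ∈ X, (inc e : ℚ)) ≤ ∑ e ∈ Y, (inc e : ℚ) := by
          rw [← Nat.cast_sum, ← Nat.cast_sum, Nat.cast_le]
          simp only [hinc]
          convert h2
        rw [Finset.sum_add_distrib, Finset.sum_add_distrib, ← Finset.mul_sum, ← Finset.mul_sum]
        have := mul_le_mul_of_nonneg_left h3 hε0
        linarith

theorem GoeWill.acyclic {F : Finset (Sym2 V)} (h : GoeWill w f F) : (edgeGraph F).IsAcyclic := by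
  obtain ⟨σ, hσ, -, rfl⟩ := h
  exact (isForestState_of_reachable hσ).acyclic.anti (edgeGraph_mono (gwPrune_subset _ _))

theorem GoeWill.not_diag {F : Finset (Sym2 V)} (h : GoeWill w f F) : ∀ e ∈ F, ¬ e.IsDiag := by
  obtain ⟨σ, hσ, -, rfl⟩ := h
  exact fun e he => (isForestState_of_reachable hσ).not_diag e (gwPrune_subset _ _ he)

theorem dvd_card_component_of_final {L : Set ℕ} {σ : GWState V} (hσ : σ.IsForestState)
    (h : ∀ C ∈ σ.comps, properFun L C ≠ 1) (v : V) :
    gcdOf L ∣ (component σ.forest v).card := by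
  have := h _ (by rw [hσ.comps_eq]; exact component_mem_components _ v)
  rwa [Ne, properFun_eq_one_iff, not_not] at this

theorem GoeWill.dvd_card {L : Set ℕ} {F : Finset (Sym2 V)} (h : GoeWill w (properFun L) F) (v : V) :
    gcdOf L ∣ (component F v).card := by
  obtain ⟨σ, hσ, hfin, rfl⟩ := h
  have hfs := isForestState_of_reachable hσ
  exact dvd_card_component_gwPrune hfs.acyclic (dvd_card_component_of_final hfs hfin) v

/-- The Goemans-Williamson forest weighs at most as much as any `L`-cycle cover: the pruned forest
crosses active components at most twice on average, the cycle cover at least twice. -/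
theorem GoeWill.weight_le {L : Set ℕ} {F C : Finset (Sym2 V)} (h : GoeWill w (properFun L) F)
    (hC : IsLCycleCover L C) : weight w F ≤ weight w C := by
  obtain ⟨σ, hσ, hfin, rfl⟩ := h
  have hfs := isForestState_of_reachable hσ
  obtain ⟨load, hle, heq, -, hsum⟩ := exists_load hσ
  have key := hsum (gwPrune (properFun L) σ.forest) C ?_
  · have h1 : ∑ e ∈ gwPrune (properFun L) σ.forest, load e =
        (weight w (gwPrune (properFun L) σ.forest) : ℚ) := by
      unfold weight
      push_cast
      exact Finset.sum_congr rfl fun e he => heq e (gwPrune_subset _ _ he)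
    have h2 : ∑ e ∈ C, load e ≤ (weight w C : ℚ) := by
      unfold weight
      push_cast
      exact Finset.sum_le_sum fun e he => hle e (hC.1.1 e he)
    rw [h1] at key
    exact_mod_cast key.trans h2
  · intro τ hτ hτσ
    rw [(isForestState_of_reachable hτ).comps_eq]
    refine (sum_card_cut_gwPrune_le (forest_subset_of_reachable hτσ) hfs.acyclic hfs.not_diag
      (dvd_card_component_of_final hfs hfin)).trans ?_
    rw [Finset.mul_sum]
    refine Finset.sum_le_sum fun R _ => ?_
    by_cases h0 : properFun L R = 0
    · simp [h0]
    · have : 2 ≤ (cut C R).card := two_le_card_cut hC fun h =>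
        h0 (properFun_eq_zero_iff.2 (gcdOf_dvd_of_admissible h))
      rw [mul_comm]
      exact Nat.mul_le_mul_left _ this

end GW

/-! ### The repair phases -/

section Phase
variable [Fintype V] [DecidableEq V] {w : Sym2 V → ℕ} {L : Set ℕ}

theorem mem_illegal {F : Finset (Sym2 V)} {S : Finset V} :
    S ∈ illegal L F ↔ S ∈ components F ∧ ¬ Admissible L S.card := by
  classical
  unfold illegal
  rw [Finset.mem_filter]
  congr!

theorem BreakStep.reachable_iff {A H H' : Finset (Sym2 V)} (h : BreakStep A H H') (u v : V) :
    (edgeGraph H').Reachable u v ↔ (edgeGraph H).Reachable u v := by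
  obtain ⟨e, -, ⟨x, c, hc, he⟩, rfl⟩ := h
  refine ⟨fun h => h.mono (edgeGraph_mono (Finset.erase_subset _ _)), ?_⟩
  induction e with | h a b =>
  have := SimpleGraph.adj_and_reachable_delete_edges_iff_exists_cycle.2 ⟨x, c, hc, he⟩
  rw [← edgeGraph_erase] at this
  have hab := this.2
  intro hr
  obtain ⟨p⟩ := hr
  induction p with
  | nil => exact .rfl
  | @cons y z t hyz q ih =>
    refine SimpleGraph.Reachable.trans ?_ ih
    by_cases heq : s(y, z) = s(a, b)
    · rcases Sym2.eq_iff.1 heq with ⟨rfl, rfl⟩ | ⟨rfl, rfl⟩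
      · exact hab
      · exact hab.symm
    · refine (edgeGraph_adj.2 ⟨Finset.mem_erase.2 ⟨heq, ?_⟩, ?_⟩).reachable
      · exact (edgeGraph_adj.1 hyz).1
      · exact (edgeGraph_adj.1 hyz).2

theorem breakSteps_reachable_iff {A H H' : Finset (Sym2 V)}
    (h : Relation.ReflTransGen (BreakStep A) H H') (u v : V) :
    (edgeGraph H').Reachable u v ↔ (edgeGraph H).Reachable u v := by
  induction h with
  | refl => rfl
  | tail _ h ih => rw [h.reachable_iff, ih]

theorem breakSteps_subset {A H H' : Finset (Sym2 V)}
    (h : Relation.ReflTransGen (BreakStep A) H H') : H' ⊆ H ∧ H ⊆ H' ∪ A := by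
  induction h with
  | refl => exact ⟨subset_rfl, Finset.subset_union_left⟩
  | tail _ h ih =>
    obtain ⟨e, heA, -, rfl⟩ := h
    refine ⟨(Finset.erase_subset _ _).trans ih.1, fun x hx => ?_⟩
    rcases Finset.mem_union.1 (ih.2 hx) with h | h
    · by_cases hxe : x = e
      · exact Finset.mem_union_right _ (hxe ▸ heA)
      · exact Finset.mem_union_left _ (Finset.mem_erase.2 ⟨hxe, h⟩)
    · exact Finset.mem_union_right _ h

/-- The lightest edges leaving the illegal components weigh at most as much as a cycle cover: a
cycle cover leaves every illegal component at least twice, and every edge leaves at most two. -/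
theorem sum_lightest_le {F C : Finset (Sym2 V)} (hC : IsLCycleCover L C) {e : Finset V → Sym2 V}
    (he : ∀ S ∈ illegal L F, IsLightestCrossing w S (e S)) :
    ∑ S ∈ illegal L F, w (e S) ≤ weight w C := by
  classical
  have h1 : ∀ S ∈ illegal L F, 2 * w (e S) ≤ ∑ x ∈ C, if Crosses S x then w x else 0 := by
    intro S hS
    have h2 := two_le_card_cut hC (mem_illegal.1 hS).2
    calc 2 * w (e S) ≤ (cut C S).card * w (e S) := Nat.mul_le_mul_right _ h2
      _ = ∑ x ∈ cut C S, w (e S) := by simp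
      _ ≤ ∑ x ∈ cut C S, w x := Finset.sum_le_sum fun x hx => (he S hS).2 x (mem_cut.1 hx).2
      _ = _ := by
        rw [← Finset.sum_filter]
        refine Finset.sum_congr ?_ fun _ _ => rfl
        ext x
        rw [mem_cut, Finset.mem_filter]
  have h3 := Finset.sum_le_sum h1
  rw [← Finset.mul_sum, Finset.sum_comm] at h3
  have h4 : ∀ x ∈ C, (∑ S ∈ illegal L F, if Crosses S x then w x else 0) ≤ 2 * w x := by
    intro x _
    refine (Finset.sum_le_sum_of_subset (t := components F) fun S hS => (mem_illegal.1 hS).1).trans ?_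
    induction x with | h u v =>
    rw [sum_crosses_components]
    split_ifs <;> omega
  have h5 := h3.trans (Finset.sum_le_sum h4)
  rw [← Finset.mul_sum] at h5
  exact Nat.le_of_mul_le_mul_left h5 (by norm_num)

/-- What holds for the forest after `k` phases. -/
structure PhaseInv (L : Set ℕ) (F : Finset (Sym2 V)) (k : ℕ) : Prop where
  acyclic : (edgeGraph F).IsAcyclic
  not_diag : ∀ e ∈ F, ¬ e.IsDiag
  dvd_card : ∀ v, gcdOf L ∣ (component F v).card
  le_card : ∀ S ∈ illegal L F, (k + 1) * gcdOf L ≤ S.card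

theorem GoeWill.phaseInv {F : Finset (Sym2 V)} (h : GoeWill w (properFun L) F) :
    PhaseInv L F 0 where
  acyclic := h.acyclic
  not_diag := h.not_diag
  dvd_card := h.dvd_card
  le_card := by
    intro S hS
    obtain ⟨v, rfl⟩ := mem_components.1 (mem_illegal.1 hS).1
    simpa using Nat.le_of_dvd (Finset.card_pos.2 ⟨v, self_mem_component F v⟩) (h.dvd_card v)

/-- An illegal component of the new forest contains an illegal component of the old one together with
a further component, whose size is a positive multiple of `g_L`. -/
theorem Phase.phaseInv {F F' : Finset (Sym2 V)} {k : ℕ} (h : Phase L w F F')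
    (hF : PhaseInv L F k) : PhaseInv L F' (k + 1) := by
  obtain ⟨-, e, he, hbreak, hac⟩ := h
  have hreach := breakSteps_reachable_iff hbreak
  have hsub := breakSteps_subset hbreak
  have hFF' : ∀ v, component F v ⊆ component F' v := by
    intro v u hu
    rw [mem_component] at hu ⊢
    exact (hreach v u).2 (hu.mono (edgeGraph_mono Finset.subset_union_left))
  have hclosed : ∀ x, ∀ v ∈ component F' x, component F v ⊆ component F' x := by
    intro x v hv
    rw [← component_eq_of_mem hv]
    exact hFF' v
  have hdvd : ∀ v, gcdOf L ∣ (component F' v).card := by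
    intro v
    rw [card_eq_sum_components (hclosed v)]
    refine Finset.dvd_sum fun R hR => ?_
    obtain ⟨x, rfl⟩ := mem_components.1 (Finset.mem_filter.1 hR).1
    exact hF.dvd_card x
  refine ⟨hac, ?_, hdvd, ?_⟩
  · intro x hx
    rcases Finset.mem_union.1 (hsub.1 hx) with h | h
    · exact hF.not_diag x h
    · obtain ⟨S, hS, rfl⟩ := Finset.mem_image.1 h
      obtain ⟨u, hu, v, hv, huv⟩ := (he S hS).1
      rw [huv, Sym2.mk_isDiag_iff]
      rintro rfl
      exact hv hu
  · intro S hS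
    obtain ⟨hS1, hS2⟩ := mem_illegal.1 hS
    obtain ⟨x, rfl⟩ := mem_components.1 hS1
    -- some illegal component `R` of `F` lies in the new illegal component
    have hex : ∃ R ∈ illegal L F, R ⊆ component F' x := by
      by_contra hcon
      push Not at hcon
      apply hS2
      rw [card_eq_sum_components (hclosed x)]
      refine AddSubmonoid.sum_mem _ fun R hR => ?_
      by_contra hna
      rw [Finset.mem_filter] at hR
      exact hcon R (mem_illegal.2 ⟨hR.1, hna⟩) hR.2
    obtain ⟨R, hR, hRS⟩ := hex
    -- and it is properly contained, because of the edge added for it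
    obtain ⟨u, hu, v, hv, huv⟩ := (he R hR).1
    have hv' : v ∈ component F' x := by
      rw [mem_component]
      refine (mem_component.1 (hRS hu)).trans ((hreach u v).2 ?_)
      refine (edgeGraph_adj.2 ⟨Finset.mem_union_right _ ?_, ?_⟩).reachable
      · rw [← huv]; exact Finset.mem_image_of_mem e hR
      · rintro rfl; exact hv hu
    have hlt : R.card < (component F' x).card :=
      Finset.card_lt_card ⟨hRS, fun h => hv (h hv')⟩
    have h1 := hF.le_card R hR
    obtain ⟨m, hm⟩ := hdvd x
    have h2 : gcdOf L * (k + 1) < gcdOf L * m := by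
      rw [← hm, mul_comm]; omega
    have h3 : k + 1 < m := Nat.lt_of_mul_lt_mul_left h2
    rw [hm, mul_comm]
    exact Nat.mul_le_mul_left _ h3

theorem Phase.weight_le {F F' C : Finset (Sym2 V)} (h : Phase L w F F')
    (hC : IsLCycleCover L C) : weight w F' ≤ weight w F + weight w C := by
  obtain ⟨-, e, he, hbreak, -⟩ := h
  have h1 : weight w F' ≤ weight w (F ∪ (illegal L F).image e) :=
    Finset.sum_le_sum_of_subset (breakSteps_subset hbreak).1
  have h2 : weight w (F ∪ (illegal L F).image e) ≤ weight w F + weight w ((illegal L F).image e) := by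
    unfold weight
    rw [← Finset.sum_union_inter]
    exact Nat.le_add_right _ _
  have h3 : weight w ((illegal L F).image e) ≤ ∑ S ∈ illegal L F, w (e S) :=
    Finset.sum_image_le_of_nonneg (fun _ _ => Nat.zero_le _)
  have h4 := sum_lightest_le hC he
  omega

/-- All multiples of `g_L` above `p_L * g_L` are admissible, so a phase is entered at most `p_L`
times. -/
theorem PhaseInv.le_frob {F : Finset (Sym2 V)} {k : ℕ} (h : PhaseInv L F k)
    (hne : (illegal L F).Nonempty) : k + 1 ≤ frob L := by
  obtain ⟨S, hS⟩ := hne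
  obtain ⟨hS1, hS2⟩ := mem_illegal.1 hS
  obtain ⟨v, rfl⟩ := mem_components.1 hS1
  obtain ⟨m, hm⟩ := h.dvd_card v
  by_contra hlt
  have h1 := h.le_card _ hS
  have hpos : 0 < (component F v).card := Finset.card_pos.2 ⟨v, self_mem_component F v⟩
  have hg : 0 < gcdOf L := Nat.pos_of_mul_pos_right (hm ▸ hpos)
  rw [hm, mul_comm] at h1
  have h2 := Nat.le_of_mul_le_mul_left h1 hg
  refine hS2 ?_
  rw [hm, mul_comm]
  exact frob_spec L m (by omega)

/-- Every phase enlarges the illegal components, so that there are at most `p_L` phases. -/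
theorem exists_phaseInv {F₀ F : Finset (Sym2 V)} (h₀ : GoeWill w (properFun L) F₀)
    (h : Relation.ReflTransGen (Phase L w) F₀ F) :
    ∃ k ≤ frob L, PhaseInv L F k ∧
      ∀ C, IsLCycleCover L C → weight w F ≤ (k + 1) * weight w C := by
  induction h with
  | refl => exact ⟨0, Nat.zero_le _, h₀.phaseInv, fun C hC => by simpa using h₀.weight_le hC⟩
  | tail _ h ih =>
    obtain ⟨k, -, hinv, hw⟩ := ih
    refine ⟨k + 1, hinv.le_frob h.1, h.phaseInv hinv, fun C hC => ?_⟩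
    have h1 := hw C hC
    have h2 := h.weight_le hC
    calc _ ≤ _ := h2
      _ ≤ (k + 1) * weight w C + weight w C := by omega
      _ = _ := by ring

end Phase
end CycleCover

namespace CycleCover

variable {V : Type*}

/-! ### Paths and tours given by lists -/

/-- The edges of the path through the entries of a list. -/
def pathEdges (l : List V) : List (Sym2 V) := List.zipWith (fun x y => s(x, y)) l l.tail

@[simp] theorem pathEdges_nil : pathEdges ([] : List V) = [] := rfl

@[simp] theorem pathEdges_singleton (a : V) : pathEdges [a] = [] := rfl

@[simp] theorem pathEdges_cons_cons (a b : V) (t : List V) :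
    pathEdges (a :: b :: t) = s(a, b) :: pathEdges (b :: t) := rfl

theorem tourEdges_cons (a : V) (t : List V) : tourEdges (a :: t) = pathEdges (a :: (t ++ [a])) := by
  unfold tourEdges pathEdges
  rw [List.rotate_cons_succ, List.rotate_zero, List.tail_cons]
  conv_rhs => rw [← List.cons_append, ← List.append_nil (t ++ [a])]
  rw [List.zipWith_append (by simp)]
  simp

theorem tourEdges_rotate (l : List V) (k : ℕ) : tourEdges (l.rotate k) = (tourEdges l).rotate k := by
  unfold tourEdges
  rw [List.zipWith_rotate_distrib _ _ _ _ (by simp), List.rotate_rotate, List.rotate_rotate, add_comm]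

theorem mem_of_mem_pathEdges {l : List V} {e : Sym2 V} (h : e ∈ pathEdges l) {v : V} (hv : v ∈ e) :
    v ∈ l := by
  induction l with
  | nil => simp at h
  | cons a t ih =>
    cases t with
    | nil => simp at h
    | cons b t =>
      rw [pathEdges_cons_cons, List.mem_cons] at h
      rcases h with rfl | h
      · rcases Sym2.mem_iff.1 hv with rfl | rfl <;> simp
      · exact List.mem_cons_of_mem _ (ih h)

theorem pathEdges_append_pair (l : List V) (a b : V) :
    pathEdges (l ++ [a, b]) = pathEdges (l ++ [a]) ++ [s(a, b)] := by
  induction l with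
  | nil => rfl
  | cons x t ih =>
    cases t with
    | nil => rfl
    | cons y t =>
      simp only [List.cons_append, pathEdges_cons_cons] at ih ⊢
      rw [ih]

theorem walk_edges_eq_pathEdges {G : SimpleGraph V} {u v : V} (p : G.Walk u v) :
    p.edges = pathEdges p.support := by
  induction p with
  | nil => rfl
  | cons h q ih =>
    cases q with
    | nil => rfl
    | cons h' q => simpa using ih

theorem mem_tourEdges_of_mem {b : List V} {e : Sym2 V} (h : e ∈ tourEdges b) {v : V} (hv : v ∈ e) :
    v ∈ b := by
  cases b with
  | nil => simp [tourEdges] at h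
  | cons a t =>
    rw [tourEdges_cons] at h
    simpa [or_comm] using mem_of_mem_pathEdges h hv

theorem exists_rotate_eq_cons {b : List V} {v : V} (hv : v ∈ b) : ∃ k t, b.rotate k = v :: t := by
  obtain ⟨l₁, l₂, rfl⟩ := List.append_of_mem hv
  exact ⟨l₁.length, l₂ ++ l₁, by simp⟩

/-- In a tour through at least three distinct vertices, every vertex has two neighbours. -/
theorem exists_neighbors_tourEdges {b : List V} (hb : b.Nodup) (h3 : 3 ≤ b.length) {v : V}
    (hv : v ∈ b) : ∃ x y, x ≠ y ∧ v ≠ x ∧ v ≠ y ∧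
      ∀ e, (e ∈ tourEdges b ∧ v ∈ e) ↔ (e = s(v, x) ∨ e = s(v, y)) := by
  obtain ⟨k, t, hk⟩ := exists_rotate_eq_cons hv
  have hnd : (v :: t).Nodup := by rw [← hk]; exact List.nodup_rotate.2 hb
  have hlen : 3 ≤ (v :: t).length := by rw [← hk]; simpa using h3
  have hmem : ∀ e, e ∈ tourEdges b ↔ e ∈ tourEdges (v :: t) := by
    intro e
    rw [← hk, tourEdges_rotate, List.mem_rotate]
  simp only [hmem]
  cases t with
  | nil => simp at hlen
  | cons x t =>
    rcases List.eq_nil_or_concat t with rfl | ⟨m, y, rfl⟩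
    · simp at hlen
    simp only [List.concat_eq_append] at hnd hlen ⊢
    refine ⟨x, y, ?_, ?_, ?_, ?_⟩
    · rintro rfl; simp at hnd
    · rintro rfl; simp at hnd
    · rintro rfl; simp at hnd
    · intro e
      have hE : tourEdges (v :: x :: (m ++ [y])) =
          s(v, x) :: (pathEdges (x :: (m ++ [y])) ++ [s(y, v)]) := by
        rw [tourEdges_cons]
        have := pathEdges_append_pair (x :: m) y v
        simp only [List.cons_append, pathEdges_cons_cons, List.append_assoc, List.nil_append] at this ⊢
        rw [this]
      rw [hE]
      simp only [List.mem_cons, List.mem_append, List.not_mem_nil, or_false]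
      constructor
      · rintro ⟨h | h | h, hve⟩
        · exact Or.inl h
        · exfalso
          have := mem_of_mem_pathEdges h hve
          rw [List.nodup_cons] at hnd
          exact hnd.1 this
        · exact Or.inr (h.trans Sym2.eq_swap)
      · rintro (h | h)
        · exact ⟨Or.inl h, h ▸ Sym2.mem_mk_left _ _⟩
        · exact ⟨Or.inr (Or.inr (h.trans Sym2.eq_swap)), h ▸ Sym2.mem_mk_left _ _⟩

theorem reachable_of_pathEdges {C : Finset (Sym2 V)} {a : V} {t : List V}
    (h : ∀ e ∈ pathEdges (a :: t), e ∈ C) : ∀ u ∈ a :: t, (edgeGraph C).Reachable a u := by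
  induction t generalizing a with
  | nil => simp
  | cons b t ih =>
    intro u hu
    rw [pathEdges_cons_cons] at h
    rcases List.mem_cons.1 hu with rfl | hu
    · exact .rfl
    · have h1 := ih (fun e he => h e (List.mem_cons_of_mem _ he)) u hu
      by_cases hab : a = b
      · exact hab ▸ h1
      · exact (edgeGraph_adj.2 ⟨h _ List.mem_cons_self, hab⟩).reachable.trans h1

/-- The tours through disjoint blocks with lengths in `L` that cover all vertices form an `L`-cycle
cover. -/
theorem isLCycleCover_of_blocks [Fintype V] [DecidableEq V] {L : Set ℕ} (hL : L ⊆ {m : ℕ | 3 ≤ m})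
    {C : Finset (Sym2 V)} {B : Set (List V)} (hC : ∀ e, e ∈ C ↔ ∃ b ∈ B, e ∈ tourEdges b)
    (hnd : ∀ b ∈ B, b.Nodup) (hlen : ∀ b ∈ B, b.length ∈ L) (hcov : ∀ v, ∃ b ∈ B, v ∈ b)
    (huniq : ∀ b ∈ B, ∀ b' ∈ B, ∀ v ∈ b, v ∈ b' → b = b') : IsLCycleCover L C := by
  have hdiag : ∀ e ∈ C, ¬ e.IsDiag := by
    intro e he
    obtain ⟨b, hb, heb⟩ := (hC e).1 he
    induction e with | h u v =>
    have hu := mem_tourEdges_of_mem heb (Sym2.mem_mk_left u v)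
    obtain ⟨x, y, -, hx, hy, hxy⟩ := exists_neighbors_tourEdges (hnd b hb) (hL (hlen b hb)) hu
    rcases (hxy s(u, v)).1 ⟨heb, Sym2.mem_mk_left u v⟩ with h | h
    · rw [h]; simpa using hx
    · rw [h]; simpa using hy
  have hcover : IsCycleCover C := by
    refine ⟨hdiag, fun v => ?_⟩
    obtain ⟨b, hb, hv⟩ := hcov v
    obtain ⟨x, y, hxy, hx, hy, hE⟩ := exists_neighbors_tourEdges (hnd b hb) (hL (hlen b hb)) hv
    have : C.filter (fun e => v ∈ e) = {s(v, x), s(v, y)} := by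
      ext e
      rw [Finset.mem_filter, Finset.mem_insert, Finset.mem_singleton, ← hE e, hC]
      constructor
      · rintro ⟨⟨b', hb', he⟩, hve⟩
        rw [huniq b hb b' hb' v hv (mem_tourEdges_of_mem he hve)]
        exact ⟨he, hve⟩
      · rintro ⟨he, hve⟩
        exact ⟨⟨b, hb, he⟩, hve⟩
    rw [this, Finset.card_pair]
    exact fun h => hxy (Sym2.congr_right.1 h)
  refine ⟨hcover, fun v p hp => ?_⟩
  obtain ⟨b, hb, hv⟩ := hcov v
  have hcomp : component C v = b.toFinset := by
    ext u
    rw [mem_component, List.mem_toFinset]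
    constructor
    · intro h
      obtain ⟨q⟩ := h.symm
      clear h hp p
      induction q with
      | nil => exact hv
      | @cons x z t hadj q ih =>
        have hz := ih hv
        obtain ⟨b', hb', he⟩ := (hC _).1 (edgeGraph_adj.1 hadj).1
        rw [huniq b hb b' hb' z hz (mem_tourEdges_of_mem he (Sym2.mem_mk_right _ _))]
        exact mem_tourEdges_of_mem he (Sym2.mem_mk_left _ _)
    · intro hu
      obtain ⟨k, t, hk⟩ := exists_rotate_eq_cons hv
      refine reachable_of_pathEdges (t := t ++ [v]) (fun e he => ?_) u ?_
      · rw [← tourEdges_cons, ← hk, tourEdges_rotate, List.mem_rotate] at he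
        exact (hC e).2 ⟨b, hb, he⟩
      · have : u ∈ v :: t := by rw [← hk]; simpa using hu
        simp only [List.mem_cons, List.mem_append] at this ⊢
        tauto
  rw [length_eq_card_component hcover p hp, hcomp, List.toFinset_card_of_nodup (hnd b hb)]
  exact hlen b hb

/-! ### First visits -/

section FirstVisits
variable [DecidableEq V]

theorem firstVisits_concat (l : List V) (x : V) :
    firstVisits (l ++ [x]) = if x ∈ l then firstVisits l else firstVisits l ++ [x] := by
  unfold firstVisits
  rw [List.reverse_append, List.reverse_singleton, List.singleton_append]
  split_ifs with h
  · rw [List.dedup_cons_of_mem (List.mem_reverse.2 h)]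
  · rw [List.dedup_cons_of_notMem (fun h' => h (List.mem_reverse.1 h'))]
    simp

theorem mem_firstVisits {l : List V} {x : V} : x ∈ firstVisits l ↔ x ∈ l := by
  simp [firstVisits]

theorem nodup_firstVisits (l : List V) : (firstVisits l).Nodup := by
  simp [firstVisits, List.nodup_dedup]

theorem firstVisits_sublist (l : List V) : (firstVisits l).Sublist l := by
  have := (List.dedup_sublist l.reverse).reverse
  simpa [firstVisits] using this

theorem firstVisits_cons (v : V) (t : List V) : ∃ s, firstVisits (v :: t) = v :: s := by
  induction t using List.reverseRecOn with
  | nil => exact ⟨[], by simp [firstVisits]⟩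
  | append_singleton t x ih =>
    obtain ⟨s, hs⟩ := ih
    rw [← List.cons_append, firstVisits_concat, hs]
    split_ifs
    · exact ⟨s, rfl⟩
    · exact ⟨s ++ [x], rfl⟩

end FirstVisits

/-! ### Weights of paths and tours -/

section Weight
variable [DecidableEq V]

/-- The weight of an edge, extended by zero to the diagonal. -/
def extWeight (w : Sym2 V → ℕ) (e : Sym2 V) : ℕ := if e.IsDiag then 0 else w e

/-- The total weight of a list of edges. -/
def listWeight (w : Sym2 V → ℕ) (l : List (Sym2 V)) : ℕ := (l.map (extWeight w)).sum

variable {w : Sym2 V → ℕ}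

theorem extWeight_triangle (hw : TriangleInequality w) (u x v : V) :
    extWeight w s(u, v) ≤ extWeight w s(u, x) + extWeight w s(x, v) := by
  unfold extWeight
  simp only [Sym2.mk_isDiag_iff]
  by_cases h1 : u = v
  · simp [h1]
  by_cases h2 : u = x
  · subst h2; simp
  by_cases h3 : x = v
  · subst h3; simp
  simp only [h1, h2, h3, if_false]
  exact hw u v x h1 h2 h3

@[simp] theorem listWeight_nil : listWeight w [] = 0 := rfl

@[simp] theorem listWeight_cons (e : Sym2 V) (l : List (Sym2 V)) :
    listWeight w (e :: l) = extWeight w e + listWeight w l := by simp [listWeight]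

/-- Shortcuts do not increase the weight of a path. -/
theorem listWeight_pathEdges_sublist (hw : TriangleInequality w) {l l' : List V}
    (h : l'.Sublist l) : listWeight w (pathEdges l') ≤ listWeight w (pathEdges l) ∧
      ∀ a, listWeight w (pathEdges (a :: l')) ≤ listWeight w (pathEdges (a :: l)) := by
  induction h with
  | slnil => simp
  | @cons l₁ l₂ b h ih =>
    have hb : ∀ a, listWeight w (pathEdges (a :: l₁)) ≤
        extWeight w s(a, b) + listWeight w (pathEdges (b :: l₁)) := by
      intro a
      cases l₁ with
      | nil => simp
      | cons c t =>
        have := extWeight_triangle hw a b c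
        simp only [pathEdges_cons_cons, listWeight_cons]
        omega
    have h0 : listWeight w (pathEdges l₁) ≤ listWeight w (pathEdges (b :: l₁)) := by
      cases l₁ <;> simp
    refine ⟨h0.trans (ih.2 b), fun a => ?_⟩
    have h1 := hb a
    have h2 := ih.2 b
    simp only [pathEdges_cons_cons, listWeight_cons]
    omega
  | @cons_cons l₁ l₂ b h ih =>
    refine ⟨ih.2 b, fun a => ?_⟩
    have h2 := ih.2 b
    simp only [pathEdges_cons_cons, listWeight_cons]
    omega

theorem listWeight_tourEdges_le_aux (hw : TriangleInequality w) (a c : V) (t : List V) :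
    listWeight w (pathEdges (a :: (t ++ [c]))) ≤
      2 * listWeight w (pathEdges (a :: t)) + extWeight w s(c, a) := by
  induction t generalizing a with
  | nil => simp [Sym2.eq_swap]
  | cons b t ih =>
    have h1 := ih b
    have h2 := extWeight_triangle hw c a b
    simp only [List.cons_append, pathEdges_cons_cons, listWeight_cons]
    omega

/-- Closing a path to a cycle at most doubles its weight. -/
theorem listWeight_tourEdges_le (hw : TriangleInequality w) (b : List V) :
    listWeight w (tourEdges b) ≤ 2 * listWeight w (pathEdges b) := by
  cases b with
  | nil => simp [tourEdges]
  | cons a t =>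
    rw [tourEdges_cons]
    have := listWeight_tourEdges_le_aux hw a a t
    simpa [extWeight] using this

theorem listWeight_pathEdges_append (l l' : List V) :
    listWeight w (pathEdges l) + listWeight w (pathEdges l') ≤ listWeight w (pathEdges (l ++ l')) := by
  induction l with
  | nil => simp
  | cons a t ih =>
    cases t with
    | nil => cases l' <;> simp
    | cons b t =>
      simp only [List.cons_append, pathEdges_cons_cons, listWeight_cons] at ih ⊢
      omega

theorem listWeight_pathEdges_le_tourEdges (l : List V) :
    listWeight w (pathEdges l) ≤ listWeight w (tourEdges l) := by
  cases l with
  | nil => simp [tourEdges]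
  | cons a t =>
    rw [tourEdges_cons, ← List.cons_append]
    exact le_trans (Nat.le_add_right _ _) (listWeight_pathEdges_append (a :: t) [a])

/-- Cutting a tour into paths and closing these at most doubles the weight. -/
theorem listWeight_flatMap_tourEdges_le (hw : TriangleInequality w) (bs : List (List V)) :
    listWeight w (bs.flatMap tourEdges) ≤ 2 * listWeight w (tourEdges bs.flatten) := by
  refine le_trans ?_ (Nat.mul_le_mul_left 2 (listWeight_pathEdges_le_tourEdges bs.flatten))
  induction bs with
  | nil => simp
  | cons b bs ih =>
    have h1 := listWeight_tourEdges_le hw b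
    have h2 := listWeight_pathEdges_append (w := w) b bs.flatten
    rw [List.flatMap_cons, List.flatten_cons]
    have h3 : listWeight w (tourEdges b ++ bs.flatMap tourEdges) =
        listWeight w (tourEdges b) + listWeight w (bs.flatMap tourEdges) := by simp [listWeight]
    omega

theorem listWeight_tourEdges_rotated {l l' : List V} (h : List.IsRotated l l') :
    listWeight w (tourEdges l) = listWeight w (tourEdges l') := by
  obtain ⟨k, rfl⟩ := h
  rw [tourEdges_rotate]
  unfold listWeight
  exact List.Perm.sum_eq ((List.rotate_perm _ _).symm.map _)

/-- Taking shortcuts in a closed walk does not increase the weight. -/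
theorem listWeight_firstVisits_le (hw : TriangleInequality w) {G : SimpleGraph V} {v : V}
    (p : G.Walk v v) :
    listWeight w (tourEdges (firstVisits p.support)) ≤ listWeight w p.edges := by
  rw [walk_edges_eq_pathEdges]
  cases p with
  | nil => simp [firstVisits, tourEdges, extWeight]
  | @cons _ x _ h q =>
    have hq : q.support = q.support.dropLast ++ [v] := by
      conv_lhs => rw [← List.dropLast_append_getLast q.support_ne_nil]
      simp
    rw [SimpleGraph.Walk.support_cons, hq, ← List.cons_append, firstVisits_concat,
      if_pos List.mem_cons_self]
    obtain ⟨s, hs⟩ := firstVisits_cons v q.support.dropLast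
    rw [hs, tourEdges_cons, ← List.cons_append, ← hs]
    exact (listWeight_pathEdges_sublist hw
      ((firstVisits_sublist _).append (List.Sublist.refl _))).1

end Weight

/-! ### The weight of the output -/

section Output
variable [Fintype V] [DecidableEq V] {w : Sym2 V → ℕ} {L : Set ℕ}

theorem support_subset_of_mem_components {F : Finset (Sym2 V)} {S : Finset V}
    (hS : S ∈ components F) {u v : V} (hv : u ∈ S) (p : (edgeGraph F).Walk u v) {x : V}
    (hx : x ∈ p.support) : x ∈ S := by
  rw [eq_component_of_mem hS hv, mem_component]
  exact ⟨p.takeUntil x hx⟩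

/-- A doubled Euler tour visits exactly the vertices of its component. -/
theorem IsDoubledEulerTour.mem_support_iff {F : Finset (Sym2 V)} {S : Finset V}
    (hS : S ∈ components F) {v : V} {p : (edgeGraph F).Walk v v} (hp : IsDoubledEulerTour F S p)
    (u : V) : u ∈ p.support ↔ u ∈ S := by
  refine ⟨support_subset_of_mem_components hS hp.1 p, fun hu => ?_⟩
  by_cases huv : u = v
  · exact huv ▸ p.start_mem_support
  have hr : (edgeGraph F).Reachable u v := by
    have h1 := mem_component.1 (eq_component_of_mem hS hp.1 ▸ hu)
    exact h1.symm
  obtain ⟨q⟩ := hr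
  cases q with
  | nil => exact absurd rfl huv
  | @cons _ x _ hadj q =>
    have h1 := hp.2 _ (edgeGraph_adj.1 hadj).1 ⟨u, Sym2.mem_mk_left _ _, hu⟩
    have h2 : s(u, x) ∈ p.edges := List.count_pos_iff.1 (by rw [h1]; norm_num)
    exact p.fst_mem_support_of_mem_edges h2

theorem listWeight_edges_doubledEulerTour {F : Finset (Sym2 V)} {S : Finset V}
    (hS : S ∈ components F) {v : V} {p : (edgeGraph F).Walk v v} (hp : IsDoubledEulerTour F S p) :
    listWeight w p.edges ≤ 2 * ∑ e ∈ F.filter (fun e => ∃ u ∈ S, u ∈ e), w e := by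
  unfold listWeight
  rw [Finset.sum_list_map_count, Finset.mul_sum]
  have hmem : ∀ e ∈ p.edges.toFinset, e ∈ F ∧ ∃ u ∈ S, u ∈ e := by
    intro e he
    rw [List.mem_toFinset] at he
    refine ⟨(mem_edgeSet_edgeGraph.1 (p.edges_subset_edgeSet he)).1, ?_⟩
    induction e with | h x y =>
    exact ⟨x, support_subset_of_mem_components hS hp.1 p (p.fst_mem_support_of_mem_edges he),
      Sym2.mem_mk_left _ _⟩
  refine (Finset.sum_le_sum_of_subset
    (t := F.filter fun e => ∃ u ∈ S, u ∈ e) fun e he => Finset.mem_filter.2 (hmem e he)).trans ?_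
  refine Finset.sum_le_sum fun e he => ?_
  obtain ⟨he, u, hu, hue⟩ := Finset.mem_filter.1 he
  rw [hp.2 e he ⟨u, hue, hu⟩, smul_eq_mul]
  refine Nat.mul_le_mul_left _ ?_
  unfold extWeight
  split_ifs <;> simp

/-- Doubling the edges, and closing up the paths, each cost a factor of two. -/
theorem IsPathSplit.weight_le (hw : TriangleInequality w) {F : Finset (Sym2 V)} {S : Finset V}
    (hS : S ∈ components F) {bs : List (List V)} (h : IsPathSplit L F S bs) :
    listWeight w (bs.flatMap tourEdges) ≤ 4 * ∑ e ∈ F.filter (fun e => ∃ u ∈ S, u ∈ e), w e := by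
  obtain ⟨⟨v, p, hp, hrot⟩, -⟩ := h
  have h1 := listWeight_flatMap_tourEdges_le hw bs
  rw [listWeight_tourEdges_rotated hrot] at h1
  have h2 := listWeight_firstVisits_le hw p
  have h3 := listWeight_edges_doubledEulerTour (w := w) hS hp
  omega

theorem IsPathSplit.flatten {F : Finset (Sym2 V)} {S : Finset V} (hS : S ∈ components F)
    {bs : List (List V)} (h : IsPathSplit L F S bs) :
    bs.flatten.Nodup ∧ ∀ u, u ∈ bs.flatten ↔ u ∈ S := by
  obtain ⟨⟨v, p, hp, hrot⟩, -⟩ := h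
  refine ⟨hrot.perm.nodup_iff.2 (nodup_firstVisits _), fun u => ?_⟩
  rw [hrot.perm.mem_iff, mem_firstVisits, hp.mem_support_iff hS]

theorem IsClosedUp.isLCycleCover (hL : L ⊆ {m : ℕ | 3 ≤ m}) {F C : Finset (Sym2 V)}
    (h : IsClosedUp L F C) : IsLCycleCover L C := by
  obtain ⟨bs, hbs, rfl⟩ := h
  have hfl := fun S hS => (hbs S hS).flatten hS
  refine isLCycleCover_of_blocks hL (B := {b | ∃ S ∈ components F, b ∈ bs S}) ?_ ?_ ?_ ?_ ?_
  · intro e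
    simp only [Finset.mem_biUnion, List.mem_toFinset, List.mem_flatMap]
    exact ⟨fun ⟨S, hS, b, hb, he⟩ => ⟨b, ⟨S, hS, hb⟩, he⟩, fun ⟨b, ⟨S, hS, hb⟩, he⟩ => ⟨S, hS, b, hb, he⟩⟩
  · rintro b ⟨S, hS, hb⟩
    exact (List.nodup_flatten.1 (hfl S hS).1).1 b hb
  · rintro b ⟨S, hS, hb⟩
    exact (hbs S hS).2 b hb
  · intro v
    have hS := component_mem_components F v
    obtain ⟨b, hb, hv⟩ := List.mem_flatten.1 (((hfl _ hS).2 v).2 (self_mem_component F v))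
    exact ⟨b, ⟨_, hS, hb⟩, hv⟩
  · rintro b ⟨S, hS, hb⟩ b' ⟨S', hS', hb'⟩ v hv hv'
    have h1 : v ∈ S := ((hfl S hS).2 v).1 (List.mem_flatten.2 ⟨b, hb, hv⟩)
    have h2 : v ∈ S' := ((hfl S' hS').2 v).1 (List.mem_flatten.2 ⟨b', hb', hv'⟩)
    obtain rfl : S = S' := by rw [eq_component_of_mem hS h1, eq_component_of_mem hS' h2]
    by_contra hne
    have : Std.Symm (List.Disjoint (α := V)) := ⟨fun _ _ h => h.symm⟩
    exact (List.nodup_flatten.1 (hfl S hS).1).2.forall hb hb' hne hv hv'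

theorem IsClosedUp.weight_le (hL : L ⊆ {m : ℕ | 3 ≤ m}) (hw : TriangleInequality w)
    {F C : Finset (Sym2 V)} (h : IsClosedUp L F C) : weight w C ≤ 4 * weight w F := by
  have hcov := h.isLCycleCover hL
  obtain ⟨bs, hbs, rfl⟩ := h
  have h1 : weight w ((components F).biUnion fun S => ((bs S).flatMap tourEdges).toFinset) =
      ∑ e ∈ (components F).biUnion fun S => ((bs S).flatMap tourEdges).toFinset, extWeight w e :=
    Finset.sum_congr rfl fun e he => (if_neg (hcov.1.1 e he)).symm
  have h2 : ∀ l : List (Sym2 V), ∑ e ∈ l.toFinset, extWeight w e ≤ listWeight w l := by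
    intro l
    unfold listWeight
    rw [Finset.sum_list_map_count]
    refine Finset.sum_le_sum fun e he => ?_
    rw [smul_eq_mul]
    exact Nat.le_mul_of_pos_left _ (List.count_pos_iff.2 (List.mem_toFinset.1 he))
  rw [h1]
  calc _ ≤ ∑ S ∈ components F, ∑ e ∈ ((bs S).flatMap tourEdges).toFinset, extWeight w e := by
        generalize components F = P
        induction P using Finset.induction_on with
        | empty => simp
        | insert S P hS ih =>
          rw [Finset.biUnion_insert, Finset.sum_insert hS]
          refine le_trans ?_ (Nat.add_le_add_left ih _)
          rw [← Finset.sum_union_inter]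
          exact Nat.le_add_right _ _
    _ ≤ ∑ S ∈ components F, 4 * ∑ e ∈ F.filter (fun e => ∃ u ∈ S, u ∈ e), w e :=
        Finset.sum_le_sum fun S hS => (h2 _).trans ((hbs S hS).weight_le hw hS)
    _ ≤ 4 * weight w F := by
        rw [← Finset.mul_sum]
        refine Nat.mul_le_mul_left 4 ?_
        rw [← Finset.sum_biUnion]
        · refine Finset.sum_le_sum_of_subset fun e he => ?_
          obtain ⟨S, -, h⟩ := Finset.mem_biUnion.1 he
          exact (Finset.mem_filter.1 h).1
        · intro S hS S' hS' hne
          refine Finset.disjoint_left.2 fun e he he' => hne ?_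
          obtain ⟨heF, u, hu, hue⟩ := Finset.mem_filter.1 he
          obtain ⟨-, u', hu', hue'⟩ := Finset.mem_filter.1 he'
          rw [eq_component_of_mem hS hu, eq_component_of_mem hS' hu', component_eq_iff]
          by_cases huu : u = u'
          · rw [huu]
          · rw [(Sym2.mem_and_mem_iff huu).1 ⟨hue, hue'⟩] at heF
            exact (edgeGraph_adj.2 ⟨heF, huu⟩).reachable

/-- The approximation guarantee. -/
theorem isApproxAnswer_of_apxUndir (hL : L ⊆ {m : ℕ | 3 ≤ m}) (hw : TriangleInequality w)
    {out : Option (Finset (Sym2 V))} (h : ApxUndir L w out) :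
    IsApproxAnswer L w (4 * (frob L + 4)) out := by
  rcases h with ⟨hadm, rfl⟩ | ⟨-, F₀, F, C, hGW, hph, -, hcl, rfl⟩
  · rintro ⟨C, hC⟩
    apply hadm
    rw [← Finset.card_univ]
    refine admissible_of_cut_eq_empty hC ?_
    ext e
    simp only [mem_cut, Finset.notMem_empty, iff_false, not_and]
    rintro - ⟨u, -, v, hv, -⟩
    exact hv (Finset.mem_univ v)
  · refine ⟨hcl.isLCycleCover hL, fun C' hC' => ?_⟩
    obtain ⟨k, hk, -, hweight⟩ := exists_phaseInv hGW hph
    calc weight w C ≤ 4 * weight w F := hcl.weight_le hL hw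
      _ ≤ 4 * ((k + 1) * weight w C') := Nat.mul_le_mul_left 4 (hweight C' hC')
      _ = 4 * (k + 1) * weight w C' := by ring
      _ ≤ _ := Nat.mul_le_mul_right _ (by omega)

end Output
end CycleCover

/-! ### Programs with counting loops -/

namespace RAM

instance (k : ℕ) : OfNat IExpr k := ⟨.const k⟩
instance : Add IExpr := ⟨.add⟩
instance : Sub IExpr := ⟨.sub⟩
instance : Add SExpr := ⟨.add⟩
instance : Sub SExpr := ⟨.sub⟩

@[simp] theorem IExpr.eval_const (σ : Store) (k : ℕ) : (IExpr.const k).eval σ = k := rfl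
@[simp] theorem IExpr.eval_zero (σ : Store) : (0 : IExpr).eval σ = 0 := rfl
@[simp] theorem IExpr.eval_one (σ : Store) : (1 : IExpr).eval σ = 1 := rfl
@[simp] theorem IExpr.eval_two (σ : Store) : (2 : IExpr).eval σ = 2 := rfl
@[simp] theorem IExpr.eval_load (σ : Store) (a : ℕ) (i : IExpr) :
    (IExpr.load a i).eval σ = σ.idx a (i.eval σ) := rfl
@[simp] theorem IExpr.eval_add (σ : Store) (x y : IExpr) : (x + y).eval σ = x.eval σ + y.eval σ := rfl
@[simp] theorem IExpr.eval_sub (σ : Store) (x y : IExpr) : (x - y).eval σ = x.eval σ - y.eval σ := rfl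
@[simp] theorem IExpr.eval_half (σ : Store) (x : IExpr) : (IExpr.half x).eval σ = x.eval σ / 2 := rfl
@[simp] theorem SExpr.eval_load (σ : Store) (a : ℕ) (i : IExpr) :
    (SExpr.load a i).eval σ = σ.scal a (i.eval σ) := rfl
@[simp] theorem SExpr.eval_add (σ : Store) (x y : SExpr) : (x + y).eval σ = x.eval σ + y.eval σ := rfl
@[simp] theorem SExpr.eval_sub (σ : Store) (x y : SExpr) : (x - y).eval σ = x.eval σ - y.eval σ := rfl
@[simp] theorem SExpr.eval_half (σ : Store) (x : SExpr) : (SExpr.half x).eval σ = x.eval σ / 2 := rfl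
@[simp] theorem Test.holds_ile (σ : Store) (x y : IExpr) :
    (Test.ile x y).holds σ ↔ x.eval σ ≤ y.eval σ := Iff.rfl
@[simp] theorem Test.holds_sle (σ : Store) (x y : SExpr) :
    (Test.sle x y).holds σ ↔ x.eval σ ≤ y.eval σ := Iff.rfl
@[simp] theorem Test.holds_not (σ : Store) (b : Test) : (Test.not b).holds σ ↔ ¬ b.holds σ := Iff.rfl
@[simp] theorem Test.holds_and (σ : Store) (b c : Test) :
    (Test.and b c).holds σ ↔ b.holds σ ∧ c.holds σ := Iff.rfl

/-- The variable `a`: cell `0` of the index array `a`. -/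
def IExpr.var (a : ℕ) : IExpr := .load a 0

@[simp] theorem IExpr.eval_var (σ : Store) (a : ℕ) : (IExpr.var a).eval σ = σ.idx a 0 := rfl

/-- Strict comparison. -/
def Test.ilt (x y : IExpr) : Test := .not (.ile y x)

/-- Equality of natural numbers. -/
def Test.ieq (x y : IExpr) : Test := .and (.ile x y) (.ile y x)

@[simp] theorem Test.holds_ilt (σ : Store) (x y : IExpr) :
    (Test.ilt x y).holds σ ↔ x.eval σ < y.eval σ := by simp [Test.ilt]

@[simp] theorem Test.holds_ieq (σ : Store) (x y : IExpr) :
    (Test.ieq x y).holds σ ↔ x.eval σ = y.eval σ := by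
  simp [Test.ieq, le_antisymm_iff]

@[simp] theorem Store.setIdx_idx (σ : Store) (a i x b k : ℕ) :
    (σ.setIdx a i x).idx b k = if b = a ∧ k = i then x else σ.idx b k := by
  unfold Store.setIdx
  simp only [Function.update_apply]
  split_ifs <;> simp_all

@[simp] theorem Store.setIdx_scal (σ : Store) (a i x : ℕ) : (σ.setIdx a i x).scal = σ.scal := rfl

@[simp] theorem Store.setScal_scal (σ : Store) (a i : ℕ) (x : ℚ) (b k : ℕ) :
    (σ.setScal a i x).scal b k = if b = a ∧ k = i then x else σ.scal b k := by
  unfold Store.setScal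
  simp only [Function.update_apply]
  split_ifs <;> simp_all

@[simp] theorem Store.setScal_idx (σ : Store) (a i : ℕ) (x : ℚ) : (σ.setScal a i x).idx = σ.idx := rfl

/-- Programs whose only loops are counting loops: `forTo v a c` executes `c` for the values
`0, 1, ...` of the variable `v` below the value of the variable `a`. -/
inductive Code
  | skip
  | istore (a : ℕ) (i x : IExpr)
  | sstore (a : ℕ) (i : IExpr) (x : SExpr)
  | seq (c d : Code)
  | ite (b : Test) (c d : Code)
  | forTo (v a : ℕ) (c : Code)

namespace Code

/-- Sequential composition of a list of programs. -/
def block : List Code → Code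
  | [] => skip
  | c :: cs => seq c (block cs)

/-- Assignment to the variable `a`. -/
def assign (a : ℕ) (x : IExpr) : Code := istore a 0 x

/-- A conditional without alternative. -/
def when (b : Test) (c : Code) : Code := ite b c skip

/-- Translation into the language of structured programs. -/
def toProgram : Code → Program
  | skip => .skip
  | istore a i x => .istore a i x
  | sstore a i x => .sstore a i x
  | seq c d => .seq c.toProgram d.toProgram
  | ite b c d => .branch b c.toProgram d.toProgram
  | forTo v a c => .seq (.istore v 0 0)
      (.loop (.ilt (.var v) (.var a)) (.seq c.toProgram (.istore v 0 (.var v + 1))))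

open Classical in
/-- The effect of a program on the store. -/
noncomputable def den : Code → Store → Store
  | skip, σ => σ
  | istore a i x, σ => σ.setIdx a (i.eval σ) (x.eval σ)
  | sstore a i x, σ => σ.setScal a (i.eval σ) (x.eval σ)
  | seq c d, σ => d.den (c.den σ)
  | ite b c d, σ => if b.holds σ then c.den σ else d.den σ
  | forTo v a c, σ => (fun τ => (c.den τ).setIdx v 0 ((c.den τ).idx v 0 + 1))^[σ.idx a 0]
      (σ.setIdx v 0 0)

/-- The index arrays that may be written. -/
def iw : Code → List ℕ
  | skip => []
  | istore a _ _ => [a]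
  | sstore _ _ _ => []
  | seq c d => c.iw ++ d.iw
  | ite _ c d => c.iw ++ d.iw
  | forTo v _ c => v :: c.iw

/-- The scalar arrays that may be written. -/
def sw : Code → List ℕ
  | skip => []
  | istore _ _ _ => []
  | sstore a _ _ => [a]
  | seq c d => c.sw ++ d.sw
  | ite _ c d => c.sw ++ d.sw
  | forTo _ _ c => c.sw

/-- The variables that serve as loop bounds. -/
def bounds : Code → List ℕ
  | skip => []
  | istore _ _ _ => []
  | sstore _ _ _ => []
  | seq c d => c.bounds ++ d.bounds
  | ite _ c d => c.bounds ++ d.bounds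
  | forTo _ a c => a :: c.bounds

/-- No loop body writes to the counter of its loop. -/
def wf : Code → Bool
  | skip => true
  | istore _ _ _ => true
  | sstore _ _ _ => true
  | seq c d => c.wf && d.wf
  | ite _ c d => c.wf && d.wf
  | forTo v _ c => decide (v ∉ c.iw) && c.wf

/-- An upper bound for the running time, if the loop bound in the variable `a` is `ν a`. -/
def time (ν : ℕ → ℕ) : Code → ℕ
  | skip => 1
  | istore _ i x => i.cost + x.cost + 1
  | sstore _ i x => i.cost + x.cost + 1
  | seq c d => c.time ν + d.time ν
  | ite b c d => b.cost + (c.time ν + d.time ν) + 1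
  | forTo _ a c => (c.time ν + 20) * ν a + 20

@[simp] theorem den_skip (σ : Store) : skip.den σ = σ := by simp [den]
@[simp] theorem den_istore (a : ℕ) (i x : IExpr) (σ : Store) :
    (istore a i x).den σ = σ.setIdx a (i.eval σ) (x.eval σ) := by simp [den]
@[simp] theorem den_sstore (a : ℕ) (i : IExpr) (x : SExpr) (σ : Store) :
    (sstore a i x).den σ = σ.setScal a (i.eval σ) (x.eval σ) := by simp [den]
@[simp] theorem den_seq (c d : Code) (σ : Store) : (seq c d).den σ = d.den (c.den σ) := by
  simp [den]
@[simp] theorem den_block_nil (σ : Store) : (block []).den σ = σ := by simp [block]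
@[simp] theorem den_block_cons (c : Code) (cs : List Code) (σ : Store) :
    (block (c :: cs)).den σ = (block cs).den (c.den σ) := by simp [block]
@[simp] theorem den_assign (a : ℕ) (x : IExpr) (σ : Store) :
    (assign a x).den σ = σ.setIdx a 0 (x.eval σ) := by simp [assign]

theorem den_ite_pos {b : Test} {σ : Store} (h : b.holds σ) (c d : Code) :
    (ite b c d).den σ = c.den σ := by simp [den, h]
theorem den_ite_neg {b : Test} {σ : Store} (h : ¬ b.holds σ) (c d : Code) :
    (ite b c d).den σ = d.den σ := by simp [den, h]
theorem den_when_pos {b : Test} {σ : Store} (h : b.holds σ) (c : Code) :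
    (when b c).den σ = c.den σ := den_ite_pos h _ _
theorem den_when_neg {b : Test} {σ : Store} (h : ¬ b.holds σ) (c : Code) :
    (when b c).den σ = σ := (den_ite_neg h _ _).trans (den_skip σ)

/-- The stores `σ` and `τ` differ at most in the index arrays `A` and the scalar arrays `S`. -/
structure _root_.RAM.Agree (A S : List ℕ) (σ τ : Store) : Prop where
  idx : ∀ a ∉ A, τ.idx a = σ.idx a
  scal : ∀ a ∉ S, τ.scal a = σ.scal a

theorem _root_.RAM.Agree.rfl {A S : List ℕ} {σ : Store} : Agree A S σ σ :=
  ⟨fun _ _ => Eq.refl _, fun _ _ => Eq.refl _⟩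

theorem _root_.RAM.Agree.trans {A S : List ℕ} {σ τ ρ : Store} (h : Agree A S σ τ)
    (h' : Agree A S τ ρ) : Agree A S σ ρ :=
  ⟨fun a ha => (h'.idx a ha).trans (h.idx a ha), fun a ha => (h'.scal a ha).trans (h.scal a ha)⟩

theorem _root_.RAM.Agree.mono {A A' S S' : List ℕ} {σ τ : Store} (h : Agree A S σ τ)
    (hA : A ⊆ A') (hS : S ⊆ S') : Agree A' S' σ τ :=
  ⟨fun a ha => h.idx a fun h' => ha (hA h'), fun a ha => h.scal a fun h' => ha (hS h')⟩

theorem _root_.RAM.agree_setIdx {A S : List ℕ} {a : ℕ} (ha : a ∈ A) (σ : Store) (i x : ℕ) :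
    Agree A S σ (σ.setIdx a i x) := by
  refine ⟨fun b hb => ?_, fun _ _ => Eq.refl _⟩
  have : b ≠ a := fun h => hb (h ▸ ha)
  simp [Store.setIdx, this]

theorem _root_.RAM.agree_setScal {A S : List ℕ} {a : ℕ} (ha : a ∈ S) (σ : Store) (i : ℕ) (x : ℚ) :
    Agree A S σ (σ.setScal a i x) := by
  refine ⟨fun _ _ => Eq.refl _, fun b hb => ?_⟩
  have : b ≠ a := fun h => hb (h ▸ ha)
  simp [Store.setScal, this]

/-- A program changes only the arrays that it may write. -/
theorem agree_den (c : Code) (σ : Store) : Agree c.iw c.sw σ (c.den σ) := by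
  induction c generalizing σ with
  | skip => rw [den_skip]; exact Agree.rfl
  | istore a i x => rw [den_istore]; exact agree_setIdx (by simp [iw]) _ _ _
  | sstore a i x => rw [den_sstore]; exact agree_setScal (by simp [sw]) _ _ _
  | seq c d hc hd =>
    rw [den_seq]
    exact ((hc σ).mono (by simp [iw]) (by simp [sw])).trans
      ((hd _).mono (by simp [iw]) (by simp [sw]))
  | ite b c d hc hd =>
    by_cases h : b.holds σ
    · rw [den_ite_pos h]; exact (hc σ).mono (by simp [iw]) (by simp [sw])
    · rw [den_ite_neg h]; exact (hd σ).mono (by simp [iw]) (by simp [sw])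
  | forTo v a c hc =>
    rw [den]
    generalize σ.idx a 0 = m
    induction m with
    | zero => exact agree_setIdx (by simp [iw]) _ _ _
    | succ m ih =>
      rw [Function.iterate_succ_apply']
      refine ih.trans (((hc _).mono (by simp [iw]) (by simp [sw])).trans ?_)
      exact agree_setIdx (by simp [iw]) _ _ _

/-- The invariant rule for counting loops. -/
theorem forTo_rule {v a : ℕ} {c : Code} (hv : v ∉ c.iw) (σ : Store) (I : ℕ → Store → Prop)
    (h0 : I 0 (σ.setIdx v 0 0))
    (hs : ∀ k τ, k < σ.idx a 0 → τ.idx v 0 = k → Agree (v :: c.iw) c.sw σ τ → I k τ →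
      I (k + 1) ((c.den τ).setIdx v 0 (k + 1))) :
    I (σ.idx a 0) ((forTo v a c).den σ) := by
  rw [den]
  have key : ∀ m ≤ σ.idx a 0,
      ((fun τ => (c.den τ).setIdx v 0 ((c.den τ).idx v 0 + 1))^[m] (σ.setIdx v 0 0)).idx v 0 = m ∧
      Agree (v :: c.iw) c.sw σ
        ((fun τ => (c.den τ).setIdx v 0 ((c.den τ).idx v 0 + 1))^[m] (σ.setIdx v 0 0)) ∧
      I m ((fun τ => (c.den τ).setIdx v 0 ((c.den τ).idx v 0 + 1))^[m] (σ.setIdx v 0 0)) := by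
    intro m
    induction m with
    | zero => exact fun _ => ⟨by simp, agree_setIdx (by simp) _ _ _, h0⟩
    | succ m ih =>
      intro hm
      obtain ⟨h1, h2, h3⟩ := ih (by omega)
      rw [Function.iterate_succ_apply']
      set τ := (fun τ => (c.den τ).setIdx v 0 ((c.den τ).idx v 0 + 1))^[m] (σ.setIdx v 0 0)
      have h4 : (c.den τ).idx v 0 = m := by rw [(agree_den c τ).idx v hv, h1]
      rw [h4]
      refine ⟨by simp, ?_, hs m τ (by omega) h1 h2 h3⟩
      exact h2.trans (((agree_den c τ).mono (by simp) (by simp)).trans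
        (agree_setIdx (by simp) _ _ _))
  exact (key _ le_rfl).2.2

/-- The translated program computes the denotation within the time bound, provided that no loop bound
is ever written to. -/
theorem exec_toProgram (c : Code) (hwf : c.wf = true) (ν : ℕ → ℕ)
    (hb : ∀ a ∈ c.bounds, a ∉ c.iw) (σ : Store) (hν : ∀ a ∈ c.bounds, σ.idx a 0 = ν a) :
    ∃ t ≤ c.time ν, Exec c.toProgram σ t (c.den σ) := by
  induction c generalizing σ with
  | skip => exact ⟨1, le_rfl, by rw [den_skip]; exact .skip σ⟩
  | istore a i x => exact ⟨_, le_rfl, by rw [den_istore]; exact .istore σ a i x⟩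
  | sstore a i x => exact ⟨_, le_rfl, by rw [den_sstore]; exact .sstore σ a i x⟩
  | seq c d hc hd =>
    simp only [wf, Bool.and_eq_true] at hwf
    simp only [bounds, iw, List.mem_append, not_or] at hb hν
    obtain ⟨t₁, ht₁, h₁⟩ := hc hwf.1 (fun a ha => (hb a (Or.inl ha)).1) σ fun a ha => hν a (Or.inl ha)
    obtain ⟨t₂, ht₂, h₂⟩ := hd hwf.2 (fun a ha => (hb a (Or.inr ha)).2) (c.den σ) fun a ha => by
      rw [(agree_den c σ).idx a (hb a (Or.inr ha)).1]; exact hν a (Or.inr ha)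
    exact ⟨t₁ + t₂, Nat.add_le_add ht₁ ht₂, by rw [den_seq]; exact .seq h₁ h₂⟩
  | ite b c d hc hd =>
    simp only [wf, Bool.and_eq_true] at hwf
    simp only [bounds, iw, List.mem_append, not_or] at hb hν
    by_cases h : b.holds σ
    · obtain ⟨t, ht, h₁⟩ := hc hwf.1 (fun a ha => (hb a (Or.inl ha)).1) σ fun a ha => hν a (Or.inl ha)
      refine ⟨b.cost + t + 1, ?_, by rw [den_ite_pos h]; exact .branch_true h h₁⟩
      simp only [time]
      omega
    · obtain ⟨t, ht, h₁⟩ := hd hwf.2 (fun a ha => (hb a (Or.inr ha)).2) σ fun a ha => hν a (Or.inr ha)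
      refine ⟨b.cost + t + 1, ?_, by rw [den_ite_neg h]; exact .branch_false h h₁⟩
      simp only [time]
      omega
  | forTo v a c hc =>
    simp only [wf, Bool.and_eq_true, decide_eq_true_eq] at hwf
    simp only [bounds, iw, List.mem_cons, not_or] at hb hν
    have hva : a ≠ v := (hb a (Or.inl rfl)).1
    have haw : a ∉ c.iw := (hb a (Or.inl rfl)).2
    have hc1 : (Test.ilt (.var v) (.var a)).cost = 6 := rfl
    have hc2 : (0 : IExpr).cost + (IExpr.var v + 1).cost + 1 = 6 := rfl
    have hc3 : (0 : IExpr).cost = 1 := rfl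
    -- `m` iterations are left
    have key : ∀ m (τ : Store), (∀ x ∈ c.bounds, τ.idx x 0 = ν x) → τ.idx a 0 = ν a →
        τ.idx v 0 + m = ν a →
        ∃ t ≤ (c.time ν + 20) * m + 10,
          Exec (.loop (.ilt (.var v) (.var a)) (.seq c.toProgram (.istore v 0 (.var v + 1)))) τ t
            ((fun τ => (c.den τ).setIdx v 0 ((c.den τ).idx v 0 + 1))^[m] τ) := by
      intro m
      induction m with
      | zero =>
        intro τ _ h2 h3
        refine ⟨_, ?_, .loop_done ?_⟩
        · rw [hc1]; omega
        · simp only [Test.holds_ilt, IExpr.eval_var]; omega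
      | succ m ih =>
        intro τ h1 h2 h3
        obtain ⟨t₁, ht₁, hE₁⟩ := hc hwf.2 (fun x hx => (hb x (Or.inr hx)).2) τ h1
        have h4 : (c.den τ).idx v 0 = τ.idx v 0 := by rw [(agree_den c τ).idx v hwf.1]
        have h5 : (c.den τ).idx a 0 = τ.idx a 0 := by rw [(agree_den c τ).idx a haw]
        obtain ⟨t₂, ht₂, hE₂⟩ := ih ((c.den τ).setIdx v 0 ((c.den τ).idx v 0 + 1))
          (fun x hx => by
            have hxv := (hb x (Or.inr hx)).1
            have h6 : (c.den τ).idx x 0 = τ.idx x 0 := by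
              rw [(agree_den c τ).idx x (hb x (Or.inr hx)).2]
            simp [hxv, h6, h1 x hx])
          (by simp [hva, h5, h2])
          (by simp [h4]; omega)
        rw [Function.iterate_succ_apply]
        refine ⟨_, ?_, .loop_next ?_ (.seq hE₁ (.istore _ v 0 (.var v + 1))) hE₂⟩
        · rw [hc1, hc2, Nat.mul_succ]
          omega
        · simp only [Test.holds_ilt, IExpr.eval_var]; omega
    obtain ⟨t, ht, hE⟩ := key (σ.idx a 0) (σ.setIdx v 0 0)
      (fun x hx => by
        have hxv := (hb x (Or.inr hx)).1
        simp [hxv, hν x (Or.inr hx)])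
      (by simp [hva, hν a (Or.inl rfl)]) (by simp [hν a (Or.inl rfl)])
    refine ⟨_, ?_, .seq (.istore σ v 0 0) (by rw [den]; exact hE)⟩
    rw [hν a (Or.inl rfl)] at ht
    rw [hc3]
    simp only [time]
    omega

/-- The nesting depth of loops with bound `a`. -/
def depth (a : ℕ) : Code → ℕ
  | skip => 0
  | istore _ _ _ => 0
  | sstore _ _ _ => 0
  | seq c d => max (c.depth a) (d.depth a)
  | ite _ c d => max (c.depth a) (d.depth a)
  | forTo _ b c => c.depth a + if b = a then 1 else 0

/-- If all loop bounds but those in the variables `a` and `b` are constant, the running time is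
bounded by a product of powers of these two. -/
theorem time_le (c : Code) (a b : ℕ) (hab : a ≠ b) (q : ℕ) : ∃ K, ∀ ν : ℕ → ℕ,
    (∀ x ∈ c.bounds, x ≠ a → x ≠ b → ν x ≤ q) →
    c.time ν ≤ K * ((ν a + 1) ^ c.depth a * (ν b + 1) ^ c.depth b) := by
  have hpos : ∀ x y i j : ℕ, 1 ≤ (x + 1) ^ i * (y + 1) ^ j := fun x y i j =>
    Nat.mul_pos (Nat.pow_pos (Nat.succ_pos _)) (Nat.pow_pos (Nat.succ_pos _))
  have hmono : ∀ x y i j i' j' : ℕ, i ≤ i' → j ≤ j' →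
      (x + 1) ^ i * (y + 1) ^ j ≤ (x + 1) ^ i' * (y + 1) ^ j' := fun x y i j i' j' hi hj =>
    Nat.mul_le_mul (Nat.pow_le_pow_right (Nat.succ_pos _) hi) (Nat.pow_le_pow_right (Nat.succ_pos _) hj)
  induction c with
  | skip => exact ⟨1, fun ν _ => by simp [time, depth]⟩
  | istore x i y => exact ⟨i.cost + y.cost + 1, fun ν _ => by simp [time, depth]⟩
  | sstore x i y => exact ⟨i.cost + y.cost + 1, fun ν _ => by simp [time, depth]⟩
  | seq c d hc hd =>
    obtain ⟨K₁, h₁⟩ := hc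
    obtain ⟨K₂, h₂⟩ := hd
    refine ⟨K₁ + K₂, fun ν hν => ?_⟩
    simp only [bounds, List.mem_append] at hν
    simp only [time, depth]
    rw [add_mul]
    exact Nat.add_le_add
      ((h₁ ν fun x hx => hν x (Or.inl hx)).trans (Nat.mul_le_mul_left _
        (hmono _ _ _ _ _ _ (le_max_left _ _) (le_max_left _ _))))
      ((h₂ ν fun x hx => hν x (Or.inr hx)).trans (Nat.mul_le_mul_left _
        (hmono _ _ _ _ _ _ (le_max_right _ _) (le_max_right _ _))))
  | ite t c d hc hd =>
    obtain ⟨K₁, h₁⟩ := hc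
    obtain ⟨K₂, h₂⟩ := hd
    refine ⟨K₁ + K₂ + (t.cost + 1), fun ν hν => ?_⟩
    simp only [bounds, List.mem_append] at hν
    simp only [time, depth]
    have e1 := (h₁ ν fun x hx => hν x (Or.inl hx)).trans (Nat.mul_le_mul_left _
        (hmono (ν a) (ν b) _ _ _ _ (le_max_left _ (d.depth a)) (le_max_left _ (d.depth b))))
    have e2 := (h₂ ν fun x hx => hν x (Or.inr hx)).trans (Nat.mul_le_mul_left _
        (hmono (ν a) (ν b) _ _ _ _ (le_max_right (c.depth a) _) (le_max_right (c.depth b) _)))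
    have e3 := Nat.mul_le_mul_left (t.cost + 1) (hpos (ν a) (ν b) (max (c.depth a) (d.depth a))
      (max (c.depth b) (d.depth b)))
    rw [add_mul, add_mul]
    omega
  | forTo v x c hc =>
    obtain ⟨K, h⟩ := hc
    refine ⟨(K + 20) * (q + 1) + 20, fun ν hν => ?_⟩
    simp only [bounds, List.mem_cons] at hν
    simp only [time, depth]
    have e1 := h ν fun x hx => hν x (Or.inr hx)
    set D := (ν a + 1) ^ c.depth a * (ν b + 1) ^ c.depth b with hD
    have e2 : 1 ≤ D := hpos _ _ _ _
    have e3 : (c.time ν + 20) * ν x ≤ (K + 20) * (D * ν x) := by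
      rw [← mul_assoc]
      refine Nat.mul_le_mul_right _ ?_
      rw [add_mul]
      omega
    -- the factor for the new loop
    have e4 : D * ν x ≤ (q + 1) * ((ν a + 1) ^ (c.depth a + if x = a then 1 else 0) *
        (ν b + 1) ^ (c.depth b + if x = b then 1 else 0)) := by
      by_cases hxa : x = a
      · subst hxa
        rw [if_pos rfl, if_neg hab, add_zero, pow_succ]
        calc D * ν x ≤ 1 * ((ν x + 1) ^ c.depth x * (ν x + 1) * (ν b + 1) ^ c.depth b) := by
              rw [hD, one_mul, mul_right_comm]
              exact Nat.mul_le_mul_right _ (Nat.mul_le_mul_left _ (Nat.le_succ _))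
          _ ≤ _ := Nat.mul_le_mul_right _ (by omega)
      · by_cases hxb : x = b
        · subst hxb
          rw [if_neg hxa, if_pos rfl, add_zero, pow_succ]
          calc D * ν x ≤ 1 * ((ν a + 1) ^ c.depth a * ((ν x + 1) ^ c.depth x * (ν x + 1))) := by
                rw [hD, one_mul, ← mul_assoc]
                exact Nat.mul_le_mul_left _ (Nat.le_succ _)
            _ ≤ _ := Nat.mul_le_mul_right _ (by omega)
        · rw [if_neg hxa, if_neg hxb, add_zero, add_zero, ← hD, mul_comm]
          exact Nat.mul_le_mul_right _ ((hν x (Or.inl rfl) hxa hxb).trans (Nat.le_succ _))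
    have e5 := Nat.mul_le_mul_left 20 (hpos (ν a) (ν b) (c.depth a + if x = a then 1 else 0)
      (c.depth b + if x = b then 1 else 0))
    rw [add_mul ((K + 20) * (q + 1)), mul_assoc (K + 20)]
    exact Nat.add_le_add (e3.trans (Nat.mul_le_mul_left _ e4)) (by omega)

end Code
end RAM

/-! ### The program -/

namespace RAM

/-! The arrays used by the program. Those with the prefix `v` are used as variables. -/

-- tables that are computed first: loop bounds, divisibility, admissibility, path lengths, row offsets
notation "vLog" => (4 : ℕ)
notation "vPhases" => (5 : ℕ)
notation "aIndiv" => (6 : ℕ)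
notation "aAdm" => (7 : ℕ)
notation "aPart" => (8 : ℕ)
notation "aRow" => (9 : ℕ)
notation "vGcd" => (10 : ℕ)
notation "vOneMod" => (16 : ℕ)
notation "vPow" => (17 : ℕ)
-- loop counters
notation "vK" => (11 : ℕ)
notation "vU" => (12 : ℕ)
notation "vV" => (13 : ℕ)
notation "vLevel" => (14 : ℕ)
notation "vPhase" => (15 : ℕ)
-- growing the forest
notation "aLab" => (20 : ℕ)
notation "aSize" => (21 : ℕ)
notation "aBestI" => (22 : ℕ)
notation "aBestJ" => (23 : ℕ)
notation "aWin" => (24 : ℕ)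
notation "aLeafI" => (25 : ℕ)
notation "aLeafJ" => (26 : ℕ)
notation "vM" => (27 : ℕ)
notation "aEdgeI" => (28 : ℕ)
notation "aEdgeJ" => (29 : ℕ)
notation "vI" => (30 : ℕ)
notation "vJ" => (31 : ℕ)
notation "vNode" => (32 : ℕ)
notation "vLeaf" => (33 : ℕ)
notation "vP" => (34 : ℕ)
notation "vQ" => (35 : ℕ)
notation "vWin" => (36 : ℕ)
notation "sWt" => (0 : ℕ)
notation "sDual" => (1 : ℕ)
notation "sKey" => (2 : ℕ)
notation "sTime" => (3 : ℕ)
notation "sEps" => (4 : ℕ)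
-- exploring a forest
notation "aVis" => (40 : ℕ)
notation "aCnt" => (41 : ℕ)
notation "vFound" => (42 : ℕ)
notation "vA" => (43 : ℕ)
notation "vB" => (44 : ℕ)
notation "aPar" => (45 : ℕ)
notation "aRoot" => (46 : ℕ)
notation "aPos" => (47 : ℕ)
notation "aOrd" => (48 : ℕ)
-- pruning
notation "aSub" => (50 : ℕ)
notation "vX" => (51 : ℕ)
notation "vKept" => (52 : ℕ)
-- repair phases
notation "aFlag" => (55 : ℕ)
notation "aCandI" => (56 : ℕ)
notation "aCandJ" => (57 : ℕ)
notation "vC" => (58 : ℕ)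
notation "vD" => (59 : ℕ)
-- output
notation "aTour" => (62 : ℕ)
notation "vCompLeft" => (63 : ℕ)
notation "vPathLeft" => (64 : ℕ)
notation "vStart" => (65 : ℕ)

open Code IExpr Test

/-- The position of the pair `(i, j)` among the leaves of the tournament tree. With row offsets
`i * n`, it is `n * n + (i * n + j)`. -/
def leafOf (i j : IExpr) : IExpr := load aRow (var 0) + (load aRow i + j)

/-- The weight of the edge `{u, v}`. -/
def wtOf (u v : IExpr) : SExpr := .load sWt (load aRow u + v)

/-- The amount by which the edge stored for the leaf `l` fails to be tight. -/
def slackOf (l : IExpr) : SExpr :=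
  wtOf (load aBestI l) (load aBestJ l) - .load sDual (load aBestI l) - .load sDual (load aBestJ l)

/-- Decide the match at the node `vNode` of the tournament tree. The entry `0` means that no leaf
takes part in the tournament. -/
def playMatch : Code :=
  let x : IExpr := var vNode
  let l := load aWin (x + x)
  let r := load aWin (x + x + 1)
  ite (ile l 0) (istore aWin x r)
    (ite (ile r 0) (istore aWin x l)
      (ite (sle (.load sKey l) (.load sKey r)) (istore aWin x l) (istore aWin x r)))

/-- Repeat all matches on the way from a leaf, whose position is in `vNode`, to the root. -/
def climb : Code :=
  forTo vLevel vLog (block [assign vNode (half (var vNode)), when (ile 1 (var vNode)) playMatch])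

/-- Recompute the time at which the best edge between the components `vI` and `vJ` becomes tight,
and update the tournament tree. -/
def refresh : Code :=
  let f := load aIndiv (load aSize (var vI)) + load aIndiv (load aSize (var vJ))
  let l : IExpr := var vLeaf
  block [
    assign vLeaf (leafOf (var vI) (var vJ)),
    assign vNode l,
    ite (.and (ieq (load aLab (var vI)) (var vI)) (.and (ieq (load aLab (var vJ)) (var vJ))
        (.and (.not (ieq (var vI) (var vJ))) (ile 1 f))))
      (block [
        ite (ile 2 f) (sstore sKey l (.load sTime 0 + .half (slackOf l)))
          (sstore sKey l (.load sTime 0 + slackOf l)),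
        istore aWin l l])
      (istore aWin l 0),
    climb]

/-- Every vertex is a component of its own. -/
def gwLabels : Code :=
  forTo vU 0 (block [istore aLab (var vU) (var vU), istore aSize (var vU) 1])

/-- Store the edge `{u, v}` for the components `{u}` and `{v}`, and the pair `(u, v)` for its leaf. -/
def gwPairs : Code :=
  let l := leafOf (var vU) (var vV)
  forTo vU 0 (forTo vV 0 (block [istore aBestI l (var vU), istore aBestJ l (var vV),
    istore aLeafI l (var vU), istore aLeafJ l (var vV)]))

/-- Build the tournament tree by refreshing all leaves. -/
def gwTree : Code :=
  forTo vU 0 (forTo vV 0 (block [assign vI (var vU), assign vJ (var vV), refresh]))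

/-- Replace the edge stored for the leaf `a` by that for the leaf `b`, if the latter has less
slack. -/
def relax (a b : IExpr) : Code :=
  when (.not (sle (slackOf a) (slackOf b)))
    (block [istore aBestI a (load aBestI b), istore aBestJ a (load aBestJ b)])

/-- Raise the dual values of all vertices in active components. -/
def gwRaise : Code :=
  forTo vU 0 (when (ile 1 (load aIndiv (load aSize (load aLab (var vU)))))
    (sstore sDual (var vU) (.load sDual (var vU) + .load sEps 0)))

/-- For every third component, keep the better of the edges to the two components that are united. -/
def gwRelax : Code :=
  forTo vU 0 (block [
    relax (leafOf (var vP) (var vU)) (leafOf (var vQ) (var vU)),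
    relax (leafOf (var vU) (var vP)) (leafOf (var vU) (var vQ))])

/-- Give the vertices of the component `vQ` the label `vP`. -/
def gwRelabel : Code :=
  forTo vU 0 (when (ieq (load aLab (var vU)) (var vQ)) (istore aLab (var vU) (var vP)))

def refreshAt (i j : IExpr) : Code := block [assign vI i, assign vJ j, refresh]

/-- Refresh the leaves of all pairs that involve one of the two united components. -/
def gwRefresh : Code :=
  forTo vU 0 (block [refreshAt (var vP) (var vU), refreshAt (var vU) (var vP),
    refreshAt (var vQ) (var vU), refreshAt (var vU) (var vQ)])

/-- Select the edge that becomes tight first, and append it to the list of edges. -/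
def gwSelect : Code := block [
    assign vWin (load aWin 1),
    assign vP (load aLeafI (var vWin)),
    assign vQ (load aLeafJ (var vWin)),
    sstore sEps 0 (.load sKey (var vWin) - .load sTime 0),
    istore aEdgeI (var vM) (load aBestI (var vWin)),
    istore aEdgeJ (var vM) (load aBestJ (var vWin)),
    assign vM (var vM + 1)]

/-- One iteration of the Goemans-Williamson algorithm; the united component gets the label `vP`. -/
def gwStep : Code := block [gwSelect, gwRaise, sstore sTime 0 (.load sTime 0 + .load sEps 0), gwRelax,
    istore aSize (var vP) (load aSize (var vP) + load aSize (var vQ)), gwRelabel, gwRefresh]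

def gwInit : Code := block [gwLabels, gwPairs, gwTree]

/-- The main loop. After at most `n` iterations no leaf takes part in the tournament any more. -/
def gwLoop : Code := forTo vK 0 (when (ile 1 (load aWin 1)) gwStep)

def exploreInit : Code := forTo vU 0 (block [istore aVis (var vU) 0, istore aCnt (var vU) 0])

def checkEdge : Code :=
  when (.and (ilt (var vU) (var vM)) (.not (ieq (load aVis (load aEdgeI (var vU)))
      (load aVis (load aEdgeJ (var vU))))))
    (block [assign vFound 1,
      ite (ieq (load aVis (load aEdgeI (var vU))) 1)
        (block [assign vA (load aEdgeI (var vU)), assign vB (load aEdgeJ (var vU))])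
        (block [assign vA (load aEdgeJ (var vU)), assign vB (load aEdgeI (var vU))])])

/-- Look for an edge `{vA, vB}` such that `vA` is visited and `vB` is not. -/
def findEdge : Code := block [assign vFound 0, forTo vU 0 checkEdge]

/-- Make room for a vertex behind `vA`. -/
def shiftTour : Code :=
  forTo vU 0 (when (ilt (load aPos (var vA)) (load aPos (var vU)))
    (istore aPos (var vU) (load aPos (var vU) + 1)))

/-- Append the leaf `vB` at `vA`. -/
def addLeaf : Code := block [
  istore aPar (var vB) (var vA),
  istore aRoot (var vB) (load aRoot (var vA)),
  shiftTour,
  istore aPos (var vB) (load aPos (var vA) + 1)]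

def findUnvisited : Code := forTo vU 0 (when (ieq (load aVis (var vU)) 0) (assign vB (var vU)))

/-- Start a new tree at an unvisited vertex. -/
def addRoot : Code := block [findUnvisited,
  istore aPar (var vB) (var vB),
  istore aRoot (var vB) (var vB),
  istore aPos (var vB) (var vK)]

def visit : Code := block [
  istore aVis (var vB) 1,
  istore aOrd (var vK) (var vB),
  istore aCnt (load aRoot (var vB)) (load aCnt (load aRoot (var vB)) + 1)]

def exploreStep : Code := block [findEdge, ite (ieq (var vFound) 1) addLeaf addRoot, visit]

/-- Explore the forest given by the list of edges, one vertex after the other. -/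
def explore : Code := block [exploreInit, forTo vK 0 exploreStep]

def subInit : Code := forTo vU 0 (istore aSub (var vU) (var vOneMod))

/-- Pass the number computed for the next vertex, in reverse order, on to its parent. -/
def subStep : Code := block [
  assign vX (load aOrd (var 0 - 1 - var vK)),
  when (.not (ieq (load aPar (var vX)) (var vX))) (block [
    istore aSub (load aPar (var vX)) (load aSub (load aPar (var vX)) + load aSub (var vX)),
    when (ile (var vGcd) (load aSub (load aPar (var vX))))
      (istore aSub (load aPar (var vX)) (load aSub (load aPar (var vX)) - var vGcd))])]

/-- Compute the numbers of vertices below all vertices, modulo `g_L`. -/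
def subtreeSizes : Code := block [subInit, forTo vK 0 subStep]

def filterStep : Code := when (ilt (var vU) (var vM)) (block [
  ite (ieq (load aPar (load aEdgeI (var vU))) (load aEdgeJ (var vU)))
    (assign vX (load aEdgeI (var vU))) (assign vX (load aEdgeJ (var vU))),
  when (ile 1 (load aSub (var vX))) (block [
    istore aEdgeI (var vKept) (load aEdgeI (var vU)),
    istore aEdgeJ (var vKept) (load aEdgeJ (var vU)),
    assign vKept (var vKept + 1)])])

/-- Keep the edges that do not cut off a number of vertices divisible by `g_L`. -/
def filterEdges : Code := block [assign vKept 0, forTo vU 0 filterStep, assign vM (var vKept)]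

/-- The final deletion step of the Goemans-Williamson algorithm. -/
def prune : Code := block [explore, subtreeSizes, filterEdges]

def clearFlags : Code := forTo vU 0 (istore aFlag (var vU) 0)

/-- Consider the edge `{vU, vV}` as a candidate for the component of `vU`. -/
def offer : Code :=
  let r := load aRoot (var vU)
  when (.and (.not (ieq r (load aRoot (var vV)))) (ieq (load aAdm (load aCnt r)) 0))
    (when (.not (.and (ieq (load aFlag r) 1)
        (sle (wtOf (load aCandI r) (load aCandJ r)) (wtOf (var vU) (var vV)))))
      (block [istore aFlag r 1, istore aCandI r (var vU), istore aCandJ r (var vV)]))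

/-- Find a lightest edge leaving the component, for every illegal component. -/
def findLightest : Code := block [clearFlags, forTo vU 0 (forTo vV 0 offer)]

def uniteRoots : Code :=
  forTo vU 0 (when (ieq (load aRoot (var vU)) (var vD)) (istore aRoot (var vU) (var vC)))

/-- Add the edge found for the component `vK`, unless it closes a cycle. -/
def link : Code := when (ieq (load aFlag (var vK)) 1)
  (when (.not (ieq (load aRoot (load aCandI (var vK))) (load aRoot (load aCandJ (var vK)))))
    (block [
      istore aEdgeI (var vM) (load aCandI (var vK)),
      istore aEdgeJ (var vM) (load aCandJ (var vK)),
      assign vM (var vM + 1),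
      assign vC (load aRoot (load aCandI (var vK))),
      assign vD (load aRoot (load aCandJ (var vK))),
      uniteRoots]))

def linkLightest : Code := forTo vK 0 link

def phase : Code := block [explore, findLightest, linkLightest]

/-- As many phases as can be needed; without illegal components, a phase has no effect. -/
def phases : Code := forTo vPhase vPhases phase

/-- Invert the array of positions. -/
def readTour : Code := forTo vU 0 (istore aTour (load aPos (var vU)) (var vU))

/-- At the end of a component, start the next one. -/
def openComponent : Code := when (ieq (var vCompLeft) 0)
  (assign vCompLeft (load aCnt (load aRoot (load aTour (var vK)))))

/-- At the end of a path, start the next one and look up its length. -/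
def openPath : Code := when (ieq (var vPathLeft) 0)
  (block [openComponent, assign vPathLeft (load aPart (var vCompLeft)), assign vStart (var vK)])

/-- Output the edge that follows the `vK`-th vertex. -/
def emitEdge : Code := block [
  assign vPathLeft (var vPathLeft - 1),
  assign vCompLeft (var vCompLeft - 1),
  istore 2 (var vK) (load aTour (var vK)),
  ite (ieq (var vPathLeft) 0) (istore 3 (var vK) (load aTour (var vStart)))
    (istore 3 (var vK) (load aTour (var vK + 1)))]

def emit : Code := block [openPath, emitEdge]

/-- Cut the tours of all components into paths and output the edges of the resulting cycles. -/
def closeUp : Code := block [explore, readTour, assign vCompLeft 0, assign vPathLeft 0,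
  forTo vK 0 emit, istore 1 0 1, istore 1 1 (var 0)]

/-- The algorithm, without the computation of the tables. -/
def mainCode : Code := when (ieq (load aAdm (var 0)) 1)
  (block [gwInit, gwLoop, prune, phases, closeUp])

theorem wf_mainCode : mainCode.wf = true := by decide +kernel
theorem bounds_mainCode : ∀ a ∈ mainCode.bounds, a ∉ mainCode.iw := by decide +kernel
theorem bounds_mainCode_subset : ∀ a ∈ mainCode.bounds, a ≠ 0 → a ≠ vLog → a = vPhases := by
  decide +kernel
theorem depth_mainCode : mainCode.depth 0 = 2 := by decide +kernel
theorem depth_log_mainCode : mainCode.depth vLog = 1 := by decide +kernel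

end RAM

/-! ### The tournament tree -/

namespace RAM

open Code

open Classical in
@[simp] theorem Code.den_ite (b : Test) (c d : Code) (σ : Store) :
    (Code.ite b c d).den σ = if b.holds σ then c.den σ else d.den σ := by simp [den]

open Classical in
@[simp] theorem Code.den_when (b : Test) (c : Code) (σ : Store) :
    (Code.when b c).den σ = if b.holds σ then c.den σ else σ := by simp [Code.when]

/-- The winner of a match: the leaf with the smaller key. Here `0` stands for no leaf. -/
def bestOf (key : ℕ → ℚ) (a b : ℕ) : ℕ :=
  if a = 0 then b else if b = 0 then a else if key a ≤ key b then a else b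

theorem bestOf_eq_or (key : ℕ → ℚ) (a b : ℕ) : bestOf key a b = a ∨ bestOf key a b = b := by
  unfold bestOf; split_ifs <;> simp

theorem bestOf_left {key : ℕ → ℚ} {a : ℕ} (b : ℕ) (ha : a ≠ 0) :
    bestOf key a b ≠ 0 ∧ key (bestOf key a b) ≤ key a := by
  unfold bestOf
  rw [if_neg ha]
  split_ifs with h1 h2
  · exact ⟨ha, le_rfl⟩
  · exact ⟨ha, le_rfl⟩
  · exact ⟨h1, (not_le.1 h2).le⟩

theorem bestOf_right {key : ℕ → ℚ} (a : ℕ) {b : ℕ} (hb : b ≠ 0) :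
    bestOf key a b ≠ 0 ∧ key (bestOf key a b) ≤ key b := by
  unfold bestOf
  split_ifs with h1 h2
  · exact ⟨hb, le_rfl⟩
  · exact ⟨h1, h2⟩
  · exact ⟨hb, le_rfl⟩

/-- The match at node `x` has been played. -/
def MatchOK (win : ℕ → ℕ) (key : ℕ → ℚ) (x : ℕ) : Prop :=
  win x = bestOf key (win (2 * x)) (win (2 * x + 1))

/-- In a tournament with the nodes `1, ..., N - 1` and the leaves `N, ..., 2 * N - 1`, every winner
comes from a leaf below. -/
theorem exists_leaf_of_matchOK {N : ℕ} {win : ℕ → ℕ} {key : ℕ → ℚ}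
    (hok : ∀ x, 1 ≤ x → x < N → MatchOK win key x)
    (hleaf : ∀ y, N ≤ y → y < 2 * N → win y = 0 ∨ win y = y) (x : ℕ) (hx : 1 ≤ x)
    (hxN : x < 2 * N) :
    win x = 0 ∨ (N ≤ win x ∧ win x < 2 * N ∧ win (win x) = win x ∧ ∃ s, win x / 2 ^ s = x) := by
  induction hm : 2 * N - x using Nat.strong_induction_on generalizing x with
  | _ m ih =>
    by_cases hxl : N ≤ x
    · rcases hleaf x hxl hxN with h | h
      · exact Or.inl h
      · exact Or.inr ⟨by omega, by omega, by rw [h, h], 0, by simp [h]⟩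
    · have h1 := hok x hx (by omega)
      unfold MatchOK at h1
      rcases bestOf_eq_or key (win (2 * x)) (win (2 * x + 1)) with h | h
      · rw [h] at h1
        rw [h1]
        rcases ih _ (by omega) (2 * x) (by omega) (by omega) rfl with h | ⟨a, b, c, s, hs⟩
        · exact Or.inl h
        · exact Or.inr ⟨a, b, c, s + 1, by rw [pow_succ, ← Nat.div_div_eq_div_mul, hs]; omega⟩
      · rw [h] at h1
        rw [h1]
        rcases ih _ (by omega) (2 * x + 1) (by omega) (by omega) rfl with h | ⟨a, b, c, s, hs⟩
        · exact Or.inl h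
        · exact Or.inr ⟨a, b, c, s + 1, by rw [pow_succ, ← Nat.div_div_eq_div_mul, hs]; omega⟩

/-- The winner of the whole tournament has the smallest key. -/
theorem winner_le {N : ℕ} {win : ℕ → ℕ} {key : ℕ → ℚ}
    (hok : ∀ x, 1 ≤ x → x < N → MatchOK win key x) (y : ℕ) (hy : 1 ≤ y) (hyN : y < 2 * N)
    (hwin : win y ≠ 0) : win 1 ≠ 0 ∧ key (win 1) ≤ key (win y) := by
  induction y using Nat.strong_induction_on with
  | _ y ih =>
    by_cases h1 : y = 1
    · subst h1; exact ⟨hwin, le_rfl⟩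
    · have h2 := hok (y / 2) (by omega) (by omega)
      unfold MatchOK at h2
      have h3 : win (y / 2) ≠ 0 ∧ key (win (y / 2)) ≤ key (win y) := by
        rw [h2]
        rcases Nat.mod_two_eq_zero_or_one y with h | h
        · have : 2 * (y / 2) = y := by omega
          rw [this]
          exact bestOf_left _ hwin
        · have : 2 * (y / 2) + 1 = y := by omega
          rw [this]
          exact bestOf_right _ hwin
      obtain ⟨h4, h5⟩ := ih (y / 2) (by omega) (by omega) (by omega) h3.1
      exact ⟨h4, h5.trans h3.2⟩

theorem playMatch_den (σ : Store) : playMatch.den σ = σ.setIdx aWin (σ.idx vNode 0)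
    (bestOf (σ.scal sKey) (σ.idx aWin (2 * σ.idx vNode 0)) (σ.idx aWin (2 * σ.idx vNode 0 + 1))) := by
  simp only [playMatch, den_ite, den_istore, Test.holds_ile, Test.holds_sle, IExpr.eval_load,
    IExpr.eval_add, IExpr.eval_var, IExpr.eval_zero, IExpr.eval_one, SExpr.eval_load, bestOf,
    Nat.le_zero, two_mul]
  split_ifs <;> rfl

/-- Repeating the matches above a leaf repairs the tournament tree, if it was correct elsewhere. -/
theorem climb_spec {σ : Store} {N l : ℕ} (hl : σ.idx vNode 0 = l) (hlN : l < 2 * N)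
    (hlog : l < 2 ^ σ.idx vLog 0)
    (hok : ∀ x, 1 ≤ x → x < N → (∀ s, 1 ≤ s → x ≠ l / 2 ^ s) → MatchOK (σ.idx aWin) (σ.scal sKey) x) :
    (∀ x, 1 ≤ x → x < N → MatchOK ((climb.den σ).idx aWin) (σ.scal sKey) x) ∧
      ∀ y, N ≤ y → (climb.den σ).idx aWin y = σ.idx aWin y := by
  have key := forTo_rule (v := vLevel) (a := vLog)
    (c := block [assign vNode (.half (.var vNode)), when (.ile 1 (.var vNode)) playMatch])
    (by decide) σ
    (fun t τ => τ.idx vNode 0 = l / 2 ^ t ∧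
      (∀ x, 1 ≤ x → x < N → (∀ s, t + 1 ≤ s → x ≠ l / 2 ^ s) →
        MatchOK (τ.idx aWin) (σ.scal sKey) x) ∧
      ∀ y, N ≤ y → τ.idx aWin y = σ.idx aWin y) ?_ ?_
  · obtain ⟨-, h2, h3⟩ := key
    refine ⟨fun x hx hxN => h2 x hx hxN fun s hs h => ?_, h3⟩
    have : l / 2 ^ s = 0 := Nat.div_eq_of_lt (hlog.trans_le (Nat.pow_le_pow_right (by norm_num) (by omega)))
    omega
  · refine ⟨by simp [hl], ?_, by simp⟩
    intro x hx hxN hs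
    have := hok x hx hxN fun s h => hs s (by omega)
    simpa [MatchOK] using this
  · rintro t τ ht hlev hag ⟨h1, h2, h3⟩
    have hscal : τ.scal = σ.scal := funext fun a => hag.scal a (by simp [sw, block, assign, when, playMatch])
    have hX : τ.idx vNode 0 / 2 = l / 2 ^ (t + 1) := by
      rw [h1, pow_succ, Nat.div_div_eq_div_mul]
    set X := l / 2 ^ (t + 1) with hXdef
    have hXN : X < N := by
      have : X ≤ l / 2 := by
        rw [hXdef, pow_succ, mul_comm, ← Nat.div_div_eq_div_mul]
        exact Nat.div_le_self _ _
      omega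
    have hX2 : l / 2 ^ (t + 2) = X / 2 := by
      rw [hXdef, Nat.div_div_eq_div_mul]; rfl
    simp only [den_block_cons, den_block_nil, den_assign, den_when, Test.holds_ile, IExpr.eval_one,
      IExpr.eval_var, IExpr.eval_half]
    by_cases hX0 : 1 ≤ X
    · rw [if_pos (by simpa [hX] using hX0), playMatch_den]
      refine ⟨by simp [hX], ?_, ?_⟩
      · intro x hx hxN hs
        have hne2 : x ≠ X / 2 := hX2 ▸ hs (t + 2) (by omega)
        by_cases hxX : x = X
        · have e1 : ¬ 2 * X = X := by omega
          have e2 : ¬ 2 * X + 1 = X := by omega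
          simp [MatchOK, hX, hxX, e1, e2, hscal]
        · have e1 : ¬ 2 * x = X := by omega
          have e2 : ¬ 2 * x + 1 = X := by omega
          have := h2 x hx hxN fun s hs' => by
            rcases Nat.eq_or_lt_of_le hs' with h | h
            · rw [← h]; exact hxX
            · exact hs s h
          simpa [MatchOK, hX, hxX, e1, e2] using this
      · intro y hy
        have : ¬ y = X := by omega
        simpa [hX, this] using h3 y hy
    · rw [if_neg (by simpa [hX] using hX0)]
      refine ⟨by simp [hX], ?_, by simpa using h3⟩
      intro x hx hxN hs
      have := h2 x hx hxN fun s hs' => by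
        rcases Nat.eq_or_lt_of_le hs' with h | h
        · rw [← h]; omega
        · exact hs s h
      simpa [MatchOK] using this

/-! ### Refreshing a leaf -/

/-- The slack of the edge stored for the leaf `l`. -/
def slack (σ : Store) (l : ℕ) : ℚ :=
  σ.scal sWt (σ.idx aRow (σ.idx aBestI l) + σ.idx aBestJ l) - σ.scal sDual (σ.idx aBestI l)
    - σ.scal sDual (σ.idx aBestJ l)

/-- The number of active components among the two with the labels `i` and `j`. -/
def rate (σ : Store) (i j : ℕ) : ℕ := σ.idx aIndiv (σ.idx aSize i) + σ.idx aIndiv (σ.idx aSize j)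

/-- `i` and `j` are the labels of distinct components, at least one of which is active. -/
def IsCompPair (σ : Store) (i j : ℕ) : Prop :=
  σ.idx aLab i = i ∧ σ.idx aLab j = j ∧ i ≠ j ∧ 1 ≤ rate σ i j

/-- The position of the pair `(i, j)` among the leaves. -/
def leafIdx (n i j : ℕ) : ℕ := n * n + (i * n + j)

/-- The leaf of the pair `(i, j)` is up to date. -/
def LeafOK (n : ℕ) (σ : Store) (i j : ℕ) : Prop :=
  (IsCompPair σ i j → σ.idx aWin (leafIdx n i j) = leafIdx n i j ∧
    σ.scal sKey (leafIdx n i j) = σ.scal sTime 0 + slack σ (leafIdx n i j) / rate σ i j) ∧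
  (¬ IsCompPair σ i j → σ.idx aWin (leafIdx n i j) = 0)

/-- What is needed for, and preserved by, refreshing leaves. -/
structure TreeInv (n : ℕ) (σ : Store) : Prop where
  n_eq : σ.idx 0 0 = n
  row : ∀ i ≤ n, σ.idx aRow i = i * n
  log : 2 * (n * n) ≤ 2 ^ σ.idx vLog 0
  indiv : ∀ i < n, σ.idx aLab i = i → σ.idx aIndiv (σ.idx aSize i) ≤ 1
  matchOK : ∀ x, 1 ≤ x → x < n * n → MatchOK (σ.idx aWin) (σ.scal sKey) x
  leaf : ∀ y, n * n ≤ y → y < 2 * (n * n) → σ.idx aWin y = 0 ∨ σ.idx aWin y = y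

theorem leafIdx_lt {n i j : ℕ} (hi : i < n) (hj : j < n) :
    n * n ≤ leafIdx n i j ∧ leafIdx n i j < 2 * (n * n) := by
  unfold leafIdx
  have : i * n + n ≤ n * n := by
    calc i * n + n = (i + 1) * n := by ring
      _ ≤ n * n := Nat.mul_le_mul_right _ hi
  omega

theorem leafIdx_inj {n i j i' j' : ℕ} (hj : j < n) (hj' : j' < n)
    (h : leafIdx n i j = leafIdx n i' j') : i = i' ∧ j = j' := by
  unfold leafIdx at h
  have h1 : i * n + j = i' * n + j' := by omega
  have hn : 0 < n := by omega
  have e1 : (i * n + j) / n = i := by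
    rw [mul_comm, Nat.mul_add_div hn, Nat.div_eq_of_lt hj, add_zero]
  have e2 : (i' * n + j') / n = i' := by
    rw [mul_comm, Nat.mul_add_div hn, Nat.div_eq_of_lt hj', add_zero]
  have : i = i' := by rw [← e1, h1, e2]
  subst this
  exact ⟨rfl, by omega⟩

theorem eval_slackOf (σ : Store) (l : IExpr) : (slackOf l).eval σ = slack σ (l.eval σ) := rfl

theorem eval_leafOf {σ : Store} {n : ℕ} (hn : σ.idx 0 0 = n) (hrow : ∀ i ≤ n, σ.idx aRow i = i * n)
    {i : IExpr} (hi : i.eval σ < n) (j : IExpr) :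
    (leafOf i j).eval σ = leafIdx n (i.eval σ) (j.eval σ) := by
  simp [leafOf, hn, hrow n le_rfl, hrow _ hi.le, leafIdx]

/-- The arrays on which the data of a leaf depend. -/
theorem LeafOK.congr {n : ℕ} {σ τ : Store} {i j : ℕ} (h : LeafOK n σ i j)
    (hag : Agree [vI, vJ, aWin, vNode, vLeaf, vLevel, vU, vV, vK] [sKey] σ τ)
    (h1 : τ.idx aWin (leafIdx n i j) = σ.idx aWin (leafIdx n i j))
    (h2 : τ.scal sKey (leafIdx n i j) = σ.scal sKey (leafIdx n i j)) : LeafOK n τ i j := by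
  have hlab := hag.idx aLab (by decide)
  have hsz := hag.idx aSize (by decide)
  have hin := hag.idx aIndiv (by decide)
  have hbi := hag.idx aBestI (by decide)
  have hbj := hag.idx aBestJ (by decide)
  have hrow := hag.idx aRow (by decide)
  have hw := hag.scal sWt (by decide)
  have hd := hag.scal sDual (by decide)
  have ht := hag.scal sTime (by decide)
  have hr : rate τ i j = rate σ i j := by simp [rate, hsz, hin]
  have hv : IsCompPair τ i j ↔ IsCompPair σ i j := by simp [IsCompPair, hlab, hr]
  have hs : ∀ l, slack τ l = slack σ l := by simp [slack, hbi, hbj, hrow, hw, hd]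
  unfold LeafOK
  rw [hv, h1, h2, hr, hs, ht]
  exact h

theorem TreeInv.congr {n : ℕ} {σ τ : Store} (h : TreeInv n σ)
    (hag : Agree [vI, vJ, aWin, vNode, vLeaf, vLevel, vU, vV, vK] [sKey] σ τ)
    (h1 : τ.idx aWin = σ.idx aWin) (h2 : τ.scal sKey = σ.scal sKey) : TreeInv n τ where
  n_eq := by rw [hag.idx 0 (by decide)]; exact h.n_eq
  row := by rw [hag.idx aRow (by decide)]; exact h.row
  log := by rw [hag.idx vLog (by decide)]; exact h.log
  indiv := by
    rw [hag.idx aIndiv (by decide), hag.idx aSize (by decide), hag.idx aLab (by decide)]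
    exact h.indiv
  matchOK := by rw [h1, h2]; exact h.matchOK
  leaf := by rw [h1]; exact h.leaf

/-- Refreshing a leaf brings it up to date and does not affect other leaves. -/
theorem refresh_spec {n : ℕ} {σ : Store} (h : TreeInv n σ) {i j : ℕ} (hi : σ.idx vI 0 = i)
    (hj : σ.idx vJ 0 = j) (hin : i < n) (hjn : j < n) :
    TreeInv n (refresh.den σ) ∧ LeafOK n (refresh.den σ) i j ∧
      ∀ i' j', i' < n → j' < n → LeafOK n σ i' j' → LeafOK n (refresh.den σ) i' j' := by
  classical
  have hagall : Agree [vI, vJ, aWin, vNode, vLeaf, vLevel, vU, vV, vK] [sKey] σ (refresh.den σ) :=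
    (agree_den refresh σ).mono (by decide) (by decide)
  obtain ⟨hl1, hl2⟩ := leafIdx_lt hin hjn
  set l := leafIdx n i j with hl
  -- the store before climbing
  obtain ⟨ρ, hρ, hag, hnode, hwin, hkey, hwl, hkl⟩ : ∃ ρ, refresh.den σ = climb.den ρ ∧
      Agree [vI, vJ, aWin, vNode, vLeaf, vLevel, vU, vV, vK] [sKey] σ ρ ∧ ρ.idx vNode 0 = l ∧
      (∀ y, y ≠ l → ρ.idx aWin y = σ.idx aWin y) ∧ (∀ y, y ≠ l → ρ.scal sKey y = σ.scal sKey y) ∧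
      ρ.idx aWin l = (if IsCompPair σ i j then l else 0) ∧
      (IsCompPair σ i j → ρ.scal sKey l = σ.scal sTime 0 + slack σ l / rate σ i j) := by
    set c : Code := block [
      assign vLeaf (leafOf (.var vI) (.var vJ)),
      assign vNode (.var vLeaf),
      ite (.and (.ieq (.load aLab (.var vI)) (.var vI)) (.and (.ieq (.load aLab (.var vJ)) (.var vJ))
          (.and (.not (.ieq (.var vI) (.var vJ)))
            (.ile 1 (.load aIndiv (.load aSize (.var vI)) + .load aIndiv (.load aSize (.var vJ)))))))
        (block [
          ite (.ile 2 (.load aIndiv (.load aSize (.var vI)) + .load aIndiv (.load aSize (.var vJ))))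
            (sstore sKey (.var vLeaf) (.load sTime 0 + .half (slackOf (.var vLeaf))))
            (sstore sKey (.var vLeaf) (.load sTime 0 + slackOf (.var vLeaf))),
          istore aWin (.var vLeaf) (.var vLeaf)])
        (istore aWin (.var vLeaf) 0)] with hc
    refine ⟨c.den σ, ?_, (agree_den c σ).mono (by decide) (by decide), ?_⟩
    · simp only [refresh, hc, den_block_cons, den_block_nil]
    have hle : (leafOf (.var vI) (.var vJ)).eval σ = l := by
      rw [eval_leafOf h.n_eq h.row (by simpa [hi] using hin)]
      simp [hi, hj, hl]
    have hA : σ.idx aLab i = i → σ.idx aIndiv (σ.idx aSize i) ≤ 1 := h.indiv i hin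
    have hB : σ.idx aLab j = j → σ.idx aIndiv (σ.idx aSize j) ≤ 1 := h.indiv j hjn
    simp only [hc, den_block_cons, den_block_nil, den_assign, den_ite, den_istore, den_sstore, hle,
      Test.holds_and, Test.holds_ieq, Test.holds_not, Test.holds_ile, IExpr.eval_load,
      IExpr.eval_var, IExpr.eval_add, IExpr.eval_one, IExpr.eval_zero, IExpr.eval_two,
      Store.setIdx_idx, SExpr.eval_add, SExpr.eval_half, eval_slackOf, SExpr.eval_load,
      Store.setIdx_scal, hi, hj]
    norm_num [hi, hj]
    by_cases hv : IsCompPair σ i j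
    · have hv' := hv
      unfold IsCompPair rate at hv'
      rw [if_pos hv', if_pos hv]
      have hr : (rate σ i j : ℚ) = if 2 ≤ rate σ i j then 2 else 1 := by
        have h1 : rate σ i j ≤ 2 := by
          have := hA hv.1; have := hB hv.2.1; unfold rate; omega
        have h2 := hv.2.2.2
        split_ifs with h3
        · have : rate σ i j = 2 := by omega
          rw [this]; norm_num
        · have : rate σ i j = 1 := by omega
          rw [this]; norm_num
      rw [hr]
      simp only [rate]
      split_ifs with h2
      · refine ⟨by simp, ?_, ?_, by simp, ?_⟩
        · intro y hy; simp [hy]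
        · intro y hy; simp [hy]
        · simp [hv, slack, h2]
      · refine ⟨by simp, ?_, ?_, by simp, ?_⟩
        · intro y hy; simp [hy]
        · intro y hy; simp [hy]
        · simp [hv, slack, h2]
    · have hv' := hv
      unfold IsCompPair rate at hv'
      rw [if_neg hv', if_neg hv]
      refine ⟨by simp, ?_, by simp, by simp, fun h => absurd h hv⟩
      intro y hy; simp [hy]
  have hlog : ρ.idx vLog 0 = σ.idx vLog 0 := by rw [hag.idx vLog (by decide)]
  obtain ⟨hm, hleaf⟩ := climb_spec (σ := ρ) (N := n * n) (l := l) hnode hl2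
    (by rw [hlog]; exact hl2.trans_le h.log) (by
      intro x hx hxN hs
      -- the leaf `l` does not win below `x`
      have hne : ∀ y, y < 2 * (n * n) → 1 ≤ y → (∀ s, y ≠ l / 2 ^ s) → y ≠ l ∧ σ.idx aWin y ≠ l := by
        intro y hyN hy hys
        refine ⟨by simpa using hys 0, fun hw => ?_⟩
        rcases exists_leaf_of_matchOK h.matchOK h.leaf y hy hyN with h0 | ⟨-, -, -, s, hs⟩
        · have : l = 0 := by omega
          omega
        · exact hys s (by rw [← hs, hw])
      have hx0 : x ≠ l := by omega
      have h2x : ∀ s, 2 * x ≠ l / 2 ^ s := by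
        intro s hs'
        exact hs (s + 1) (by omega) (by rw [pow_succ, ← Nat.div_div_eq_div_mul, ← hs']; omega)
      have h2x1 : ∀ s, 2 * x + 1 ≠ l / 2 ^ s := by
        intro s hs'
        exact hs (s + 1) (by omega) (by rw [pow_succ, ← Nat.div_div_eq_div_mul, ← hs']; omega)
      obtain ⟨a1, a2⟩ := hne (2 * x) (by omega) (by omega) h2x
      obtain ⟨b1, b2⟩ := hne (2 * x + 1) (by omega) (by omega) h2x1
      have := h.matchOK x hx hxN
      unfold MatchOK at this ⊢
      rw [hwin _ hx0, hwin _ a1, hwin _ b1, this]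
      unfold bestOf
      rw [hkey _ a2, hkey _ b2])
  have hsc : ∀ a, (climb.den ρ).scal a = ρ.scal a := fun a => (agree_den climb ρ).scal a (by decide +revert)
  rw [hρ] at hagall ⊢
  have hV : ∀ i j, IsCompPair (climb.den ρ) i j ↔ IsCompPair σ i j := by
    intro i j
    simp only [IsCompPair, rate, hagall.idx aLab (by decide), hagall.idx aSize (by decide),
      hagall.idx aIndiv (by decide)]
  refine ⟨⟨?_, ?_, ?_, ?_, ?_, ?_⟩, ⟨?_, ?_⟩, ?_⟩
  · rw [hagall.idx 0 (by decide)]; exact h.n_eq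
  · rw [hagall.idx aRow (by decide)]; exact h.row
  · rw [hagall.idx vLog (by decide)]; exact h.log
  · rw [hagall.idx aIndiv (by decide), hagall.idx aSize (by decide), hagall.idx aLab (by decide)]
    exact h.indiv
  · rw [hsc]; exact hm
  · intro y hy hy2
    rw [hleaf y hy]
    by_cases hyl : y = l
    · rw [hyl, hwl]; split_ifs <;> simp
    · rw [hwin y hyl]; exact h.leaf y hy hy2
  · intro hv
    rw [hV] at hv
    refine ⟨by rw [hleaf _ hl1, hwl, if_pos hv], ?_⟩
    rw [hsc, hkl hv, hagall.scal sTime (by decide)]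
    simp only [slack, rate, hagall.idx aBestI (by decide), hagall.idx aBestJ (by decide),
      hagall.idx aRow (by decide), hagall.scal sWt (by decide), hagall.scal sDual (by decide),
      hagall.idx aSize (by decide), hagall.idx aIndiv (by decide)]
    rfl
  · intro hv
    rw [hV] at hv
    rw [hleaf _ hl1, hwl, if_neg hv]
  · intro i' j' hi' hj' hok
    by_cases heq : leafIdx n i' j' = l
    · obtain ⟨rfl, rfl⟩ := leafIdx_inj hj' hjn heq
      constructor
      · intro hv
        rw [hV] at hv
        refine ⟨by rw [hleaf _ hl1, hwl, if_pos hv], ?_⟩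
        rw [hsc, hkl hv, hagall.scal sTime (by decide)]
        simp only [slack, rate, hagall.idx aBestI (by decide), hagall.idx aBestJ (by decide),
          hagall.idx aRow (by decide), hagall.scal sWt (by decide), hagall.scal sDual (by decide),
          hagall.idx aSize (by decide), hagall.idx aIndiv (by decide)]
        rfl
      · intro hv
        rw [hV] at hv
        rw [hleaf _ hl1, hwl, if_neg hv]
    · refine hok.congr hagall ?_ ?_
      · rw [hleaf _ (leafIdx_lt hi' hj').1, hwin _ heq]
      · rw [hsc, hkey _ heq]

end RAM

/-! ### Growing the forest -/

namespace RAM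

open Code CycleCover

variable {n : ℕ}

/-- The tables on which the program relies, and which it does not modify. -/
structure Static (L : Set ℕ) (w : Sym2 (Fin n) → ℕ) (σ : Store) : Prop where
  n_eq : σ.idx 0 0 = n
  log : 2 * (n * n) ≤ 2 ^ σ.idx vLog 0
  phases : σ.idx vPhases 0 = frob L
  indiv_dvd : ∀ m ≤ n, gcdOf L ∣ m → σ.idx aIndiv m = 0
  indiv_not_dvd : ∀ m ≤ n, ¬ gcdOf L ∣ m → σ.idx aIndiv m = 1
  adm : ∀ m ≤ n, Admissible L m → σ.idx aAdm m = 1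
  not_adm : ∀ m ≤ n, ¬ Admissible L m → σ.idx aAdm m = 0
  part : ∀ m ≤ n, 0 < m → Admissible L m →
    σ.idx aPart m ∈ L ∧ σ.idx aPart m ≤ m ∧ Admissible L (m - σ.idx aPart m)
  row : ∀ i ≤ n, σ.idx aRow i = i * n
  gcd : σ.idx vGcd 0 = gcdOf L
  oneMod : σ.idx vOneMod 0 = 1 % gcdOf L
  wt : ∀ i j : Fin n, i ≠ j → σ.scal sWt (i * n + j) = w s(i, j)

theorem Static.congr {L : Set ℕ} {w : Sym2 (Fin n) → ℕ} {σ τ : Store} (h : Static L w σ)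
    {A S : List ℕ} (hag : Agree A S σ τ)
    (hA : ∀ a ∈ [0, vLog, vPhases, aIndiv, aAdm, aPart, aRow, vGcd, vOneMod], a ∉ A)
    (hS : sWt ∉ S) : Static L w τ := by
  have e := fun a ha => hag.idx a (hA a ha)
  constructor
  · rw [e 0 (by simp)]; exact h.n_eq
  · rw [e vLog (by simp)]; exact h.log
  · rw [e vPhases (by simp)]; exact h.phases
  · rw [e aIndiv (by simp)]; exact h.indiv_dvd
  · rw [e aIndiv (by simp)]; exact h.indiv_not_dvd
  · rw [e aAdm (by simp)]; exact h.adm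
  · rw [e aAdm (by simp)]; exact h.not_adm
  · rw [e aPart (by simp)]; exact h.part
  · rw [e aRow (by simp)]; exact h.row
  · rw [e vGcd (by simp)]; exact h.gcd
  · rw [e vOneMod (by simp)]; exact h.oneMod
  · rw [hag.scal sWt hS]; exact h.wt

/-- A counting loop whose bound is the number of vertices. -/
theorem forTo_n {v : ℕ} {c : Code} (hv : v ∉ c.iw) {σ : Store} (hn : σ.idx 0 0 = n)
    (I : ℕ → Store → Prop) (h0 : I 0 (σ.setIdx v 0 0))
    (hs : ∀ k τ, k < n → τ.idx v 0 = k → Agree (v :: c.iw) c.sw σ τ → I k τ →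
      I (k + 1) ((c.den τ).setIdx v 0 (k + 1))) :
    I n ((forTo v 0 c).den σ) := by
  subst hn
  exact forTo_rule hv σ I h0 hs

/-- The list `l` of edges is stored in the arrays. -/
def ListsEdges (σ : Store) (l : List (Fin n × Fin n)) : Prop :=
  σ.idx vM 0 = l.length ∧ ∀ k (h : k < l.length),
    σ.idx aEdgeI k = (l[k].1 : ℕ) ∧ σ.idx aEdgeJ k = (l[k].2 : ℕ)

/-- The set `F` of edges is stored in the arrays. -/
def ListsForest (σ : Store) (F : Finset (Sym2 (Fin n))) : Prop :=
  ∃ l : List (Fin n × Fin n), ListsEdges σ l ∧ (l.map fun p => s(p.1, p.2)).Nodup ∧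
    (l.map fun p => s(p.1, p.2)).toFinset = F

theorem ListsForest.congr {σ τ : Store} {F : Finset (Sym2 (Fin n))} (h : ListsForest σ F)
    (h1 : τ.idx vM = σ.idx vM) (h2 : τ.idx aEdgeI = σ.idx aEdgeI)
    (h3 : τ.idx aEdgeJ = σ.idx aEdgeJ) : ListsForest τ F := by
  obtain ⟨l, hl, h⟩ := h
  exact ⟨l, by simpa only [ListsEdges, h1, h2, h3] using hl, h⟩

/-- Appending an edge to the list. -/
theorem ListsForest.append {σ τ : Store} {F : Finset (Sym2 (Fin n))} (h : ListsForest σ F)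
    (u v : Fin n) (huv : s(u, v) ∉ F) (hm : τ.idx vM 0 = σ.idx vM 0 + 1)
    (hI : ∀ k, τ.idx aEdgeI k = if k = σ.idx vM 0 then (u : ℕ) else σ.idx aEdgeI k)
    (hJ : ∀ k, τ.idx aEdgeJ k = if k = σ.idx vM 0 then (v : ℕ) else σ.idx aEdgeJ k) :
    ListsForest τ (insert s(u, v) F) := by
  obtain ⟨l, ⟨hl1, hl2⟩, hnd, rfl⟩ := h
  refine ⟨l ++ [(u, v)], ⟨by simp [hm, hl1], fun k hk => ?_⟩, ?_, ?_⟩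
  · rw [hI, hJ, hl1]
    by_cases hk' : k < l.length
    · have := hl2 k hk'
      rw [if_neg (by omega), if_neg (by omega), List.getElem_append_left hk']
      exact this
    · have hk2 : k = l.length := by simp at hk; omega
      subst hk2
      simp
  · rw [List.map_append, List.nodup_append]
    refine ⟨hnd, by simp, ?_⟩
    intro a ha b hb
    simp only [List.map_cons, List.map_nil, List.mem_singleton] at hb
    rintro rfl
    exact huv (by rw [← hb]; exact List.mem_toFinset.2 ha)
  · ext e
    simp only [List.map_append, List.map_cons, List.map_nil, List.mem_toFinset, List.mem_append,
      List.mem_singleton, Finset.mem_insert]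
    tauto

/-- The vertices with label `r`. -/
def cls (σ : Store) (r : ℕ) : Finset (Fin n) := Finset.univ.filter fun v => σ.idx aLab v = r

@[simp] theorem mem_cls {σ : Store} {r : ℕ} {v : Fin n} : v ∈ cls σ r ↔ σ.idx aLab v = r := by
  simp [cls]

/-- `{u, v}` is a lightest edge between `A` and `B` with respect to `val`. -/
def IsBest (val : Fin n → Fin n → ℚ) (A B : Finset (Fin n)) (u v : Fin n) : Prop :=
  u ∈ A ∧ v ∈ B ∧ ∀ u' ∈ A, ∀ v' ∈ B, val u v ≤ val u' v'

theorem IsBest.union_left {val : Fin n → Fin n → ℚ} {A A' B : Finset (Fin n)} {u v u' v' : Fin n}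
    (h : IsBest val A B u v) (h' : IsBest val A' B u' v') :
    (val u v ≤ val u' v' → IsBest val (A ∪ A') B u v) ∧
      (¬ val u v ≤ val u' v' → IsBest val (A ∪ A') B u' v') := by
  obtain ⟨h1, h2, h3⟩ := h
  obtain ⟨h1', h2', h3'⟩ := h'
  constructor
  · intro hle
    refine ⟨Finset.mem_union_left _ h1, h2, fun x hx y hy => ?_⟩
    rcases Finset.mem_union.1 hx with hx | hx
    · exact h3 x hx y hy
    · exact hle.trans (h3' x hx y hy)
  · intro hle
    refine ⟨Finset.mem_union_right _ h1', h2', fun x hx y hy => ?_⟩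
    rcases Finset.mem_union.1 hx with hx | hx
    · exact (not_le.1 hle).le.trans (h3 x hx y hy)
    · exact h3' x hx y hy

theorem IsBest.union_right {val : Fin n → Fin n → ℚ} {A B B' : Finset (Fin n)} {u v u' v' : Fin n}
    (h : IsBest val A B u v) (h' : IsBest val A B' u' v') :
    (val u v ≤ val u' v' → IsBest val A (B ∪ B') u v) ∧
      (¬ val u v ≤ val u' v' → IsBest val A (B ∪ B') u' v') := by
  obtain ⟨h1, h2, h3⟩ := h
  obtain ⟨h1', h2', h3'⟩ := h'
  constructor
  · intro hle
    refine ⟨h1, Finset.mem_union_left _ h2, fun x hx y hy => ?_⟩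
    rcases Finset.mem_union.1 hy with hy | hy
    · exact h3 x hx y hy
    · exact hle.trans (h3' x hx y hy)
  · intro hle
    refine ⟨h1', Finset.mem_union_right _ h2', fun x hx y hy => ?_⟩
    rcases Finset.mem_union.1 hy with hy | hy
    · exact (not_le.1 hle).le.trans (h3 x hx y hy)
    · exact h3' x hx y hy

/-- The edge stored for the leaf `l`. -/
def edgeAt (σ : Store) (l : ℕ) : ℕ × ℕ := (σ.idx aBestI l, σ.idx aBestJ l)

theorem slack_congr {σ τ : Store} {l m : ℕ} (h0 : τ.scal sWt = σ.scal sWt)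
    (h1 : τ.scal sDual = σ.scal sDual) (hr : τ.idx aRow = σ.idx aRow)
    (he : edgeAt τ l = edgeAt σ m) : slack τ l = slack σ m := by
  simp only [edgeAt, Prod.mk.injEq] at he
  simp only [slack, h0, h1, hr, he.1, he.2]

/-- A loop whose `k`-th iteration changes only the `k`-th of the observed cells. -/
theorem forTo_cells {α : Type*} {v : ℕ} {c : Code} {σ : Store} (obs : Store → ℕ → α) (new : ℕ → α)
    (hn : σ.idx 0 0 = n) (hv : v ∉ c.iw) (hobs : ∀ τ x, obs (τ.setIdx v 0 x) = obs τ)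
    (h : ∀ k τ, k < n → τ.idx v 0 = k → Agree (v :: c.iw) c.sw σ τ → obs τ k = obs σ k →
      obs (c.den τ) k = new k ∧ ∀ u, u ≠ k → obs (c.den τ) u = obs τ u) (u : ℕ) :
    obs ((forTo v 0 c).den σ) u = if u < n then new u else obs σ u := by
  refine forTo_n hv hn (fun k τ => ∀ u, obs τ u = if u < k then new u else obs σ u)
    (fun u => by simp [hobs]) ?_ u
  intro k τ hk hv hag ih u
  obtain ⟨h1, h2⟩ := h k τ hk hv hag (by simp [ih k])
  rw [hobs]
  by_cases huk : u = k
  · rw [huk, h1, if_pos (by omega)]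
  · rw [h2 u huk, ih u]
    by_cases hlt : u < k
    · rw [if_pos hlt, if_pos (by omega)]
    · rw [if_neg hlt, if_neg (by omega)]

theorem gwRaise_spec {σ : Store} (hn : σ.idx 0 0 = n) (u : ℕ) :
    (gwRaise.den σ).scal sDual u =
      if u < n then (if 1 ≤ σ.idx aIndiv (σ.idx aSize (σ.idx aLab u)) then
        σ.scal sDual u + σ.scal sEps 0 else σ.scal sDual u) else σ.scal sDual u := by
  unfold gwRaise
  refine forTo_cells (v := vU) (fun τ => τ.scal sDual) (fun u => if 1 ≤ σ.idx aIndiv (σ.idx aSize (σ.idx aLab u)) then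
    σ.scal sDual u + σ.scal sEps 0 else σ.scal sDual u) hn ?_ (fun _ _ => rfl) ?_ u
  · decide
  intro k τ hk hv hag ih
  simp only [den_when, Test.holds_ile, IExpr.eval_one, IExpr.eval_load, IExpr.eval_var, hv,
    hag.idx aIndiv (by decide), hag.idx aSize (by decide), hag.idx aLab (by decide)]
  split_ifs with hc
  · simp +contextual [hv, ih, hag.scal sEps (by decide)]
  · simp [ih]

theorem gwRelabel_spec {σ : Store} (hn : σ.idx 0 0 = n) (u : ℕ) :
    (gwRelabel.den σ).idx aLab u = if u < n then
      (if σ.idx aLab u = σ.idx vQ 0 then σ.idx vP 0 else σ.idx aLab u) else σ.idx aLab u := by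
  unfold gwRelabel
  refine forTo_cells (v := vU) (fun τ => τ.idx aLab)
    (fun u => if σ.idx aLab u = σ.idx vQ 0 then σ.idx vP 0 else σ.idx aLab u) hn ?_ (fun _ _ => by ext; simp) ?_ u
  · decide
  intro k τ hk hv hag ih
  simp only [den_when, Test.holds_ieq, IExpr.eval_load, IExpr.eval_var, hv, ih,
    hag.idx vQ (by decide)]
  split_ifs with hc
  · simp +contextual [hv, hag.idx vP (by decide)]
  · simp [ih]

theorem relax_den (a b : IExpr) (σ : Store) (l : ℕ)
    (ha : ∀ x, (a.eval (σ.setIdx aBestI (a.eval σ) x)) = a.eval σ)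
    (hb : ∀ x, (b.eval (σ.setIdx aBestI (a.eval σ) x)) = b.eval σ) :
    edgeAt ((relax a b).den σ) l =
      if l = a.eval σ ∧ ¬ slack σ (a.eval σ) ≤ slack σ (b.eval σ) then edgeAt σ (b.eval σ)
      else edgeAt σ l := by
  simp only [relax, den_when, Test.holds_not, Test.holds_sle, eval_slackOf, den_block_cons,
    den_block_nil, den_istore, IExpr.eval_load, ha, hb]
  by_cases h : slack σ (a.eval σ) ≤ slack σ (b.eval σ)
  · simp [h]
  · by_cases hl : l = a.eval σ
    · simp [h, hl, edgeAt]
    · simp [hl, edgeAt, h]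

theorem gwRelax_spec {σ : Store} (hn : σ.idx 0 0 = n) (hrow : ∀ i ≤ n, σ.idx aRow i = i * n)
    {i j : ℕ} (hi : σ.idx vP 0 = i) (hj : σ.idx vQ 0 = j) (hin : i < n) (hjn : j < n)
    (hij : i ≠ j) :
    (∀ u < n, u ≠ i → u ≠ j → edgeAt (gwRelax.den σ) (leafIdx n i u) =
      if slack σ (leafIdx n i u) ≤ slack σ (leafIdx n j u) then edgeAt σ (leafIdx n i u)
      else edgeAt σ (leafIdx n j u)) ∧
    (∀ u < n, u ≠ i → u ≠ j → edgeAt (gwRelax.den σ) (leafIdx n u i) =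
      if slack σ (leafIdx n u i) ≤ slack σ (leafIdx n u j) then edgeAt σ (leafIdx n u i)
      else edgeAt σ (leafIdx n u j)) ∧
    ∀ a b, a < n → b < n → a ≠ i → b ≠ i →
      edgeAt (gwRelax.den σ) (leafIdx n a b) = edgeAt σ (leafIdx n a b) := by
  have key := forTo_n (v := vU) (c := block [
    relax (leafOf (.var vP) (.var vU)) (leafOf (.var vQ) (.var vU)),
    relax (leafOf (.var vU) (.var vP)) (leafOf (.var vU) (.var vQ))]) (by decide) hn
    (fun k τ => (∀ u < n, u ≠ i → u ≠ j → edgeAt τ (leafIdx n i u) =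
      if u < k ∧ ¬ slack σ (leafIdx n i u) ≤ slack σ (leafIdx n j u) then edgeAt σ (leafIdx n j u)
      else edgeAt σ (leafIdx n i u)) ∧
    (∀ u < n, u ≠ i → u ≠ j → edgeAt τ (leafIdx n u i) =
      if u < k ∧ ¬ slack σ (leafIdx n u i) ≤ slack σ (leafIdx n u j) then edgeAt σ (leafIdx n u j)
      else edgeAt σ (leafIdx n u i)) ∧
    ∀ a b, a < n → b < n → a ≠ i → b ≠ i → edgeAt τ (leafIdx n a b) = edgeAt σ (leafIdx n a b))
    (by simp [edgeAt]) ?_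
  · obtain ⟨h1, h2, h3⟩ := key
    refine ⟨fun u hu hui huj => (h1 u hu hui huj).trans ?_,
      fun u hu hui huj => (h2 u hu hui huj).trans ?_, h3⟩
    · by_cases h : slack σ (leafIdx n i u) ≤ slack σ (leafIdx n j u) <;> simp [h, hu]
    · by_cases h : slack σ (leafIdx n u i) ≤ slack σ (leafIdx n u j) <;> simp [h, hu]
  · rintro k τ hk hv hag ⟨h1, h2, h3⟩
    have eP : τ.idx vP 0 = i := by rw [hag.idx vP (by decide), hi]
    have eQ : τ.idx vQ 0 = j := by rw [hag.idx vQ (by decide), hj]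
    have eR : τ.idx aRow = σ.idx aRow := hag.idx aRow (by decide)
    have eN : τ.idx 0 0 = n := by rw [hag.idx 0 (by decide), hn]
    have eW : τ.scal sWt = σ.scal sWt := hag.scal sWt (by decide)
    have eD : τ.scal sDual = σ.scal sDual := hag.scal sDual (by decide)
    have hrow' : ∀ i ≤ n, τ.idx aRow i = i * n := by rw [eR]; exact hrow
    have hS : ∀ l, edgeAt τ l = edgeAt σ l → slack τ l = slack σ l := fun l => slack_congr eW eD eR
    have hL : ∀ a b c d, b < n → d < n → (leafIdx n a b = leafIdx n c d ↔ a = c ∧ b = d) :=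
      fun a b c d hb hd => ⟨leafIdx_inj hb hd, by rintro ⟨rfl, rfl⟩; rfl⟩
    obtain ⟨ρ, hρ⟩ : ∃ ρ, ρ = (relax (leafOf (.var vP) (.var vU)) (leafOf (.var vQ) (.var vU))).den τ :=
      ⟨_, rfl⟩
    have hagρ : Agree [aBestI, aBestJ] [] τ ρ := by
      rw [hρ]; exact (agree_den _ τ).mono (by simp [relax, when, block, iw])
        (by simp [relax, when, block, sw])
    have hP : ∀ {ρ : Store}, Agree [aBestI, aBestJ] [] τ ρ → ρ.idx vP 0 = i ∧ ρ.idx vQ 0 = j ∧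
        ρ.idx vU 0 = k ∧ ρ.idx 0 0 = n ∧ ρ.idx aRow = τ.idx aRow := fun h =>
      ⟨by rw [h.idx vP (by decide), eP], by rw [h.idx vQ (by decide), eQ],
        by rw [h.idx vU (by decide), hv], by rw [h.idx 0 (by decide), eN], h.idx aRow (by decide)⟩
    obtain ⟨fP, fQ, fU, fN, fR⟩ := hP hagρ
    have hrow'' : ∀ i ≤ n, ρ.idx aRow i = i * n := by rw [fR]; exact hrow'
    have E1 : ∀ l, edgeAt ρ l = if l = leafIdx n i k ∧
        ¬ slack τ (leafIdx n i k) ≤ slack τ (leafIdx n j k) then edgeAt τ (leafIdx n j k)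
        else edgeAt τ l := by
      intro l
      rw [hρ, relax_den _ _ _ _ (by simp [leafOf]) (by simp [leafOf]),
        eval_leafOf eN hrow' (by simpa [eP] using hin), eval_leafOf eN hrow' (by simpa [eQ] using hjn)]
      simp [eP, eQ, hv]
    have E2 : ∀ l, edgeAt ((block [
        relax (leafOf (.var vP) (.var vU)) (leafOf (.var vQ) (.var vU)),
        relax (leafOf (.var vU) (.var vP)) (leafOf (.var vU) (.var vQ))]).den τ) l =
        if l = leafIdx n k i ∧
        ¬ slack ρ (leafIdx n k i) ≤ slack ρ (leafIdx n k j) then edgeAt ρ (leafIdx n k j)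
        else edgeAt ρ l := by
      intro l
      rw [den_block_cons, ← hρ, den_block_cons, den_block_nil,
        relax_den _ _ _ _ (by simp [leafOf]) (by simp [leafOf]),
        eval_leafOf fN hrow'' (by simpa [fU] using hk), eval_leafOf fN hrow'' (by simpa [fU] using hk)]
      simp [fP, fQ, fU]
    have hset : ∀ (τ : Store) x l, edgeAt (τ.setIdx vU 0 x) l = edgeAt τ l := by simp [edgeAt]
    refine ⟨fun u hu hui huj => ?_, fun u hu hui huj => ?_, fun a b ha hb hai hbi => ?_⟩
    · rw [hset, E2, if_neg (by rw [hL _ _ _ _ hu hin]; tauto), E1]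
      simp only [hL _ _ _ _ hu hk]
      by_cases huk : u = k
      · subst huk
        rw [hS _ (by simpa using h1 u hu hui huj), hS _ (h3 j u hjn hu hij.symm hui),
          h3 j u hjn hu hij.symm hui, h1 u hu hui huj]
        simp
      · rw [if_neg (by tauto), h1 u hu hui huj]
        simp [Nat.lt_succ_iff_lt_or_eq, huk, - Order.lt_add_one_iff]
    · by_cases huk : u = k
      · subst huk
        have e1 : edgeAt ρ (leafIdx n u i) = edgeAt τ (leafIdx n u i) := by
          rw [E1, if_neg (by rw [hL _ _ _ _ hin hu]; tauto)]
        have e2 : edgeAt ρ (leafIdx n u j) = edgeAt τ (leafIdx n u j) := by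
          rw [E1, if_neg (by rw [hL _ _ _ _ hjn hu]; tauto)]
        have e3 : edgeAt τ (leafIdx n u i) = edgeAt σ (leafIdx n u i) := by
          simpa using h2 u hu hui huj
        have e4 := h3 u j hu hjn hui hij.symm
        have gW : ρ.scal sWt = σ.scal sWt := by rw [hagρ.scal sWt (by decide), eW]
        have gD : ρ.scal sDual = σ.scal sDual := by rw [hagρ.scal sDual (by decide), eD]
        have gR : ρ.idx aRow = σ.idx aRow := by rw [fR, eR]
        rw [hset, E2, slack_congr gW gD gR (e1.trans e3), slack_congr gW gD gR (e2.trans e4), e1, e2,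
          e3, e4]
        simp
      · rw [hset, E2, if_neg (by rw [hL _ _ _ _ hin hin]; tauto), E1,
          if_neg (by rw [hL _ _ _ _ hin hk]; tauto), h2 u hu hui huj]
        simp [Nat.lt_succ_iff_lt_or_eq, huk, - Order.lt_add_one_iff]
    · rw [hset, E2, if_neg (by rw [hL _ _ _ _ hb hin]; tauto), E1,
        if_neg (by rw [hL _ _ _ _ hb hk]; tauto), h3 a b ha hb hai hbi]

end RAM

/-! ### The Goemans-Williamson algorithm on the machine -/

namespace RAM

open Code CycleCover

variable {n : ℕ}

theorem refreshAt_spec {σ : Store} (h : TreeInv n σ) (i j : IExpr) (hi : i.eval σ < n)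
    (hj : j.eval σ < n) (hj' : j.eval (σ.setIdx vI 0 (i.eval σ)) = j.eval σ) :
    TreeInv n ((refreshAt i j).den σ) ∧ LeafOK n ((refreshAt i j).den σ) (i.eval σ) (j.eval σ) ∧
      ∀ i' j', i' < n → j' < n → LeafOK n σ i' j' → LeafOK n ((refreshAt i j).den σ) i' j' := by
  set τ := (σ.setIdx vI 0 (i.eval σ)).setIdx vJ 0 (j.eval σ) with hτ
  have e : (refreshAt i j).den σ = refresh.den τ := by
    simp only [refreshAt, den_block_cons, den_block_nil, den_assign, hj', hτ]
  have hag : Agree [vI, vJ, aWin, vNode, vLeaf, vLevel, vU, vV, vK] [sKey] σ τ :=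
    (agree_setIdx (by decide) _ _ _).trans (agree_setIdx (by decide) _ _ _)
  have hw : τ.idx aWin = σ.idx aWin := by ext; simp [hτ]
  have hk : τ.scal sKey = σ.scal sKey := by ext; simp [hτ]
  obtain ⟨h1, h2, h3⟩ := refresh_spec (h.congr hag hw hk) (i := i.eval σ) (j := j.eval σ)
    (by simp [hτ]) (by simp [hτ]) hi hj
  rw [e]
  exact ⟨h1, h2, fun i' j' hi' hj' hl =>
    h3 i' j' hi' hj' (hl.congr hag (by rw [hw]) (by rw [hk]))⟩

theorem TreeInv.setVar {σ : Store} (h : TreeInv n σ) {v : ℕ}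
    (hv : v ∈ [vI, vJ, vNode, vLeaf, vLevel, vU, vV, vK]) (x : ℕ) : TreeInv n (σ.setIdx v 0 x) := by
  have hw : v ≠ aWin := by rintro rfl; revert hv; decide
  refine h.congr (agree_setIdx ?_ _ _ _) ?_ rfl
  · revert hv; simp only [List.mem_cons]; tauto
  · ext; simp [hw.symm]

theorem LeafOK.setVar {σ : Store} {i j : ℕ} (h : LeafOK n σ i j) {v : ℕ}
    (hv : v ∈ [vI, vJ, vNode, vLeaf, vLevel, vU, vV, vK]) (x : ℕ) :
    LeafOK n (σ.setIdx v 0 x) i j := by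
  have hw : v ≠ aWin := by rintro rfl; revert hv; decide
  refine h.congr (agree_setIdx ?_ _ _ _) ?_ rfl
  · revert hv; simp only [List.mem_cons]; tauto
  · simp [hw.symm]

/-- All leaves are up to date again, if this was so for the pairs not involving `i` or `j`. -/
theorem gwRefresh_spec {σ : Store} (h : TreeInv n σ) {i j : ℕ} (hi : σ.idx vP 0 = i)
    (hj : σ.idx vQ 0 = j) (hin : i < n) (hjn : j < n)
    (hl : ∀ a b, a < n → b < n → a ≠ i → a ≠ j → b ≠ i → b ≠ j → LeafOK n σ a b) :
    TreeInv n (gwRefresh.den σ) ∧ ∀ a b, a < n → b < n → LeafOK n (gwRefresh.den σ) a b := by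
  have key := forTo_n (v := vU) (c := block [refreshAt (.var vP) (.var vU),
    refreshAt (.var vU) (.var vP), refreshAt (.var vQ) (.var vU), refreshAt (.var vU) (.var vQ)])
    (by decide) h.n_eq
    (fun k τ => TreeInv n τ ∧ ∀ a b, a < n → b < n →
      (a ≠ i ∧ a ≠ j ∧ b ≠ i ∧ b ≠ j ∨ (a = i ∨ a = j) ∧ b < k ∨ (b = i ∨ b = j) ∧ a < k) →
      LeafOK n τ a b) ⟨h.setVar (by decide) _, fun a b ha hb hc => (hl a b ha hb (by tauto) (by tauto)
        (by tauto) (by tauto)).setVar (by decide) _⟩ ?_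
  · refine ⟨key.1, fun a b ha hb => key.2 a b ha hb ?_⟩
    tauto
  · rintro k τ hk hv hag ⟨h1, h2⟩
    have eP : τ.idx vP 0 = i := by rw [hag.idx vP (by decide), hi]
    have eQ : τ.idx vQ 0 = j := by rw [hag.idx vQ (by decide), hj]
    have frame : ∀ (a b : IExpr) (ρ : Store), (ρ.idx vP 0 = i ∧ ρ.idx vQ 0 = j ∧ ρ.idx vU 0 = k) →
        ((refreshAt a b).den ρ).idx vP 0 = i ∧ ((refreshAt a b).den ρ).idx vQ 0 = j ∧
          ((refreshAt a b).den ρ).idx vU 0 = k := by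
      intro a b ρ hρ
      have := agree_den (refreshAt a b) ρ
      rw [this.idx vP (by change vP ∉ (refreshAt 0 0).iw; decide),
        this.idx vQ (by change vQ ∉ (refreshAt 0 0).iw; decide),
        this.idx vU (by change vU ∉ (refreshAt 0 0).iw; decide)]
      exact hρ
    simp only [den_block_cons, den_block_nil]
    have f0 : τ.idx vP 0 = i ∧ τ.idx vQ 0 = j ∧ τ.idx vU 0 = k := ⟨eP, eQ, hv⟩
    obtain ⟨t1, l1, p1⟩ := refreshAt_spec h1 (.var vP) (.var vU) (by simpa [f0] using hin)
      (by simpa [f0] using hk) (by simp)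
    simp only [IExpr.eval_var, f0] at l1
    have f1 := frame (.var vP) (.var vU) τ f0
    generalize (refreshAt (.var vP) (.var vU)).den τ = ρ1 at *
    obtain ⟨t2, l2, p2⟩ := refreshAt_spec t1 (.var vU) (.var vP) (by simpa [f1] using hk)
      (by simpa [f1] using hin) (by simp)
    simp only [IExpr.eval_var, f1] at l2
    have f2 := frame (.var vU) (.var vP) ρ1 f1
    generalize (refreshAt (.var vU) (.var vP)).den ρ1 = ρ2 at *
    obtain ⟨t3, l3, p3⟩ := refreshAt_spec t2 (.var vQ) (.var vU) (by simpa [f2] using hjn)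
      (by simpa [f2] using hk) (by simp)
    simp only [IExpr.eval_var, f2] at l3
    have f3 := frame (.var vQ) (.var vU) ρ2 f2
    generalize (refreshAt (.var vQ) (.var vU)).den ρ2 = ρ3 at *
    obtain ⟨t4, l4, p4⟩ := refreshAt_spec t3 (.var vU) (.var vQ) (by simpa [f3] using hk)
      (by simpa [f3] using hjn) (by simp)
    simp only [IExpr.eval_var, f3] at l4
    refine ⟨t4.setVar (by decide) _, fun a b ha hb hc => LeafOK.setVar ?_ (by decide) _⟩
    by_cases hold : (a ≠ i ∧ a ≠ j ∧ b ≠ i ∧ b ≠ j ∨ (a = i ∨ a = j) ∧ b < k ∨ (b = i ∨ b = j) ∧ a < k)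
    · exact p4 a b ha hb (p3 a b ha hb (p2 a b ha hb (p1 a b ha hb (h2 a b ha hb hold))))
    · have hkey : ∀ x, x < k + 1 → ¬ x < k → x = k := fun x h1 h2 => by omega
      rcases hc with hc | ⟨rfl | rfl, hlt⟩ | ⟨rfl | rfl, hlt⟩
      · exact absurd (Or.inl hc) hold
      · obtain rfl := hkey b hlt fun h' => hold (Or.inr (Or.inl ⟨Or.inl rfl, h'⟩))
        exact p4 _ _ ha hb (p3 _ _ ha hb (p2 _ _ ha hb l1))
      · obtain rfl := hkey b hlt fun h' => hold (Or.inr (Or.inl ⟨Or.inr rfl, h'⟩))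
        exact p4 _ _ ha hb l3
      · obtain rfl := hkey a hlt fun h' => hold (Or.inr (Or.inr ⟨Or.inl rfl, h'⟩))
        exact p4 _ _ ha hb (p3 _ _ ha hb l2)
      · obtain rfl := hkey a hlt fun h' => hold (Or.inr (Or.inr ⟨Or.inr rfl, h'⟩))
        exact l4

/-- The length of the edge `{u, v}` that is not yet covered by dual values. -/
def uncovered (w : Sym2 (Fin n) → ℕ) (σ : Store) (u v : Fin n) : ℚ :=
  w s(u, v) - σ.scal sDual u - σ.scal sDual v

/-- The machine represents the state `s` of the Goemans-Williamson algorithm. For any two labels of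
distinct components it stores a shortest edge between them. -/
structure GWCore (L : Set ℕ) (w : Sym2 (Fin n) → ℕ) (σ : Store) (s : GWState (Fin n)) : Prop where
  static : Static L w σ
  lab_lt : ∀ v < n, σ.idx aLab v < n
  lab_lab : ∀ v < n, σ.idx aLab (σ.idx aLab v) = σ.idx aLab v
  comps : s.comps = Finset.univ.image fun v : Fin n => cls σ (σ.idx aLab v)
  size : ∀ v < n, σ.idx aLab v = v → σ.idx aSize v = (cls (n := n) σ v).card
  dual : ∀ v : Fin n, σ.scal sDual v = s.d v
  list : ListsForest σ s.forest
  best : ∀ i < n, ∀ j < n, σ.idx aLab i = i → σ.idx aLab j = j → i ≠ j → ∃ u v : Fin n,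
    edgeAt σ (leafIdx n i j) = ((u : ℕ), (v : ℕ)) ∧ IsBest (uncovered w σ) (cls σ i) (cls σ j) u v
  leaf : ∀ i < n, ∀ j < n, σ.idx aLeafI (leafIdx n i j) = i ∧ σ.idx aLeafJ (leafIdx n i j) = j
  reach : Relation.ReflTransGen (GWStep w (properFun L)) GWState.init s

/-- In addition, the tournament tree is up to date. -/
structure GWInv (L : Set ℕ) (w : Sym2 (Fin n) → ℕ) (σ : Store) (s : GWState (Fin n)) : Prop
    extends GWCore L w σ s where
  tree : TreeInv n σ
  leafOK : ∀ i j, i < n → j < n → LeafOK n σ i j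

section
variable {L : Set ℕ} {w : Sym2 (Fin n) → ℕ} {σ : Store} {s : GWState (Fin n)}

theorem Static.properFun_cls (h : Static L w σ) {r m : ℕ} (hm : m = (cls (n := n) σ r).card) :
    properFun L (cls (n := n) σ r) = σ.idx aIndiv m := by
  have hle : m ≤ n := by
    rw [hm]; exact (Finset.card_le_univ _).trans (by simp)
  unfold properFun
  rw [← hm]
  split_ifs with hd
  · exact (h.indiv_dvd m hle hd).symm
  · exact (h.indiv_not_dvd m hle hd).symm

theorem GWCore.rate_eq (h : GWCore L w σ s) {i j : ℕ} (hi : i < n) (hj : j < n)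
    (hli : σ.idx aLab i = i) (hlj : σ.idx aLab j = j) :
    rate σ i j = properFun L (cls (n := n) σ i) + properFun L (cls (n := n) σ j) := by
  rw [h.static.properFun_cls (h.size i hi hli), h.static.properFun_cls (h.size j hj hlj)]
  rfl

theorem Static.slack_eq (h : Static L w σ) {l : ℕ} {u v : Fin n}
    (he : edgeAt σ l = ((u : ℕ), (v : ℕ))) (huv : u ≠ v) : slack σ l = uncovered w σ u v := by
  simp only [edgeAt, Prod.mk.injEq] at he
  unfold slack uncovered
  rw [he.1, he.2, h.row u u.2.le, h.wt u v huv]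

theorem GWCore.cls_mem_comps (h : GWCore L w σ s) {i : ℕ} (hi : i < n) (hli : σ.idx aLab i = i) :
    cls σ i ∈ s.comps := by
  rw [h.comps, Finset.mem_image]
  exact ⟨⟨i, hi⟩, Finset.mem_univ _, by simp [hli]⟩

theorem GWCore.exists_of_mem_comps (h : GWCore L w σ s) {C : Finset (Fin n)} (hC : C ∈ s.comps) :
    ∃ i < n, σ.idx aLab i = i ∧ C = cls σ i := by
  rw [h.comps, Finset.mem_image] at hC
  obtain ⟨v, -, rfl⟩ := hC
  exact ⟨_, h.lab_lt v v.2, h.lab_lab v v.2, rfl⟩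

theorem cls_inj {i j : ℕ} (hi : i < n) (hli : σ.idx aLab i = i)
    (h : cls (n := n) σ i = cls σ j) : i = j := by
  have : (⟨i, hi⟩ : Fin n) ∈ cls σ j := h ▸ (mem_cls.2 hli)
  rw [mem_cls, hli] at this
  exact this

/-- The winner of the tournament corresponds to the edge that becomes tight first. -/
theorem GWInv.winner (h : GWInv L w σ s) (hn : 0 < n) (hwin : σ.idx aWin 1 ≠ 0) :
    ∃ i j : ℕ, i < n ∧ j < n ∧ σ.idx aWin 1 = leafIdx n i j ∧ IsCompPair σ i j ∧
      ∃ u v : Fin n, edgeAt σ (leafIdx n i j) = ((u : ℕ), (v : ℕ)) ∧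
      IsBest (uncovered w σ) (cls σ i) (cls σ j) u v ∧
      GWCandidate w (properFun L) s (cls σ i) (cls σ j) u v
        (σ.scal sKey (leafIdx n i j) - σ.scal sTime 0) ∧
      ∀ P' Q' i' j' ε', GWCandidate w (properFun L) s P' Q' i' j' ε' →
        σ.scal sKey (leafIdx n i j) - σ.scal sTime 0 ≤ ε' := by
  have pair : ∀ i j, i < n → j < n → IsCompPair σ i j → ∃ u v : Fin n,
      edgeAt σ (leafIdx n i j) = ((u : ℕ), (v : ℕ)) ∧
      IsBest (uncovered w σ) (cls σ i) (cls σ j) u v ∧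
      σ.scal sKey (leafIdx n i j) - σ.scal sTime 0 = uncovered w σ u v / rate σ i j := by
    intro i j hi hj hp
    obtain ⟨u, v, he, hb⟩ := h.best i hi j hj hp.1 hp.2.1 hp.2.2.1
    have huv : u ≠ v := by
      rintro rfl
      have h1 := mem_cls.1 hb.1
      have h2 := mem_cls.1 hb.2.1
      exact hp.2.2.1 (h1.symm.trans h2)
    refine ⟨u, v, he, hb, ?_⟩
    rw [((h.leafOK i j hi hj).1 hp).2, h.static.slack_eq he huv]
    ring
  have hnn : 1 ≤ n * n := Nat.mul_pos hn hn
  rcases exists_leaf_of_matchOK h.tree.matchOK h.tree.leaf 1 le_rfl (by omega) with h0 |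
    ⟨hl1, hl2, hl3, -⟩
  · exact absurd h0 hwin
  set l := σ.idx aWin 1 with hl
  obtain ⟨i, j, hi, hj, hlij⟩ : ∃ i j, i < n ∧ j < n ∧ l = leafIdx n i j := by
    refine ⟨(l - n * n) / n, (l - n * n) % n, Nat.div_lt_of_lt_mul (by omega), Nat.mod_lt _ hn, ?_⟩
    unfold leafIdx
    rw [Nat.div_add_mod']
    omega
  have hp : IsCompPair σ i j := by
    by_contra hp
    have := (h.leafOK i j hi hj).2 hp
    rw [← hlij] at this
    omega
  obtain ⟨u, v, he, hb, hε⟩ := pair i j hi hj hp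
  refine ⟨i, j, hi, hj, hlij, hp, u, v, he, hb, ?_, ?_⟩
  · have hr := h.rate_eq hi hj hp.1 hp.2.1
    refine ⟨h.cls_mem_comps hi hp.1, h.cls_mem_comps hj hp.2.1,
      fun hc => hp.2.2.1 (cls_inj hi hp.1 hc), hb.1, hb.2.1, ?_, ?_⟩
    · have := hp.2.2.2
      omega
    · rw [hε, hr, uncovered, h.dual, h.dual]
      push_cast
      rfl
  · rintro P' Q' i' j' ε' ⟨hP', hQ', hne, hi', hj', hf, rfl⟩
    obtain ⟨a, ha, hla, rfl⟩ := h.exists_of_mem_comps hP'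
    obtain ⟨b, hb', hlb, rfl⟩ := h.exists_of_mem_comps hQ'
    have hr := h.rate_eq ha hb' hla hlb
    have hp' : IsCompPair σ a b := ⟨hla, hlb, fun hc => hne (by rw [hc]), by omega⟩
    obtain ⟨u', v', he', hbest', hε'⟩ := pair a b ha hb' hp'
    have hwl := ((h.leafOK a b ha hb').1 hp').1
    obtain ⟨k1, k2⟩ := leafIdx_lt ha hb'
    obtain ⟨-, hk⟩ := winner_le h.tree.matchOK (leafIdx n a b) (by omega) k2 (by omega)
    rw [hwl, ← hl, hlij] at hk
    have h1 : σ.scal sKey (leafIdx n i j) - σ.scal sTime 0 ≤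
        σ.scal sKey (leafIdx n a b) - σ.scal sTime 0 := by linarith
    refine h1.trans ?_
    rw [hε', hr, ← h.dual, ← h.dual]
    push_cast
    have h2 := hbest'.2.2 i' hi' j' hj'
    exact div_le_div_of_nonneg_right h2 (by positivity)

end
end RAM

namespace RAM

open Code CycleCover

variable {n : ℕ}

theorem gwSelect_spec (σ : Store) {l i j : ℕ} (hl : σ.idx aWin 1 = l) (hi : σ.idx aLeafI l = i)
    (hj : σ.idx aLeafJ l = j) :
    (gwSelect.den σ).idx vP 0 = i ∧ (gwSelect.den σ).idx vQ 0 = j ∧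
    (gwSelect.den σ).scal sEps 0 = σ.scal sKey l - σ.scal sTime 0 ∧
    (gwSelect.den σ).idx vM 0 = σ.idx vM 0 + 1 ∧
    (∀ k, (gwSelect.den σ).idx aEdgeI k =
      if k = σ.idx vM 0 then σ.idx aBestI l else σ.idx aEdgeI k) ∧
    ∀ k, (gwSelect.den σ).idx aEdgeJ k =
      if k = σ.idx vM 0 then σ.idx aBestJ l else σ.idx aEdgeJ k := by
  refine ⟨?_, ?_, ?_, ?_, ?_, ?_⟩ <;> simp [gwSelect, hl, hi, hj]

theorem GWCore.congr {L : Set ℕ} {w : Sym2 (Fin n) → ℕ} {σ τ : Store} {s : GWState (Fin n)}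
    (h : GWCore L w σ s)
    (hag : Agree [vI, vJ, aWin, vNode, vLeaf, vLevel, vU, vV, vK] [sKey] σ τ) :
    GWCore L w τ s := by
  have hlab := hag.idx aLab (by decide)
  have hc : ∀ r, cls (n := n) τ r = cls σ r := fun r => by simp [cls, hlab]
  have hd := hag.scal sDual (by decide)
  have he : ∀ l, edgeAt τ l = edgeAt σ l := fun l => by
    simp [edgeAt, hag.idx aBestI (by decide), hag.idx aBestJ (by decide)]
  have hu : uncovered w τ = uncovered w σ := by
    ext; simp [uncovered, hd]
  constructor
  · exact h.static.congr hag (by decide) (by decide)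
  · rw [hlab]; exact h.lab_lt
  · rw [hlab]; exact h.lab_lab
  · simp only [hlab, hc]; exact h.comps
  · rw [hlab, hag.idx aSize (by decide)]; simp only [hc]; exact h.size
  · rw [hd]; exact h.dual
  · exact h.list.congr (hag.idx vM (by decide)) (hag.idx aEdgeI (by decide))
      (hag.idx aEdgeJ (by decide))
  · rw [hlab, hu]; simp only [hc, he]; exact h.best
  · rw [hag.idx aLeafI (by decide), hag.idx aLeafJ (by decide)]; exact h.leaf
  · exact h.reach

/-- The part of an iteration before the tournament tree is updated. -/
def gwMerge : Code := block [gwSelect, gwRaise, sstore sTime 0 (.load sTime 0 + .load sEps 0), gwRelax,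
    istore aSize (.var vP) (.load aSize (.var vP) + .load aSize (.var vQ)), gwRelabel]

theorem gwStep_den (σ : Store) : gwStep.den σ = gwRefresh.den (gwMerge.den σ) := by
  simp only [gwStep, gwMerge, den_block_cons, den_block_nil]

/-- The effect of uniting the components with the labels `i` and `j` on the store. -/
structure Merged (n : ℕ) (σ τ : Store) (i j l : ℕ) : Prop where
  agree : Agree gwMerge.iw gwMerge.sw σ τ
  vP_eq : τ.idx vP 0 = i
  vQ_eq : τ.idx vQ 0 = j
  lab : ∀ x < n, τ.idx aLab x = if σ.idx aLab x = j then i else σ.idx aLab x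
  size : ∀ r, τ.idx aSize r = if r = i then σ.idx aSize i + σ.idx aSize j else σ.idx aSize r
  dual : ∀ x < n, τ.scal sDual x = if 1 ≤ σ.idx aIndiv (σ.idx aSize (σ.idx aLab x)) then
    σ.scal sDual x + (σ.scal sKey l - σ.scal sTime 0) else σ.scal sDual x
  time : τ.scal sTime 0 = σ.scal sTime 0 + (σ.scal sKey l - σ.scal sTime 0)
  m_eq : τ.idx vM 0 = σ.idx vM 0 + 1
  edgeI : ∀ k, τ.idx aEdgeI k = if k = σ.idx vM 0 then σ.idx aBestI l else σ.idx aEdgeI k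
  edgeJ : ∀ k, τ.idx aEdgeJ k = if k = σ.idx vM 0 then σ.idx aBestJ l else σ.idx aEdgeJ k
  /-- The stored edges are compared after the duals have been raised. -/
  relax : ∃ ρ : Store, ρ.scal sWt = σ.scal sWt ∧ ρ.scal sDual = τ.scal sDual ∧
    ρ.idx aRow = σ.idx aRow ∧ (∀ m, edgeAt ρ m = edgeAt σ m) ∧
    (∀ u < n, u ≠ i → u ≠ j → edgeAt τ (leafIdx n i u) =
      if slack ρ (leafIdx n i u) ≤ slack ρ (leafIdx n j u) then edgeAt σ (leafIdx n i u)
      else edgeAt σ (leafIdx n j u)) ∧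
    (∀ u < n, u ≠ i → u ≠ j → edgeAt τ (leafIdx n u i) =
      if slack ρ (leafIdx n u i) ≤ slack ρ (leafIdx n u j) then edgeAt σ (leafIdx n u i)
      else edgeAt σ (leafIdx n u j)) ∧
    ∀ a b, a < n → b < n → a ≠ i → b ≠ i → edgeAt τ (leafIdx n a b) = edgeAt σ (leafIdx n a b)

theorem gwMerge_spec {σ : Store} {i j l : ℕ} (hn : σ.idx 0 0 = n)
    (hrow : ∀ i ≤ n, σ.idx aRow i = i * n) (hl : σ.idx aWin 1 = l) (hi : σ.idx aLeafI l = i)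
    (hj : σ.idx aLeafJ l = j) (hin : i < n) (hjn : j < n) (hij : i ≠ j) :
    Merged n σ (gwMerge.den σ) i j l := by
  obtain ⟨s1, s2, s3, s4, s5, s6⟩ := gwSelect_spec σ hl hi hj
  have a1 := agree_den gwSelect σ
  have hfin : gwMerge.den σ = gwRelabel.den ((istore aSize (.var vP)
      (.load aSize (.var vP) + .load aSize (.var vQ))).den (gwRelax.den
      ((sstore sTime 0 (.load sTime 0 + .load sEps 0)).den (gwRaise.den (gwSelect.den σ))))) := by
    simp only [gwMerge, den_block_cons, den_block_nil]
  have hag := agree_den gwMerge σ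
  generalize gwMerge.den σ = τ at *
  generalize gwSelect.den σ = σ1 at *
  have n1 : σ1.idx 0 0 = n := by rw [a1.idx 0 (by decide), hn]
  have h2 := gwRaise_spec n1
  have a2 := agree_den gwRaise σ1
  generalize gwRaise.den σ1 = σ2 at *
  have a3 := agree_den (sstore sTime 0 (.load sTime 0 + .load sEps 0)) σ2
  have h3 : ((sstore sTime 0 (.load sTime 0 + .load sEps 0)).den σ2).scal sTime 0 =
      σ2.scal sTime 0 + σ2.scal sEps 0 := by simp
  generalize (sstore sTime 0 (.load sTime 0 + .load sEps 0)).den σ2 = σ3 at *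
  have a13 : Agree (gwSelect.iw ++ gwRaise.iw) (gwSelect.sw ++ gwRaise.sw ++ [sTime]) σ σ3 :=
    ((a1.mono (by simp) (by simp)).trans (a2.mono (by simp) (by simp))).trans
      (a3.mono (by simp [iw]) (by simp [sw]))
  have n3 : σ3.idx 0 0 = n := by rw [a13.idx 0 (by decide), hn]
  have r3 : σ3.idx aRow = σ.idx aRow := a13.idx aRow (by decide)
  have p3 : σ3.idx vP 0 = i := by rw [a3.idx vP (by decide), a2.idx vP (by decide), s1]
  have q3 : σ3.idx vQ 0 = j := by rw [a3.idx vQ (by decide), a2.idx vQ (by decide), s2]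
  have h4 := gwRelax_spec n3 (by rw [r3]; exact hrow) p3 q3 hin hjn hij
  have a4 := agree_den gwRelax σ3
  generalize gwRelax.den σ3 = σ4 at *
  have p4 : σ4.idx vP 0 = i := by rw [a4.idx vP (by decide), p3]
  have q4 : σ4.idx vQ 0 = j := by rw [a4.idx vQ (by decide), q3]
  have a5 := agree_den (istore aSize (.var vP) (.load aSize (.var vP) + .load aSize (.var vQ))) σ4
  have h5 : ∀ r, ((istore aSize (.var vP) (.load aSize (.var vP) + .load aSize (.var vQ))).den
      σ4).idx aSize r = if r = i then σ4.idx aSize i + σ4.idx aSize j else σ4.idx aSize r := by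
    simp [p4, q4]
  generalize (istore aSize (.var vP) (.load aSize (.var vP) + .load aSize (.var vQ))).den σ4 = σ5 at *
  have a45 : Agree (gwRelax.iw ++ [aSize]) [] σ3 σ5 :=
    (a4.mono (by simp) (by decide)).trans (a5.mono (by simp [iw]) (by decide))
  have n5 : σ5.idx 0 0 = n := by rw [a45.idx 0 (by decide), n3]
  have h6 := gwRelabel_spec n5
  have a6 := agree_den gwRelabel σ5
  rw [← hfin] at h6 a6
  have a46 : Agree (gwRelax.iw ++ [aSize] ++ gwRelabel.iw) [] σ3 τ :=
    (a45.mono (by simp) (by decide)).trans (a6.mono (by simp) (by decide))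
  have l5 : σ5.idx aLab = σ.idx aLab := by
    rw [a45.idx aLab (by decide), a13.idx aLab (by decide)]
  have z4 : σ4.idx aSize = σ.idx aSize := by
    rw [a4.idx aSize (by decide), a13.idx aSize (by decide)]
  have e3 : ∀ m, edgeAt σ3 m = edgeAt σ m := fun m => by
    simp only [edgeAt, a13.idx aBestI (by decide), a13.idx aBestJ (by decide)]
  have e6 : ∀ m, edgeAt τ m = edgeAt σ4 m := fun m => by
    simp only [edgeAt, a6.idx aBestI (by decide), a6.idx aBestJ (by decide),
      a5.idx aBestI (by decide), a5.idx aBestJ (by decide)]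
  refine ⟨hag, ?_, ?_, ?_, ?_, ?_, ?_, ?_, ?_, ?_, σ3, ?_, ?_, r3, e3, ?_, ?_, ?_⟩
  · rw [a46.idx vP (by decide), p3]
  · rw [a46.idx vQ (by decide), q3]
  · intro x hx
    rw [h6, if_pos hx, l5, a45.idx vP (by decide), p3, a45.idx vQ (by decide), q3]
  · intro r
    rw [a6.idx aSize (by decide), h5, z4]
  · intro x hx
    rw [a46.scal sDual (by decide), a3.scal sDual (by decide), h2, if_pos hx,
      a1.idx aIndiv (by decide), a1.idx aSize (by decide), a1.idx aLab (by decide),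
      a1.scal sDual (by decide), s3]
  · rw [a46.scal sTime (by decide), h3, a2.scal sTime (by decide), a2.scal sEps (by decide), s3,
      a1.scal sTime (by decide)]
  · rw [a46.idx vM (by decide), a3.idx vM (by decide), a2.idx vM (by decide), s4]
  · intro k
    rw [a46.idx aEdgeI (by decide), a3.idx aEdgeI (by decide), a2.idx aEdgeI (by decide), s5]
  · intro k
    rw [a46.idx aEdgeJ (by decide), a3.idx aEdgeJ (by decide), a2.idx aEdgeJ (by decide), s6]
  · exact a13.scal sWt (by decide)
  · exact (a46.scal sDual (by decide)).symm
  · intro u hu hui huj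
    rw [e6, h4.1 u hu hui huj, e3, e3]
  · intro u hu hui huj
    rw [e6, h4.2.1 u hu hui huj, e3, e3]
  · intro a b ha hb hai hbi
    rw [e6, h4.2.2 a b ha hb hai hbi, e3]

section
variable {L : Set ℕ} {w : Sym2 (Fin n) → ℕ} {σ : Store} {s : GWState (Fin n)}

/-- One iteration on the machine is one iteration of the algorithm. -/
theorem GWInv.step (h : GWInv L w σ s) (hn : 0 < n) (hwin : σ.idx aWin 1 ≠ 0) :
    ∃ s', GWInv L w (gwStep.den σ) s' ∧ s'.forest.card = s.forest.card + 1 := by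
  obtain ⟨i, j, hi, hj, hl, hp, u, v, he, hb, hcand, hleast⟩ := h.winner hn hwin
  set l := leafIdx n i j with hldef
  obtain ⟨hli, hlj, hij, hrate⟩ := hp
  obtain ⟨lI, lJ⟩ := h.leaf i hi j hj
  have hm := gwMerge_spec h.static.n_eq h.static.row hl lI lJ hi hj hij
  have hst := h.static.congr hm.agree (by decide) (by decide)
  rw [gwStep_den]
  generalize gwMerge.den σ = τ at *
  set ε := σ.scal sKey l - σ.scal sTime 0 with hε
  -- labels and components after the union
  have hrep : ∀ a < n, (τ.idx aLab a = a ↔ σ.idx aLab a = a ∧ a ≠ j) := by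
    intro a ha
    rw [hm.lab a ha]
    split_ifs with hc
    · constructor
      · rintro rfl
        exact absurd (hli.symm.trans hc) hij
      · rintro ⟨h1, h2⟩
        exact absurd (h1.symm.trans hc) h2
    · constructor
      · intro h1
        exact ⟨h1, fun h2 => hc (by rw [h2, hlj])⟩
      · exact fun h1 => h1.1
  have hclsi : cls (n := n) τ i = cls σ i ∪ cls σ j := by
    ext x
    simp only [mem_cls, Finset.mem_union, hm.lab x x.2]
    split_ifs with hc
    · simp [hc]
    · simp [hc]
  have hcls : ∀ a, a ≠ i → a ≠ j → cls (n := n) τ a = cls σ a := by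
    intro a hai haj
    ext x
    simp only [mem_cls, hm.lab x x.2]
    split_ifs with hc
    · rw [hc]
      exact iff_of_false (fun h => hai h.symm) (fun h => haj h.symm)
    · rfl
  have hf : ∀ a < n, σ.idx aLab a = a →
      properFun L (cls (n := n) σ a) = σ.idx aIndiv (σ.idx aSize a) := fun a ha hla =>
    h.static.properFun_cls (h.size a ha hla)
  have hf1 : ∀ S : Finset (Fin n), properFun L S ≤ 1 := by
    intro S; unfold properFun; split_ifs <;> omega
  -- the new dual values
  have hdual : ∀ x : Fin n, τ.scal sDual x =
      σ.scal sDual x + ε * (properFun L (cls (n := n) σ (σ.idx aLab x)) : ℕ) := by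
    intro x
    have hx := h.lab_lt x x.2
    rw [hm.dual x x.2, hf _ hx (h.lab_lab x x.2)]
    have := hf1 (cls (n := n) σ (σ.idx aLab x))
    rw [hf _ hx (h.lab_lab x x.2)] at this
    split_ifs with hc
    · rw [le_antisymm this hc]; simp [hε]
    · rw [Nat.lt_one_iff.1 (not_le.1 hc)]; simp
  have hunc : ∀ a b (x y : Fin n), x ∈ cls (n := n) σ a → y ∈ cls (n := n) σ b →
      uncovered w τ x y = uncovered w σ x y -
        ε * ((properFun L (cls (n := n) σ a) : ℕ) + (properFun L (cls (n := n) σ b) : ℕ)) := by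
    intro a b x y hx hy
    rw [mem_cls] at hx hy
    unfold uncovered
    rw [hdual x, hdual y, hx, hy]
    ring
  -- the stored edges are still the best ones for the old components
  have hbest : ∀ a < n, ∀ b < n, σ.idx aLab a = a → σ.idx aLab b = b → a ≠ b → ∃ x y : Fin n,
      edgeAt σ (leafIdx n a b) = ((x : ℕ), (y : ℕ)) ∧ x ≠ y ∧
      IsBest (uncovered w τ) (cls σ a) (cls σ b) x y := by
    intro a ha b hb hla hlb hab
    obtain ⟨x, y, h1, h2, h3, h4⟩ := h.best a ha b hb hla hlb hab
    refine ⟨x, y, h1, ?_, h2, h3, fun x' hx' y' hy' => ?_⟩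
    · rintro rfl
      exact hab ((mem_cls.1 h2).symm.trans (mem_cls.1 h3))
    · rw [hunc a b x y h2 h3, hunc a b x' y' hx' hy']
      have := h4 x' hx' y' hy'
      linarith
  obtain ⟨ρ, ρW, ρD, ρR, ρE, hr1, hr2, hr3⟩ := hm.relax
  have hslack : ∀ a (x y : Fin n), edgeAt σ a = ((x : ℕ), (y : ℕ)) → x ≠ y →
      slack ρ a = uncovered w τ x y := by
    intro a x y hxy hne
    rw [← ρE, edgeAt, Prod.mk.injEq] at hxy
    unfold slack uncovered
    rw [hxy.1, hxy.2, ρW, ρD, ρR, h.static.row x x.2.le, h.static.wt x y hne]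
  obtain ⟨hPm, hQm, hPQ, huP, hvQ, hff, hεeq⟩ := hcand
  set s' : GWState (Fin n) :=
    { forest := insert s(u, v) s.forest
      comps := insert (cls σ i ∪ cls σ j) ((s.comps.erase (cls σ i)).erase (cls σ j))
      d := fun x => τ.scal sDual x } with hs'
  have hgw : GWStep w (properFun L) s s' := by
    refine GWStep.grow s _ _ u v ε _ ?_ ⟨hPm, hQm, hPQ, huP, hvQ, hff, hεeq⟩ hleast ?_
    · have h1 := hf1 (cls σ i)
      have h2 := hf1 (cls σ j)
      by_cases h0 : properFun L (cls (n := n) σ i) = 0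
      · exact ⟨_, hQm, by omega⟩
      · exact ⟨_, hPm, by omega⟩
    · intro R hR x hx
      obtain ⟨a, ha, hla, rfl⟩ := h.exists_of_mem_comps hR
      simp only [hdual x, mem_cls.1 hx, h.dual x]
  have hnew : s(u, v) ∉ s.forest := by
    intro hmem
    have hfs := isForestState_of_reachable h.reach
    have hreach : (edgeGraph s.forest).Reachable u v :=
      (SimpleGraph.Adj.reachable (by
        rw [edgeGraph_adj]
        exact ⟨hmem, fun huv => hPQ (by
          rw [mem_cls] at huP hvQ
          rw [huv] at huP
          rw [← huP, hvQ])⟩))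
    rw [h.comps] at *
    have hcu : cls σ i = component s.forest u := by
      have : cls σ i ∈ components s.forest := by rw [← hfs.comps_eq, h.comps]; exact hPm
      exact eq_component_of_mem this huP
    have hcv : cls σ j = component s.forest v := by
      have : cls σ j ∈ components s.forest := by rw [← hfs.comps_eq, h.comps]; exact hQm
      exact eq_component_of_mem this hvQ
    exact hPQ (by rw [hcu, hcv, component_eq_iff]; exact hreach)
  have hcore : GWCore L w τ s' := by
    constructor
    · exact hst
    · intro x hx
      rw [hm.lab x hx]
      split_ifs
      · exact hi
      · exact h.lab_lt x hx
    · intro x hx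
      have hx' := h.lab_lt x hx
      rw [hm.lab x hx]
      split_ifs with hc
      · rw [hm.lab i hi, hli, if_neg hij]
      · rw [hm.lab _ hx', h.lab_lab x hx, if_neg hc]
    · ext C
      simp only [hs', Finset.mem_insert, Finset.mem_erase, Finset.mem_image, Finset.mem_univ,
        true_and]
      constructor
      · rintro (rfl | ⟨hCj, hCi, hC⟩)
        · exact ⟨⟨i, hi⟩, by simp only [hm.lab i hi, hli, if_neg hij, hclsi]⟩
        · obtain ⟨a, ha, hla, rfl⟩ := h.exists_of_mem_comps hC
          have hai : a ≠ i := by rintro rfl; exact hCi rfl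
          have haj : a ≠ j := by rintro rfl; exact hCj rfl
          exact ⟨⟨a, ha⟩, by simp only [hm.lab a ha, hla, if_neg haj, hcls a hai haj]⟩
      · rintro ⟨x, rfl⟩
        have hx := h.lab_lt x x.2
        have hlx := h.lab_lab x x.2
        rw [hm.lab x x.2]
        split_ifs with hc
        · exact Or.inl hclsi
        · by_cases hc' : σ.idx aLab x = i
          · rw [hc']
            exact Or.inl hclsi
          · refine Or.inr ⟨?_, ?_, ?_⟩
            · rw [hcls _ hc' hc]
              exact fun he => hc (cls_inj hx hlx he)
            · rw [hcls _ hc' hc]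
              exact fun he => hc' (cls_inj hx hlx he)
            · rw [hcls _ hc' hc]
              exact h.cls_mem_comps hx hlx
    · intro x hx hlx
      obtain ⟨hlx', hxj⟩ := (hrep x hx).1 hlx
      rw [hm.size]
      split_ifs with hxi
      · rw [hxi, hclsi, Finset.card_union_of_disjoint, ← h.size i hi hli, ← h.size j hj hlj]
        rw [Finset.disjoint_left]
        intro y hy hy'
        exact hij ((mem_cls.1 hy).symm.trans (mem_cls.1 hy'))
      · rw [hcls x hxi hxj]
        exact h.size x hx hlx'
    · exact fun _ => rfl
    · refine h.list.append u v hnew hm.m_eq ?_ ?_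
      · intro k
        rw [hm.edgeI]
        simp only [edgeAt, Prod.mk.injEq] at he
        rw [he.1]
      · intro k
        rw [hm.edgeJ]
        simp only [edgeAt, Prod.mk.injEq] at he
        rw [he.2]
    · intro a ha b hb' hla hlb hab
      obtain ⟨hla', haj⟩ := (hrep a ha).1 hla
      obtain ⟨hlb', hbj⟩ := (hrep b hb').1 hlb
      by_cases hai : a = i
      · subst hai
        obtain ⟨x, y, hx1, hx2, hx3⟩ := hbest a hi b hb' hla' hlb' hab
        obtain ⟨x', y', hx1', hx2', hx3'⟩ := hbest j hj b hb' hlj hlb' hbj.symm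
        have hu := hx3.union_left hx3'
        rw [hr1 b hb' hab.symm hbj, hslack _ x y hx1 hx2, hslack _ x' y' hx1' hx2', hclsi,
          hcls b hab.symm hbj]
        split_ifs with hc
        · exact ⟨x, y, hx1, hu.1 hc⟩
        · exact ⟨x', y', hx1', hu.2 hc⟩
      · by_cases hbi : b = i
        · subst hbi
          obtain ⟨x, y, hx1, hx2, hx3⟩ := hbest a ha b hi hla' hlb' hab
          obtain ⟨x', y', hx1', hx2', hx3'⟩ := hbest a ha j hj hla' hlj haj
          have hu := hx3.union_right hx3'
          rw [hr2 a ha hai haj, hslack _ x y hx1 hx2, hslack _ x' y' hx1' hx2', hclsi,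
            hcls a hai haj]
          split_ifs with hc
          · exact ⟨x, y, hx1, hu.1 hc⟩
          · exact ⟨x', y', hx1', hu.2 hc⟩
        · obtain ⟨x, y, hx1, hx2, hx3⟩ := hbest a ha b hb' hla' hlb' hab
          rw [hr3 a b ha hb' hai hbi, hcls a hai haj, hcls b hbi hbj]
          exact ⟨x, y, hx1, hx3⟩
    · rw [hm.agree.idx aLeafI (by decide), hm.agree.idx aLeafJ (by decide)]
      exact h.leaf
    · exact h.reach.tail hgw
  -- the tree is still correct, except for the pairs that involve `i` or `j`
  have htree : TreeInv n τ := by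
    constructor
    · exact hst.n_eq
    · exact hst.row
    · exact hst.log
    · intro a ha hla
      rw [← hst.properFun_cls (hcore.size a ha hla)]
      exact hf1 _
    · rw [hm.agree.idx aWin (by decide), hm.agree.scal sKey (by decide)]
      exact h.tree.matchOK
    · rw [hm.agree.idx aWin (by decide)]
      exact h.tree.leaf
  have hleaf : ∀ a b, a < n → b < n → a ≠ i → a ≠ j → b ≠ i → b ≠ j → LeafOK n τ a b := by
    intro a b ha hb' hai haj hbi hbj
    have hsa : τ.idx aSize a = σ.idx aSize a := by rw [hm.size, if_neg hai]
    have hsb : τ.idx aSize b = σ.idx aSize b := by rw [hm.size, if_neg hbi]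
    have hre : rate τ a b = rate σ a b := by
      unfold rate
      rw [hsa, hsb, hm.agree.idx aIndiv (by decide)]
    have hpair : IsCompPair τ a b ↔ IsCompPair σ a b := by
      unfold IsCompPair
      rw [hrep a ha, hrep b hb', hre]
      tauto
    obtain ⟨o1, o2⟩ := h.leafOK a b ha hb'
    refine ⟨fun hp => ?_, fun hp => ?_⟩
    · rw [hpair] at hp
      obtain ⟨o3, o4⟩ := o1 hp
      rw [hm.agree.idx aWin (by decide), hm.agree.scal sKey (by decide), hm.time, hre]
      refine ⟨o3, ?_⟩
      obtain ⟨hla, hlb, hab, hr⟩ := hp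
      obtain ⟨x, y, hx1, hx2, hx3, hx4⟩ := h.best a ha b hb' hla hlb hab
      have hxy : x ≠ y := by
        rintro rfl
        exact hab ((mem_cls.1 hx2).symm.trans (mem_cls.1 hx3))
      rw [o4, hst.slack_eq ((hr3 a b ha hb' hai hbi).trans hx1) hxy, h.static.slack_eq hx1 hxy,
        hunc a b x y hx2 hx3, ← Nat.cast_add, ← h.rate_eq ha hb' hla hlb]
      have : (rate σ a b : ℚ) ≠ 0 := by
        rw [Nat.cast_ne_zero]; omega
      field_simp
      ring
    · rw [hpair] at hp
      rw [hm.agree.idx aWin (by decide)]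
      exact o2 hp
  obtain ⟨g1, g2⟩ := gwRefresh_spec htree hm.vP_eq hm.vQ_eq hi hj hleaf
  refine ⟨s', ⟨hcore.congr ((agree_den gwRefresh τ).mono (by decide) (by decide)), g1, g2⟩, ?_⟩
  exact Finset.card_insert_of_notMem hnew

end
end RAM

namespace RAM

open Code CycleCover

variable {n : ℕ}

/-- Two nested loops over all pairs, whose body establishes `P` for the current pair. -/
theorem forTo_pairs {c : Code} {σ : Store} (hn : σ.idx 0 0 = n) (hU : vU ∉ c.iw) (hV : vV ∉ c.iw)
    (h0 : 0 ∉ c.iw) (Q : Store → Prop) (P : Store → ℕ → ℕ → Prop)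
    (hQ : ∀ τ v x, v = vU ∨ v = vV → Q τ → Q (τ.setIdx v 0 x))
    (hP : ∀ τ v x a b, v = vU ∨ v = vV → P τ a b → P (τ.setIdx v 0 x) a b) (hQσ : Q σ)
    (step : ∀ τ a b, a < n → b < n → τ.idx vU 0 = a → τ.idx vV 0 = b →
      Agree (vU :: vV :: c.iw) c.sw σ τ → Q τ → Q (c.den τ) ∧ P (c.den τ) a b ∧
      ∀ a' b', a' < n → b' < n → P τ a' b' → P (c.den τ) a' b') :
    Q ((forTo vU 0 (forTo vV 0 c)).den σ) ∧
      ∀ a b, a < n → b < n → P ((forTo vU 0 (forTo vV 0 c)).den σ) a b := by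
  have outer := forTo_n (v := vU) (c := forTo vV 0 c) (by simpa [iw] using hU) hn
    (fun k τ => Q τ ∧ ∀ a b, a < k → b < n → P τ a b) ⟨hQ _ _ _ (Or.inl rfl) hQσ, by simp⟩ ?_
  · exact outer
  · rintro k τ hk hv hag ⟨q, hp⟩
    have hnτ : τ.idx 0 0 = n := by rw [hag.idx 0 (by simpa [iw] using h0), hn]
    have inner := forTo_n (v := vV) (c := c) hV hnτ
      (fun m ρ => Q ρ ∧ (∀ a b, a < k → b < n → P ρ a b) ∧ ∀ b < m, P ρ k b)
      ⟨hQ _ _ _ (Or.inr rfl) q, fun a b ha hb => hP _ _ _ _ _ (Or.inr rfl) (hp a b ha hb), by simp⟩ ?_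
    · obtain ⟨q', p1, p2⟩ := inner
      refine ⟨hQ _ _ _ (Or.inl rfl) q', fun a b ha hb => hP _ _ _ _ _ (Or.inl rfl) ?_⟩
      rcases Nat.lt_succ_iff_lt_or_eq.1 ha with ha | rfl
      · exact p1 a b ha hb
      · exact p2 b hb
    · rintro m ρ hm hv' hag' ⟨q', p1, p2⟩
      have hU' : ρ.idx vU 0 = k := by
        rw [hag'.idx vU (by simp [hU]), hv]
      obtain ⟨s1, s2, s3⟩ := step ρ k m hk hm hU' hv'
        ((hag.mono (by simp [iw]) (by simp [sw])).trans (hag'.mono (by simp) (by simp))) q'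
      refine ⟨hQ _ _ _ (Or.inr rfl) s1, fun a b ha hb => hP _ _ _ _ _ (Or.inr rfl)
        (s3 a b (by omega) hb (p1 a b ha hb)), fun b hb => hP _ _ _ _ _ (Or.inr rfl) ?_⟩
      rcases Nat.lt_succ_iff_lt_or_eq.1 hb with hb | rfl
      · exact s3 k b hk (by omega) (p2 b hb)
      · exact s2

theorem gwLabels_spec {σ : Store} (hn : σ.idx 0 0 = n) :
    ∀ u < n, (gwLabels.den σ).idx aLab u = u ∧ (gwLabels.den σ).idx aSize u = 1 := by
  intro u hu
  have key := forTo_cells (v := vU) (n := n)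
    (c := block [istore aLab (.var vU) (.var vU), istore aSize (.var vU) 1])
    (fun τ u => (τ.idx aLab u, τ.idx aSize u)) (fun u => (u, 1)) hn (by decide)
    (fun _ _ => by ext <;> simp) (fun k τ hk hv hag h => by simp +contextual [hv]) u
  rw [if_pos hu, Prod.mk.injEq] at key
  exact key

theorem gwPairs_spec {σ : Store} (hn : σ.idx 0 0 = n) (hrow : ∀ i ≤ n, σ.idx aRow i = i * n) :
    ∀ a b, a < n → b < n → edgeAt (gwPairs.den σ) (leafIdx n a b) = (a, b) ∧
      (gwPairs.den σ).idx aLeafI (leafIdx n a b) = a ∧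
      (gwPairs.den σ).idx aLeafJ (leafIdx n a b) = b := by
  refine (forTo_pairs (c := block [istore aBestI (leafOf (.var vU) (.var vV)) (.var vU),
      istore aBestJ (leafOf (.var vU) (.var vV)) (.var vV),
      istore aLeafI (leafOf (.var vU) (.var vV)) (.var vU),
      istore aLeafJ (leafOf (.var vU) (.var vV)) (.var vV)]) hn (by decide) (by decide) (by decide)
    (fun _ => True) (fun τ a b => edgeAt τ (leafIdx n a b) = (a, b) ∧
      τ.idx aLeafI (leafIdx n a b) = a ∧ τ.idx aLeafJ (leafIdx n a b) = b)
    (fun _ _ _ _ _ => trivial) ?_ trivial ?_).2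
  · rintro τ v x a b (rfl | rfl) h <;> simpa [edgeAt] using h
  · intro τ a b ha hb hU hV hag _
    have e : (leafOf (.var vU) (.var vV)).eval τ = leafIdx n a b := by
      rw [eval_leafOf (by rw [hag.idx 0 (by decide), hn])
        (by rw [hag.idx aRow (by decide)]; exact hrow) (by simpa [hU] using ha)]
      simp [hU, hV]
    have hset : ∀ r i x, r ∈ [aBestI, aBestJ, aLeafI, aLeafJ] → ∀ τ : Store,
        (leafOf (.var vU) (.var vV)).eval (τ.setIdx r i x) = (leafOf (.var vU) (.var vV)).eval τ := by
      intro r i x hr τ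
      simp only [List.mem_cons, List.not_mem_nil, or_false] at hr
      rcases hr with rfl | rfl | rfl | rfl <;> simp [leafOf]
    refine ⟨trivial, ?_, ?_⟩
    · simp [hset, e, hU, hV, edgeAt]
    · intro a' b' ha' hb' h
      by_cases hl : leafIdx n a' b' = leafIdx n a b
      · obtain ⟨rfl, rfl⟩ := leafIdx_inj hb' hb hl
        simp [hset, e, hU, hV, edgeAt]
      · simpa [hset, e, hl, edgeAt] using h

theorem gwTree_spec {σ : Store} (h : TreeInv n σ) :
    TreeInv n (gwTree.den σ) ∧ ∀ a b, a < n → b < n → LeafOK n (gwTree.den σ) a b := by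
  refine forTo_pairs (c := refreshAt (.var vU) (.var vV)) h.n_eq (by decide) (by decide) (by decide)
    (TreeInv n) (LeafOK n) ?_ ?_ h ?_
  · rintro τ v x (rfl | rfl) h <;> exact h.setVar (by decide) _
  · rintro τ v x a b (rfl | rfl) h <;> exact h.setVar (by decide) _
  · intro τ a b ha hb hU hV hag q
    have := refreshAt_spec q (.var vU) (.var vV) (by simpa [hU] using ha) (by simpa [hV] using hb)
      (by simp)
    simpa only [IExpr.eval_var, hU, hV] using this

section
variable {L : Set ℕ} {w : Sym2 (Fin n) → ℕ} {σ : Store}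

theorem gwInit_spec (h : Static L w σ) (hwin : ∀ k, σ.idx aWin k = 0) (hm : σ.idx vM 0 = 0)
    (hd : ∀ k, σ.scal sDual k = 0) : GWInv L w (gwInit.den σ) GWState.init := by
  have e : gwInit.den σ = gwTree.den (gwPairs.den (gwLabels.den σ)) := by
    simp only [gwInit, den_block_cons, den_block_nil]
  rw [e]
  have h1 := gwLabels_spec h.n_eq
  have a1 := agree_den gwLabels σ
  generalize gwLabels.den σ = σ1 at *
  have s1 : Static L w σ1 := h.congr a1 (by decide) (by decide)
  have h2 := gwPairs_spec s1.n_eq s1.row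
  have a2 := agree_den gwPairs σ1
  generalize gwPairs.den σ1 = τ at *
  have s2 : Static L w τ := s1.congr a2 (by decide) (by decide)
  have a : Agree (gwLabels.iw ++ gwPairs.iw) [] σ τ :=
    (a1.mono (by simp) (by decide)).trans (a2.mono (by simp) (by decide))
  have hlab : ∀ u < n, τ.idx aLab u = u := fun u hu => by
    rw [a2.idx aLab (by decide)]; exact (h1 u hu).1
  have hsize : ∀ u < n, τ.idx aSize u = 1 := fun u hu => by
    rw [a2.idx aSize (by decide)]; exact (h1 u hu).2
  have hwin' : τ.idx aWin = fun _ => 0 := by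
    rw [a.idx aWin (by decide)]; exact funext hwin
  have hcls : ∀ i : Fin n, cls τ (i : ℕ) = {i} := by
    intro i
    ext x
    simp only [mem_cls, hlab x x.2, Finset.mem_singleton, Fin.ext_iff]
  have hdual : ∀ k, τ.scal sDual k = 0 := by
    rw [a.scal sDual (by decide)]; exact hd
  have core : GWCore L w τ GWState.init := by
    constructor
    · exact s2
    · intro v hv; rw [hlab v hv]; exact hv
    · intro v hv; rw [hlab v hv, hlab v hv]
    · simp only [GWState.init]
      refine Finset.image_congr fun v _ => ?_
      simp only [hlab v v.2, hcls]
    · intro v hv _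
      rw [hsize v hv, hcls ⟨v, hv⟩, Finset.card_singleton]
    · intro v; exact hdual v
    · refine ⟨[], ⟨?_, by simp⟩, by simp, by simp [GWState.init]⟩
      rw [a.idx vM (by decide), hm]; rfl
    · intro i hi j hj _ _ _
      refine ⟨⟨i, hi⟩, ⟨j, hj⟩, (h2 i j hi hj).1, ?_, ?_, ?_⟩
      · exact mem_cls.2 (hlab i hi)
      · exact mem_cls.2 (hlab j hj)
      · intro u hu v hv
        rw [hcls ⟨i, hi⟩, Finset.mem_singleton] at hu
        rw [hcls ⟨j, hj⟩, Finset.mem_singleton] at hv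
        rw [hu, hv]
    · exact fun i hi j hj => (h2 i j hi hj).2
    · exact .refl
  have tree : TreeInv n τ := by
    constructor
    · exact s2.n_eq
    · exact s2.row
    · exact s2.log
    · intro i hi hli
      rw [← s2.properFun_cls (core.size i hi hli)]
      unfold properFun; split_ifs <;> omega
    · intro x _ _
      simp [MatchOK, hwin', bestOf]
    · intro y _ _
      simp [hwin']
  obtain ⟨t1, t2⟩ := gwTree_spec tree
  exact ⟨core.congr ((agree_den gwTree τ).mono (by decide) (by decide)), t1, t2⟩

theorem GWInv.setVar {s : GWState (Fin n)} (h : GWInv L w σ s) {v : ℕ}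
    (hv : v ∈ [vI, vJ, vNode, vLeaf, vLevel, vU, vV, vK]) (x : ℕ) :
    GWInv L w (σ.setIdx v 0 x) s := by
  refine ⟨h.toGWCore.congr (agree_setIdx ?_ _ _ _), h.tree.setVar hv x,
    fun i j hi hj => (h.leafOK i j hi hj).setVar hv x⟩
  revert hv; simp only [List.mem_cons]; tauto

/-- When nobody wins the tournament, there is no active component left. -/
theorem GWInv.final {s : GWState (Fin n)} (h : GWInv L w σ s) (hwin : σ.idx aWin 1 = 0)
    (hn : gcdOf L ∣ n) : ∀ C ∈ s.comps, properFun L C ≠ 1 := by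
  intro C hC hf
  obtain ⟨i, hi, hli, rfl⟩ := h.exists_of_mem_comps hC
  have hnopair : ∀ j < n, σ.idx aLab j = j → j = i := by
    intro j hj hlj
    by_contra hji
    have hp : IsCompPair σ i j := by
      refine ⟨hli, hlj, fun h => hji h.symm, ?_⟩
      rw [h.rate_eq hi hj hli hlj]
      omega
    have hw := ((h.leafOK i j hi hj).1 hp).1
    obtain ⟨k1, k2⟩ := leafIdx_lt hi hj
    have : 1 ≤ n * n := Nat.mul_pos (by omega) (by omega)
    exact (winner_le h.tree.matchOK (leafIdx n i j) (by omega) k2 (by omega)).1 hwin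
  have huniv : cls (n := n) σ i = Finset.univ := by
    ext x
    simp only [mem_cls, Finset.mem_univ, iff_true]
    exact hnopair _ (h.lab_lt x x.2) (h.lab_lab x x.2)
  rw [huniv, properFun_eq_one_iff] at hf
  simp [hn] at hf

/-- The main loop on the machine ends in a final state of the Goemans-Williamson algorithm: an
iteration adds an edge to a forest, so `n` iterations are enough. -/
theorem gwLoop_spec {s : GWState (Fin n)} (h : GWInv L w σ s) (hs : s.forest = ∅)
    (hn : gcdOf L ∣ n) :
    ∃ s, GWInv L w (gwLoop.den σ) s ∧ ∀ C ∈ s.comps, properFun L C ≠ 1 := by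
  have key := forTo_n (v := vK) (c := when (.ile 1 (.load aWin 1)) gwStep) (by decide) h.static.n_eq
    (fun k τ => ∃ s, GWInv L w τ s ∧ (τ.idx aWin 1 = 0 ∨ s.forest.card = k))
    ⟨s, h.setVar (by decide) _, Or.inr (by simp [hs])⟩ ?_
  · obtain ⟨s, hinv, hfin⟩ := key
    refine ⟨s, hinv, ?_⟩
    rcases hfin with hfin | hfin
    · exact hinv.final hfin hn
    · have hfs := isForestState_of_reachable hinv.reach
      have hcard := card_add_card_components _ hfs.acyclic hfs.not_diag
      rw [Fintype.card_fin, hfin] at hcard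
      have : s.comps = ∅ := by
        rw [hfs.comps_eq, ← Finset.card_eq_zero]; omega
      simp [this]
  · rintro k τ hk hv hag ⟨s, hinv, hfin⟩
    by_cases hw : τ.idx aWin 1 = 0
    · rw [den_when_neg (by simp [hw])]
      exact ⟨s, hinv.setVar (by decide) _, Or.inl (by simpa using hw)⟩
    · rw [den_when_pos (by simp; omega)]
      obtain ⟨s', h1, h2⟩ := hinv.step (by omega) hw
      refine ⟨s', h1.setVar (by decide) _, Or.inr ?_⟩
      rw [h2, hfin.resolve_left hw]

end
end RAM

/-! ### Exploring a forest -/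

namespace CycleCover

variable {V : Type*} [DecidableEq V]

theorem firstVisits_append (l m : List V) :
    firstVisits (l ++ m) = firstVisits l ++ (firstVisits m).filter (· ∉ l) := by
  induction m using List.reverseRecOn with
  | nil => simp [firstVisits]
  | append_singleton m x ih =>
    rw [← List.append_assoc, firstVisits_concat, firstVisits_concat, ih]
    by_cases h1 : x ∈ l
    · by_cases h2 : x ∈ m <;> simp [h1, h2]
    · by_cases h2 : x ∈ m <;> simp [h1, h2]

theorem pathEdges_append_cons (l : List V) (a : V) (m : List V) :
    pathEdges (l ++ a :: m) = pathEdges (l ++ [a]) ++ pathEdges (a :: m) := by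
  induction l with
  | nil => simp
  | cons x t ih =>
    cases t with
    | nil => simp
    | cons y t =>
      simp only [List.cons_append, pathEdges_cons_cons] at ih ⊢
      rw [ih]

/-- `t` is the list of vertices of a closed walk that uses exactly the edges of `E` with an endpoint
in `b`, each of them twice, and visits the vertices in the order given by `b`. -/
structure IsTourList (E : Finset (Sym2 V)) (b t : List V) : Prop where
  closed : ∃ v s, t = v :: s ∧ t.getLast? = some v
  edges : ∀ e ∈ pathEdges t, e ∈ E
  twice : ∀ e ∈ E, (∃ u ∈ e, u ∈ b) → (pathEdges t).count e = 2
  visits : firstVisits t = b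

theorem IsTourList.mem_iff {E : Finset (Sym2 V)} {b t : List V} (h : IsTourList E b t) {x : V} :
    x ∈ t ↔ x ∈ b := by
  rw [← h.visits, mem_firstVisits]

/-- Insert a detour to the new vertex `j` at the first visit of `i`. -/
theorem IsTourList.insert_leaf {E : Finset (Sym2 V)} {b₁ b₂ t : List V} {i j : V}
    (h : IsTourList E (b₁ ++ i :: b₂) t) (hj : j ∉ b₁ ++ i :: b₂) (hE : ∀ e ∈ E, j ∉ e) :
    ∃ t', IsTourList (insert s(i, j) E) (b₁ ++ i :: j :: b₂) t' := by
  have hmem := fun x => h.mem_iff (x := x)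
  have hit : i ∈ t := (hmem i).2 (by simp)
  have hjt : j ∉ t := fun h' => hj ((hmem j).1 h')
  have hij : i ≠ j := by rintro rfl; exact hjt hit
  obtain ⟨t₁, t₂, rfl, hi1⟩ := List.eq_append_cons_of_mem hit
  have hj1 : j ∉ t₁ := fun h' => hjt (by simp [h'])
  have hj2 : j ∉ t₂ := fun h' => hjt (by simp [h'])
  have hpe : pathEdges (t₁ ++ i :: j :: i :: t₂) =
      pathEdges (t₁ ++ [i]) ++ s(i, j) :: s(j, i) :: pathEdges (i :: t₂) := by
    rw [pathEdges_append_cons]; rfl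
  have hpe0 := pathEdges_append_cons t₁ i t₂
  have hnot : s(i, j) ∉ pathEdges (t₁ ++ i :: t₂) := fun h' =>
    hE _ (h.edges _ h') (Sym2.mem_mk_right _ _)
  refine ⟨t₁ ++ i :: j :: i :: t₂, ?_, ?_, ?_, ?_⟩
  · obtain ⟨v, s, h1, h2⟩ := h.closed
    cases t₁ with
    | nil =>
      simp only [List.nil_append, List.cons.injEq] at h1
      obtain ⟨rfl, rfl⟩ := h1
      refine ⟨i, j :: i :: t₂, rfl, ?_⟩
      simpa [List.getLast?_cons_cons] using h2
    | cons x t₁ =>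
      simp only [List.cons_append, List.cons.injEq] at h1
      obtain ⟨rfl, rfl⟩ := h1
      refine ⟨x, _, rfl, ?_⟩
      rw [List.getLast?_append_of_ne_nil _ (by simp)] at h2
      rw [show x :: t₁ ++ i :: j :: i :: t₂ = (x :: t₁ ++ [i, j]) ++ i :: t₂ by simp,
        List.getLast?_append_of_ne_nil _ (by simp), h2]
  · intro e he
    rw [hpe] at he
    simp only [List.mem_append, List.mem_cons] at he
    rw [Finset.mem_insert]
    rcases he with he | rfl | rfl | he
    · exact Or.inr (h.edges e (by rw [hpe0]; simp [he]))
    · exact Or.inl rfl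
    · exact Or.inl Sym2.eq_swap
    · exact Or.inr (h.edges e (by rw [hpe0]; simp [he]))
  · intro e he hu
    have hc : (pathEdges (t₁ ++ i :: j :: i :: t₂)).count e =
        (pathEdges (t₁ ++ i :: t₂)).count e + if e = s(i, j) then 2 else 0 := by
      rw [hpe, hpe0]
      simp only [List.count_append, List.count_cons, beq_iff_eq, Sym2.eq_swap (a := j) (b := i),
        eq_comm (a := s(i, j))]
      split_ifs <;> omega
    rw [hc]
    by_cases hee : e = s(i, j)
    · rw [hee, if_pos rfl, List.count_eq_zero.2 hnot]
    · rw [if_neg hee]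
      have heE := (Finset.mem_insert.1 he).resolve_left hee
      refine h.twice e heE ?_
      obtain ⟨u, hu1, hu2⟩ := hu
      refine ⟨u, hu1, ?_⟩
      have : u ≠ j := by rintro rfl; exact hE e heE hu1
      simpa [this] using hu2
  · have e1 := h.visits
    have hsplit : ∀ m, firstVisits (t₁ ++ i :: m) =
        firstVisits t₁ ++ i :: (firstVisits m).filter (· ∉ t₁ ++ [i]) := by
      intro m
      rw [show t₁ ++ i :: m = (t₁ ++ [i]) ++ m by simp, firstVisits_append, firstVisits_concat,
        if_neg hi1]
      simp
    have e2 : firstVisits (j :: i :: t₂) = j :: (firstVisits (i :: t₂)).filter (· ≠ j) := by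
      have := firstVisits_append [j] (i :: t₂)
      simpa [firstVisits] using this
    have e3 : firstVisits (i :: t₂) = i :: (firstVisits t₂).filter (· ≠ i) := by
      have := firstVisits_append [i] t₂
      simpa [firstVisits] using this
    rw [hsplit] at e1 ⊢
    rw [e2, e3]
    have hfj : ((firstVisits t₂).filter (· ≠ i)).filter (· ≠ j) = (firstVisits t₂).filter (· ≠ i) := by
      refine List.filter_eq_self.2 fun x hx => ?_
      have := mem_firstVisits.1 (List.mem_of_mem_filter hx)
      have hxj : x ≠ j := by rintro rfl; exact hj2 this
      simpa using hxj
    have hff : ((firstVisits t₂).filter (· ≠ i)).filter (· ∉ t₁ ++ [i]) =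
        (firstVisits t₂).filter (· ∉ t₁ ++ [i]) := by
      rw [List.filter_filter]
      refine List.filter_congr fun x _ => ?_
      by_cases hx : x = i <;> simp [hx]
    have h1 : firstVisits t₁ = b₁ ∧ (firstVisits t₂).filter (· ∉ t₁ ++ [i]) = b₂ := by
      have hif : i ∉ firstVisits t₁ := fun h' => hi1 (mem_firstVisits.1 h')
      have := (List.append_cons_inj_of_notMem hif (by simp)).1 e1
      exact ⟨this.1, this.2.2⟩
    have hfin : ((j :: (i :: (firstVisits t₂).filter (· ≠ i)).filter (· ≠ j)).filter
        (· ∉ t₁ ++ [i])) = j :: b₂ := by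
      have hji : j ≠ i := hij.symm
      rw [List.filter_cons_of_pos (by simp [hj1, hji]),
        List.filter_cons_of_pos (by simpa using hij), List.filter_cons_of_neg (by simp), hfj, hff, h1.2]
    rw [hfin, h1.1]

/-- A partial exploration of the forest `F`. The vertices `ord` have been visited in this order; each
of them has a parent and a root. The lists `segs` are the blocks of vertices of the components, in
the order in which a doubled Euler tour of the part visited so far, which has the edges `E`, visits
them for the first time. -/
structure Explored (F : Finset (Sym2 V)) (ord : List V) (par root : V → V) (segs : List (List V))
    (E : Finset (Sym2 V)) : Prop where
  perm : segs.flatten.Perm ord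
  nodup : ord.Nodup
  sub : E ⊆ F
  ends : ∀ e ∈ E, ∀ v ∈ e, v ∈ ord
  exists_par : ∀ e ∈ E, ∃ x ∈ ord, par x ≠ x ∧ e = s(x, par x)
  par_mem : ∀ k (h : k < ord.length), par ord[k] ≠ ord[k] →
    s(ord[k], par ord[k]) ∈ F ∧ ∃ m, ∃ h' : m < ord.length, m < k ∧ ord[m] = par ord[k]
  root_mem : ∀ u ∈ ord, root u ∈ ord
  reachable : ∀ u ∈ ord, ∀ v ∈ ord, root u = root v → (edgeGraph E).Reachable u v
  root_eq : ∀ u ∈ ord, ∀ v ∈ ord, (edgeGraph F).Reachable u v → root u = root v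
  tour : ∀ b ∈ segs, ∃ t, IsTourList E b t

namespace Explored

variable {F E : Finset (Sym2 V)} {ord : List V} {par root : V → V} {segs : List (List V)}

theorem nil (par root : V → V) : Explored F [] par root [] ∅ := by
  constructor <;> simp

theorem mem_flatten (h : Explored F ord par root segs E) {v : V} : v ∈ segs.flatten ↔ v ∈ ord :=
  h.perm.mem_iff

theorem par_mem_append (h : Explored F ord par root segs E) {j i : V} (hj : j ∉ ord)
    (hi : i ≠ j → i ∈ ord ∧ s(j, i) ∈ F) : ∀ k (hk : k < (ord ++ [j]).length),
      Function.update par j i (ord ++ [j])[k] ≠ (ord ++ [j])[k] →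
      s((ord ++ [j])[k], Function.update par j i (ord ++ [j])[k]) ∈ F ∧
      ∃ m, ∃ h' : m < (ord ++ [j]).length, m < k ∧
        (ord ++ [j])[m] = Function.update par j i (ord ++ [j])[k] := by
  intro k hk
  by_cases hk' : k < ord.length
  · rw [List.getElem_append_left hk']
    have hne : ord[k] ≠ j := fun he => hj (he ▸ List.getElem_mem hk')
    rw [Function.update_of_ne hne]
    intro hp
    obtain ⟨h1, m, hm, hmk, he⟩ := h.par_mem k hk' hp
    exact ⟨h1, m, by simp; omega, hmk, by rw [List.getElem_append_left hm, he]⟩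
  · have hk2 : k = ord.length := by simp at hk; omega
    subst hk2
    simp only [List.getElem_concat_length, Function.update_self]
    intro hij
    obtain ⟨h1, h2⟩ := hi hij
    obtain ⟨m, hm, he⟩ := List.getElem_of_mem h1
    exact ⟨h2, m, by simp; omega, hm, by rw [List.getElem_append_left hm, he]⟩

/-- Visit a new vertex from which no visited vertex can be reached. -/
theorem add_root (h : Explored F ord par root segs E) {j : V} (hj : j ∉ ord)
    (hno : ∀ u ∈ ord, ∀ v ∉ ord, s(u, v) ∉ F) :
    Explored F (ord ++ [j]) (Function.update par j j) (Function.update root j j)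
      (segs ++ [[j]]) E := by
  have hne : ∀ u ∈ ord, u ≠ j := fun u hu he => hj (he ▸ hu)
  have hreach : ∀ u v, (edgeGraph F).Reachable u v → u ∈ ord → v ∈ ord := by
    rintro u v ⟨p⟩
    induction p with
    | nil => exact id
    | @cons x y z hxy q ih =>
      intro hx
      refine ih ?_
      by_contra hy
      exact hno x hx y hy (edgeGraph_adj.1 hxy).1
  have hr : ∀ u ∈ ord, Function.update root j j u = root u := fun u hu =>
    Function.update_of_ne (hne u hu) _ _
  have hjE : ∀ e ∈ E, j ∉ e := fun e he hje => hj (h.ends e he j hje)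
  constructor
  · simpa using h.perm.append_right [j]
  · rw [List.nodup_append]
    refine ⟨h.nodup, by simp, ?_⟩
    intro a ha b hb
    rw [List.mem_singleton.1 hb]
    exact hne a ha
  · exact h.sub
  · exact fun e he v hv => List.mem_append_left _ (h.ends e he v hv)
  · intro e he
    obtain ⟨x, hx, h1, h2⟩ := h.exists_par e he
    refine ⟨x, List.mem_append_left _ hx, ?_⟩
    rw [Function.update_of_ne (hne x hx)]
    exact ⟨h1, h2⟩
  · exact h.par_mem_append hj fun h' => absurd rfl h'
  · intro u hu
    rcases List.mem_append.1 hu with hu | hu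
    · rw [hr u hu]; exact List.mem_append_left _ (h.root_mem u hu)
    · rw [List.mem_singleton.1 hu, Function.update_self]; simp
  · intro u hu v hv
    rcases List.mem_append.1 hu with hu | hu <;> rcases List.mem_append.1 hv with hv | hv
    · rw [hr u hu, hr v hv]; exact h.reachable u hu v hv
    · rw [List.mem_singleton.1 hv, Function.update_self, hr u hu]
      exact fun he => absurd (he ▸ h.root_mem u hu) hj
    · rw [List.mem_singleton.1 hu, Function.update_self, hr v hv]
      exact fun he => absurd (he ▸ h.root_mem v hv) hj
    · rw [List.mem_singleton.1 hv, List.mem_singleton.1 hu]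
      exact fun _ => .rfl
  · intro u hu v hv huv
    rcases List.mem_append.1 hu with hu | hu <;> rcases List.mem_append.1 hv with hv | hv
    · rw [hr u hu, hr v hv]; exact h.root_eq u hu v hv huv
    · exact absurd (hreach u v huv hu) (by rw [List.mem_singleton.1 hv]; exact hj)
    · exact absurd (hreach v u huv.symm hv) (by rw [List.mem_singleton.1 hu]; exact hj)
    · rw [List.mem_singleton.1 hv, List.mem_singleton.1 hu]
  · intro b hb
    rcases List.mem_append.1 hb with hb | hb
    · exact h.tour b hb
    · rw [List.mem_singleton.1 hb]
      refine ⟨[j], ⟨j, [], rfl, rfl⟩, by simp, ?_, by simp [firstVisits]⟩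
      rintro e he ⟨u, hu, huj⟩
      rw [List.mem_singleton.1 huj] at hu
      exact absurd hu (hjE e he)

/-- Visit a neighbour `j` of the visited vertex `i`. -/
theorem add_leaf (h : Explored F ord par root segs E) {i j : V} (hi : i ∈ ord) (hj : j ∉ ord)
    (hij : s(i, j) ∈ F) : ∃ pre post segs', segs.flatten = pre ++ i :: post ∧
      segs'.flatten = pre ++ i :: j :: post ∧
      Explored F (ord ++ [j]) (Function.update par j i) (Function.update root j (root i)) segs'
        (insert s(i, j) E) := by
  have hne : ∀ u ∈ ord, u ≠ j := fun u hu he => hj (he ▸ hu)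
  have hr : ∀ u ∈ ord, Function.update root j (root i) u = root u := fun u hu =>
    Function.update_of_ne (hne u hu) _ _
  have hjE : ∀ e ∈ E, j ∉ e := fun e he hje => hj (h.ends e he j hje)
  have hadj : (edgeGraph F).Adj i j := edgeGraph_adj.2 ⟨hij, hne i hi⟩
  have hmono : edgeGraph E ≤ edgeGraph (insert s(i, j) E) :=
    edgeGraph_mono (Finset.subset_insert _ _)
  have hadj' : (edgeGraph (insert s(i, j) E)).Adj i j :=
    edgeGraph_adj.2 ⟨Finset.mem_insert_self _ _, hne i hi⟩
  obtain ⟨b, hb, hib⟩ := List.mem_flatten.1 (h.mem_flatten.2 hi)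
  obtain ⟨S₁, S₂, rfl⟩ := List.append_of_mem hb
  obtain ⟨b₁, b₂, rfl⟩ := List.append_of_mem hib
  have hjseg : ∀ b ∈ S₁ ++ (b₁ ++ i :: b₂) :: S₂, j ∉ b := fun b hb hjb =>
    hj (h.mem_flatten.1 (List.mem_flatten.2 ⟨b, hb, hjb⟩))
  have hnd := h.perm.nodup_iff.2 h.nodup
  have hinot : ∀ b ∈ S₁ ++ S₂, i ∉ b := by
    intro b hb hib'
    have h1 : (S₁ ++ (b₁ ++ i :: b₂) :: S₂).Perm ((b₁ ++ i :: b₂) :: (S₁ ++ S₂)) :=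
      List.perm_middle
    have h2 := h1.flatten.nodup_iff.1 hnd
    rw [List.flatten_cons, List.nodup_append] at h2
    exact h2.2.2 i (by simp) i (List.mem_flatten.2 ⟨b, hb, hib'⟩) rfl
  refine ⟨S₁.flatten ++ b₁, b₂ ++ S₂.flatten, S₁ ++ (b₁ ++ i :: j :: b₂) :: S₂, by simp, by simp, ?_⟩
  constructor
  · have h1 := h.perm
    have h2 : (S₁ ++ (b₁ ++ i :: j :: b₂) :: S₂).flatten =
        (S₁.flatten ++ b₁ ++ [i]) ++ j :: (b₂ ++ S₂.flatten) := by simp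
    have h3 : (S₁ ++ (b₁ ++ i :: b₂) :: S₂).flatten =
        (S₁.flatten ++ b₁ ++ [i]) ++ (b₂ ++ S₂.flatten) := by simp
    rw [h3] at h1
    rw [h2]
    exact List.perm_middle.trans ((h1.cons j).trans (List.perm_append_singleton j ord).symm)
  · rw [List.nodup_append]
    refine ⟨h.nodup, by simp, ?_⟩
    intro a ha b hb
    rw [List.mem_singleton.1 hb]
    exact hne a ha
  · exact Finset.insert_subset hij h.sub
  · intro e he v hv
    rcases Finset.mem_insert.1 he with rfl | he
    · rcases Sym2.mem_iff.1 hv with rfl | rfl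
      · simp [hi]
      · simp
    · exact List.mem_append_left _ (h.ends e he v hv)
  · intro e he
    rcases Finset.mem_insert.1 he with rfl | he
    · refine ⟨j, by simp, ?_⟩
      rw [Function.update_self]
      exact ⟨hne i hi, Sym2.eq_swap⟩
    · obtain ⟨x, hx, h1, h2⟩ := h.exists_par e he
      refine ⟨x, List.mem_append_left _ hx, ?_⟩
      rw [Function.update_of_ne (hne x hx)]
      exact ⟨h1, h2⟩
  · exact h.par_mem_append hj fun _ => ⟨hi, by rw [Sym2.eq_swap]; exact hij⟩
  · intro u hu
    rcases List.mem_append.1 hu with hu | hu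
    · rw [hr u hu]; exact List.mem_append_left _ (h.root_mem u hu)
    · rw [List.mem_singleton.1 hu, Function.update_self]
      exact List.mem_append_left _ (h.root_mem i hi)
  · intro u hu v hv
    rcases List.mem_append.1 hu with hu | hu <;> rcases List.mem_append.1 hv with hv | hv
    · rw [hr u hu, hr v hv]; exact fun he => (h.reachable u hu v hv he).mono hmono
    · rw [List.mem_singleton.1 hv, Function.update_self, hr u hu]
      exact fun he => ((h.reachable u hu i hi he).mono hmono).trans hadj'.reachable
    · rw [List.mem_singleton.1 hu, Function.update_self, hr v hv]
      exact fun he => hadj'.symm.reachable.trans ((h.reachable i hi v hv he).mono hmono)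
    · rw [List.mem_singleton.1 hv, List.mem_singleton.1 hu]
      exact fun _ => .rfl
  · intro u hu v hv huv
    rcases List.mem_append.1 hu with hu | hu <;> rcases List.mem_append.1 hv with hv | hv
    · rw [hr u hu, hr v hv]; exact h.root_eq u hu v hv huv
    · rw [List.mem_singleton.1 hv] at huv ⊢
      rw [Function.update_self, hr u hu]
      exact h.root_eq u hu i hi (huv.trans hadj.symm.reachable)
    · rw [List.mem_singleton.1 hu] at huv ⊢
      rw [Function.update_self, hr v hv]
      exact h.root_eq i hi v hv (hadj.reachable.trans huv)
    · rw [List.mem_singleton.1 hv, List.mem_singleton.1 hu]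
  · have hcase : ∀ b ∈ S₁ ++ S₂, ∃ t, IsTourList (insert s(i, j) E) b t := by
      intro b hbS
      have hb' : b ∈ S₁ ++ (b₁ ++ i :: b₂) :: S₂ := by
        simp only [List.mem_append, List.mem_cons] at hbS ⊢; tauto
      obtain ⟨t, ht⟩ := h.tour b hb'
      refine ⟨t, ht.closed, fun e he => Finset.mem_insert_of_mem (ht.edges e he), ?_, ht.visits⟩
      rintro e he ⟨u, hu, hub⟩
      rcases Finset.mem_insert.1 he with rfl | he
      · rcases Sym2.mem_iff.1 hu with rfl | rfl
        · exact absurd hub (hinot b hbS)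
        · exact absurd hub (hjseg b hb')
      · exact ht.twice e he ⟨u, hu, hub⟩
    intro b hb
    rw [List.mem_append, List.mem_cons] at hb
    rcases hb with hb | rfl | hb
    · exact hcase b (List.mem_append_left _ hb)
    · obtain ⟨t, ht⟩ := h.tour (b₁ ++ i :: b₂) (by simp)
      exact ht.insert_leaf (hjseg _ (by simp)) hjE
    · exact hcase b (List.mem_append_right _ hb)

/-- At the end, all edges of the forest have been found. -/
theorem edges_eq (h : Explored F ord par root segs E) (hall : ∀ v, v ∈ ord)
    (hF : (edgeGraph F).IsAcyclic) (hd : ∀ e ∈ F, ¬ e.IsDiag) : E = F := by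
  refine Finset.Subset.antisymm h.sub fun e he => ?_
  by_contra hE
  induction e with | h u v =>
  have huv : u ≠ v := by simpa using hd _ he
  have h1 := h.root_eq u (hall u) v (hall v) (edgeGraph_adj.2 ⟨he, huv⟩).reachable
  have h2 := h.reachable u (hall u) v (hall v) h1
  refine not_reachable_erase hF he huv (h2.mono (edgeGraph_mono fun e' he' => ?_))
  exact Finset.mem_erase.2 ⟨fun h' => hE (h' ▸ he'), h.sub he'⟩

theorem root_eq_iff (h : Explored F ord par root segs E) (hall : ∀ v, v ∈ ord) {u v : V} :
    root u = root v ↔ (edgeGraph F).Reachable u v :=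
  ⟨fun he => (h.reachable u (hall u) v (hall v) he).mono (edgeGraph_mono h.sub),
    h.root_eq u (hall u) v (hall v)⟩

/-- At the end, every block consists of the vertices of a component, in the order in which a doubled
Euler tour visits them. -/
theorem block_spec [Fintype V] (h : Explored F ord par root segs E) (hall : ∀ v, v ∈ ord)
    (hF : (edgeGraph F).IsAcyclic) (hd : ∀ e ∈ F, ¬ e.IsDiag) {b : List V} (hb : b ∈ segs) :
    ∃ v, b.toFinset = component F v ∧ ∃ p : (edgeGraph F).Walk v v,
      IsDoubledEulerTour F (component F v) p ∧ firstVisits p.support = b := by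
  obtain rfl := h.edges_eq hall hF hd
  obtain ⟨t, ht⟩ := h.tour b hb
  obtain ⟨v, s, rfl, hlast⟩ := ht.closed
  -- the list is the support of a closed walk
  have hwalk : ∀ (s : List V) (x y : V), (x :: s).getLast? = some y →
      (∀ e ∈ pathEdges (x :: s), e ∈ E) →
      ∃ p : (edgeGraph E).Walk x y, p.support = x :: s := by
    intro s
    induction s with
    | nil =>
      intro x y hxy _
      obtain rfl : x = y := by simpa using hxy
      exact ⟨.nil, rfl⟩
    | cons z s ih =>
      intro x y hxy he
      rw [pathEdges_cons_cons] at he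
      obtain ⟨q, hq⟩ := ih z y (by simpa [List.getLast?_cons_cons] using hxy)
        fun e h' => he e (List.mem_cons_of_mem _ h')
      have hxz := he s(x, z) List.mem_cons_self
      exact ⟨.cons (edgeGraph_adj.2 ⟨hxz, by simpa using hd _ hxz⟩) q, by simp [hq]⟩
  obtain ⟨p, hp⟩ := hwalk s v v hlast ht.edges
  have hvb : v ∈ b := ht.mem_iff.1 (by simp)
  have hclosed : ∀ (x y : V), (edgeGraph E).Walk x y → x ∈ b → y ∈ b := by
    intro x y q
    induction q with
    | nil => exact id
    | @cons x y z hxy q ih =>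
      intro hx
      have h1 := ht.twice _ (edgeGraph_adj.1 hxy).1 ⟨x, Sym2.mem_mk_left x y, hx⟩
      have h2 : s(x, y) ∈ pathEdges (v :: s) := List.count_pos_iff.1 (by omega)
      exact ih (ht.mem_iff.1 (mem_of_mem_pathEdges h2 (Sym2.mem_mk_right x y)))
  have hcomp : b.toFinset = component E v := by
    ext u
    rw [List.mem_toFinset, mem_component]
    constructor
    · intro hu
      have : u ∈ p.support := by rw [hp]; exact ht.mem_iff.2 hu
      exact ⟨p.takeUntil u this⟩
    · rintro ⟨q⟩
      exact hclosed v u q hvb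
  refine ⟨v, hcomp, p, ⟨self_mem_component E v, ?_⟩, by rw [hp, ht.visits]⟩
  rintro e he ⟨u, hu, huc⟩
  rw [walk_edges_eq_pathEdges, hp]
  refine ht.twice e he ⟨u, hu, ?_⟩
  rw [← hcomp, List.mem_toFinset] at huc
  exact huc

end Explored

end CycleCover

/-! ### Exploring a forest on the machine -/

namespace RAM

open Code CycleCover

variable {n : ℕ}

theorem ListsForest.card_eq {σ : Store} {F : Finset (Sym2 (Fin n))} (h : ListsForest σ F) :
    σ.idx vM 0 = F.card := by
  obtain ⟨l, ⟨h1, -⟩, h2, rfl⟩ := h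
  rw [h1, List.toFinset_card_of_nodup h2, List.length_map]

theorem card_le_of_acyclic {F : Finset (Sym2 (Fin n))} (hF : (edgeGraph F).IsAcyclic)
    (hd : ∀ e ∈ F, ¬ e.IsDiag) : F.card ≤ n := by
  have := card_add_card_components F hF hd
  rw [Fintype.card_fin] at this
  omega

/-- The numbers `pos` are the positions of the entries of the list `l`. -/
def PosOK (pos : ℕ → ℕ) (l : List (Fin n)) : Prop :=
  ∀ (m : ℕ) (x : Fin n), l[m]? = some x → pos x = m

/-- Inserting `j` behind `i` shifts the positions of all later entries. -/
theorem PosOK.insert {pos pos' : ℕ → ℕ} {pre post : List (Fin n)} {i j : Fin n}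
    (h : PosOK pos (pre ++ i :: post)) (hnd : (pre ++ i :: j :: post).Nodup)
    (hj : pos' j = pos i + 1)
    (hpos : ∀ u : Fin n, u ≠ j → pos' u = if pos i < pos u then pos u + 1 else pos u) :
    PosOK pos' (pre ++ i :: j :: post) := by
  have hi : pos i = pre.length := h _ _ (by simp)
  have hne : ∀ x ∈ pre ++ i :: post, x ≠ j := by
    have : (j :: (pre ++ i :: post)).Nodup := by
      refine (List.Perm.nodup_iff ?_).1 hnd
      have := List.perm_middle (a := j) (l₁ := pre ++ [i]) (l₂ := post)
      simpa using this
    rintro x hx rfl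
    exact (List.nodup_cons.1 this).1 hx
  intro m x hm
  rcases lt_trichotomy m (pre.length + 1) with hlt | rfl | hgt
  · have hm' : (pre ++ i :: post)[m]? = some x := by
      rw [← hm]
      rcases Nat.lt_succ_iff_lt_or_eq.1 hlt with hlt | rfl
      · rw [List.getElem?_append_left hlt, List.getElem?_append_left hlt]
      · simp
    rw [hpos x (hne x (List.mem_of_getElem? hm')), h m x hm', hi, if_neg (by omega)]
  · have : j = x := by simpa [List.getElem?_append_right] using hm
    rw [← this, hj, hi]
  · obtain ⟨k, rfl⟩ : ∃ k, m = pre.length + (k + 2) := ⟨m - pre.length - 2, by omega⟩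
    have hm' : (pre ++ i :: post)[pre.length + (k + 1)]? = some x := by
      rw [← hm]
      simp [List.getElem?_append_right]
    rw [hpos x (hne x (List.mem_of_getElem? hm')), h _ x hm', hi, if_pos (by omega)]
    omega

theorem PosOK.append {pos pos' : ℕ → ℕ} {l : List (Fin n)} {j : Fin n} (h : PosOK pos l)
    (hj : pos' j = l.length) (hpos : ∀ u ∈ l, pos' u = pos u) : PosOK pos' (l ++ [j]) := by
  intro m x hm
  rcases lt_trichotomy m l.length with hlt | rfl | hgt
  · rw [List.getElem?_append_left hlt] at hm
    rw [hpos x (List.mem_of_getElem? hm), h m x hm]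
  · have : j = x := by simpa using hm
    rw [← this, hj]
  · rw [List.getElem?_eq_none (by simp; omega)] at hm
    simp at hm

section
variable {F : Finset (Sym2 (Fin n))} {σ : Store}

theorem findEdge_spec (hn : σ.idx 0 0 = n) (hF : ListsForest σ F) (hm : F.card ≤ n)
    {ord : List (Fin n)} (hvis : ∀ v : Fin n, σ.idx aVis v = if v ∈ ord then 1 else 0) :
    ((findEdge.den σ).idx vFound 0 = 1 ∧ ∃ a b : Fin n, (findEdge.den σ).idx vA 0 = a ∧
      (findEdge.den σ).idx vB 0 = b ∧ a ∈ ord ∧ b ∉ ord ∧ s(a, b) ∈ F) ∨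
    ((findEdge.den σ).idx vFound 0 = 0 ∧ ∀ u ∈ ord, ∀ v ∉ ord, s(u, v) ∉ F) := by
  have hcard := hF.card_eq
  obtain ⟨l, ⟨hl1, hl2⟩, -, rfl⟩ := hF
  have hvis' : ∀ u v : Fin n, σ.idx aVis u = σ.idx aVis v ↔ (u ∈ ord ↔ v ∈ ord) := by
    intro u v
    rw [hvis, hvis]
    split_ifs with h1 h2 h2 <;> simp [h1, h2]
  have key := forTo_n (v := vU) (c := checkEdge)
    (by decide) (σ := σ.setIdx vFound 0 0) (n := n) (by simpa using hn)
    (fun k τ => (τ.idx vFound 0 = 1 ∧ ∃ a b : Fin n, τ.idx vA 0 = a ∧ τ.idx vB 0 = b ∧ a ∈ ord ∧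
      b ∉ ord ∧ s(a, b) ∈ (l.map fun p => s(p.1, p.2)).toFinset) ∨
      (τ.idx vFound 0 = 0 ∧ ∀ p (hp : p < l.length), p < k → (l[p].1 ∈ ord ↔ l[p].2 ∈ ord)))
    (Or.inr (by simp)) ?_
  · have e : findEdge.den σ = (forTo vU 0 checkEdge).den (σ.setIdx vFound 0 0) := by
      simp only [findEdge, den_block_cons, den_block_nil, den_assign, IExpr.eval_zero]
    rw [e]
    rcases key with key | ⟨k1, k2⟩
    · exact Or.inl key
    · refine Or.inr ⟨k1, fun u hu v hv huv => ?_⟩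
      rw [List.mem_toFinset, List.mem_map] at huv
      obtain ⟨q, hq, hquv⟩ := huv
      obtain ⟨p, hp, rfl⟩ := List.getElem_of_mem hq
      have := k2 p hp (by omega)
      rcases Sym2.eq_iff.1 hquv with ⟨h1, h2⟩ | ⟨h1, h2⟩
      · rw [h1, h2] at this; exact hv (this.1 hu)
      · rw [h1, h2] at this; exact hv (this.2 hu)
  · intro k τ hk hv hag ih
    have e1 : τ.idx vM = σ.idx vM := by rw [hag.idx vM (by decide)]; ext; simp
    have e2 : τ.idx aEdgeI = σ.idx aEdgeI := by rw [hag.idx aEdgeI (by decide)]; ext; simp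
    have e3 : τ.idx aEdgeJ = σ.idx aEdgeJ := by rw [hag.idx aEdgeJ (by decide)]; ext; simp
    have e4 : τ.idx aVis = σ.idx aVis := by rw [hag.idx aVis (by decide)]; ext; simp
    simp only [checkEdge, den_when, Test.holds_and, Test.holds_ilt, Test.holds_not, Test.holds_ieq,
      IExpr.eval_var, IExpr.eval_load, hv, e1, e2, e3, e4, hl1]
    by_cases hkl : k < l.length
    · obtain ⟨hI, hJ⟩ := hl2 k hkl
      rw [hI, hJ]
      by_cases hc : (l[k].1 ∈ ord ↔ l[k].2 ∈ ord)
      · rw [if_neg (by rw [hvis']; tauto)]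
        rcases ih with ih | ⟨ih1, ih2⟩
        · exact Or.inl (by simpa using ih)
        · refine Or.inr ⟨by simpa using ih1, fun p hp hpk => ?_⟩
          rcases Nat.lt_succ_iff_lt_or_eq.1 hpk with hpk | rfl
          · exact ih2 p hp hpk
          · exact hc
      · rw [if_pos ⟨hkl, by rw [hvis']; exact hc⟩]
        left
        have hmem : s(l[k].1, l[k].2) ∈ (l.map fun p => s(p.1, p.2)).toFinset :=
          List.mem_toFinset.2 (List.mem_map.2 ⟨_, List.getElem_mem hkl, rfl⟩)
        simp only [den_block_cons, den_block_nil, den_assign, den_ite, Test.holds_ieq,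
          IExpr.eval_load, IExpr.eval_var, IExpr.eval_one, Store.setIdx_idx]
        norm_num [hv, e2, e3, e4, hI, hJ, hvis]
        by_cases h1 : l[k].1 ∈ ord
        · have h2 : l[k].2 ∉ ord := fun h2 => hc (by tauto)
          simp only [h1, if_true]
          norm_num [hv, e2, e3, hI, hJ]
          exact ⟨_, rfl, _, rfl, h1, h2, _, _, List.getElem_mem hkl, Or.inl ⟨rfl, rfl⟩⟩
        · have h2 : l[k].2 ∈ ord := by tauto
          simp only [h1, if_false]
          norm_num [hv, e2, e3, hI, hJ]
          exact ⟨_, rfl, _, rfl, h2, h1, _, _, List.getElem_mem hkl, Or.inr ⟨rfl, rfl⟩⟩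
    · rw [if_neg (by tauto)]
      rcases ih with ih | ⟨ih1, ih2⟩
      · exact Or.inl (by simpa using ih)
      · exact Or.inr ⟨by simpa using ih1, fun p hp hpk => ih2 p hp (by omega)⟩

theorem shiftTour_spec (hn : σ.idx 0 0 = n) (u : ℕ) (hu : u < n) :
    (shiftTour.den σ).idx aPos u = if σ.idx aPos (σ.idx vA 0) < σ.idx aPos u then
      σ.idx aPos u + 1 else σ.idx aPos u := by
  have key := forTo_n (v := vU) (c := when (.ilt (.load aPos (.var vA)) (.load aPos (.var vU)))
      (istore aPos (.var vU) (.load aPos (.var vU) + 1))) (by decide) hn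
    (fun k τ => ∀ u, τ.idx aPos u = if u < k ∧ σ.idx aPos (σ.idx vA 0) < σ.idx aPos u then
      σ.idx aPos u + 1 else σ.idx aPos u) (by simp) ?_
  · refine (key u).trans ?_
    simp [hu]
  · intro k τ hk hv hag ih u
    have e1 : τ.idx vA = σ.idx vA := hag.idx vA (by decide)
    have e2 : τ.idx aPos (σ.idx vA 0) = σ.idx aPos (σ.idx vA 0) := by rw [ih]; simp
    have e3 : τ.idx aPos k = σ.idx aPos k := by rw [ih]; simp
    simp only [den_when, Test.holds_ilt, IExpr.eval_load, IExpr.eval_var, hv, e1, e2, e3]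
    by_cases hc : σ.idx aPos (σ.idx vA 0) < σ.idx aPos k
    · rw [if_pos hc]
      by_cases huk : u = k
      · subst huk
        simp [hv, e3, hc]
      · simp [hv, huk, ih, Nat.lt_succ_iff_lt_or_eq, - Order.lt_add_one_iff]
    · rw [if_neg hc]
      by_cases huk : u = k
      · subst huk
        simp [e3, hc]
      · simp [huk, ih, Nat.lt_succ_iff_lt_or_eq, - Order.lt_add_one_iff]

theorem addLeaf_spec (hn : σ.idx 0 0 = n) {a b : ℕ} (ha : σ.idx vA 0 = a) (hb : σ.idx vB 0 = b) (han : a < n) :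
    (∀ u, (addLeaf.den σ).idx aPar u = if u = b then a else σ.idx aPar u) ∧
    (∀ u, (addLeaf.den σ).idx aRoot u = if u = b then σ.idx aRoot a else σ.idx aRoot u) ∧
    ∀ u < n, (addLeaf.den σ).idx aPos u = if u = b then σ.idx aPos a + 1 else
      if σ.idx aPos a < σ.idx aPos u then σ.idx aPos u + 1 else σ.idx aPos u := by
  set ρ := (σ.setIdx aPar b a).setIdx aRoot b (σ.idx aRoot a) with hρ
  have e : addLeaf.den σ = (istore aPos (.var vB) (.load aPos (.var vA) + 1)).den (shiftTour.den ρ) := by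
    simp [addLeaf, ha, hb, hρ]
  have hag := agree_den shiftTour ρ
  have h1 := shiftTour_spec (σ := ρ) (n := n) (by simp [hρ, hn])
  have hA : (shiftTour.den ρ).idx vA = σ.idx vA := by
    rw [hag.idx vA (by decide)]; ext; simp [hρ]
  have hB : (shiftTour.den ρ).idx vB = σ.idx vB := by
    rw [hag.idx vB (by decide)]; ext; simp [hρ]
  have hp : ∀ u, ρ.idx aPos u = σ.idx aPos u := by simp [hρ]
  have hAρ : ρ.idx vA 0 = a := by simp [hρ, ha]
  simp only [hp, hAρ] at h1
  have hPar : ∀ u, ρ.idx aPar u = if u = b then a else σ.idx aPar u := by simp [hρ]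
  have hRoot : ∀ u, ρ.idx aRoot u = if u = b then σ.idx aRoot a else σ.idx aRoot u := by simp [hρ]
  refine ⟨fun u => ?_, fun u => ?_, fun u hu => ?_⟩
  · rw [e]
    simp [hag.idx aPar (by decide), hPar]
  · rw [e]
    simp [hag.idx aRoot (by decide), hRoot]
  · rw [e]
    simp [hA, hB, ha, hb, h1 u hu, h1 a han]

theorem addRoot_spec (hn : σ.idx 0 0 = n) (hex : ∃ u < n, σ.idx aVis u = 0) :
    ∃ b < n, σ.idx aVis b = 0 ∧ (addRoot.den σ).idx vB 0 = b ∧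
    (∀ u, (addRoot.den σ).idx aPar u = if u = b then b else σ.idx aPar u) ∧
    (∀ u, (addRoot.den σ).idx aRoot u = if u = b then b else σ.idx aRoot u) ∧
    ∀ u, (addRoot.den σ).idx aPos u = if u = b then σ.idx vK 0 else σ.idx aPos u := by
  have key := forTo_n (v := vU) (c := when (.ieq (.load aVis (.var vU)) 0) (assign vB (.var vU)))
    (by decide) hn
    (fun k τ => (∃ u < k, σ.idx aVis u = 0) → τ.idx vB 0 < n ∧ σ.idx aVis (τ.idx vB 0) = 0)
    (by simp) ?_
  · obtain ⟨h1, h2⟩ := key hex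
    have hag := agree_den findUnvisited σ
    change (findUnvisited.den σ).idx vB 0 < n at h1
    change σ.idx aVis ((findUnvisited.den σ).idx vB 0) = 0 at h2
    refine ⟨(findUnvisited.den σ).idx vB 0, h1, h2, ?_, fun u => ?_, fun u => ?_, fun u => ?_⟩
    · simp [addRoot]
    · simp [addRoot, hag.idx aPar (by decide)]
    · simp [addRoot, hag.idx aRoot (by decide)]
    · simp [addRoot, hag.idx aPos (by decide), hag.idx vK (by decide)]
  · rintro k τ hk hv hag ih ⟨u, hu, hvis⟩
    have e : τ.idx aVis = σ.idx aVis := hag.idx aVis (by decide)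
    simp only [den_when, Test.holds_ieq, IExpr.eval_load, IExpr.eval_var, hv, e, IExpr.eval_zero]
    by_cases hc : σ.idx aVis k = 0
    · rw [if_pos hc]
      simp [hv, hc, hk]
    · rw [if_neg hc]
      have huk : u < k := by
        rcases Nat.lt_succ_iff_lt_or_eq.1 hu with h | rfl
        · exact h
        · exact absurd hvis hc
      simpa using ih ⟨u, huk, hvis⟩

/-- The machine stores the partial exploration of the forest `F`. -/
structure ExploreInv (σ : Store) (F : Finset (Sym2 (Fin n))) (ord : List (Fin n))
    (par root : Fin n → Fin n) (segs : List (List (Fin n))) (E : Finset (Sym2 (Fin n))) : Prop where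
  explored : Explored F ord par root segs E
  list : ListsForest σ F
  vis : ∀ v : Fin n, σ.idx aVis v = if v ∈ ord then 1 else 0
  ord_eq : ∀ k (h : k < ord.length), σ.idx aOrd k = ord[k]
  par_eq : ∀ v ∈ ord, σ.idx aPar v = par v
  root_eq : ∀ v ∈ ord, σ.idx aRoot v = root v
  pos : PosOK (σ.idx aPos) segs.flatten
  cnt : ∀ r : Fin n, σ.idx aCnt r = ord.countP fun v => root v = r

theorem exploreInit_spec (hn : σ.idx 0 0 = n) (u : ℕ) (hu : u < n) :
    (exploreInit.den σ).idx aVis u = 0 ∧ (exploreInit.den σ).idx aCnt u = 0 := by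
  have key := forTo_cells (v := vU) (n := n)
    (c := block [istore aVis (.var vU) 0, istore aCnt (.var vU) 0])
    (fun τ u => (τ.idx aVis u, τ.idx aCnt u)) (fun u => (0, 0)) hn (by decide)
    (fun _ _ => by ext <;> simp) (fun k τ hk hv hag h => by simp +contextual [hv]) u
  rw [if_pos hu, Prod.mk.injEq] at key
  exact key

theorem ExploreInv.congr {τ : Store} {ord : List (Fin n)} {par root : Fin n → Fin n}
    {segs : List (List (Fin n))} {E : Finset (Sym2 (Fin n))} (h : ExploreInv σ F ord par root segs E)
    {A S : List ℕ} (hag : Agree A S σ τ)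
    (hA : ∀ a ∈ [vM, aEdgeI, aEdgeJ, aVis, aOrd, aPar, aRoot, aPos, aCnt], a ∉ A) :
    ExploreInv τ F ord par root segs E := by
  have e := fun a ha => hag.idx a (hA a ha)
  constructor
  · exact h.explored
  · exact h.list.congr (e vM (by simp)) (e aEdgeI (by simp)) (e aEdgeJ (by simp))
  · rw [e aVis (by simp)]; exact h.vis
  · rw [e aOrd (by simp)]; exact h.ord_eq
  · rw [e aPar (by simp)]; exact h.par_eq
  · rw [e aRoot (by simp)]; exact h.root_eq
  · rw [e aPos (by simp)]; exact h.pos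
  · rw [e aCnt (by simp)]; exact h.cnt

/-- The bookkeeping when a vertex `b` is visited. -/
theorem ExploreInv.visit {τ : Store} {ord : List (Fin n)} {par root : Fin n → Fin n}
    {segs segs' : List (List (Fin n))} {E E' : Finset (Sym2 (Fin n))} {p r b : Fin n}
    (h : ExploreInv σ F ord par root segs E) (hbo : b ∉ ord)
    (hex : Explored F (ord ++ [b]) (Function.update par b p) (Function.update root b r) segs' E')
    (hl : ListsForest τ F)
    (hvis : τ.idx aVis = σ.idx aVis) (hord : τ.idx aOrd = σ.idx aOrd)
    (hcnt : τ.idx aCnt = σ.idx aCnt) (hk : τ.idx vK 0 = ord.length) (hb : τ.idx vB 0 = b)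
    (hpar : ∀ u, τ.idx aPar u = if u = b then (p : ℕ) else σ.idx aPar u)
    (hroot : ∀ u, τ.idx aRoot u = if u = b then (r : ℕ) else σ.idx aRoot u)
    (hpos : PosOK (τ.idx aPos) segs'.flatten) :
    ExploreInv (visit.den τ) F (ord ++ [b]) (Function.update par b p) (Function.update root b r)
      segs' E' := by
  have hag := agree_den RAM.visit τ
  have hne : ∀ u ∈ ord, u ≠ b := fun u hu he => hbo (he ▸ hu)
  have hne' : ∀ u ∈ ord, (u : ℕ) ≠ b := fun u hu he => hne u hu (Fin.ext he)
  constructor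
  · exact hex
  · exact hl.congr (hag.idx _ (by decide)) (hag.idx _ (by decide)) (hag.idx _ (by decide))
  · intro v
    have h1 := h.vis v
    rw [← hvis] at h1
    by_cases hvb : v = b
    · simp [RAM.visit, hb, hvb]
    · have : (v : ℕ) ≠ b := fun he => hvb (Fin.ext he)
      simp [RAM.visit, hb, hvb, this, h1]
  · intro k hk'
    by_cases hkl : k < ord.length
    · have h1 := h.ord_eq k hkl
      rw [← hord] at h1
      rw [List.getElem_append_left hkl, ← h1]
      have : k ≠ ord.length := by omega
      simp [RAM.visit, hk, this]
    · have hk2 : k = ord.length := by simp at hk'; omega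
      subst hk2
      simp [RAM.visit, hk, hb]
  · intro v hv
    rw [hag.idx _ (by decide), hpar]
    rcases List.mem_append.1 hv with hv | hv
    · rw [if_neg (hne' v hv), Function.update_of_ne (hne v hv), h.par_eq v hv]
    · rw [List.mem_singleton.1 hv, if_pos rfl, Function.update_self]
  · intro v hv
    rw [hag.idx _ (by decide), hroot]
    rcases List.mem_append.1 hv with hv | hv
    · rw [if_neg (hne' v hv), Function.update_of_ne (hne v hv), h.root_eq v hv]
    · rw [List.mem_singleton.1 hv, if_pos rfl, Function.update_self]
  · rw [hag.idx _ (by decide)]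
    exact hpos
  · intro x
    have h1 := h.cnt x
    rw [← hcnt] at h1
    have h2 : (ord ++ [b]).countP (fun v => decide (Function.update root b r v = x)) =
        ord.countP (fun v => decide (root v = x)) + if r = x then 1 else 0 := by
      rw [List.countP_append]
      congr 1
      · refine List.countP_congr fun u hu => ?_
        rw [Function.update_of_ne (hne u hu)]
      · simp [List.countP_singleton]
    rw [h2, ← h1]
    by_cases hrx : r = x
    · subst hrx
      simp [RAM.visit, hb, hroot]
    · have : (x : ℕ) ≠ r := fun he => hrx (Fin.ext he.symm)
      simp [RAM.visit, hb, hroot, hrx, this]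

theorem ExploreInv.step (hn : σ.idx 0 0 = n) (hm : F.card ≤ n) {ord : List (Fin n)}
    {par root : Fin n → Fin n} {segs : List (List (Fin n))} {E : Finset (Sym2 (Fin n))}
    (h : ExploreInv σ F ord par root segs E) (hk : σ.idx vK 0 = ord.length) (hkn : ord.length < n) :
    ∃ ord' par' root' segs' E', ExploreInv (exploreStep.den σ) F ord' par' root' segs' E' ∧
      ord'.length = ord.length + 1 := by
  have hfind := findEdge_spec hn h.list hm h.vis
  have hag := agree_den findEdge σ
  have hinv := h.congr hag (by decide)
  have hdef : exploreStep.den σ = RAM.visit.den ((ite (.ieq (.var vFound) 1) addLeaf addRoot).den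
      (findEdge.den σ)) := by
    simp only [exploreStep, den_block_cons, den_block_nil]
  rw [hdef]
  have hn1 : (findEdge.den σ).idx 0 0 = n := by rw [hag.idx 0 (by decide), hn]
  have hk1 : (findEdge.den σ).idx vK 0 = ord.length := by rw [hag.idx vK (by decide), hk]
  generalize findEdge.den σ = τ at *
  rcases hfind with ⟨hfound, a, b, ha, hb, hao, hbo, hab⟩ | ⟨hfound, hno⟩
  · rw [den_ite_pos (by simp [hfound])]
    obtain ⟨pre, post, segs', hf, hf', hex⟩ := h.explored.add_leaf hao hbo hab
    obtain ⟨s1, s2, s3⟩ := addLeaf_spec hn1 ha hb a.2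
    have hag2 := agree_den addLeaf τ
    refine ⟨ord ++ [b], _, _, segs', _, hinv.visit hbo hex
      (hinv.list.congr (hag2.idx _ (by decide)) (hag2.idx _ (by decide)) (hag2.idx _ (by decide)))
      (hag2.idx _ (by decide)) (hag2.idx _ (by decide)) (hag2.idx _ (by decide)) ?_ ?_ s1 ?_ ?_, by simp⟩
    · rw [hag2.idx _ (by decide), hk1]
    · rw [hag2.idx _ (by decide), hb]
    · intro u
      rw [s2, hinv.root_eq a hao]
    · rw [hf']
      refine PosOK.insert (pos := τ.idx aPos) (by rw [← hf]; exact hinv.pos) ?_ ?_ ?_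
      · rw [← hf']; exact hex.perm.nodup_iff.2 hex.nodup
      · rw [s3 b b.2, if_pos rfl]
      · intro u hu
        rw [s3 u u.2, if_neg fun he => hu (Fin.ext he)]
  · rw [den_ite_neg (by simp [hfound])]
    have hex0 : ∃ u < n, τ.idx aVis u = 0 := by
      by_contra hcon
      push Not at hcon
      have hall : ∀ v : Fin n, v ∈ ord := by
        intro v
        have h1 := hinv.vis v
        have h2 := hcon v v.2
        by_contra hv
        rw [if_neg hv] at h1
        exact h2 h1
      have h1 : (Finset.univ : Finset (Fin n)) ⊆ ord.toFinset := fun v _ => List.mem_toFinset.2 (hall v)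
      have h2 := Finset.card_le_card h1
      rw [List.toFinset_card_of_nodup h.explored.nodup, Finset.card_univ, Fintype.card_fin] at h2
      omega
    obtain ⟨b', hbn, hbv, hb, s1, s2, s3⟩ := addRoot_spec hn1 hex0
    obtain ⟨b, rfl⟩ : ∃ b : Fin n, b' = b := ⟨⟨b', hbn⟩, rfl⟩
    have hbo : b ∉ ord := by
      intro hbo
      rw [hinv.vis b, if_pos hbo] at hbv
      omega
    have hag2 := agree_den addRoot τ
    have hex := h.explored.add_root hbo hno
    refine ⟨ord ++ [b], _, _, _, _, hinv.visit hbo hex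
      (hinv.list.congr (hag2.idx _ (by decide)) (hag2.idx _ (by decide)) (hag2.idx _ (by decide)))
      (hag2.idx _ (by decide)) (hag2.idx _ (by decide)) (hag2.idx _ (by decide)) ?_ hb s1 s2 ?_, by simp⟩
    · rw [hag2.idx _ (by decide), hk1]
    · rw [show (segs ++ [[b]]).flatten = segs.flatten ++ [b] by simp]
      refine PosOK.append (pos := τ.idx aPos) hinv.pos ?_ ?_
      · rw [s3, if_pos rfl, hk1, h.explored.perm.length_eq]
      · intro u hu
        have hne : (u : ℕ) ≠ b := fun he => hbo (Fin.ext he ▸ h.explored.mem_flatten.1 hu)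
        rw [s3, if_neg hne]

/-- An exploration visits all vertices, and finds all edges of the forest. -/
theorem explore_spec (hn : σ.idx 0 0 = n) (hl : ListsForest σ F) (hF : (edgeGraph F).IsAcyclic)
    (hd : ∀ e ∈ F, ¬ e.IsDiag) : ∃ ord par root segs, ExploreInv (explore.den σ) F ord par root segs F ∧
      ord.length = n ∧ ∀ v, v ∈ ord := by
  have hm := card_le_of_acyclic hF hd
  have e : explore.den σ = (forTo vK 0 exploreStep).den (exploreInit.den σ) := by
    simp only [explore, den_block_cons, den_block_nil]
  rw [e]
  have hini := exploreInit_spec hn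
  have hag := agree_den exploreInit σ
  have hn1 : (exploreInit.den σ).idx 0 0 = n := by rw [hag.idx 0 (by decide), hn]
  have hl1 := hl.congr (hag.idx vM (by decide)) (hag.idx aEdgeI (by decide)) (hag.idx aEdgeJ (by decide))
  generalize exploreInit.den σ = τ at *
  have key := forTo_n (v := vK) (c := exploreStep) (by decide) hn1
    (fun k ρ => ∃ ord par root segs E, ExploreInv ρ F ord par root segs E ∧ ord.length = k) ?_ ?_
  · obtain ⟨ord, par, root, segs, E, hinv, hlen⟩ := key
    have hall : ∀ v, v ∈ ord := by
      have h1 : ord.toFinset = Finset.univ := by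
        rw [← Finset.card_eq_iff_eq_univ, List.toFinset_card_of_nodup hinv.explored.nodup, hlen,
          Fintype.card_fin]
      intro v
      rw [← List.mem_toFinset, h1]
      exact Finset.mem_univ v
    obtain rfl := hinv.explored.edges_eq hall hF hd
    exact ⟨ord, par, root, segs, hinv, hlen, hall⟩
  · refine ⟨[], id, id, [], ∅, ⟨Explored.nil _ _, ?_, ?_, ?_, ?_, ?_, ?_, ?_⟩, rfl⟩
    · exact hl1.congr (by ext; simp) (by ext; simp) (by ext; simp)
    · intro v; simpa using (hini v v.2).1
    · simp
    · simp
    · simp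
    · intro m x hm; simp at hm
    · intro r; simpa using (hini r r.2).2
  · rintro k ρ hk hv hag' ⟨ord, par, root, segs, E, hinv, rfl⟩
    have hnρ : ρ.idx 0 0 = n := by rw [hag'.idx 0 (by decide), hn1]
    obtain ⟨ord', par', root', segs', E', hinv', hlen⟩ := hinv.step hnρ hm hv hk
    exact ⟨ord', par', root', segs', E', hinv'.congr (agree_setIdx (A := [vK]) (by simp) _ _ _ :
      Agree [vK] [] _ _) (by decide), hlen⟩

end
end RAM

/-! ### Discarding superfluous edges on the machine -/

namespace CycleCover.Explored

variable {n : ℕ} {F E : Finset (Sym2 (Fin n))} {ord : List (Fin n)} {par root : Fin n → Fin n}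
  {segs : List (List (Fin n))}

/-- Parents come before their children. -/
theorem getElem?_par (h : Explored F ord par root segs E) {k : ℕ} {x : Fin n} (hk : ord[k]? = some x)
    (hp : par x ≠ x) : s(x, par x) ∈ F ∧ ∃ m < k, ord[m]? = some (par x) := by
  obtain ⟨hk', rfl⟩ := List.getElem?_eq_some_iff.1 hk
  obtain ⟨h1, m, hm, hmk, he⟩ := h.par_mem k hk' hp
  exact ⟨h1, m, hmk, by rw [List.getElem?_eq_some_iff]; exact ⟨hm, he⟩⟩

theorem getElem?_inj (h : Explored F ord par root segs E) {k m : ℕ} {x : Fin n}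
    (hk : ord[k]? = some x) (hm : ord[m]? = some x) : k = m := by
  obtain ⟨hk', h1⟩ := List.getElem?_eq_some_iff.1 hk
  obtain ⟨hm', h2⟩ := List.getElem?_eq_some_iff.1 hm
  exact (List.Nodup.getElem_inj_iff h.nodup).1 (h1.trans h2.symm)

/-- The vertices below `x` are `x` itself and those below the children of `x`. -/
theorem sideCard_eq (h : Explored F ord par root segs F) (hall : ∀ v, v ∈ ord)
    (hF : (edgeGraph F).IsAcyclic) {x : Fin n} (hx : par x ≠ x) :
    sideCard F (par x) x = 1 + ∑ c ∈ Finset.univ.filter (fun c => par c = x ∧ c ≠ x),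
      sideCard F x c := by
  obtain ⟨k, hk⟩ := List.mem_iff_getElem?.1 (hall x)
  obtain ⟨hpF, m, hmk, hm⟩ := h.getElem?_par hk hx
  have hset : Finset.univ.filter (fun y => s(x, y) ∈ F ∧ x ≠ y) =
      insert (par x) (Finset.univ.filter fun c => par c = x ∧ c ≠ x) := by
    ext y
    simp only [Finset.mem_filter, Finset.mem_univ, true_and, Finset.mem_insert]
    constructor
    · rintro ⟨hy, hxy⟩
      obtain ⟨z, -, -, hz⟩ := h.exists_par _ hy
      rcases Sym2.eq_iff.1 hz with ⟨rfl, rfl⟩ | ⟨rfl, rfl⟩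
      · exact Or.inl rfl
      · exact Or.inr ⟨rfl, hxy.symm⟩
    · rintro (rfl | ⟨rfl, hy⟩)
      · exact ⟨hpF, hx.symm⟩
      · obtain ⟨q, hq⟩ := List.mem_iff_getElem?.1 (hall y)
        have := (h.getElem?_par hq hy.symm).1
        exact ⟨by rwa [Sym2.eq_swap], hy.symm⟩
  have hnot : par x ∉ Finset.univ.filter fun c => par c = x ∧ c ≠ x := by
    simp only [Finset.mem_filter, Finset.mem_univ, true_and, not_and]
    intro hpp _
    obtain ⟨-, q, hqm, hq⟩ := h.getElem?_par hm (by rw [hpp]; exact hx.symm)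
    rw [hpp] at hq
    have := h.getElem?_inj hk hq
    omega
  have h1 := card_component_eq_one_add hF x
  rw [hset, Finset.sum_insert hnot] at h1
  have h2 := sideCard_add_sideCard hF hpF hx.symm
  omega

end CycleCover.Explored

namespace RAM

open Code CycleCover

variable {n : ℕ} {F : Finset (Sym2 (Fin n))} {σ : Store} {L : Set ℕ} {w : Sym2 (Fin n) → ℕ}
  {ord : List (Fin n)} {par root : Fin n → Fin n} {segs : List (List (Fin n))}

theorem add_mod_of_lt {a b g : ℕ} (ha : a < g) (hb : b < g) :
    (a + b) % g = if g ≤ a + b then a + b - g else a + b := by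
  split_ifs with h
  · rw [Nat.mod_eq_sub_mod h, Nat.mod_eq_of_lt (by omega)]
  · exact Nat.mod_eq_of_lt (by omega)

open Classical in
/-- The children of `v` among the last `k` vertices of the list. -/
noncomputable def lateChildren (ord : List (Fin n)) (par : Fin n → Fin n) (k : ℕ) (v : Fin n) :
    Finset (Fin n) :=
  Finset.univ.filter fun c => par c = v ∧ c ≠ v ∧ ∃ m, n - k ≤ m ∧ ord[m]? = some c

theorem subInit_spec (hn : σ.idx 0 0 = n) (u : ℕ) (hu : u < n) :
    (subInit.den σ).idx aSub u = σ.idx vOneMod 0 := by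
  have key := forTo_cells (v := vU) (n := n) (c := istore aSub (.var vU) (.var vOneMod))
    (fun τ u => τ.idx aSub u) (fun _ => σ.idx vOneMod 0) hn (by decide)
    (fun _ _ => by ext; simp) (fun k τ hk hv hag h => ?_) u
  · rw [if_pos hu] at key
    exact key
  · have e := hag.idx vOneMod (by decide)
    simp +contextual [hv, e]

theorem subStep_spec {x p : ℕ} (hx : σ.idx aOrd (σ.idx 0 0 - 1 - σ.idx vK 0) = x)
    (hp : σ.idx aPar x = p) (u : ℕ) :
    (subStep.den σ).idx aSub u = if u = p ∧ p ≠ x then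
      (if σ.idx vGcd 0 ≤ σ.idx aSub p + σ.idx aSub x then σ.idx aSub p + σ.idx aSub x - σ.idx vGcd 0
        else σ.idx aSub p + σ.idx aSub x) else σ.idx aSub u := by
  by_cases hpx : p = x
  · simp [subStep, hx, hp, hpx]
  · have e : σ.idx aOrd (σ.idx 0 0 - 1 - σ.idx vK 0) = x := hx
    by_cases hc : σ.idx vGcd 0 ≤ σ.idx aSub p + σ.idx aSub x
    · by_cases hu : u = p <;> simp [subStep, hx, hp, hpx, hc, hu]
    · by_cases hu : u = p <;> simp [subStep, hx, hp, hpx, hc, hu]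

/-- In reverse order of exploration, all children of a vertex come before it, so the numbers below
all vertices are computed in one pass. -/
theorem subtreeSizes_spec (hs : Static L w σ) (hg : 0 < gcdOf L)
    (h : ExploreInv σ F ord par root segs F) (hlen : ord.length = n) (hall : ∀ v, v ∈ ord)
    (hF : (edgeGraph F).IsAcyclic) {x : Fin n} (hx : par x ≠ x) :
    (subtreeSizes.den σ).idx aSub x = sideCard F (par x) x % gcdOf L := by
  have hex := h.explored
  have e : subtreeSizes.den σ = (forTo vK 0 subStep).den (subInit.den σ) := by
    simp only [subtreeSizes, den_block_cons, den_block_nil]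
  rw [e]
  have hini := subInit_spec hs.n_eq
  have hag := agree_den subInit σ
  have hs1 : Static L w (subInit.den σ) := hs.congr hag (by decide) (by decide)
  have h1 := h.congr hag (by decide)
  rw [hs.oneMod] at hini
  generalize subInit.den σ = τ at *
  -- all children of a vertex come after it
  have hchild : ∀ k (x : Fin n), ord[n - 1 - k]? = some x → k < n → lateChildren ord par k x =
      Finset.univ.filter (fun c => par c = x ∧ c ≠ x) := by
    intro k x hkx hkn
    ext c
    simp only [lateChildren, Finset.mem_filter, Finset.mem_univ, true_and]
    refine ⟨fun hc => ⟨hc.1, hc.2.1⟩, fun hc => ⟨hc.1, hc.2, ?_⟩⟩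
    obtain ⟨m, hm⟩ := List.mem_iff_getElem?.1 (hall c)
    obtain ⟨-, q, hq, hqc⟩ := hex.getElem?_par hm (by rw [hc.1]; exact hc.2.symm)
    rw [hc.1] at hqc
    have := hex.getElem?_inj hkx hqc
    exact ⟨m, by omega, hm⟩
  have key := forTo_n (v := vK) (c := subStep) (by decide) hs1.n_eq
    (fun k ρ => ∀ v : Fin n, ρ.idx aSub v =
      (1 + ∑ c ∈ lateChildren ord par k v, sideCard F v c) % gcdOf L) ?_ ?_
  · have h2 := key x
    rw [h2, hex.sideCard_eq hall hF hx]
    congr 3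
    ext c
    simp only [lateChildren, Finset.mem_filter, Finset.mem_univ, true_and]
    refine ⟨fun hc => ⟨hc.1, hc.2.1⟩, fun hc => ⟨hc.1, hc.2, ?_⟩⟩
    obtain ⟨m, hm⟩ := List.mem_iff_getElem?.1 (hall c)
    exact ⟨m, by omega, hm⟩
  · intro v
    have : lateChildren ord par 0 v = ∅ := by
      ext c
      simp only [lateChildren, Finset.mem_filter, Finset.mem_univ, true_and, Finset.notMem_empty,
        iff_false]
      rintro ⟨-, -, m, hm, hc⟩
      rw [List.getElem?_eq_none (by omega)] at hc
      simp at hc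
    rw [this]
    simpa using hini v v.2
  · intro k ρ hk hv hag' ih v
    obtain ⟨x, hx⟩ : ∃ x, ord[n - 1 - k]? = some x :=
      ⟨_, List.getElem?_eq_getElem (by omega)⟩
    obtain ⟨hxl, hxe⟩ := List.getElem?_eq_some_iff.1 hx
    have hx' : ρ.idx aOrd (ρ.idx 0 0 - 1 - ρ.idx vK 0) = x := by
      rw [hv, hag'.idx 0 (by decide), hs1.n_eq, hag'.idx aOrd (by decide), h1.ord_eq _ hxl, hxe]
    have hp' : ρ.idx aPar x = par x := by
      rw [hag'.idx aPar (by decide), h1.par_eq x (hall x)]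
    have hgρ : ρ.idx vGcd 0 = gcdOf L := by rw [hag'.idx vGcd (by decide), hs1.gcd]
    have hstep := subStep_spec hx' hp' v
    have hset : ((subStep.den ρ).setIdx vK 0 (k + 1)).idx aSub v = (subStep.den ρ).idx aSub v := by
      simp
    rw [hset, hstep, hgρ]
    by_cases hc : (v : ℕ) = par x ∧ (par x : ℕ) ≠ x
    · obtain ⟨hvp, hpx⟩ := hc
      have hpx' : par x ≠ x := fun he => hpx (by rw [he])
      obtain rfl : v = par x := Fin.ext hvp
      rw [if_pos ⟨rfl, hpx⟩, ih, ih, hchild k x hx hk, ← hex.sideCard_eq hall hF hpx',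
        ← add_mod_of_lt (Nat.mod_lt _ hg) (Nat.mod_lt _ hg), ← Nat.add_mod]
      have hins : lateChildren ord par (k + 1) (par x) = insert x (lateChildren ord par k (par x)) := by
        ext c
        simp only [lateChildren, Finset.mem_filter, Finset.mem_univ, true_and, Finset.mem_insert]
        constructor
        · rintro ⟨a1, a2, m, hm, hmc⟩
          by_cases hmm : n - k ≤ m
          · exact Or.inr ⟨a1, a2, m, hmm, hmc⟩
          · have : m = n - 1 - k := by omega
            rw [this, hx] at hmc
            exact Or.inl (Option.some.inj hmc).symm
        · rintro (rfl | ⟨a1, a2, m, hm, hmc⟩)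
          · exact ⟨rfl, hpx'.symm, n - 1 - k, by omega, hx⟩
          · exact ⟨a1, a2, m, by omega, hmc⟩
      have hnot : x ∉ lateChildren ord par k (par x) := by
        simp only [lateChildren, Finset.mem_filter, Finset.mem_univ, true_and, not_and, not_exists]
        intro _ m hm hmc
        have := hex.getElem?_inj hmc hx
        omega
      rw [hins, Finset.sum_insert hnot]
      congr 1
      ring
    · rw [if_neg hc, ih]
      congr 3
      ext c
      simp only [lateChildren, Finset.mem_filter, Finset.mem_univ, true_and]
      refine and_congr_right fun a1 => and_congr_right fun a2 => ⟨?_, ?_⟩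
      · rintro ⟨m, hm, hmc⟩
        exact ⟨m, by omega, hmc⟩
      · rintro ⟨m, hm, hmc⟩
        refine ⟨m, ?_, hmc⟩
        by_contra hmm
        have : m = n - 1 - k := by omega
        rw [this, hx] at hmc
        obtain rfl := Option.some.inj hmc
        exact hc ⟨by rw [a1], fun he => a2 ((Fin.ext he).symm.trans a1)⟩

/-- If the stored numbers decide which edges to keep, then the list is filtered in place. -/
theorem filterEdges_spec (hn : σ.idx 0 0 = n) {l : List (Fin n × Fin n)} (hl : ListsEdges σ l)
    (hln : l.length ≤ n) (keep : Fin n × Fin n → Bool)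
    (hkeep : ∀ p ∈ l, (σ.idx aPar p.1 = p.2 → (1 ≤ σ.idx aSub p.1 ↔ keep p = true)) ∧
      (σ.idx aPar p.1 ≠ p.2 → (1 ≤ σ.idx aSub p.2 ↔ keep p = true))) :
    ListsEdges (filterEdges.den σ) (l.filter keep) := by
  obtain ⟨hm, hlk⟩ := hl
  have key := forTo_n (v := vU) (c := filterStep) (by decide) (σ := σ.setIdx vKept 0 0) (n := n)
    (by simpa using hn)
    (fun k τ => τ.idx vKept 0 = ((l.take k).filter keep).length ∧
      (∀ m (h : m < ((l.take k).filter keep).length),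
        τ.idx aEdgeI m = ((l.take k).filter keep)[m].1 ∧
        τ.idx aEdgeJ m = ((l.take k).filter keep)[m].2) ∧
      ∀ m (h : m < l.length), k ≤ m → τ.idx aEdgeI m = l[m].1 ∧ τ.idx aEdgeJ m = l[m].2)
    (by simpa using hlk) ?_
  · have e : filterEdges.den σ = (assign vM (.var vKept)).den
        ((forTo vU 0 filterStep).den (σ.setIdx vKept 0 0)) := by
      simp only [filterEdges, den_block_cons, den_block_nil, den_assign, IExpr.eval_zero]
    obtain ⟨k1, k2, -⟩ := key
    rw [List.take_of_length_le hln] at k1 k2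
    rw [e]
    exact ⟨by simpa using k1, fun m h => by simpa using k2 m h⟩
  · rintro k τ hk hv hag ⟨h1, h2, h3⟩
    have e1 : τ.idx vM = σ.idx vM := by rw [hag.idx vM (by decide)]; ext; simp
    have e2 : τ.idx aPar = σ.idx aPar := by rw [hag.idx aPar (by decide)]; ext; simp
    have e3 : τ.idx aSub = σ.idx aSub := by rw [hag.idx aSub (by decide)]; ext; simp
    by_cases hkl : k < l.length
    · obtain ⟨hI, hJ⟩ := h3 k hkl le_rfl
      obtain ⟨hk1, hk2⟩ := hkeep _ (List.getElem_mem hkl)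
      have htake : (l.take (k + 1)).filter keep =
          (l.take k).filter keep ++ if keep l[k] = true then [l[k]] else [] := by
        rw [List.take_succ_eq_append_getElem hkl, List.filter_append, List.filter_singleton]
        cases keep l[k] <;> rfl
      have hle : ((l.take k).filter keep).length ≤ k :=
        (List.length_filter_le _ _).trans (by simp)
      -- the effect of this iteration
      have hden : ∃ ρ : Store, filterStep.den τ = (if keep l[k] = true then
          ((ρ.setIdx aEdgeI (τ.idx vKept 0) l[k].1).setIdx aEdgeJ (τ.idx vKept 0) l[k].2).setIdx
            vKept 0 (τ.idx vKept 0 + 1) else ρ) ∧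
          ρ.idx aEdgeI = τ.idx aEdgeI ∧ ρ.idx aEdgeJ = τ.idx aEdgeJ ∧ ρ.idx vKept = τ.idx vKept := by
        by_cases hc : σ.idx aPar l[k].1 = l[k].2
        · refine ⟨τ.setIdx vX 0 l[k].1, ?_, by ext; simp, by ext; simp, by ext; simp⟩
          have := hk1 hc
          by_cases hkeep : keep l[k] = true
          · simp [filterStep, hv, e1, hm, hkl, hI, hJ, e2, hc, e3, this.2 hkeep, hkeep]
          · have h0 : ¬ 1 ≤ σ.idx aSub l[k].1 := fun h => hkeep (this.1 h)
            simp [filterStep, hv, e1, hm, hkl, hI, hJ, e2, hc, e3, h0, hkeep]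
        · refine ⟨τ.setIdx vX 0 l[k].2, ?_, by ext; simp, by ext; simp, by ext; simp⟩
          have := hk2 hc
          by_cases hkeep : keep l[k] = true
          · simp [filterStep, hv, e1, hm, hkl, hI, hJ, e2, hc, e3, this.2 hkeep, hkeep]
          · have h0 : ¬ 1 ≤ σ.idx aSub l[k].2 := fun h => hkeep (this.1 h)
            simp [filterStep, hv, e1, hm, hkl, hI, hJ, e2, hc, e3, h0, hkeep]
      obtain ⟨ρ, hρ, r1, r2, r3⟩ := hden
      rw [hρ, htake]
      by_cases hkeep : keep l[k] = true
      · rw [if_pos hkeep, if_pos hkeep]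
        refine ⟨by simp [h1], fun m hm' => ?_, fun m hm' hkm => ?_⟩
        · by_cases hml : m < ((l.take k).filter keep).length
          · rw [List.getElem_append_left hml]
            have : m ≠ τ.idx vKept 0 := by omega
            simpa [this, r1, r2] using h2 m hml
          · have hm2 : m = ((l.take k).filter keep).length := by simp at hm' hml; omega
            subst hm2
            simp [h1]
        · have : m ≠ τ.idx vKept 0 := by omega
          simpa [this, r1, r2] using h3 m hm' (by omega)
      · rw [if_neg hkeep, if_neg hkeep, List.append_nil]
        refine ⟨by simp [h1, r3], fun m hm' => by simpa [r1, r2] using h2 m hm', fun m hm' hkm => ?_⟩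
        simpa [r1, r2] using h3 m hm' (by omega)
    · have e : filterStep.den τ = τ := by
        rw [filterStep, den_when_neg]
        simp [hv, e1, hm]
        omega
      rw [e, List.take_of_length_le (by omega)]
      rw [List.take_of_length_le (by omega)] at h1 h2
      exact ⟨by simpa using h1, fun m h => by simpa using h2 m h, fun m h hkm => by omega⟩

/-- Pruning on the machine: an edge is kept if `g_L` does not divide the number of vertices on the
side of the child. -/
theorem prune_spec (hs : Static L w σ) (hg : 0 < gcdOf L) (hl : ListsForest σ F)
    (hF : (edgeGraph F).IsAcyclic) (hd : ∀ e ∈ F, ¬ e.IsDiag)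
    (hdvd : ∀ v, gcdOf L ∣ (component F v).card) :
    Static L w (prune.den σ) ∧ ListsForest (prune.den σ) (gwPrune (properFun L) F) := by
  classical
  refine ⟨hs.congr (agree_den prune σ) (by decide) (by decide), ?_⟩
  have e : prune.den σ = filterEdges.den (subtreeSizes.den (explore.den σ)) := by
    simp only [prune, den_block_cons, den_block_nil]
  rw [e]
  obtain ⟨ord, par, root, segs, h, hlen, hall⟩ := explore_spec hs.n_eq hl hF hd
  have hs1 : Static L w (explore.den σ) := hs.congr (agree_den explore σ) (by decide) (by decide)
  generalize explore.den σ = τ at *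
  have hsub := fun x (hx : par x ≠ x) => subtreeSizes_spec hs1 hg h hlen hall hF hx
  have hag := agree_den subtreeSizes τ
  have h2 := h.congr hag (by decide)
  have hs2 : Static L w (subtreeSizes.den τ) := hs1.congr hag (by decide) (by decide)
  generalize subtreeSizes.den τ = ρ at *
  have hcard := card_le_of_acyclic hF hd
  have hm := h2.list.card_eq
  obtain ⟨l, hll, hnd, hlF⟩ := h2.list
  have hmemF : ∀ p ∈ l, s(p.1, p.2) ∈ F := by
    intro p hp
    rw [← hlF, List.mem_toFinset]
    exact List.mem_map.2 ⟨p, hp, rfl⟩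
  have hkeepF : ∀ p ∈ l, (s(p.1, p.2) ∈ gwPrune (properFun L) F ↔ ¬ gcdOf L ∣ sideCard F p.1 p.2) := by
    intro p hp
    refine mem_gwPrune_iff hF hdvd (hmemF p hp) ?_
    simpa using hd _ (hmemF p hp)
  refine ⟨l.filter fun p => decide (¬ gcdOf L ∣ sideCard F p.1 p.2),
    filterEdges_spec hs2.n_eq hll (by rw [← hll.1, hm]; exact hcard) _ ?_, ?_, ?_⟩
  · intro p hp
    have hpar : ρ.idx aPar p.1 = par p.1 := h2.par_eq _ (hall _)
    have hne : p.1 ≠ p.2 := by simpa using hd _ (hmemF p hp)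
    have hmod : ∀ a, 1 ≤ a % gcdOf L ↔ ¬ gcdOf L ∣ a := fun a => by
      rw [Nat.dvd_iff_mod_eq_zero]; omega
    rw [hpar]
    constructor
    · intro hc
      have hc' : par p.1 = p.2 := Fin.ext hc
      rw [hsub p.1 (by rw [hc']; exact hne.symm), hc', hmod, decide_eq_true_eq]
      have h3 := sideCard_add_sideCard hF (hmemF p hp) hne
      have h4 := hdvd p.1
      rw [← h3] at h4
      exact not_congr ⟨fun h => (Nat.dvd_add_left h).1 h4, fun h => (Nat.dvd_add_right h).1 h4⟩
    · intro hc
      have hc' : par p.2 = p.1 := by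
        obtain ⟨z, -, -, hz⟩ := h.explored.exists_par _ (hmemF p hp)
        rcases Sym2.eq_iff.1 hz with ⟨h5, h6⟩ | ⟨h5, h6⟩
        · exact absurd (by rw [h5, h6]) hc
        · rw [h5, h6]
      rw [hsub p.2 (by rw [hc']; exact hne), hc', hmod, decide_eq_true_eq]
  · exact hnd.sublist (List.filter_sublist.map _)
  · ext e
    rw [List.mem_toFinset, List.mem_map]
    constructor
    · rintro ⟨p, hp, rfl⟩
      rw [List.mem_filter, decide_eq_true_eq] at hp
      exact (hkeepF p hp.1).2 hp.2
    · intro he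
      have heF := gwPrune_subset _ _ he
      rw [← hlF, List.mem_toFinset, List.mem_map] at heF
      obtain ⟨p, hp, rfl⟩ := heF
      exact ⟨p, List.mem_filter.2 ⟨hp, decide_eq_true ((hkeepF p hp).1 he)⟩, rfl⟩

end RAM

/-! ### Repairing illegal components on the machine -/

namespace CycleCover

variable {V : Type*} [DecidableEq V]

/-- Added edges whose endpoints are connected anyway can be removed one by one. -/
theorem breakSteps_of_reachable {A H : Finset (Sym2 V)} (D : Finset (Sym2 V)) (hDA : D ⊆ A)
    (hDH : Disjoint H D) (hd : ∀ e ∈ D, ¬ e.IsDiag)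
    (h : ∀ u v, s(u, v) ∈ D → (edgeGraph H).Reachable u v) :
    Relation.ReflTransGen (BreakStep A) (H ∪ D) H := by
  induction D using Finset.induction_on with
  | empty => rw [Finset.union_empty]
  | insert e D he ih =>
    have heH : e ∉ H := fun h' => (Finset.disjoint_left.1 hDH h') (Finset.mem_insert_self _ _)
    have hsub := Finset.subset_insert e D
    refine Relation.ReflTransGen.head ?_ (ih (hsub.trans hDA) (hDH.mono_right hsub)
      (fun x hx => hd x (hsub hx)) fun u v hx => h u v (hsub hx))
    refine ⟨e, hDA (Finset.mem_insert_self _ _), ?_, ?_⟩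
    · induction e with | h u v =>
      refine SimpleGraph.adj_and_reachable_delete_edges_iff_exists_cycle.1 ⟨?_, ?_⟩
      · refine edgeGraph_adj.2 ⟨by simp, by simpa using hd _ (Finset.mem_insert_self _ _)⟩
      · rw [← edgeGraph_erase]
        refine (h u v (Finset.mem_insert_self _ _)).mono (edgeGraph_mono fun x hx => ?_)
        rw [Finset.mem_erase]
        exact ⟨fun h' => heH (h' ▸ hx), Finset.mem_union_left _ hx⟩
    · ext x
      simp only [Finset.mem_union, Finset.mem_erase, Finset.mem_insert]
      constructor
      · rintro (hx | hx)
        · exact ⟨fun h' => heH (h' ▸ hx), Or.inl hx⟩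
        · exact ⟨fun h' => he (h' ▸ hx), Or.inr (Or.inr hx)⟩
      · tauto

/-- Labels of the components after a new edge `{a, b}` is added. -/
theorem label_insert_iff {α : Type*} [DecidableEq α] {H : Finset (Sym2 V)} {lab : V → α}
    (h : ∀ u v, lab u = lab v ↔ (edgeGraph H).Reachable u v) {a b : V} (hab : a ≠ b) (u v : V) :
    ((if lab u = lab b then lab a else lab u) = if lab v = lab b then lab a else lab v) ↔
      (edgeGraph (insert s(a, b) H)).Reachable u v := by
  have hmono : edgeGraph H ≤ edgeGraph (insert s(a, b) H) :=
    edgeGraph_mono (Finset.subset_insert _ _)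
  have hadj : (edgeGraph (insert s(a, b) H)).Reachable a b :=
    (edgeGraph_adj.2 ⟨Finset.mem_insert_self _ _, hab⟩).reachable
  have hr : ∀ x y, lab x = lab y → (edgeGraph (insert s(a, b) H)).Reachable x y :=
    fun x y hxy => ((h x y).1 hxy).mono hmono
  constructor
  · intro he
    split_ifs at he with h1 h2 h2
    · exact hr u v (h1.trans h2.symm)
    · exact (hr u b h1).trans (hadj.symm.trans (hr a v he))
    · exact (hr u a he).trans (hadj.trans (hr b v h2.symm))
    · exact hr u v he
  · rintro ⟨p⟩
    induction p with
    | nil => rfl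
    | @cons x y z hxy q ih =>
      rw [← ih]
      obtain ⟨h1, h2⟩ := edgeGraph_adj.1 hxy
      rcases Finset.mem_insert.1 h1 with h1 | h1
      · rcases Sym2.eq_iff.1 h1 with ⟨rfl, rfl⟩ | ⟨rfl, rfl⟩ <;> simp
      · have := (h x y).2 (edgeGraph_adj.2 ⟨h1, h2⟩).reachable
        simp only [this]

end CycleCover

namespace RAM

open Code CycleCover

variable {n : ℕ} {F : Finset (Sym2 (Fin n))} {σ : Store} {L : Set ℕ} {w : Sym2 (Fin n) → ℕ}
  {ord : List (Fin n)} {par root : Fin n → Fin n} {segs : List (List (Fin n))}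

theorem ExploreInv.cnt_root {E : Finset (Sym2 (Fin n))} (h : ExploreInv σ F ord par root segs E)
    (hall : ∀ v, v ∈ ord) (u : Fin n) : σ.idx aCnt (root u) = (component F u).card := by
  rw [h.cnt, List.countP_eq_length_filter, ← List.toFinset_card_of_nodup (h.explored.nodup.filter _)]
  congr 1
  ext v
  rw [List.mem_toFinset, List.mem_filter, decide_eq_true_eq, mem_component,
    ← h.explored.root_eq_iff hall]
  exact ⟨fun hv => hv.2.symm, fun hv => ⟨hall v, hv.symm⟩⟩

theorem clearFlags_spec (hn : σ.idx 0 0 = n) (u : ℕ) (hu : u < n) :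
    (clearFlags.den σ).idx aFlag u = 0 := by
  have key := forTo_cells (v := vU) (n := n) (c := istore aFlag (.var vU) 0)
    (fun τ u => τ.idx aFlag u) (fun _ => 0) hn (by decide)
    (fun _ _ => by ext; simp) (fun k τ hk hv hag h => by simp +contextual [hv]) u
  rw [if_pos hu] at key
  exact key

/-- For the component with the root `r`, a lightest edge `{u, v}` that leaves it is stored. -/
def StoredCrossing (σ : Store) (L : Set ℕ) (F : Finset (Sym2 (Fin n))) (root : Fin n → Fin n)
    (r u v : Fin n) : Prop :=
  σ.idx aCandI r = u ∧ σ.idx aCandJ r = v ∧ root u = r ∧ root v ≠ r ∧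
    ¬ Admissible L (component F u).card

/-- The effect of considering the edge `{u, v}` as a candidate. -/
theorem offer_spec (hs : Static L w σ) (h : ExploreInv σ F ord par root segs F)
    (hall : ∀ v, v ∈ ord) {u v : Fin n} (hu : σ.idx vU 0 = u) (hv : σ.idx vV 0 = v)
    (hflag : σ.idx aFlag (root u) = 1 → ∃ a b : Fin n, a ≠ b ∧ σ.idx aCandI (root u) = a ∧
      σ.idx aCandJ (root u) = b) :
    (root u ≠ root v ∧ ¬ Admissible L (component F u).card ∧
      (σ.idx aFlag (root u) = 1 → ∀ a b : Fin n, σ.idx aCandI (root u) = a →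
        σ.idx aCandJ (root u) = b → w s(u, v) < w s(a, b)) ∧
      offer.den σ = ((σ.setIdx aFlag (root u) 1).setIdx aCandI (root u) u).setIdx aCandJ (root u) v) ∨
    (offer.den σ = σ ∧ (root u ≠ root v → ¬ Admissible L (component F u).card →
      σ.idx aFlag (root u) = 1 ∧ ∀ a b : Fin n, σ.idx aCandI (root u) = a →
        σ.idx aCandJ (root u) = b → w s(a, b) ≤ w s(u, v))) := by
  have hru : σ.idx aRoot u = root u := h.root_eq u (hall u)
  have hrv : σ.idx aRoot v = root v := h.root_eq v (hall v)
  have hcard : (component F u).card ≤ n := (Finset.card_le_univ _).trans (by simp)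
  have hadm : σ.idx aAdm (σ.idx aCnt (root u)) = 0 ↔ ¬ Admissible L (component F u).card := by
    rw [h.cnt_root hall]
    by_cases ha : Admissible L (component F u).card
    · simp [hs.adm _ hcard ha, ha]
    · simp [hs.not_adm _ hcard ha, ha]
  have hne : (root u : ℕ) = root v ↔ root u = root v := Fin.ext_iff.symm
  by_cases hc : ¬ root u = root v ∧ ¬ Admissible L (component F u).card
  · rw [offer, den_when_pos (by
      simpa only [Test.holds_and, Test.holds_not, Test.holds_ieq, IExpr.eval_load, IExpr.eval_var,
        hu, hv, hru, hrv, IExpr.eval_zero, hadm, hne] using hc)]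
    have huv : u ≠ v := by rintro rfl; exact hc.1 rfl
    have hw1 : σ.scal sWt (σ.idx aRow u + v) = w s(u, v) := by
      rw [hs.row u u.2.le, hs.wt u v huv]
    have hin : ∀ x : ℚ, σ.scal sWt (σ.idx aRow (σ.idx aCandI (root u)) +
        σ.idx aCandJ (root u)) = x → (Test.holds σ (.not (.and
          (.ieq (.load aFlag (.load aRoot (.var vU))) 1)
          (.sle (wtOf (.load aCandI (.load aRoot (.var vU))) (.load aCandJ (.load aRoot (.var vU))))
            (wtOf (.var vU) (.var vV))))) ↔
        ¬ (σ.idx aFlag (root u) = 1 ∧ x ≤ w s(u, v))) := by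
      rintro x rfl
      simp only [Test.holds_and, Test.holds_not, Test.holds_ieq, Test.holds_sle, IExpr.eval_load,
        IExpr.eval_var, hu, hv, hru, IExpr.eval_one, wtOf, SExpr.eval_load, IExpr.eval_add, hw1]
    by_cases hf : σ.idx aFlag (root u) = 1
    · obtain ⟨a, b, hab, hA, hB⟩ := hflag hf
      have hw2 : σ.scal sWt (σ.idx aRow a + b) = w s(a, b) := by
        rw [hs.row a a.2.le, hs.wt a b hab]
      have hin' := hin (w s(a, b)) (by rw [hA, hB, hw2])
      by_cases hle : w s(a, b) ≤ w s(u, v)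
      · right
        have : (w s(a, b) : ℚ) ≤ w s(u, v) := by exact_mod_cast hle
        rw [den_when_neg (by rw [hin']; simp [hf, this])]
        refine ⟨rfl, fun _ _ => ⟨hf, fun a' b' ha hb => ?_⟩⟩
        rw [← Fin.ext (hA.symm.trans ha), ← Fin.ext (hB.symm.trans hb)]
        exact hle
      · left
        have : ¬ (w s(a, b) : ℚ) ≤ w s(u, v) := by exact_mod_cast hle
        rw [den_when_pos (by rw [hin']; simp [this])]
        refine ⟨hc.1, hc.2, fun _ a' b' ha hb => ?_, ?_⟩
        · rw [← Fin.ext (hA.symm.trans ha), ← Fin.ext (hB.symm.trans hb)]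
          exact not_le.1 hle
        · simp [hu, hv, hru]
    · left
      rw [den_when_pos (by rw [hin _ rfl]; simp [hf])]
      refine ⟨hc.1, hc.2, fun h => absurd h hf, ?_⟩
      simp [hu, hv, hru]
  · right
    rw [offer, den_when_neg (by
      simpa only [Test.holds_and, Test.holds_not, Test.holds_ieq, IExpr.eval_load, IExpr.eval_var,
        hu, hv, hru, hrv, IExpr.eval_zero, hadm, hne] using hc)]
    exact ⟨rfl, fun h1 h2 => absurd ⟨h1, h2⟩ hc⟩

/-- After all pairs have been considered, a lightest leaving edge is stored for every component that is
illegal and does not contain all vertices. -/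
theorem findLightest_spec (hs : Static L w σ) (h : ExploreInv σ F ord par root segs F)
    (hall : ∀ v, v ∈ ord) :
    (∀ r : Fin n, (findLightest.den σ).idx aFlag r ≠ 0 → (findLightest.den σ).idx aFlag r = 1 ∧
      ∃ a b, StoredCrossing (findLightest.den σ) L F root r a b) ∧
    ∀ u v : Fin n, root u ≠ root v → ¬ Admissible L (component F u).card →
      (findLightest.den σ).idx aFlag (root u) = 1 ∧
      ∀ a b, StoredCrossing (findLightest.den σ) L F root (root u) a b → w s(a, b) ≤ w s(u, v) := by
  have e : findLightest.den σ = (forTo vU 0 (forTo vV 0 offer)).den (clearFlags.den σ) := by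
    simp only [findLightest, den_block_cons, den_block_nil]
  rw [e]
  have hini := clearFlags_spec hs.n_eq
  have hag := agree_den clearFlags σ
  have hs1 : Static L w (clearFlags.den σ) := hs.congr hag (by decide) (by decide)
  have h1 := h.congr hag (by decide)
  generalize clearFlags.den σ = τ at *
  have key := forTo_pairs (c := offer) hs1.n_eq (by decide) (by decide) (by decide)
    (fun ρ => ∀ r : Fin n, ρ.idx aFlag r ≠ 0 → ρ.idx aFlag r = 1 ∧
      ∃ a b, StoredCrossing ρ L F root r a b)
    (fun ρ i j => ∀ u v : Fin n, (u : ℕ) = i → (v : ℕ) = j → root u ≠ root v →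
      ¬ Admissible L (component F u).card → ρ.idx aFlag (root u) = 1 ∧
      ∀ a b, StoredCrossing ρ L F root (root u) a b → w s(a, b) ≤ w s(u, v)) ?_ ?_ ?_ ?_
  · exact ⟨key.1, fun u v => key.2 u v u.2 v.2 u v rfl rfl⟩
  · rintro ρ v x (rfl | rfl) hQ <;> simpa [StoredCrossing] using hQ
  · rintro ρ v x i j (rfl | rfl) hP <;> simpa [StoredCrossing] using hP
  · intro r hr
    exact absurd (hini r r.2) hr
  · intro ρ i j hi hj hU hV hag' hQ
    have hsρ : Static L w ρ := hs1.congr hag' (by decide) (by decide)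
    have hρ := h1.congr hag' (by decide)
    obtain ⟨u, rfl⟩ : ∃ u : Fin n, (u : ℕ) = i := ⟨⟨i, hi⟩, rfl⟩
    obtain ⟨v, rfl⟩ : ∃ v : Fin n, (v : ℕ) = j := ⟨⟨j, hj⟩, rfl⟩
    rcases offer_spec hsρ hρ hall hU hV (fun hf => by
      obtain ⟨-, a, b, h2, h3, h4, h5, -⟩ := hQ (root u) (by omega)
      exact ⟨a, b, by rintro rfl; exact h5 h4, h2, h3⟩) with ⟨o1, o2, o3, o4⟩ | ⟨o1, o2⟩
    · rw [o4]
      have hflag : ∀ r : Fin n, (((ρ.setIdx aFlag (root u) 1).setIdx aCandI (root u) u).setIdx aCandJ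
          (root u) v).idx aFlag r = if r = root u then 1 else ρ.idx aFlag r := by
        intro r
        by_cases hr : r = root u
        · simp [hr]
        · have : (r : ℕ) ≠ root u := fun he => hr (Fin.ext he)
          simp [hr, this]
      have hsc : ∀ r a b : Fin n, r ≠ root u → (StoredCrossing (((ρ.setIdx aFlag (root u) 1).setIdx
          aCandI (root u) u).setIdx aCandJ (root u) v) L F root r a b ↔
          StoredCrossing ρ L F root r a b) := by
        intro r a b hr
        have : (r : ℕ) ≠ root u := fun he => hr (Fin.ext he)
        simp [StoredCrossing, this]
      have hsc' : ∀ a b : Fin n, (StoredCrossing (((ρ.setIdx aFlag (root u) 1).setIdx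
          aCandI (root u) u).setIdx aCandJ (root u) v) L F root (root u) a b ↔ a = u ∧ b = v) := by
        intro a b
        simp only [StoredCrossing, Store.setIdx_idx]
        norm_num
        constructor
        · rintro ⟨h1, h2, -⟩
          exact ⟨Fin.ext h1.symm, Fin.ext h2.symm⟩
        · rintro ⟨rfl, rfl⟩
          exact ⟨rfl, rfl, rfl, fun h => o1 h.symm, o2⟩
      refine ⟨?_, ?_, ?_⟩
      · intro r hr
        by_cases hru : r = root u
        · subst hru
          exact ⟨by rw [hflag, if_pos rfl], u, v, (hsc' u v).2 ⟨rfl, rfl⟩⟩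
        · rw [hflag, if_neg hru] at hr ⊢
          obtain ⟨h2, a, b, h3⟩ := hQ r hr
          exact ⟨h2, a, b, (hsc r a b hru).2 h3⟩
      · intro u' v' hu' hv' _ _
        obtain rfl := Fin.ext hu'
        obtain rfl := Fin.ext hv'
        refine ⟨by rw [hflag, if_pos rfl], fun a b hab => ?_⟩
        obtain ⟨rfl, rfl⟩ := (hsc' a b).1 hab
        exact le_rfl
      · intro i' j' _ _ hP u' v' hu' hv' hne hna
        obtain ⟨h2, h3⟩ := hP u' v' hu' hv' hne hna
        rw [hflag]
        by_cases hru : root u' = root u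
        · refine ⟨by rw [if_pos hru], fun a b hab => ?_⟩
          rw [hru] at hab h2 h3
          obtain ⟨rfl, rfl⟩ := (hsc' a b).1 hab
          obtain ⟨-, a', b', h4⟩ := hQ (root a) (by omega)
          exact (o3 h2 a' b' h4.1 h4.2.1).le.trans (h3 a' b' h4)
        · exact ⟨by rw [if_neg hru]; exact h2, fun a b hab => h3 a b ((hsc _ a b hru).1 hab)⟩
    · rw [o1]
      refine ⟨hQ, ?_, fun i' j' _ _ hP => hP⟩
      intro u' v' hu' hv' hne hna
      obtain rfl := Fin.ext hu'
      obtain rfl := Fin.ext hv'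
      obtain ⟨h2, h3⟩ := o2 hne hna
      exact ⟨h2, fun a b hab => h3 a b hab.1 hab.2.1⟩

end RAM

namespace RAM

open Code CycleCover

variable {n : ℕ} {F : Finset (Sym2 (Fin n))} {σ : Store} {L : Set ℕ} {w : Sym2 (Fin n) → ℕ}

theorem uniteRoots_spec (hn : σ.idx 0 0 = n) (u : ℕ) :
    (uniteRoots.den σ).idx aRoot u = if u < n then
      (if σ.idx aRoot u = σ.idx vD 0 then σ.idx vC 0 else σ.idx aRoot u) else σ.idx aRoot u := by
  unfold uniteRoots
  refine forTo_cells (v := vU) (fun τ => τ.idx aRoot)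
    (fun u => if σ.idx aRoot u = σ.idx vD 0 then σ.idx vC 0 else σ.idx aRoot u) hn (by decide)
    (fun _ _ => by ext; simp) ?_ u
  intro k τ hk hv hag ih
  simp only [den_when, Test.holds_ieq, IExpr.eval_load, IExpr.eval_var, hv, ih,
    hag.idx vD (by decide)]
  split_ifs with hc
  · simp +contextual [hv, hag.idx vC (by decide)]
  · simp [ih]

/-- The store `τ` after the edges `{cu r, cv r}` of the flagged components `r < k` have been
considered: the forest `H` is stored, and `aRoot` labels its components. -/
structure LinkInv (σ : Store) (F : Finset (Sym2 (Fin n))) (cu cv : Fin n → Fin n) (k : ℕ)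
    (τ : Store) (H : Finset (Sym2 (Fin n))) : Prop where
  list : ListsForest τ H
  acyclic : (edgeGraph H).IsAcyclic
  not_diag : ∀ e ∈ H, ¬ e.IsDiag
  sub : F ⊆ H
  mem : ∀ e ∈ H, e ∈ F ∨ ∃ r : Fin n, σ.idx aFlag r = 1 ∧ e = s(cu r, cv r)
  lab : ∀ u v : Fin n, τ.idx aRoot u = τ.idx aRoot v ↔ (edgeGraph H).Reachable u v
  done : ∀ r : Fin n, (r : ℕ) < k → σ.idx aFlag r = 1 → (edgeGraph H).Reachable (cu r) (cv r)

/-- Adding the stored edges one by one, except those that would close a cycle. -/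
theorem linkLightest_spec (hn : σ.idx 0 0 = n) (hl : ListsForest σ F)
    (hF : (edgeGraph F).IsAcyclic) (hd : ∀ e ∈ F, ¬ e.IsDiag)
    (hlab : ∀ u v : Fin n, σ.idx aRoot u = σ.idx aRoot v ↔ (edgeGraph F).Reachable u v)
    (cu cv : Fin n → Fin n)
    (hc : ∀ r : Fin n, σ.idx aFlag r = 1 → σ.idx aCandI r = cu r ∧ σ.idx aCandJ r = cv r) :
    ∃ H, LinkInv σ F cu cv n (linkLightest.den σ) H := by
  refine forTo_n (v := vK) (c := link) (by decide) hn
    (fun k τ => ∃ H, LinkInv σ F cu cv k τ H) ?_ ?_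
  · refine ⟨F, ?_, hF, hd, subset_rfl, fun e he => Or.inl he, ?_, ?_⟩
    · exact hl.congr (by ext; simp) (by ext; simp) (by ext; simp)
    · simpa using hlab
    · simp
  · rintro k τ hk hv hag ⟨H, h⟩
    obtain ⟨r, rfl⟩ : ∃ r : Fin n, (r : ℕ) = k := ⟨⟨k, hk⟩, rfl⟩
    have hset : ∀ {ρ : Store} {H'}, LinkInv σ F cu cv (r + 1) ρ H' →
        LinkInv σ F cu cv (r + 1) (ρ.setIdx vK 0 (r + 1)) H' := fun h' =>
      ⟨h'.list.congr (by ext; simp) (by ext; simp) (by ext; simp), h'.acyclic, h'.not_diag, h'.sub,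
        h'.mem, by simpa using h'.lab, h'.done⟩
    have eF : τ.idx aFlag = σ.idx aFlag := hag.idx aFlag (by decide)
    have eI : τ.idx aCandI = σ.idx aCandI := hag.idx aCandI (by decide)
    have eJ : τ.idx aCandJ = σ.idx aCandJ := hag.idx aCandJ (by decide)
    by_cases hf : σ.idx aFlag r = 1
    · obtain ⟨hI, hJ⟩ := hc r hf
      rw [link, den_when_pos (by simpa [hv, eF] using hf)]
      by_cases hr : (edgeGraph H).Reachable (cu r) (cv r)
      · rw [den_when_neg (by simpa [hv, eI, eJ, hI, hJ] using (h.lab _ _).2 hr)]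
        refine ⟨H, hset { h with done := fun r' hr' hf' => ?_ }⟩
        rcases Nat.lt_succ_iff_lt_or_eq.1 hr' with h1 | h1
        · exact h.done r' h1 hf'
        · rw [Fin.ext h1]; exact hr
      · rw [den_when_pos (by simpa [hv, eI, eJ, hI, hJ] using mt (h.lab _ _).1 hr)]
        have hne : cu r ≠ cv r := fun he => hr (by rw [he])
        have hH : s(cu r, cv r) ∉ H := fun he => hr (edgeGraph_adj.2 ⟨he, hne⟩).reachable
        simp only [den_block_cons, den_block_nil, den_istore, den_assign, IExpr.eval_var,
          IExpr.eval_load, hv, eI, hI]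
        norm_num [hv, eI, eJ, hI, hJ]
        generalize hρ : (((((τ.setIdx aEdgeI (τ.idx vM 0) (cu r)).setIdx aEdgeJ (τ.idx vM 0)
          (cv r)).setIdx vM 0 (τ.idx vM 0 + 1)).setIdx vC 0 (τ.idx aRoot (cu r))).setIdx vD 0
          (τ.idx aRoot (cv r))) = ρ
        have hagρ := agree_den uniteRoots ρ
        have hnρ : ρ.idx 0 0 = n := by rw [← hρ]; simp [hag.idx 0 (by decide), hn]
        have hroot := uniteRoots_spec hnρ
        refine ⟨insert s(cu r, cv r) H, hset ⟨?_, ?_, ?_, ?_, ?_, ?_, ?_⟩⟩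
        · refine h.list.append (cu r) (cv r) hH ?_ ?_ ?_
          · rw [hagρ.idx vM (by decide), ← hρ]; simp
          · intro k; rw [hagρ.idx aEdgeI (by decide), ← hρ]; simp
          · intro k; rw [hagρ.idx aEdgeJ (by decide), ← hρ]; simp
        · exact acyclic_insert h.acyclic hr
        · intro e he
          rcases Finset.mem_insert.1 he with rfl | he
          · simpa using hne
          · exact h.not_diag e he
        · exact h.sub.trans (Finset.subset_insert _ _)
        · intro e he
          rcases Finset.mem_insert.1 he with rfl | he
          · exact Or.inr ⟨r, hf, rfl⟩
          · exact h.mem e he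
        · intro u v
          rw [← label_insert_iff h.lab hne u v, hroot, hroot, if_pos u.2, if_pos v.2, ← hρ]
          simp
        · intro r' hr' hf'
          rcases Nat.lt_succ_iff_lt_or_eq.1 hr' with h1 | h1
          · exact (h.done r' h1 hf').mono (edgeGraph_mono (Finset.subset_insert _ _))
          · rw [Fin.ext h1]
            exact (edgeGraph_adj.2 ⟨Finset.mem_insert_self _ _, hne⟩).reachable
    · rw [link, den_when_neg (by simpa [hv, eF] using hf)]
      refine ⟨H, hset { h with done := fun r' hr' hf' => ?_ }⟩
      rcases Nat.lt_succ_iff_lt_or_eq.1 hr' with h1 | h1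
      · exact h.done r' h1 hf'
      · rw [Fin.ext h1] at hf'; exact absurd hf' hf

/-- One phase on the machine. Skipping edges that close a cycle has the same result as adding all edges
and then breaking the cycles. -/
theorem phase_spec (hs : Static L w σ) (hl : ListsForest σ F) (hF : (edgeGraph F).IsAcyclic)
    (hd : ∀ e ∈ F, ¬ e.IsDiag) (hadm : Admissible L n) :
    ∃ H, Static L w (phase.den σ) ∧ ListsForest (phase.den σ) H ∧ (edgeGraph H).IsAcyclic ∧
      (∀ e ∈ H, ¬ e.IsDiag) ∧ ((illegal L F).Nonempty → Phase L w F H) ∧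
      (illegal L F = ∅ → H = F) := by
  have hs' := hs.congr (agree_den phase σ) (by decide) (by decide)
  have e : phase.den σ = linkLightest.den (findLightest.den (explore.den σ)) := by
    simp only [phase, den_block_cons, den_block_nil]
  rw [e] at hs' ⊢
  obtain ⟨ord, par, root, segs, h, -, hall⟩ := explore_spec hs.n_eq hl hF hd
  have hs1 := hs.congr (agree_den explore σ) (by decide) (by decide)
  generalize explore.den σ = σ₁ at *
  have hag2 := agree_den findLightest σ₁
  obtain ⟨hfl, hmin⟩ := findLightest_spec hs1 h hall
  have h2 := h.congr hag2 (by decide)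
  have hs2 := hs1.congr hag2 (by decide) (by decide)
  generalize findLightest.den σ₁ = σ₂ at *
  have hcand : ∀ r : Fin n, ∃ a b : Fin n, σ₂.idx aFlag r = 1 → StoredCrossing σ₂ L F root r a b := by
    intro r
    by_cases hr : σ₂.idx aFlag r = 1
    · obtain ⟨-, a, b, hab⟩ := hfl r (by omega)
      exact ⟨a, b, fun _ => hab⟩
    · exact ⟨r, r, fun h => absurd h hr⟩
  choose cu cv hc using hcand
  have hiff : ∀ u v, root u = root v ↔ (edgeGraph F).Reachable u v := fun u v =>
    h2.explored.root_eq_iff hall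
  obtain ⟨H, hH⟩ := linkLightest_spec hs2.n_eq h2.list hF hd (fun u v => by
    rw [h2.root_eq u (hall u), h2.root_eq v (hall v), ← hiff, Fin.ext_iff]) cu cv
    (fun r hr => ⟨(hc r hr).1, (hc r hr).2.1⟩)
  have hill : ∀ r : Fin n, σ₂.idx aFlag r = 1 → component F (cu r) ∈ illegal L F := fun r hr =>
    mem_illegal.2 ⟨mem_components.2 ⟨_, rfl⟩, (hc r hr).2.2.2.2⟩
  refine ⟨H, hs', hH.list, hH.acyclic, hH.not_diag, ?_, ?_⟩
  · rintro hne
    -- the edges stored for the illegal components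
    have hlight : ∀ S ∈ illegal L F, ∃ r : Fin n, σ₂.idx aFlag r = 1 ∧ (∀ u ∈ S, root u = r) ∧
        IsLightestCrossing w S s(cu r, cv r) := by
      intro S hS
      obtain ⟨hS1, hS2⟩ := mem_illegal.1 hS
      obtain ⟨u₀, rfl⟩ := mem_components.1 hS1
      have hmem : ∀ u, u ∈ component F u₀ ↔ root u = root u₀ := fun u => by
        rw [mem_component, ← hiff, eq_comm]
      obtain ⟨v₀, hv₀⟩ : ∃ v₀, v₀ ∉ component F u₀ := by
        by_contra! hcon
        refine hS2 ?_
        rw [Finset.eq_univ_of_forall hcon]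
        simpa using hadm
      have hf := (hmin u₀ v₀ (fun he => hv₀ ((hmem _).2 he.symm)) hS2).1
      have hst := hc _ hf
      refine ⟨root u₀, hf, fun u hu => (hmem u).1 hu, ⟨_, (hmem _).2 hst.2.2.1, _,
        fun hv => hst.2.2.2.1 ((hmem _).1 hv), rfl⟩, ?_⟩
      rintro _ ⟨u, hu, v, hv, rfl⟩
      have hu' := (hmem u).1 hu
      have hc' : component F u = component F u₀ :=
        component_eq_iff.2 ((hiff _ _).1 hu')
      refine (hmin u v (fun he => hv ((hmem v).2 (he.symm.trans hu'))) (by rw [hc']; exact hS2)).2 _ _ ?_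
      rw [hu']
      exact hst
    obtain ⟨S₀, hS₀⟩ := hne
    obtain ⟨r₀, -⟩ := hlight S₀ hS₀
    have : Nonempty (Fin n) := ⟨r₀⟩
    choose! r hr1 hr2 hr3 using hlight
    refine ⟨⟨S₀, hS₀⟩, fun S => s(cu (r S), cv (r S)), hr3, ?_, hH.acyclic⟩
    set A := (illegal L F).image fun S => s(cu (r S), cv (r S)) with hA
    have hHA : H ⊆ F ∪ A := by
      intro e he
      rcases hH.mem e he with he | ⟨q, hq, rfl⟩
      · exact Finset.mem_union_left _ he
      · refine Finset.mem_union_right _ (Finset.mem_image.2 ⟨_, hill q hq, ?_⟩)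
        have : q = r (component F (cu q)) :=
          (hc q hq).2.2.1.symm.trans (hr2 _ (hill q hq) _ (mem_component.2 .rfl))
        rw [← this]
    have hun : F ∪ A = H ∪ (A \ H) := by
      ext x
      have h1 := @hH.sub x
      have h2 := @hHA x
      simp only [Finset.mem_union, Finset.mem_sdiff] at h2 ⊢
      tauto
    have hAr : ∀ e ∈ A, ∃ S ∈ illegal L F, e = s(cu (r S), cv (r S)) := fun e he => by
      obtain ⟨S, hS, rfl⟩ := Finset.mem_image.1 he
      exact ⟨S, hS, rfl⟩
    rw [hun]
    refine breakSteps_of_reachable _ Finset.sdiff_subset Finset.disjoint_sdiff ?_ ?_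
    · intro e he
      obtain ⟨S, hS, rfl⟩ := hAr e (Finset.mem_sdiff.1 he).1
      have hst := hc _ (hr1 S hS)
      rw [Sym2.mk_isDiag_iff]
      intro heq
      exact hst.2.2.2.1 (by rw [← heq]; exact hst.2.2.1)
    · intro u v huv
      obtain ⟨S, hS, he⟩ := hAr _ (Finset.mem_sdiff.1 huv).1
      have hre := hH.done (r S) (r S).2 (hr1 S hS)
      rcases Sym2.eq_iff.1 he with ⟨rfl, rfl⟩ | ⟨rfl, rfl⟩
      · exact hre
      · exact hre.symm
  · intro hem
    refine (Finset.Subset.antisymm hH.sub fun e he => ?_).symm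
    rcases hH.mem e he with he | ⟨q, hq, rfl⟩
    · exact he
    · have := hill q hq
      rw [hem] at this
      simp at this

/-- After `frob L` phases no component is illegal. -/
theorem phases_spec (hs : Static L w σ) {F₀ : Finset (Sym2 (Fin n))} (hl : ListsForest σ F₀)
    (hF : GoeWill w (properFun L) F₀) (hadm : Admissible L n) :
    ∃ F, Static L w (phases.den σ) ∧ ListsForest (phases.den σ) F ∧
      Relation.ReflTransGen (Phase L w) F₀ F ∧ illegal L F = ∅ ∧ (edgeGraph F).IsAcyclic ∧
      ∀ e ∈ F, ¬ e.IsDiag := by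
  have key := forTo_rule (v := vPhase) (a := vPhases) (c := phase) (by decide) σ
    (fun k τ => ∃ F, ListsForest τ F ∧ Relation.ReflTransGen (Phase L w) F₀ F ∧
      (edgeGraph F).IsAcyclic ∧ (∀ e ∈ F, ¬ e.IsDiag) ∧ (illegal L F = ∅ ∨ PhaseInv L F k)) ?_ ?_
  · rw [hs.phases] at key
    obtain ⟨F, h1, h2, h3, h4, h5⟩ := key
    refine ⟨F, hs.congr (agree_den phases σ) (by decide) (by decide), h1, h2, ?_, h3, h4⟩
    rcases h5 with h5 | h5
    · exact h5
    · by_contra hne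
      have := h5.le_frob (Finset.nonempty_iff_ne_empty.2 hne)
      omega
  · exact ⟨F₀, hl.congr (by ext; simp) (by ext; simp) (by ext; simp), .refl, hF.phaseInv.acyclic,
      hF.phaseInv.not_diag, Or.inr hF.phaseInv⟩
  · rintro k τ - hv hag ⟨F, h1, h2, h3, h4, h5⟩
    obtain ⟨H, -, g1, g2, g3, g4, g5⟩ :=
      phase_spec (hs.congr hag (by decide) (by decide)) h1 h3 h4 hadm
    have g1' : ListsForest ((phase.den τ).setIdx vPhase 0 (k + 1)) H :=
      g1.congr (by ext; simp) (by ext; simp) (by ext; simp)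
    by_cases hne : illegal L F = ∅
    · obtain rfl := g5 hne
      exact ⟨H, g1', h2, g2, g3, Or.inl hne⟩
    · have hph := g4 (Finset.nonempty_iff_ne_empty.2 hne)
      exact ⟨H, g1', h2.tail hph, g2, g3, Or.inr (hph.phaseInv (h5.resolve_left hne))⟩

end RAM

/-! ### Output of the cycles -/

namespace CycleCover

variable {V : Type*}

theorem mem_tourEdges_iff {b : List V} {e : Sym2 V} :
    e ∈ tourEdges b ↔ ∃ (j : ℕ) (h : j < b.length),
      e = s(b[j], b[(j + 1) % b.length]'(Nat.mod_lt _ (by omega))) := by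
  unfold tourEdges
  rw [List.mem_iff_getElem]
  simp only [List.length_zipWith, List.length_rotate, min_self, List.getElem_zipWith,
    List.getElem_rotate]
  exact ⟨fun ⟨j, h, he⟩ => ⟨j, h, he.symm⟩, fun ⟨j, h, he⟩ => ⟨j, h, he.symm⟩⟩

end CycleCover

namespace RAM

open Code CycleCover

variable {n : ℕ} {F : Finset (Sym2 (Fin n))} {σ : Store} {L : Set ℕ} {w : Sym2 (Fin n) → ℕ}

/-- The edges written so far are those of the cycles through the paths `qs`. -/
def Emitted (τ : Store) (qs : List (List (Fin n))) : Prop :=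
  ∀ e : Sym2 ℕ, (∃ j < qs.flatten.length, e = s(τ.idx 2 j, τ.idx 3 j)) ↔
    ∃ q ∈ qs, ∃ e' ∈ tourEdges q, e = e'.map Fin.val

theorem Emitted.append {τ : Store} {qs : List (List (Fin n))} (h : Emitted τ qs)
    {q : List (Fin n)} (hq : ∀ (j : ℕ) (h : j < q.length), τ.idx 2 (qs.flatten.length + j) = q[j] ∧
      τ.idx 3 (qs.flatten.length + j) = q[(j + 1) % q.length]'(Nat.mod_lt _ (by omega))) :
    Emitted τ (qs ++ [q]) := by
  intro e
  have h1 : (∃ q' ∈ qs ++ [q], ∃ e' ∈ tourEdges q', e = e'.map Fin.val) ↔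
      (∃ q ∈ qs, ∃ e' ∈ tourEdges q, e = e'.map Fin.val) ∨ ∃ e' ∈ tourEdges q, e = e'.map Fin.val := by
    simp [or_and_right, exists_or]
  rw [h1, ← h e]
  constructor
  · rintro ⟨j, hj, rfl⟩
    by_cases hlt : j < qs.flatten.length
    · exact Or.inl ⟨j, hlt, rfl⟩
    · obtain ⟨m, rfl⟩ := Nat.exists_eq_add_of_le (not_lt.1 hlt)
      have hm : m < q.length := by simp at hj ⊢; omega
      exact Or.inr ⟨_, mem_tourEdges_iff.2 ⟨m, hm, rfl⟩, by simp [-List.length_flatten, hq m hm]⟩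
  · rintro (⟨j, hj, rfl⟩ | ⟨e', he', rfl⟩)
    · exact ⟨j, by simp at hj ⊢; omega, rfl⟩
    · obtain ⟨m, hm, rfl⟩ := mem_tourEdges_iff.1 he'
      exact ⟨qs.flatten.length + m, by simp; omega, by simp [-List.length_flatten, hq m hm]⟩

theorem Emitted.congr {τ ρ : Store} {qs : List (List (Fin n))} (h : Emitted τ qs)
    (he : ∀ j < qs.flatten.length, ρ.idx 2 j = τ.idx 2 j ∧ ρ.idx 3 j = τ.idx 3 j) :
    Emitted ρ qs := by
  intro e
  rw [← h e]
  constructor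
  · rintro ⟨j, hj, rfl⟩
    exact ⟨j, hj, by rw [(he j hj).1, (he j hj).2]⟩
  · rintro ⟨j, hj, rfl⟩
    exact ⟨j, hj, by rw [(he j hj).1, (he j hj).2]⟩

/-- Between two paths: the components `gs` have been cut into paths, and so has the part `ps` of
the current component, if there is one. -/
structure Between (L : Set ℕ) (segs : List (List (Fin n))) (k : ℕ) (τ : Store)
    (gs : List (List (List (Fin n)))) (ps : List (List (Fin n))) (post : List (Fin n))
    (rest : List (List (Fin n))) : Prop where
  left : τ.idx vCompLeft 0 = post.length
  path : τ.idx vPathLeft 0 = 0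
  mem : ∀ q ∈ gs.flatten ++ ps, q.length ∈ L
  pos : k = (gs.flatten ++ ps).flatten.length
  segs_eq : (post = [] ∧ ps = [] ∧ segs = gs.map List.flatten ++ rest) ∨
    (post ≠ [] ∧ segs = gs.map List.flatten ++ (ps.flatten ++ post) :: rest)
  adm : Admissible L post.length
  emitted : Emitted τ (gs.flatten ++ ps)

/-- Within a path, of which the vertices `cur` have been treated. -/
structure Within (L : Set ℕ) (segs : List (List (Fin n))) (k : ℕ) (τ : Store)
    (gs : List (List (List (Fin n)))) (ps : List (List (Fin n))) (cur post : List (Fin n))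
    (rest : List (List (Fin n))) : Prop where
  left : τ.idx vCompLeft 0 = post.length
  path_pos : 0 < τ.idx vPathLeft 0
  path_le : τ.idx vPathLeft 0 ≤ post.length
  path_mem : cur.length + τ.idx vPathLeft 0 ∈ L
  adm : Admissible L (post.length - τ.idx vPathLeft 0)
  mem : ∀ q ∈ gs.flatten ++ ps, q.length ∈ L
  start : τ.idx vStart 0 = (gs.flatten ++ ps).flatten.length
  pos : k = (gs.flatten ++ ps).flatten.length + cur.length
  segs_eq : segs = gs.map List.flatten ++ (ps.flatten ++ cur ++ post) :: rest
  emitted : Emitted τ (gs.flatten ++ ps)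
  written : ∀ j < cur.length, τ.idx 2 (τ.idx vStart 0 + j) = τ.idx aTour (τ.idx vStart 0 + j) ∧
    τ.idx 3 (τ.idx vStart 0 + j) = τ.idx aTour (τ.idx vStart 0 + j + 1)

/-- The array `aTour` contains the blocks, and the sizes of the components are available. -/
structure TourData (L : Set ℕ) (w : Sym2 (Fin n) → ℕ) (segs : List (List (Fin n))) (τ : Store) :
    Prop where
  static : Static L w τ
  zero_notMem : 0 ∉ L
  length : segs.flatten.length = n
  tour : ∀ (m : ℕ) (x : Fin n), segs.flatten[m]? = some x → τ.idx aTour m = x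
  block : ∀ b ∈ segs, b ≠ [] ∧ Admissible L b.length ∧ ∀ x ∈ b, τ.idx aCnt (τ.idx aRoot x) = b.length

theorem TourData.congr {segs : List (List (Fin n))} {τ ρ : Store} (h : TourData L w segs τ)
    {A S : List ℕ} (hag : Agree A S τ ρ) (hA : ∀ a ∈ [0, vLog, vPhases, aIndiv, aAdm, aPart, aRow,
      vGcd, vOneMod, aTour, aCnt, aRoot], a ∉ A) (hS : sWt ∉ S) : TourData L w segs ρ where
  static := h.static.congr hag (fun a ha => hA a (by simp only [List.mem_cons] at ha ⊢; tauto)) hS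
  zero_notMem := h.zero_notMem
  length := h.length
  tour := by rw [hag.idx aTour (hA _ (by simp))]; exact h.tour
  block := by rw [hag.idx aCnt (hA _ (by simp)), hag.idx aRoot (hA _ (by simp))]; exact h.block

theorem flatten_map_flatten {α : Type*} (gs : List (List (List α))) :
    (gs.map List.flatten).flatten = gs.flatten.flatten := by
  rw [List.flatten_flatten]

/-- The preparations at the end of a path. -/
theorem openPath_spec {segs : List (List (Fin n))} {k : ℕ} (hd : TourData L w segs σ) (hk : k < n)
    (hv : σ.idx vK 0 = k) {gs : List (List (List (Fin n)))} {ps : List (List (Fin n))}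
    {post : List (Fin n)} {rest : List (List (Fin n))} (h : Between L segs k σ gs ps post rest) :
    ∃ post rest, Within L segs k (openPath.den σ) gs ps [] post rest := by
  have hag := agree_den openComponent σ
  have h1 : ∃ post' rest', (openComponent.den σ).idx vCompLeft 0 = post'.length ∧ post' ≠ [] ∧
      Admissible L post'.length ∧ post'.length ≤ n ∧
      segs = gs.map List.flatten ++ (ps.flatten ++ post') :: rest' := by
    rcases h.segs_eq with ⟨rfl, rfl, hs⟩ | ⟨hne, hs⟩
    · have hpos : k = (gs.map List.flatten).flatten.length := by
        rw [flatten_map_flatten, h.pos, List.append_nil]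
      cases rest with
      | nil =>
        exfalso
        have := hd.length
        rw [hs, List.append_nil, ← hpos] at this
        omega
      | cons b rest =>
        obtain ⟨hb, hba, hbc⟩ := hd.block b (by rw [hs]; simp)
        obtain ⟨x, t, rfl⟩ := List.exists_cons_of_ne_nil hb
        have hx := hd.tour k x (by rw [hs, hpos, List.flatten_append]; simp)
        refine ⟨x :: t, rest, ?_, by simp, hba, ?_, by rw [hs]; simp⟩
        · rw [openComponent, den_when_pos (by simpa using h.left)]
          simp only [den_assign, IExpr.eval_load, IExpr.eval_var, hv, hx, hbc x (by simp)]
          simp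
        · have := hd.length
          rw [hs] at this
          simp at this ⊢
          omega
    · refine ⟨post, rest, ?_, hne, h.adm, ?_, hs⟩
      · have : post.length ≠ 0 := by simpa using hne
        rw [openComponent, den_when_neg (by simpa [h.left] using hne), h.left]
      · have := hd.length
        rw [hs] at this
        simp at this ⊢
        omega
  obtain ⟨post', rest', g1, g2, g3, g4, g5⟩ := h1
  refine ⟨post', rest', ?_⟩
  rw [openPath, den_when_pos (by simpa using h.path)]
  simp only [den_block_cons, den_block_nil, den_assign, IExpr.eval_load, IExpr.eval_var]
  obtain ⟨p1, p2, p3⟩ := hd.static.part post'.length g4 (List.length_pos_iff.2 g2) g3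
  have eP : (openComponent.den σ).idx aPart = σ.idx aPart := hag.idx aPart (by decide)
  have eK : (openComponent.den σ).idx vK = σ.idx vK := hag.idx vK (by decide)
  rw [g1, eP]
  norm_num [eK, hv]
  have hpos : 0 < σ.idx aPart post'.length :=
    Nat.pos_of_ne_zero fun he => hd.zero_notMem (he ▸ p1)
  constructor
  · simpa using g1
  · simpa using hpos
  · simpa using p2
  · simpa using p1
  · simpa using p3
  · exact h.mem
  · simpa using h.pos
  · simpa using h.pos
  · simpa using g5
  · exact h.emitted.congr fun j _ => by
      simp [hag.idx 2 (by decide), hag.idx 3 (by decide)]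
  · simp

/-- Writing one edge extends the current path or, if it closes a cycle, completes it. -/
theorem emitEdge_spec {segs : List (List (Fin n))} {k : ℕ} (hd : TourData L w segs σ)
    (hv : σ.idx vK 0 = k) {gs : List (List (List (Fin n)))} {ps : List (List (Fin n))}
    {cur post : List (Fin n)} {rest : List (List (Fin n))}
    (h : Within L segs k σ gs ps cur post rest) :
    (∃ gs ps post rest, Between L segs (k + 1) (emitEdge.den σ) gs ps post rest) ∨
      ∃ gs ps cur post rest, Within L segs (k + 1) (emitEdge.den σ) gs ps cur post rest := by
  obtain ⟨x, post, rfl⟩ : ∃ x t, post = x :: t := by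
    refine List.exists_cons_of_ne_nil ?_
    rintro rfl
    have := h.path_pos
    have := h.path_le
    simp at this
    omega
  obtain ⟨s, hs⟩ : ∃ s, s = (gs.flatten ++ ps).flatten.length := ⟨_, rfl⟩
  have hstart := h.start
  have hpos := h.pos
  rw [← hs] at hstart hpos
  have hleft := h.left
  have hle := h.path_le
  have hpp := h.path_pos
  simp only [List.length_cons] at hleft hle
  -- the entries of the array `aTour` from the start of the current path on
  have hT : ∀ (j : ℕ) (y : Fin n), (cur ++ x :: post)[j]? = some y → σ.idx aTour (s + j) = y := by
    intro j y hj
    refine hd.tour _ y ?_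
    have e : segs.flatten = (gs.flatten ++ ps).flatten ++ ((cur ++ x :: post) ++ rest.flatten) := by
      rw [h.segs_eq]
      simp [flatten_map_flatten]
    rw [e, List.getElem?_append_right (by omega), hs, Nat.add_sub_cancel_left]
    rw [List.getElem?_append_left (List.getElem?_eq_some_iff.1 hj).1, hj]
  have hTk : σ.idx aTour k = x := by
    rw [hpos]; exact hT _ _ (by simp)
  have hden : emitEdge.den σ = (((σ.setIdx vPathLeft 0 (σ.idx vPathLeft 0 - 1)).setIdx vCompLeft 0
      (σ.idx vCompLeft 0 - 1)).setIdx 2 k x).setIdx 3 k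
      (if σ.idx vPathLeft 0 = 1 then σ.idx aTour s else σ.idx aTour (k + 1)) := by
    simp only [emitEdge, den_block_cons, den_block_nil, den_assign, den_istore, den_ite]
    by_cases h1 : σ.idx vPathLeft 0 = 1
    · rw [if_pos (by simp [h1]), if_pos h1]
      simp [hv, hTk, hstart]
    · rw [if_neg (by simp; omega), if_neg h1]
      simp [hv, hTk]
  rw [hden]
  have hem : ∀ ρ : Store, (∀ j < s, ρ.idx 2 j = σ.idx 2 j ∧ ρ.idx 3 j = σ.idx 3 j) →
      Emitted ρ (gs.flatten ++ ps) := fun ρ hρ =>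
    h.emitted.congr (by rwa [← hs])
  by_cases h1 : σ.idx vPathLeft 0 = 1
  · left
    rw [if_pos h1]
    set ρ := (((σ.setIdx vPathLeft 0 (σ.idx vPathLeft 0 - 1)).setIdx vCompLeft 0
      (σ.idx vCompLeft 0 - 1)).setIdx 2 k x).setIdx 3 k (σ.idx aTour s) with hρ
    have hq : Emitted ρ (gs.flatten ++ ps ++ [cur ++ [x]]) := by
      refine (hem ρ fun j hj => ?_).append ?_
      · have : j ≠ k := by omega
        simp [hρ, this]
      · intro j hj
        rw [← hs]
        simp only [List.length_append, List.length_singleton] at hj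
        rcases Nat.lt_succ_iff_lt_or_eq.1 hj with hj | rfl
        · have hjk : s + j ≠ k := by omega
          obtain ⟨w1, w2⟩ := h.written j hj
          rw [hstart] at w1 w2
          have t1 := hT j cur[j] ((List.getElem?_append_left hj).trans
            (List.getElem?_eq_getElem hj))
          have t2 := hT (j + 1) ((cur ++ [x])[j + 1]'(by simp; omega)) (by
            rw [List.append_cons, List.getElem?_append_left (show j + 1 < (cur ++ [x]).length by
              rw [List.length_append, List.length_singleton]; omega), List.getElem?_eq_getElem])
          have hmod : (j + 1) % (cur ++ [x]).length = j + 1 := Nat.mod_eq_of_lt (by simp; omega)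
          simp only [hmod]
          refine ⟨?_, ?_⟩
          · simp [hρ, hjk, w1, t1, List.getElem_append_left hj]
          · rw [← t2]
            simp [hρ, hjk, w2, add_assoc]
        · have hjk : s + cur.length = k := hpos.symm
          have hmod : (cur.length + 1) % (cur ++ [x]).length = 0 := by simp
          have t0 := hT 0 ((cur ++ [x])[0]'(by simp)) (by cases cur <;> simp)
          simp only [hmod]
          rw [← t0]
          simp [hρ, hjk]
    have hmem : ∀ q ∈ gs.flatten ++ ps ++ [cur ++ [x]], q.length ∈ L := by
      intro q hq'
      rcases List.mem_append.1 hq' with hq' | hq'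
      · exact h.mem q hq'
      · rw [List.mem_singleton.1 hq', List.length_append, List.length_singleton, ← h1]
        exact h.path_mem
    have hlen : k + 1 = (gs.flatten ++ ps ++ [cur ++ [x]]).flatten.length := by
      rw [List.flatten_append, List.length_append, ← hs]
      simp; omega
    have hadm := h.adm
    rw [h1, List.length_cons, Nat.add_sub_cancel] at hadm
    rcases post with _ | ⟨y, post⟩
    · have e : gs.flatten ++ ps ++ [cur ++ [x]] = (gs ++ [ps ++ [cur ++ [x]]]).flatten ++ [] := by
        simp
      refine ⟨gs ++ [ps ++ [cur ++ [x]]], [], [], rest, ?_, ?_, ?_, ?_, ?_, hadm, ?_⟩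
      · simp [hρ, hleft]
      · simp [hρ, h1]
      · rw [← e]; exact hmem
      · rw [← e]; exact hlen
      · exact Or.inl ⟨rfl, rfl, by rw [h.segs_eq]; simp⟩
      · rw [← e]; exact hq
    · refine ⟨gs, ps ++ [cur ++ [x]], y :: post, rest, ?_, ?_, ?_, ?_, ?_, hadm, ?_⟩
      · simp [hρ, hleft]
      · simp [hρ, h1]
      · rw [← List.append_assoc]; exact hmem
      · rw [← List.append_assoc]; exact hlen
      · exact Or.inr ⟨by simp, by rw [h.segs_eq]; simp⟩
      · rw [← List.append_assoc]; exact hq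
  · right
    rw [if_neg h1]
    refine ⟨gs, ps, cur ++ [x], post, rest, ?_, ?_, ?_, ?_, ?_, h.mem, ?_, ?_, ?_, ?_, ?_⟩
    · simp [hleft]
    · simp; omega
    · simp; omega
    · have := h.path_mem
      simp only [List.length_append, List.length_singleton, Store.setIdx_idx]
      norm_num
      convert this using 1
      omega
    · have := h.adm
      simp only [Store.setIdx_idx]
      norm_num
      convert this using 1
      simp only [List.length_cons]
      omega
    · rw [← hs]; simpa using hstart
    · rw [← hs, List.length_append, List.length_singleton]; omega
    · rw [h.segs_eq]; simp
    · refine hem _ fun j hj => ?_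
      have : j ≠ k := by omega
      simp [this]
    · intro j hj
      simp only [List.length_append, List.length_singleton] at hj
      rcases Nat.lt_succ_iff_lt_or_eq.1 hj with hj | rfl
      · have hjk : s + j ≠ k := by omega
        have := h.written j hj
        rw [hstart] at this
        simpa [hstart, hjk] using this
      · have hjk : s + cur.length = k := hpos.symm
        simp [hstart, hjk, hTk]

/-- The blocks are cut into paths with lengths in `L`, and the edges of the cycles through these paths
are written. -/
theorem emit_loop_spec {segs : List (List (Fin n))} (hd : TourData L w segs σ)
    (h1 : σ.idx vCompLeft 0 = 0) (h2 : σ.idx vPathLeft 0 = 0) :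
    ∃ gs : List (List (List (Fin n))), gs.map List.flatten = segs ∧
      (∀ q ∈ gs.flatten, q.length ∈ L) ∧ Emitted ((forTo vK 0 emit).den σ) gs.flatten := by
  have key := forTo_n (v := vK) (c := emit) (by decide) hd.static.n_eq
    (fun k τ => (∃ gs ps post rest, Between L segs k τ gs ps post rest) ∨
      ∃ gs ps cur post rest, Within L segs k τ gs ps cur post rest) ?_ ?_
  · rcases key with ⟨gs, ps, post, rest, h⟩ | ⟨gs, ps, cur, post, rest, h⟩
    · rcases h.segs_eq with ⟨rfl, rfl, hs⟩ | ⟨hne, hs⟩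
      · have hrest : rest = [] := by
          rcases rest with _ | ⟨b, rest⟩
          · rfl
          · exfalso
            have hb := (hd.block b (by rw [hs]; simp)).1
            have h3 := hd.length
            have h4 := h.pos
            have h5 := List.length_pos_iff.2 hb
            rw [hs, List.flatten_append, flatten_map_flatten, List.length_append] at h3
            rw [List.append_nil] at h4
            simp at h3 h4
            omega
        subst hrest
        refine ⟨gs, by rw [hs, List.append_nil], by simpa using h.mem, by simpa using h.emitted⟩
      · exfalso
        have h3 := hd.length
        have h4 := h.pos
        have h5 := List.length_pos_iff.2 hne
        rw [hs, List.flatten_append, flatten_map_flatten, List.length_append] at h3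
        simp at h3 h4
        omega
    · exfalso
      have h3 := hd.length
      have h4 := h.pos
      have h5 := h.path_le
      have h6 := h.path_pos
      rw [h.segs_eq, List.flatten_append, flatten_map_flatten, List.length_append] at h3
      simp at h3 h4
      omega
  · refine Or.inl ⟨[], [], [], segs, ?_, ?_, ?_, ?_, ?_, ?_, ?_⟩
    · simpa using h1
    · simpa using h2
    · simp
    · simp
    · simp
    · simp [Admissible]
    · intro e; simp
  · intro k τ hk hv hag ih
    have hdτ := hd.congr hag (by decide) (by decide)
    have hW : ∀ gs ps cur post rest, Within L segs k (openPath.den τ) gs ps cur post rest →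
        (∃ gs ps post rest, Between L segs (k + 1) ((emit.den τ).setIdx vK 0 (k + 1)) gs ps post rest) ∨
        ∃ gs ps cur post rest,
          Within L segs (k + 1) ((emit.den τ).setIdx vK 0 (k + 1)) gs ps cur post rest := by
      intro gs ps cur post rest hW
      have hag' := agree_den openPath τ
      have e : emit.den τ = emitEdge.den (openPath.den τ) := by
        simp only [emit, den_block_cons, den_block_nil]
      rw [e]
      rcases emitEdge_spec (hdτ.congr hag' (by decide) (by decide))
        (by rw [hag'.idx vK (by decide), hv]) hW with ⟨gs, ps, post, rest, h⟩ |
          ⟨gs, ps, cur, post, rest, h⟩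
      · exact Or.inl ⟨gs, ps, post, rest, by simpa using h.left, by simpa using h.path, h.mem, h.pos,
          h.segs_eq, h.adm, h.emitted.congr (by simp)⟩
      · exact Or.inr ⟨gs, ps, cur, post, rest, by simpa using h.left, by simpa using h.path_pos,
          by simpa using h.path_le, by simpa using h.path_mem, by simpa using h.adm, h.mem,
          by simpa using h.start, h.pos, h.segs_eq, h.emitted.congr (by simp),
          by simpa using h.written⟩
    rcases ih with ⟨gs, ps, post, rest, h⟩ | ⟨gs, ps, cur, post, rest, h⟩
    · obtain ⟨post', rest', h'⟩ := openPath_spec hdτ hk hv h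
      exact hW _ _ _ _ _ h'
    · have e : openPath.den τ = τ := by
        rw [openPath, den_when_neg]
        have := h.path_pos
        simp; omega
      exact hW gs ps cur post rest (by rw [e]; exact h)

theorem readTour_spec (hn : σ.idx 0 0 = n) {l : List (Fin n)} (hpos : PosOK (σ.idx aPos) l)
    (hall : ∀ v, v ∈ l) (m : ℕ) (x : Fin n) (hm : l[m]? = some x) :
    (readTour.den σ).idx aTour m = x := by
  refine forTo_n (v := vU) (c := istore aTour (.load aPos (.var vU)) (.var vU)) (by decide) hn
    (fun k τ => ∀ (m : ℕ) (x : Fin n), l[m]? = some x → (x : ℕ) < k → τ.idx aTour m = x) (by simp) ?_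
    m x hm x.2
  intro k τ hk hv hag ih m x hm hx
  obtain ⟨i, hi⟩ := List.mem_iff_getElem?.1 (hall ⟨k, hk⟩)
  have hp : σ.idx aPos k = i := hpos i _ hi
  simp only [den_istore, IExpr.eval_load, IExpr.eval_var, hv, hag.idx aPos (by decide), hp,
    Store.setIdx_idx]
  norm_num
  by_cases hmi : m = i
  · subst hmi
    rw [hm] at hi
    rw [if_pos rfl, Option.some_injective _ hi]
  · rw [if_neg hmi]
    refine ih m x hm (lt_of_le_of_ne (Nat.lt_succ_iff.1 hx) fun he => hmi ?_)
    have h1 := hpos m x hm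
    rw [he, hp] at h1
    exact h1.symm

/-- Cutting the blocks of the components into paths yields a closed-up edge set. -/
theorem isClosedUp_of_split {ord : List (Fin n)} {par root : Fin n → Fin n}
    {segs : List (List (Fin n))} (h : Explored F ord par root segs F) (hall : ∀ v, v ∈ ord)
    (hF : (edgeGraph F).IsAcyclic) (hd : ∀ e ∈ F, ¬ e.IsDiag) {gs : List (List (List (Fin n)))}
    (hgs : gs.map List.flatten = segs) (hL : ∀ q ∈ gs.flatten, q.length ∈ L) :
    IsClosedUp L F (gs.flatten.flatMap tourEdges).toFinset := by
  have hblock : ∀ ps ∈ gs, ∃ v, ps.flatten.toFinset = component F v ∧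
      ∃ p : (edgeGraph F).Walk v v, IsDoubledEulerTour F (component F v) p ∧
        firstVisits p.support = ps.flatten := fun ps hps =>
    h.block_spec hall hF hd (by rw [← hgs]; exact List.mem_map_of_mem hps)
  have hnd : segs.flatten.Nodup := h.perm.nodup_iff.2 h.nodup
  -- a component determines the paths into which it is cut
  have huniq : ∀ ps ∈ gs, ∀ ps' ∈ gs, ∀ x, x ∈ ps.flatten → x ∈ ps'.flatten → ps = ps' := by
    intro ps hps ps' hps' x hx hx'
    by_contra hne
    have hp := (List.nodup_flatten.1 hnd).2
    rw [← hgs, List.pairwise_map] at hp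
    have : Std.Symm fun a b : List (List (Fin n)) => a.flatten.Disjoint b.flatten :=
      ⟨fun _ _ h => h.symm⟩
    exact hp.forall hps hps' hne hx hx'
  have hex : ∀ S ∈ components F, ∃ ps ∈ gs, ps.flatten.toFinset = S := by
    intro S hS
    obtain ⟨u, rfl⟩ := mem_components.1 hS
    obtain ⟨b, hb, hub⟩ := List.mem_flatten.1 (h.mem_flatten.2 (hall u))
    rw [← hgs] at hb
    obtain ⟨ps, hps, rfl⟩ := List.mem_map.1 hb
    obtain ⟨v, hv, -⟩ := hblock ps hps
    refine ⟨ps, hps, hv.trans (component_eq_of_mem ?_).symm⟩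
    rw [← hv]
    exact List.mem_toFinset.2 hub
  choose! bs hbs hbs' using hex
  refine ⟨bs, fun S hS => ⟨?_, fun q hq => hL q (List.mem_flatten.2 ⟨_, hbs S hS, hq⟩)⟩, ?_⟩
  · obtain ⟨v, hv, p, hp, hpv⟩ := hblock _ (hbs S hS)
    rw [hbs' S hS] at hv
    subst hv
    exact ⟨v, p, hp, by rw [hpv]⟩
  · ext e
    simp only [List.mem_toFinset, List.mem_flatMap, List.mem_flatten, Finset.mem_biUnion]
    constructor
    · rintro ⟨q, ⟨ps, hps, hq⟩, he⟩
      obtain ⟨v, hv, -⟩ := hblock ps hps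
      have hS := component_mem_components F v
      have hvps : v ∈ ps.flatten := by
        rw [← List.mem_toFinset, hv]; exact self_mem_component F v
      refine ⟨_, hS, q, ?_, he⟩
      rw [← huniq ps hps _ (hbs _ hS) v hvps]
      · exact hq
      · rw [← List.mem_toFinset, hbs' _ hS]; exact self_mem_component F v
    · rintro ⟨S, hS, q, hq, he⟩
      exact ⟨q, ⟨_, hbs S hS, hq⟩, he⟩

/-- The output encodes a possible result of the final stage. -/
theorem closeUp_spec (hs : Static L w σ) (hL : 0 ∉ L) (hl : ListsForest σ F)
    (hF : (edgeGraph F).IsAcyclic) (hd : ∀ e ∈ F, ¬ e.IsDiag) (hill : illegal L F = ∅) :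
    ∃ C, IsClosedUp L F C ∧ Encodes (closeUp.den σ) (some C) := by
  obtain ⟨ord, par, root, segs, h, hlen, hall⟩ := explore_spec hs.n_eq hl hF hd
  have hs1 := hs.congr (agree_den explore σ) (by decide) (by decide)
  have e : closeUp.den σ = ((((forTo vK 0 emit).den (((readTour.den (explore.den σ)).setIdx vCompLeft 0
      0).setIdx vPathLeft 0 0))).setIdx 1 0 1).setIdx 1 1 n := by
    have hag := agree_den (block [explore, readTour, assign vCompLeft 0, assign vPathLeft 0,
      forTo vK 0 emit, istore 1 0 1]) σ
    have h0 := congrFun (hag.idx 0 (by decide)) 0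
    simp only [den_block_cons, den_block_nil, den_assign, den_istore, IExpr.eval_zero,
      IExpr.eval_one] at h0
    simp only [closeUp, den_block_cons, den_block_nil, den_assign, den_istore, IExpr.eval_zero,
      IExpr.eval_one, IExpr.eval_var, h0, hs.n_eq]
  rw [e]
  generalize explore.den σ = σ₁ at *
  have hag2 := agree_den readTour σ₁
  have h2 := h.congr hag2 (by decide)
  have hall' : ∀ v, v ∈ segs.flatten := fun v => h.explored.mem_flatten.2 (hall v)
  have htour := readTour_spec hs1.n_eq h.pos hall'
  have hs2 := hs1.congr hag2 (by decide) (by decide)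
  generalize readTour.den σ₁ = σ₂ at *
  have hdata : TourData L w segs ((σ₂.setIdx vCompLeft 0 0).setIdx vPathLeft 0 0) := by
    refine TourData.congr (τ := σ₂) ⟨hs2, hL, h.explored.perm.length_eq.trans hlen, htour, ?_⟩
      ((agree_setIdx (A := [vCompLeft, vPathLeft]) (S := []) (by simp) _ _ _).trans
        (agree_setIdx (by simp) _ _ _)) (by decide) (by decide)
    intro b hb
    obtain ⟨v, hv, -⟩ := h.explored.block_spec hall hF hd hb
    have hnd : b.Nodup := (List.nodup_flatten.1 (h.explored.perm.nodup_iff.2 h.explored.nodup)).1 b hb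
    have hcard : (component F v).card = b.length := by
      rw [← hv, List.toFinset_card_of_nodup hnd]
    refine ⟨?_, ?_, ?_⟩
    · rintro rfl
      have := self_mem_component F v
      rw [← hv] at this
      simp at this
    · by_contra hna
      have : component F v ∈ illegal L F :=
        mem_illegal.2 ⟨component_mem_components F v, by rwa [hcard]⟩
      rw [hill] at this
      simp at this
    · intro x hx
      have hx' : x ∈ component F v := by rw [← hv]; exact List.mem_toFinset.2 hx
      rw [h2.root_eq x (hall x), h2.cnt_root hall, component_eq_of_mem hx', hcard]
  obtain ⟨gs, hgs, hgL, hem⟩ := emit_loop_spec hdata (by simp) (by simp)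
  refine ⟨_, isClosedUp_of_split h.explored hall hF hd hgs hgL, by simp, fun e => ?_⟩
  have hlen' : gs.flatten.flatten.length = n := by
    rw [← flatten_map_flatten, hgs, hdata.length]
  have := hem e
  rw [hlen'] at this
  simp only [List.mem_toFinset, List.mem_flatMap]
  simp only [Store.setIdx_idx]
  norm_num [-List.mem_flatten]
  rw [this]
  exact ⟨fun ⟨q, hq, e', he', he⟩ => ⟨e', ⟨q, hq, he'⟩, he⟩, fun ⟨e', ⟨q, hq, he'⟩, he⟩ =>
    ⟨q, hq, e', he', he⟩⟩

end RAM

/-! ### Tables -/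

namespace CycleCover
variable {L : Set ℕ}

theorem exists_part {m : ℕ} (hm : 0 < m) (h : Admissible L m) :
    ∃ l ∈ L, l ≤ m ∧ Admissible L (m - l) := by
  have key : ∀ m, Admissible L m → m = 0 ∨ ∃ l ∈ L, l ≤ m ∧ Admissible L (m - l) := by
    intro m h
    refine AddSubmonoid.closure_induction (motive := fun m _ => m = 0 ∨ ∃ l ∈ L, l ≤ m ∧
      Admissible L (m - l)) (fun x hx => Or.inr ⟨x, hx, le_rfl, ?_⟩) (Or.inl rfl) ?_ h
    · rw [Nat.sub_self]; exact zero_mem _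
    · rintro x y hx hy (rfl | ⟨l, hl, h1, h2⟩) h'
      · rwa [zero_add]
      · refine Or.inr ⟨l, hl, by omega, ?_⟩
        rw [show x + y - l = (x - l) + y by omega]
        exact add_mem h2 hy
  exact (key m h).resolve_left hm.ne'

theorem gcdOf_pos (hL : L ⊆ {m : ℕ | 3 ≤ m}) (hne : L.Nonempty) : 0 < gcdOf L := by
  obtain ⟨l, hl⟩ := hne
  have h1 : gcdOf L ∣ l := Nat.setGcd_dvd_of_mem hl
  have : 3 ≤ l := hL hl
  exact Nat.pos_of_dvd_of_pos h1 (by omega)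

theorem admissible_of_dvd {m : ℕ} (hd : gcdOf L ∣ m) (hm : (frob L + 1) * gcdOf L ≤ m)
    (hg : 0 < gcdOf L) : Admissible L m := by
  obtain ⟨η, rfl⟩ := hd
  rw [mul_comm]
  refine frob_spec L η ?_
  rw [mul_comm] at hm
  exact Nat.le_of_mul_le_mul_left hm hg

/-- Admissibility is eventually periodic, and so is a suitable choice of a length `part m` that can
be split off from an admissible number `m`. -/
theorem exists_tables (hL : L ⊆ {m : ℕ | 3 ≤ m}) (hne : L.Nonempty) :
    ∃ (B : ℕ) (adm part : ℕ → ℕ), gcdOf L ≤ B ∧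
      (∀ m, Admissible L m → adm m = 1) ∧ (∀ m, ¬ Admissible L m → adm m = 0) ∧
      (∀ m, 0 < m → Admissible L m → part m ∈ L ∧ part m ≤ m ∧ Admissible L (m - part m)) ∧
      (∀ m ≥ B, adm m = adm (m - gcdOf L)) ∧ ∀ m ≥ B, part m = part (m - gcdOf L) := by
  classical
  have hg := gcdOf_pos hL hne
  obtain ⟨l, hl⟩ := hne
  set g := gcdOf L with hgdef
  have hgl : g ∣ l := Nat.setGcd_dvd_of_mem hl
  have hp : ∀ m, ∃ x, 0 < m → Admissible L m → x ∈ L ∧ x ≤ m ∧ Admissible L (m - x) := by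
    intro m
    by_cases h : 0 < m ∧ Admissible L m
    · obtain ⟨x, hx⟩ := exists_part h.1 h.2
      exact ⟨x, fun _ _ => hx⟩
    · exact ⟨0, fun h1 h2 => absurd ⟨h1, h2⟩ h⟩
  choose f hf using hp
  set A := (frob L + 1) * g with hA
  have hadm : ∀ m, A ≤ m → (Admissible L m ↔ g ∣ m) := fun m hm =>
    ⟨gcdOf_dvd_of_admissible, fun h => admissible_of_dvd h hm hg⟩
  refine ⟨A + l + g, fun m => if Admissible L m then 1 else 0,
    fun m => if m < A + l then f m else l, by omega, fun m h => if_pos h, fun m h => if_neg h, ?_, ?_, ?_⟩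
  · intro m hm h
    dsimp only
    split_ifs with hlt
    · exact hf m hm h
    · exact ⟨hl, by omega, (hadm _ (by omega)).2 (Nat.dvd_sub (gcdOf_dvd_of_admissible h) hgl)⟩
  · intro m hm
    have h1 : Admissible L m ↔ Admissible L (m - g) := by
      rw [hadm m (by omega), hadm (m - g) (by omega)]
      refine ⟨fun h => Nat.dvd_sub h dvd_rfl, fun h => ?_⟩
      have := dvd_add h (dvd_refl g)
      rwa [Nat.sub_add_cancel (by omega)] at this
    simp only [h1]
  · intro m hm
    dsimp only
    rw [if_neg (by omega), if_neg (by omega)]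

end CycleCover

namespace RAM

open Code CycleCover

/-- Write the first `B` values of `f` into the array `a`. -/
def writeTable (a : ℕ) (f : ℕ → ℕ) (B : ℕ) : Code :=
  block ((List.range B).map fun m => istore a (.const m) (.const (f m)))

/-- Continue the table in the array `a` periodically. -/
def extendTable (a B g : ℕ) : Code :=
  forTo vU 0 (istore a (.const B + .var vU) (.load a (.const B + .var vU - .const g)))

/-- A table whose values `f m` have period `g` from `B` on. It is available up to the index `n`. -/
def table (a : ℕ) (f : ℕ → ℕ) (B g : ℕ) : Code := block [writeTable a f B, extendTable a B g]

/-- The row offsets `i * n`, without multiplication. -/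
def rowTable : Code := forTo vU 0 (istore aRow (.var vU + 1) (.load aRow (.var vU) + .var 0))

/-- Compute a power `2 ^ k` that is at least `n`, and `2 * k + 1`. -/
def logTable : Code := block [assign vPow 1, assign vLog 1,
  forTo vU 0 (when (.ilt (.var vPow) (.var 0))
    (block [assign vPow (.var vPow + .var vPow), assign vLog (.var vLog + 2)]))]

theorem block_agree {A S : List ℕ} (l : List Code) (h : ∀ c ∈ l, c.iw ⊆ A ∧ c.sw ⊆ S) :
    (block l).iw ⊆ A ∧ (block l).sw ⊆ S := by
  induction l with
  | nil => simp [block, iw, sw]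
  | cons c l ih =>
    have h1 := h c (by simp)
    have h2 := ih fun d hd => h d (by simp [hd])
    simp only [block, iw, sw, List.append_subset]
    exact ⟨⟨h1.1, h2.1⟩, h1.2, h2.2⟩

theorem agree_writeTable (a : ℕ) (f : ℕ → ℕ) (B : ℕ) (σ : Store) :
    Agree [a] [] σ ((writeTable a f B).den σ) := by
  have := block_agree (A := [a]) (S := []) ((List.range B).map fun m => istore a (.const m) (.const (f m)))
    (by simp [iw, sw])
  exact (agree_den _ σ).mono this.1 this.2

theorem agree_table (a : ℕ) (f : ℕ → ℕ) (B g : ℕ) (σ : Store) :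
    Agree [a, vU] [] σ ((table a f B g).den σ) := by
  simp only [table, den_block_cons, den_block_nil]
  exact ((agree_writeTable a f B σ).mono (by simp) (by simp)).trans
    ((agree_den (extendTable a B g) _).mono (by simp [extendTable, iw]) (by simp [extendTable, sw]))

theorem writeTable_spec (a : ℕ) (f : ℕ → ℕ) (B : ℕ) (σ : Store) (m : ℕ) (hm : m < B) :
    ((writeTable a f B).den σ).idx a m = f m := by
  have key : ∀ (l : List ℕ) (σ : Store) (m), (m ∈ l ∨ σ.idx a m = f m) →
      ((block (l.map fun m => istore a (.const m) (.const (f m)))).den σ).idx a m = f m := by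
    intro l
    induction l with
    | nil => intro σ m h; simpa using h
    | cons x l ih =>
      intro σ m h
      rw [List.map_cons, den_block_cons]
      refine ih _ m ?_
      by_cases hx : m = x
      · simp [hx]
      · simpa [hx] using h
  exact key _ σ m (Or.inl (List.mem_range.2 hm))

theorem table_spec {n a : ℕ} {f : ℕ → ℕ} {B g : ℕ} (ha : a ≠ 0) (hu : a ≠ vU) (hg : 0 < g)
    (hB : g ≤ B) (hf : ∀ m ≥ B, f m = f (m - g)) {σ : Store} (hn : σ.idx 0 0 = n) (m : ℕ)
    (hm : m ≤ n) : ((table a f B g).den σ).idx a m = f m := by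
  simp only [table, den_block_cons, den_block_nil]
  have h1 := writeTable_spec a f B σ
  have hn1 : ((writeTable a f B).den σ).idx 0 0 = n := by
    rw [(agree_writeTable a f B σ).idx 0 (by simpa using ha.symm), hn]
  generalize (writeTable a f B).den σ = τ at *
  refine forTo_n (v := vU) (c := istore a (.const B + .var vU) (.load a (.const B + .var vU - .const g)))
    (by simpa [iw] using hu.symm) hn1 (fun k ρ => ∀ m < B + k, ρ.idx a m = f m) ?_ ?_ m (by omega)
  · intro m hm
    simpa [hu] using h1 m hm
  · intro k ρ hk hv hag ih m hm
    simp only [den_istore, IExpr.eval_add, IExpr.eval_sub, IExpr.eval_const, IExpr.eval_var,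
      IExpr.eval_load, hv, Store.setIdx_idx, hu, false_and, if_false, true_and]
    split_ifs with he
    · rw [ih _ (by omega), he, ← hf _ (by omega)]
    · exact ih m (by omega)

theorem rowTable_spec {n : ℕ} {σ : Store} (hn : σ.idx 0 0 = n) (h0 : σ.idx aRow 0 = 0) (i : ℕ)
    (hi : i ≤ n) : (rowTable.den σ).idx aRow i = i * n := by
  refine forTo_n (v := vU) (c := istore aRow (.var vU + 1) (.load aRow (.var vU) + .var 0))
    (by decide) hn (fun k ρ => ∀ i ≤ k, ρ.idx aRow i = i * n) ?_ ?_ i hi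
  · intro i hi
    obtain rfl : i = 0 := by omega
    simpa using h0
  · intro k ρ hk hv hag ih i hi
    simp only [den_istore, IExpr.eval_add, IExpr.eval_one, IExpr.eval_var, IExpr.eval_load, hv,
      Store.setIdx_idx, hag.idx 0 (by decide), hn]
    norm_num
    split_ifs with he
    · rw [ih k le_rfl, he]; ring
    · exact ih i (by omega)

theorem logTable_spec {n : ℕ} {σ : Store} (hn : σ.idx 0 0 = n) :
    2 * (n * n) ≤ 2 ^ (logTable.den σ).idx vLog 0 ∧
      (logTable.den σ).idx vLog 0 ≤ 2 * Nat.log 2 n + 3 := by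
  have key := forTo_n (v := vU) (c := when (.ilt (.var vPow) (.var 0))
    (block [assign vPow (.var vPow + .var vPow), assign vLog (.var vLog + 2)])) (by decide)
    (σ := (σ.setIdx vPow 0 1).setIdx vLog 0 1) (n := n) (by simpa using hn)
    (fun k ρ => ∃ j, ρ.idx vPow 0 = 2 ^ j ∧ ρ.idx vLog 0 = 2 * j + 1 ∧ (j = 0 ∨ 2 ^ (j - 1) < n) ∧
      min n (k + 1) ≤ 2 ^ j) ⟨0, by simp⟩ ?_
  · have e : logTable.den σ = (forTo vU 0 (when (.ilt (.var vPow) (.var 0))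
        (block [assign vPow (.var vPow + .var vPow), assign vLog (.var vLog + 2)]))).den
        ((σ.setIdx vPow 0 1).setIdx vLog 0 1) := by
      simp only [logTable, den_block_cons, den_block_nil, den_assign, IExpr.eval_one]
    rw [e]
    obtain ⟨j, -, h2, h3, h4⟩ := key
    rw [h2]
    constructor
    · have h5 : n ≤ 2 ^ j := by omega
      calc 2 * (n * n) ≤ 2 * (2 ^ j * 2 ^ j) := Nat.mul_le_mul_left _ (Nat.mul_le_mul h5 h5)
        _ = 2 ^ (2 * j + 1) := by ring
    · rcases h3 with rfl | h3
      · omega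
      · have := Nat.le_log_of_pow_le (b := 2) (by norm_num) h3.le
        omega
  · rintro k ρ hk hv hag ⟨j, h1, h2, h3, h4⟩
    have e0 : ρ.idx 0 0 = n := by rw [hag.idx 0 (by decide)]; simpa using hn
    by_cases hlt : 2 ^ j < n
    · rw [den_when_pos (by simpa [h1, e0] using hlt)]
      refine ⟨j + 1, ?_, ?_, ?_, ?_⟩
      · simp [h1]; ring
      · simp [h2]; ring
      · right; simpa using hlt
      · rw [pow_succ]; omega
    · rw [den_when_neg (by simpa [h1, e0] using hlt)]
      exact ⟨j, by simpa using h1, by simpa using h2, h3, by omega⟩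

/-- The computation of all tables. -/
noncomputable def setup (L : Set ℕ) (adm part : ℕ → ℕ) (B : ℕ) : Code := block [logTable, rowTable,
  table aIndiv (fun m => if gcdOf L ∣ m then 0 else 1) (gcdOf L) (gcdOf L), table aAdm adm B (gcdOf L),
  table aPart part B (gcdOf L), assign vPhases (.const (frob L)), assign vGcd (.const (gcdOf L)),
  assign vOneMod (.const (1 % gcdOf L))]

/-- The arrays written by `setup`. -/
def setupArrays : List ℕ :=
  [vLog, vPow, vU, aRow, aIndiv, aAdm, aPart, vPhases, vGcd, vOneMod]

/-- The tables are correct, and the number of levels of the tournament tree is logarithmic. -/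
theorem setup_spec {L : Set ℕ} {adm part : ℕ → ℕ} {B : ℕ} {n : ℕ} {w : Sym2 (Fin n) → ℕ}
    (hg : 0 < gcdOf L) (hB : gcdOf L ≤ B) (h1 : ∀ m, Admissible L m → adm m = 1)
    (h2 : ∀ m, ¬ Admissible L m → adm m = 0)
    (h3 : ∀ m, 0 < m → Admissible L m → part m ∈ L ∧ part m ≤ m ∧ Admissible L (m - part m))
    (h4 : ∀ m ≥ B, adm m = adm (m - gcdOf L)) (h5 : ∀ m ≥ B, part m = part (m - gcdOf L)) :
    Static L w ((setup L adm part B).den (input n w)) ∧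
      Agree setupArrays [] (input n w) ((setup L adm part B).den (input n w)) ∧
      ((setup L adm part B).den (input n w)).idx vLog 0 ≤ 2 * Nat.log 2 n + 3 := by
  classical
  have hn : (input n w).idx 0 0 = n := by simp [input]
  have hw : ∀ i j : Fin n, i ≠ j → (input n w).scal sWt (i * n + j) = w s(i, j) := by
    intro i j hij
    have hlt : (i : ℕ) * n + j < n * n := by
      have := Nat.mul_le_mul_right n (Nat.succ_le_of_lt i.2)
      have := j.2
      rw [Nat.succ_mul] at *
      omega
    have hpos : 0 < n := i.pos
    have hdiv : ((i : ℕ) * n + j) / n = i := by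
      rw [mul_comm, Nat.mul_add_div hpos, Nat.div_eq_of_lt j.2, add_zero]
    have hmod : ((i : ℕ) * n + j) % n = j := by
      rw [mul_comm, Nat.mul_add_mod, Nat.mod_eq_of_lt j.2]
    simp only [input, true_and, hlt, dif_pos, hdiv, hmod, Fin.eta, if_neg hij]
  have hr : (input n w).idx aRow 0 = 0 := by simp [input]
  generalize input n w = σ at *
  have e : (setup L adm part B).den σ = ((((table aPart part B (gcdOf L)).den
      ((table aAdm adm B (gcdOf L)).den ((table aIndiv (fun m => if gcdOf L ∣ m then 0 else 1)
      (gcdOf L) (gcdOf L)).den (rowTable.den (logTable.den σ))))).setIdx vPhases 0 (frob L)).setIdx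
      vGcd 0 (gcdOf L)).setIdx vOneMod 0 (1 % gcdOf L) := by
    simp only [setup, den_block_cons, den_block_nil, den_assign, IExpr.eval_const]
  rw [e]
  have a1 : Agree [vPow, vLog, vU] [] σ (logTable.den σ) :=
    (agree_den logTable σ).mono (by decide) (by decide)
  obtain ⟨s1, s1'⟩ := logTable_spec hn
  generalize logTable.den σ = σ₁ at *
  have a2 : Agree [vU, aRow] [] σ₁ (rowTable.den σ₁) := agree_den rowTable σ₁
  have n1 : σ₁.idx 0 0 = n := by rw [a1.idx 0 (by decide), hn]
  have s2 := rowTable_spec n1 (by rw [a1.idx aRow (by decide), hr])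
  generalize rowTable.den σ₁ = σ₂ at *
  have a3 := agree_table aIndiv (fun m => if gcdOf L ∣ m then 0 else 1) (gcdOf L) (gcdOf L) σ₂
  have n2 : σ₂.idx 0 0 = n := by rw [a2.idx 0 (by decide), n1]
  have s3 := table_spec (a := aIndiv) (f := fun m => if gcdOf L ∣ m then 0 else 1) (by decide)
    (by decide) hg le_rfl (fun m hm => by
      have : gcdOf L ∣ m ↔ gcdOf L ∣ m - gcdOf L := by
        refine ⟨fun h => Nat.dvd_sub h dvd_rfl, fun h => ?_⟩
        have := dvd_add h (dvd_refl (gcdOf L))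
        rwa [Nat.sub_add_cancel hm] at this
      simp only [this]) n2
  generalize (table aIndiv (fun m => if gcdOf L ∣ m then 0 else 1) (gcdOf L) (gcdOf L)).den σ₂ = σ₃ at *
  have a4 := agree_table aAdm adm B (gcdOf L) σ₃
  have n3 : σ₃.idx 0 0 = n := by rw [a3.idx 0 (by decide), n2]
  have s4 := table_spec (a := aAdm) (f := adm) (by decide) (by decide) hg hB h4 n3
  generalize (table aAdm adm B (gcdOf L)).den σ₃ = σ₄ at *
  have a5 := agree_table aPart part B (gcdOf L) σ₄
  have n4 : σ₄.idx 0 0 = n := by rw [a4.idx 0 (by decide), n3]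
  have s5 := table_spec (a := aPart) (f := part) (by decide) (by decide) hg hB h5 n4
  generalize (table aPart part B (gcdOf L)).den σ₄ = σ₅ at *
  generalize hτ : ((σ₅.setIdx vPhases 0 (frob L)).setIdx vGcd 0 (gcdOf L)).setIdx vOneMod 0
    (1 % gcdOf L) = τ
  have a6 : Agree [vPhases, vGcd, vOneMod] [] σ₅ τ := by
    rw [← hτ]
    exact ((agree_setIdx (by simp) _ _ _).trans (agree_setIdx (by simp) _ _ _)).trans
      (agree_setIdx (by simp) _ _ _)
  have eLog : τ.idx vLog = σ₁.idx vLog := by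
    rw [a6.idx _ (by decide), a5.idx _ (by decide), a4.idx _ (by decide), a3.idx _ (by decide),
      a2.idx _ (by decide)]
  have hag : Agree setupArrays [] σ τ :=
    (((((a1.mono (by decide) (by decide)).trans (a2.mono (by decide) (by decide))).trans
      (a3.mono (by decide) (by decide))).trans (a4.mono (by decide) (by decide))).trans
      (a5.mono (by decide) (by decide))).trans (a6.mono (by decide) (by decide))
  refine ⟨?_, hag, by rw [eLog]; exact s1'⟩
  constructor
  · rw [hag.idx 0 (by decide), hn]
  · rw [eLog]; exact s1
  · rw [← hτ]; simp
  · intro m hm h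
    rw [a6.idx _ (by decide), a5.idx _ (by decide), a4.idx _ (by decide), s3 m hm, if_pos h]
  · intro m hm h
    rw [a6.idx _ (by decide), a5.idx _ (by decide), a4.idx _ (by decide), s3 m hm, if_neg h]
  · intro m hm h
    rw [a6.idx _ (by decide), a5.idx _ (by decide), s4 m hm, h1 m h]
  · intro m hm h
    rw [a6.idx _ (by decide), a5.idx _ (by decide), s4 m hm, h2 m h]
  · intro m hm hpos h
    rw [a6.idx _ (by decide), s5 m hm]
    exact h3 m hpos h
  · intro i hi
    rw [a6.idx _ (by decide), a5.idx _ (by decide), a4.idx _ (by decide), a3.idx _ (by decide),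
      s2 i hi]
  · rw [← hτ]; simp
  · rw [← hτ]; simp
  · intro i j hij
    rw [hag.scal _ (by decide), hw i j hij]

end RAM

/-! ### Running time and correctness of the program -/

namespace RAM

open Code CycleCover

variable {n : ℕ} {σ : Store} {L : Set ℕ} {w : Sym2 (Fin n) → ℕ}

theorem writeTable_shape (a : ℕ) (f : ℕ → ℕ) (B : ℕ) :
    (writeTable a f B).wf = true ∧ (writeTable a f B).bounds = [] ∧
      (writeTable a f B).depth 0 = 0 ∧ (writeTable a f B).depth vLog = 0 ∧
      (a ≠ 0 → 0 ∉ (writeTable a f B).iw) := by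
  unfold writeTable
  generalize List.range B = l
  induction l with
  | nil => simp [block, wf, bounds, depth, iw]
  | cons x l ih =>
    simp only [List.map_cons, block, wf, bounds, depth, iw]
    obtain ⟨h1, h2, h3, h4, h5⟩ := ih
    refine ⟨by simp [h1], by simp [h2], by simp [h3], by simp [h4], fun ha => ?_⟩
    simp [h5 ha, ha.symm]

theorem setup_shape (L : Set ℕ) (adm part : ℕ → ℕ) (B : ℕ) :
    (setup L adm part B).wf = true ∧ (∀ x ∈ (setup L adm part B).bounds, x = 0) ∧
      (setup L adm part B).depth 0 = 1 ∧ (setup L adm part B).depth vLog = 0 ∧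
      0 ∉ (setup L adm part B).iw := by
  have h := fun a f B => writeTable_shape a f B
  refine ⟨?_, ?_, ?_, ?_, ?_⟩ <;>
    simp [setup, table, extendTable, logTable, rowTable, block, assign, when, wf, bounds, depth, iw, h]

/-- The program returns the output of a run of the algorithm. -/
theorem mainCode_spec (hL : L ⊆ {m : ℕ | 3 ≤ m}) (hg : 0 < gcdOf L) (hs : Static L w σ)
    (h1 : σ.idx 1 0 = 0) (hwin : ∀ k, σ.idx aWin k = 0) (hm : σ.idx vM 0 = 0)
    (hd : ∀ k, σ.scal sDual k = 0) :
    ∃ out, Encodes (mainCode.den σ) out ∧ ApxUndir L w out := by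
  by_cases hadm : Admissible L n
  · rw [mainCode, den_when_pos (by simpa [hs.n_eq] using hs.adm n le_rfl hadm)]
    simp only [den_block_cons, den_block_nil]
    have hdvd := gcdOf_dvd_of_admissible hadm
    obtain ⟨s, hinv, hfin⟩ := gwLoop_spec (gwInit_spec hs hwin hm hd) rfl hdvd
    generalize gwLoop.den (gwInit.den σ) = σ₁ at *
    have hgw : GoeWill w (properFun L) (gwPrune (properFun L) s.forest) :=
      ⟨s, hinv.reach, hfin, rfl⟩
    have hst := isForestState_of_reachable hinv.reach
    obtain ⟨hs2, hl2⟩ := prune_spec hinv.static hg hinv.list hst.acyclic hst.not_diag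
      (dvd_card_component_of_final hst hfin)
    obtain ⟨F, hs3, hl3, hph, hill, hac, hnd⟩ := phases_spec hs2 hl2 hgw hadm
    obtain ⟨C, hC, henc⟩ := closeUp_spec hs3 (fun h0 => by simpa using hL h0) hl3 hac hnd hill
    exact ⟨some C, henc, Or.inr ⟨by simpa using hadm, _, F, C, hgw, hph, hill, hC, rfl⟩⟩
  · rw [mainCode, den_when_neg (by simp [hs.n_eq, hs.not_adm n le_rfl hadm])]
    exact ⟨none, h1, Or.inl ⟨by simpa using hadm, rfl⟩⟩

/-- If `L` is empty, only the empty graph has an `L`-cycle cover. -/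
theorem exists_program_empty : ∃ prog : Program, ∀ (n : ℕ) (w : Sym2 (Fin n) → ℕ),
    ∃ (t : ℕ) (τ : Store) (out : Option (Finset (Sym2 (Fin n)))),
      Exec prog (input n w) t τ ∧ t ≤ 20 ∧ Encodes τ out ∧ ApxUndir (∅ : Set ℕ) w out := by
  refine ⟨(when (.ieq (.var 0) 0) (istore 1 0 1)).toProgram, fun n w => ?_⟩
  obtain ⟨t, ht, hex⟩ := exec_toProgram (when (.ieq (.var 0) 0) (istore 1 0 1)) rfl (fun _ => 0)
    (by simp [when, bounds]) (input n w) (by simp [when, bounds])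
  refine ⟨t, (when (.ieq (.var 0) 0) (istore 1 0 1)).den (input n w), ?_⟩
  have hadm : Admissible ∅ n ↔ n = 0 := by simp [Admissible]
  have hn : (input n w).idx 0 0 = n := by simp [input]
  rcases n with _ | n
  · refine ⟨some ∅, hex, ht.trans (by decide +kernel), ?_, Or.inr ⟨by simpa using hadm, ∅, ∅, ∅, ?_, .refl, ?_, ?_, rfl⟩⟩
    · rw [den_when_pos (by simp [hn])]
      simp [Encodes, input]
    · refine ⟨GWState.init, .refl, by simp [GWState.init], ?_⟩
      simp [gwPrune, GWState.init]
    · simp [illegal, components]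
    · exact ⟨fun _ => [], by simp [components], by simp [components]⟩
  · refine ⟨none, hex, ht.trans (by decide +kernel), ?_, Or.inl ⟨by simp [hadm], rfl⟩⟩
    rw [den_when_neg (by simp [hn])]
    simp [Encodes, input]

/-- The algorithm runs in time `O(n² log n)` if `L` is not empty: apart from the loop over the phases,
whose number depends only on `L`, at most two loops of length `n` and one of logarithmic length are
nested. -/
theorem exists_program (hL : L ⊆ {m : ℕ | 3 ≤ m}) (hne : L.Nonempty) :
    ∃ (prog : Program) (K : ℕ), ∀ (n : ℕ) (w : Sym2 (Fin n) → ℕ),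
      ∃ (t : ℕ) (τ : Store) (out : Option (Finset (Sym2 (Fin n)))),
        Exec prog (input n w) t τ ∧ t ≤ K * ((n + 1) ^ 2 * (Nat.log 2 n + 2)) ∧ Encodes τ out ∧
          ApxUndir L w out := by
  obtain ⟨B, adm, part, hB, h1, h2, h3, h4, h5⟩ := exists_tables hL hne
  have hg := gcdOf_pos hL hne
  obtain ⟨s1, s2, s3, s4, s5⟩ := setup_shape L adm part B
  obtain ⟨K₁, hK₁⟩ := time_le (setup L adm part B) 0 vLog (by decide) 0
  obtain ⟨K₂, hK₂⟩ := time_le mainCode 0 vLog (by decide) (frob L)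
  rw [s3, s4] at hK₁
  rw [depth_mainCode, depth_log_mainCode] at hK₂
  refine ⟨.seq (setup L adm part B).toProgram mainCode.toProgram, K₁ + 2 * K₂, fun n w => ?_⟩
  obtain ⟨hs, hag, hlog⟩ := setup_spec (w := w) hg hB h1 h2 h3 h4 h5
  have hn : (input n w).idx 0 0 = n := by simp [input]
  obtain ⟨t₁, ht₁, hex₁⟩ := exec_toProgram (setup L adm part B) s1 (fun _ => n)
    (fun x hx => by rw [s2 x hx]; exact s5) (input n w) (fun x hx => by rw [s2 x hx, hn])
  generalize (setup L adm part B).den (input n w) = σ at *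
  obtain ⟨t₂, ht₂, hex₂⟩ := exec_toProgram mainCode wf_mainCode (fun x => σ.idx x 0)
    bounds_mainCode σ fun _ _ => rfl
  obtain ⟨out, henc, hout⟩ := mainCode_spec hL hg hs
    (by rw [hag.idx 1 (by decide)]; simp [input])
    (fun k => by rw [hag.idx _ (by decide)]; simp [input])
    (by rw [hag.idx _ (by decide)]; simp [input])
    (fun k => by rw [hag.scal _ (by decide)]; simp [input])
  refine ⟨t₁ + t₂, _, out, .seq hex₁ hex₂, ?_, henc, hout⟩
  have e1 := hK₁ (fun _ => n) fun x hx h0 => absurd (s2 x hx) h0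
  have e2 := hK₂ (fun x => σ.idx x 0) fun x hx h0 hl => by
    rw [bounds_mainCode_subset x hx h0 hl, hs.phases]
  simp only [hs.n_eq, pow_one, pow_zero, mul_one] at e1 e2
  have e3 : n + 1 ≤ (n + 1) ^ 2 * (Nat.log 2 n + 2) := by
    calc n + 1 = (n + 1) * 1 := (mul_one _).symm
      _ ≤ (n + 1) * ((n + 1) * (Nat.log 2 n + 2)) :=
        Nat.mul_le_mul_left _ (Nat.mul_pos (by omega) (by omega))
      _ = _ := by ring
  have e4 : (n + 1) ^ 2 * (σ.idx vLog 0 + 1) ≤ 2 * ((n + 1) ^ 2 * (Nat.log 2 n + 2)) := by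
    calc _ ≤ (n + 1) ^ 2 * (2 * (Nat.log 2 n + 2)) := Nat.mul_le_mul_left _ (by omega)
      _ = _ := by ring
  calc t₁ + t₂ ≤ K₁ * (n + 1) + K₂ * ((n + 1) ^ 2 * (σ.idx vLog 0 + 1)) :=
        Nat.add_le_add (ht₁.trans e1) (ht₂.trans e2)
    _ ≤ K₁ * ((n + 1) ^ 2 * (Nat.log 2 n + 2)) + K₂ * (2 * ((n + 1) ^ 2 * (Nat.log 2 n + 2))) :=
        Nat.add_le_add (Nat.mul_le_mul_left _ e3) (Nat.mul_le_mul_left _ e4)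
    _ = _ := by ring

theorem isBigO_sq_mul_log (K : ℕ) : Asymptotics.IsBigO Filter.atTop
    (fun n : ℕ => ((K * ((n + 1) ^ 2 * (Nat.log 2 n + 2)) : ℕ) : ℝ))
    (fun n : ℕ => (n : ℝ) ^ 2 * Real.log (n : ℝ)) := by
  refine Asymptotics.IsBigO.of_bound (K * (4 * (1 / Real.log 2 + 2))) ?_
  filter_upwards [Filter.eventually_ge_atTop 3] with n hn
  have hn' : (3 : ℝ) ≤ n := by exact_mod_cast hn
  have hl2 : 0 < Real.log 2 := Real.log_pos (by norm_num)
  have hln : 1 ≤ Real.log n := by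
    rw [Real.le_log_iff_exp_le (by linarith)]
    exact (Real.exp_one_lt_d9.le.trans (by norm_num)).trans hn'
  have h1 : (Nat.log 2 n : ℝ) ≤ Real.log n / Real.log 2 := by
    have := Real.natLog_le_logb n 2
    rwa [Real.logb, Nat.cast_ofNat] at this
  have h2 : ((Nat.log 2 n : ℝ) + 2) ≤ (1 / Real.log 2 + 2) * Real.log n := by
    have : (1 / Real.log 2 + 2) * Real.log n = Real.log n / Real.log 2 + 2 * Real.log n := by ring
    rw [this]
    linarith
  have h3 : ((n : ℝ) + 1) ^ 2 ≤ 4 * (n : ℝ) ^ 2 := by nlinarith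
  rw [Real.norm_of_nonneg (by positivity), Real.norm_of_nonneg (by positivity)]
  push_cast
  calc (K : ℝ) * (((n : ℝ) + 1) ^ 2 * ((Nat.log 2 n : ℝ) + 2))
      ≤ K * ((4 * (n : ℝ) ^ 2) * ((1 / Real.log 2 + 2) * Real.log n)) := by gcongr
    _ = _ := by ring

end RAM

open CycleCover RAM in
/-- `ApxUndir` is a factor `4 * (p_L + 4)` approximation algorithm for minimum-weight `L`-cycle
covers of complete undirected graphs with the triangle inequality, and it can be implemented to
run in time `O(n² log n)`. -/
theorem mainTheorem1 (L : Set ℕ) (hL : L ⊆ {m : ℕ | 3 ≤ m}) :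
    (∀ (V : Type*) [Fintype V] [DecidableEq V] (w : Sym2 V → ℕ), TriangleInequality w →
      ∀ out : Option (Finset (Sym2 V)), ApxUndir L w out →
        IsApproxAnswer L w (4 * (frob L + 4)) out) ∧
    ∃ (prog : Program) (T : ℕ → ℕ),
      Asymptotics.IsBigO Filter.atTop (fun n : ℕ => (T n : ℝ))
        (fun n : ℕ => (n : ℝ) ^ 2 * Real.log (n : ℝ)) ∧
      ∀ (n : ℕ) (w : Sym2 (Fin n) → ℕ), TriangleInequality w →
        ∃ (t : ℕ) (τ : Store) (out : Option (Finset (Sym2 (Fin n)))),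
          Exec prog (input n w) t τ ∧ t ≤ T n ∧ Encodes τ out ∧ ApxUndir L w out := by
  refine ⟨fun V _ _ w hw out h => isApproxAnswer_of_apxUndir hL hw h, ?_⟩
  rcases L.eq_empty_or_nonempty with rfl | hne
  · obtain ⟨prog, h⟩ := exists_program_empty
    refine ⟨prog, fun n => 10 * ((n + 1) ^ 2 * (Nat.log 2 n + 2)), isBigO_sq_mul_log 10,
      fun n w _ => ?_⟩
    obtain ⟨t, τ, out, h1, h2, h3⟩ := h n w
    refine ⟨t, τ, out, h1, h2.trans ?_, h3⟩
    have : 1 * 2 ≤ (n + 1) ^ 2 * (Nat.log 2 n + 2) :=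
      Nat.mul_le_mul (Nat.pow_pos (Nat.succ_pos n)) (by omega)
    dsimp only
    omega
  · obtain ⟨prog, K, h⟩ := exists_program hL hne
    exact ⟨prog, _, isBigO_sq_mul_log K, fun n w _ => h n w⟩
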